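/- Let $\Gamma=\mathbb Z a_1+\mathbb Z a_2\subset\mathbb R^2$ with $a_1=(\tfrac{\sqrt3}{2},\tfrac12)$, $a_2=(\tfrac{\sqrt3}{2},-\tfrac12)$, and let $H=\sum_{i,j}a_{ij}\partial_i\partial_j+\sum_i b_i\partial_i+c$ be a differential expression on $\mathbb R^2$ with real, bounded, measurable coefficients (for instance $H=-\Delta+q$), self-adjoint in $L^2(\mathbb R^2)$ with domain $H^2(\mathbb R^2)$, and invariant under the shifts by $\Gamma$ and under the rotation $R$ by $2\pi/3$, $(R\psi)(x_1,x_2)=\psi(-\tfrac12x_1+\tfrac{\sqrt3}2x_2,\,-\tfrac{\sqrt3}2x_1-\tfrac12x_2)$. Let $k^*=(2\pi/3,-2\pi/3)$, $\sigma\in\{1,-1\}$, $\tau=e^{2\pi i/3}$. For $k\in\mathbb R^2$ let $H(k)$ be the restriction of $H$ to the functions on $\mathbb R^2$ that are locally in $L^2$ together with their weak derivatives up to order two and satisfy $\psi(x+n_1a_1+n_2a_2)=e^{i(n_1k_1+n_2k_2)}\psi(x)$ for $n_1,n_2\in\mathbb Z$, regarded as an operator in $L^2(\Omega_H)$, where $\Omega_H$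 is the open hexagon centred at $0$ with vertices $v_m=\tfrac1{\sqrt3}(\cos\tfrac{m\pi}3,\sin\tfrac{m\pi}3)$, a fundamental domain of $\Gamma$. Fix $m\in\mathbb Z$ and let $\Omega_R$ be the open rhombus with corners $0,v_{m-1},v_m,v_{m+1}$, a third of $\Omega_H$. For $j=0,1,2$ let $Q_j$ be the operator in $L^2(\Omega_R)$ with the same differential expression as $H$, whose domain consists of the $u\in H^2(\Omega_R)$ such that, in the sense of traces, with $\partial_n$ the outward normal derivative and for $0<t<1$, $$u(tv_{m+1})=\tau^j u(tv_{m-1}),\qquad -\partial_nu(tv_{m+1})=\tau^j\,\partial_nu(tv_{m-1}),$$ $$u(v_m+t(v_{m-1}-v_m))=\theta_j\,u(v_m+t(v_{m+1}-v_m)),\qquad -\partial_nu(v_m+t(v_{m-1}-v_m))=\theta_j\,\partial_nu(v_m+t(v_{m+1}-v_m)),$$ where $\theta_j=\tau^{j-\sigma}$ if $m$ is even and $\theta_j=\tau^{j+\sigma}$ if $m$ is odd. Then the maps $T_j=\tfrac1{\sqrt3}(I+\tau^jR+\bar\tau^jR^2)$, applied to functions on $\Omega_R$ extended by $0$, define isometries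 $T_j:L^2(\Omega_R)\to L^2(\Omega_H)$, $j=0,1,2$, with mutually orthogonal ranges whose sum is $L^2(\Omega_H)$, and $$\operatorname{Dom}H(\sigma k^*)=T_0(\operatorname{Dom}Q_0)\oplus T_1(\operatorname{Dom}Q_1)\oplus T_2(\operatorname{Dom}Q_2),\qquad H(\sigma k^*)T_j\varphi=T_jQ_j\varphi\quad(\varphi\in\operatorname{Dom}Q_j).$$ In particular $H(\sigma k^*)$ is unitarily equivalent to $Q_0\oplus Q_1\oplus Q_2$. If moreover $H$ is invariant under the reflection $F:\psi(x_1,x_2)\mapsto\psi(-x_1,x_2)$ or under the inversion $V:\psi(x)\mapsto\psi(-x)$, then $Q_1$ and $Q_2$ are isospectral: they have the same spectrum, and the same eigenvalues with the same multiplicities. -/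

import Mathlib

open MeasureTheory Set
open scoped ContDiff

namespace Honeycomb

noncomputable section

/-! ### The plane, the lattice, the hexagonal cell and its rhombic thirds -/

abbrev Plane := ℝ × ℝ

/-- Complex `L²` of a subset of the plane, with Lebesgue measure. -/
abbrev L2 (Ω : Set Plane) := Lp ℂ 2 (volume.restrict Ω)

/-- The standard basis of the plane. -/
def basisVec : Fin 2 → Plane := ![(1, 0), (0, 1)]

def latticeA1 : Plane := (√3 / 2, 1 / 2)

def latticeA2 : Plane := (√3 / 2, -(1 / 2))

/-- The point map such that `R ψ = ψ ∘ rotMap` is the rotation of the function `ψ` by `2π/3`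
counter-clockwise. -/
def rotMap (x : Plane) : Plane :=
  (-(1 / 2) * x.1 + √3 / 2 * x.2, -(√3 / 2) * x.1 - 1 / 2 * x.2)

/-- The point map of the horizontal reflection `F`. -/
def reflMap (x : Plane) : Plane := (-x.1, x.2)

/-- The point map of the inversion `V`. -/
def invMap (x : Plane) : Plane := (-x.1, -x.2)

/-- The operator `R` on functions. -/
def rotOp (ψ : Plane → ℂ) : Plane → ℂ := fun x => ψ (rotMap x)

/-- The number `τ = exp (2πi/3)`. -/
def tau : ℂ := Complex.exp (2 * Real.pi * Complex.I / 3)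

/-- The quasimomentum `k* = (2π/3, -2π/3)`. -/
def kStar : ℝ × ℝ := (2 * Real.pi / 3, -(2 * Real.pi / 3))

/-- The (open) hexagonal fundamental domain `Ω_H` of the lattice, centred at the origin, with
horizontal top and bottom sides. -/
def hexagon : Set Plane :=
  {x | |x.2| < 1 / 2 ∧ |√3 / 2 * x.1 + 1 / 2 * x.2| < 1 / 2 ∧
    |√3 / 2 * x.1 - 1 / 2 * x.2| < 1 / 2}

/-- The `m`-th vertex of the hexagon, at angle `m π / 3`. -/
def vertex (m : ℤ) : Plane :=
  (Real.cos (m * Real.pi / 3) / √3, Real.sin (m * Real.pi / 3) / √3)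

/-- The open rhombus with corners `0`, `vertex (m - 1)`, `vertex m`, `vertex (m + 1)`, which
covers a third of the hexagon.  It is the lower right rhombus for `m = 5` and the lower left
one for `m = 4`. -/
def rhombus (m : ℤ) : Set Plane :=
  {x | ∃ s ∈ Ioo (0 : ℝ) 1, ∃ t ∈ Ioo (0 : ℝ) 1,
    x = s • vertex (m - 1) + t • vertex (m + 1)}

/-- Starting points of the four sides of the rhombus.  Sides `0` and `1` are the inner sides,
issuing from the centre of the hexagon; sides `2` and `3` lie on the boundary of the hexagon and
issue from `vertex m`. -/
def sideStart (m : ℤ) : Fin 4 → Plane := ![0, 0, vertex m, vertex m]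

def sideEnd (m : ℤ) : Fin 4 → Plane :=
  ![vertex (m - 1), vertex (m + 1), vertex (m - 1), vertex (m + 1)]

/-- Affine parametrization of a side by `[0, 1]`. -/
def sidePoint (m : ℤ) (s : Fin 4) (t : ℝ) : Plane :=
  sideStart m s + t • (sideEnd m s - sideStart m s)

/-- Sign `1` if the side is parametrized counter-clockwise, `-1` if clockwise. -/
def sideSign : Fin 4 → ℝ := ![1, -1, -1, 1]

/-- The outward normal vector of a side, of length equal to the length of the side (which is
`1/√3` for all four sides). -/
def sideNormal (m : ℤ) (s : Fin 4) : Fin 2 → ℝ :=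
  ![sideSign s * (sideEnd m s - sideStart m s).2,
    -(sideSign s * (sideEnd m s - sideStart m s).1)]

/-! ### Weak derivatives -/

/-- A function together with candidates for its gradient and its Hessian
(`J.2.2 i j` stands for `∂_j ∂_i`). -/
abbrev Jet := (Plane → ℂ) × (Fin 2 → Plane → ℂ) × (Fin 2 → Fin 2 → Plane → ℂ)

/-- `w` is the weak derivative of `u` in the `i`-th coordinate on the open set `Ω`. -/
def IsWeakDeriv (Ω : Set Plane) (i : Fin 2) (u w : Plane → ℂ) : Prop :=
  ∀ φ : Plane → ℝ, ContDiff ℝ ∞ φ → HasCompactSupport φ → tsupport φ ⊆ Ω →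
    ∫ x in Ω, (fderiv ℝ φ x (basisVec i) : ℂ) * u x = -∫ x in Ω, (φ x : ℂ) * w x

/-- The gradient and Hessian entries of the jet are the weak derivatives of the function. -/
def IsWeakJet (Ω : Set Plane) (J : Jet) : Prop :=
  (∀ i, IsWeakDeriv Ω i J.1 (J.2.1 i)) ∧
  ∀ i j, IsWeakDeriv Ω j (J.2.1 i) (J.2.2 i j)

/-- `L²` on the intersection of `Ω` with each compact subset of the plane. -/
def MemL2loc (Ω : Set Plane) (f : Plane → ℂ) : Prop :=
  ∀ K : Set Plane, IsCompact K → MemLp f 2 ((volume.restrict Ω).restrict K)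

theorem MemLp.memL2loc {Ω : Set Plane} {f : Plane → ℂ}
    (h : MemLp f 2 (volume.restrict Ω)) : MemL2loc Ω f := fun K _ => h.restrict K

theorem MemL2loc.integrable_mul {Ω : Set Plane} {f : Plane → ℂ} (hf : MemL2loc Ω f)
    {φ : Plane → ℝ} (hc : Continuous φ) (hs : HasCompactSupport φ) :
    Integrable (fun x => (φ x : ℂ) * f x) (volume.restrict Ω) := by
  have hs' : HasCompactSupport (fun x => (φ x : ℂ)) :=
    hs.comp_left (g := fun r : ℝ => (r : ℂ)) (by simp)
  have hc' : Continuous (fun x => (φ x : ℂ)) := Complex.continuous_ofReal.comp hc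
  have h1 : MemLp (fun x => (φ x : ℂ)) 2 ((volume.restrict Ω).restrict (tsupport φ)) :=
    hc'.memLp_of_hasCompactSupport hs'
  have h2 : IntegrableOn (fun x => (φ x : ℂ) * f x) (tsupport φ) (volume.restrict Ω) :=
    h1.integrable_mul (hf _ hs)
  refine (integrableOn_iff_integrable_of_support_subset ?_).1 h2
  intro x hx
  apply subset_tsupport
  intro h0
  exact hx (by simp [h0])

theorem fderiv_apply_continuous {φ : Plane → ℝ} (h : ContDiff ℝ ∞ φ) (v : Plane) :
    Continuous (fun x => fderiv ℝ φ x v) :=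
  (h.continuous_fderiv (by simp)).clm_apply continuous_const

theorem fderiv_apply_compact {φ : Plane → ℝ} (h : HasCompactSupport φ) (v : Plane) :
    HasCompactSupport (fun x => fderiv ℝ φ x v) :=
  (h.fderiv ℝ).comp_left (g := fun l : Plane →L[ℝ] ℝ => l v) (by simp)

theorem IsWeakDeriv.add {Ω : Set Plane} {i : Fin 2} {u w u' w' : Plane → ℂ}
    (h : IsWeakDeriv Ω i u w) (h' : IsWeakDeriv Ω i u' w')
    (hu : MemL2loc Ω u) (hw : MemL2loc Ω w) (hu' : MemL2loc Ω u') (hw' : MemL2loc Ω w') :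
    IsWeakDeriv Ω i (u + u') (w + w') := by
  intro φ h1 h2 h3
  have a := fderiv_apply_continuous h1 (basisVec i)
  have b := fderiv_apply_compact h2 (basisVec i)
  simp only [Pi.add_apply, mul_add]
  rw [integral_add (hu.integrable_mul a b) (hu'.integrable_mul a b),
    integral_add (hw.integrable_mul h1.continuous h2) (hw'.integrable_mul h1.continuous h2),
    h φ h1 h2 h3, h' φ h1 h2 h3]
  ring

theorem IsWeakDeriv.smul {Ω : Set Plane} {i : Fin 2} {u w : Plane → ℂ} (c : ℂ)
    (h : IsWeakDeriv Ω i u w) : IsWeakDeriv Ω i (c • u) (c • w) := by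
  intro φ h1 h2 h3
  simp only [Pi.smul_apply, smul_eq_mul, mul_left_comm _ c]
  rw [integral_const_mul, integral_const_mul, h φ h1 h2 h3, mul_neg]

theorem IsWeakDeriv.zero (Ω : Set Plane) (i : Fin 2) : IsWeakDeriv Ω i 0 0 := by
  intro φ _ _ _
  simp

/-- Jets of functions in the Sobolev space `H²(Ω)`. -/
def sobolevJets (Ω : Set Plane) : Submodule ℂ Jet where
  carrier := {J | MemLp J.1 2 (volume.restrict Ω) ∧
    (∀ i, MemLp (J.2.1 i) 2 (volume.restrict Ω)) ∧
    (∀ i j, MemLp (J.2.2 i j) 2 (volume.restrict Ω)) ∧ IsWeakJet Ω J}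
  zero_mem' := ⟨MemLp.zero, fun _ => MemLp.zero, fun _ _ => MemLp.zero,
    fun i => IsWeakDeriv.zero Ω i, fun _ j => IsWeakDeriv.zero Ω j⟩
  add_mem' := fun ⟨h0, h1, h2, h3, h4⟩ ⟨k0, k1, k2, k3, k4⟩ =>
    ⟨h0.add k0, fun i => (h1 i).add (k1 i), fun i j => (h2 i j).add (k2 i j),
      fun i => (h3 i).add (k3 i) (MemLp.memL2loc h0) (MemLp.memL2loc (h1 i))
        (MemLp.memL2loc k0) (MemLp.memL2loc (k1 i)),
      fun i j => (h4 i j).add (k4 i j) (MemLp.memL2loc (h1 i)) (MemLp.memL2loc (h2 i j))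
        (MemLp.memL2loc (k1 i)) (MemLp.memL2loc (k2 i j))⟩
  smul_mem' := fun c _ ⟨h0, h1, h2, h3, h4⟩ =>
    ⟨h0.const_smul c, fun i => (h1 i).const_smul c, fun i j => (h2 i j).const_smul c,
      fun i => (h3 i).smul c, fun i j => (h4 i j).smul c⟩

/-- The Bloch condition with quasimomentum `k`. -/
def IsBloch (k : ℝ × ℝ) (ψ : Plane → ℂ) : Prop :=
  ∀ n₁ n₂ : ℤ, ∀ᵐ x : Plane,
    ψ (x + (n₁ : ℝ) • latticeA1 + (n₂ : ℝ) • latticeA2) =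
      Complex.exp (Complex.I * (n₁ * k.1 + n₂ * k.2)) * ψ x

/-- Jets of the Bloch functions on the plane which are locally `L²` together with their (weak)
derivatives up to the second order. -/
def blochJets (k : ℝ × ℝ) : Submodule ℂ Jet where
  carrier := {J | MemL2loc univ J.1 ∧ (∀ i, MemL2loc univ (J.2.1 i)) ∧
    (∀ i j, MemL2loc univ (J.2.2 i j)) ∧ IsWeakJet univ J ∧ IsBloch k J.1}
  zero_mem' := ⟨fun _ _ => MemLp.zero, fun _ _ _ => MemLp.zero, fun _ _ _ _ => MemLp.zero,
    ⟨fun i => IsWeakDeriv.zero _ i, fun _ j => IsWeakDeriv.zero _ j⟩,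
    fun _ _ => by simp⟩
  add_mem' := fun ⟨h0, h1, h2, ⟨h3, h4⟩, h5⟩ ⟨k0, k1, k2, ⟨k3, k4⟩, k5⟩ =>
    ⟨fun K hK => (h0 K hK).add (k0 K hK), fun i K hK => (h1 i K hK).add (k1 i K hK),
      fun i j K hK => (h2 i j K hK).add (k2 i j K hK),
      ⟨fun i => (h3 i).add (k3 i) h0 (h1 i) k0 (k1 i),
        fun i j => (h4 i j).add (k4 i j) (h1 i) (h2 i j) (k1 i) (k2 i j)⟩,
      fun n₁ n₂ => by
        filter_upwards [h5 n₁ n₂, k5 n₁ n₂] with x hx hx'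
        simp only [Prod.fst_add, Pi.add_apply, hx, hx', mul_add]⟩
  smul_mem' := fun c _ ⟨h0, h1, h2, ⟨h3, h4⟩, h5⟩ =>
    ⟨fun K hK => (h0 K hK).const_smul c, fun i K hK => (h1 i K hK).const_smul c,
      fun i j K hK => (h2 i j K hK).const_smul c,
      ⟨fun i => (h3 i).smul c, fun i j => (h4 i j).smul c⟩,
      fun n₁ n₂ => by
        filter_upwards [h5 n₁ n₂] with x hx
        simp only [Prod.smul_fst, Pi.smul_apply, hx, smul_eq_mul, mul_left_comm]⟩

/-! ### Traces on the sides of the rhombus and twisted boundary conditions -/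

/-- The functions `g s` in `L²(0, 1)`, one for each side `s` of the rhombus, are the boundary
trace of the function `u` with weak gradient `D`: Green's formula
`∫_Ω (u ∂_i φ + φ ∂_i u) = ∫_∂Ω u φ n_i` holds for all smooth `φ`. -/
def IsTrace (m : ℤ) (u : Plane → ℂ) (D : Fin 2 → Plane → ℂ) (g : Fin 4 → ℝ → ℂ) : Prop :=
  (∀ s, MemLp (g s) 2 (volume.restrict (Ioo 0 1))) ∧
  ∀ φ : Plane → ℝ, ContDiff ℝ ∞ φ → HasCompactSupport φ → ∀ i : Fin 2,
    ∫ x in rhombus m, ((fderiv ℝ φ x (basisVec i) : ℂ) * u x + (φ x : ℂ) * D i x) =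
      ∑ s, (sideNormal m s i : ℂ) * ∫ t in Ioo (0 : ℝ) 1, (φ (sidePoint m s t) : ℂ) * g s t

theorem trace_integrable {g : ℝ → ℂ} (hg : MemLp g 2 (volume.restrict (Ioo 0 1)))
    {φ : Plane → ℝ} (h1 : ContDiff ℝ ∞ φ) (m : ℤ) (s : Fin 4) :
    Integrable (fun t => (φ (sidePoint m s t) : ℂ) * g t) (volume.restrict (Ioo 0 1)) := by
  have hcont : Continuous (fun t : ℝ => (φ (sidePoint m s t) : ℂ)) := by
    have := h1.continuous
    unfold sidePoint
    fun_prop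
  have hgi : IntegrableOn g (Ioo 0 1) volume := hg.integrable (by norm_num)
  obtain ⟨C, hC⟩ := (isCompact_Icc (a := (0 : ℝ)) (b := 1)).exists_bound_of_continuousOn
    hcont.continuousOn
  exact hgi.bdd_mul hcont.aestronglyMeasurable
    ((ae_restrict_iff' measurableSet_Ioo).2 (ae_of_all _ fun t ht => hC t ⟨ht.1.le, ht.2.le⟩))

theorem IsTrace.add {m : ℤ} {u u' : Plane → ℂ} {D D' : Fin 2 → Plane → ℂ}
    {g g' : Fin 4 → ℝ → ℂ} (h : IsTrace m u D g) (h' : IsTrace m u' D' g')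
    (hu : MemL2loc (rhombus m) u) (hD : ∀ i, MemL2loc (rhombus m) (D i))
    (hu' : MemL2loc (rhombus m) u') (hD' : ∀ i, MemL2loc (rhombus m) (D' i)) :
    IsTrace m (u + u') (D + D') (g + g') := by
  refine ⟨fun s => (h.1 s).add (h'.1 s), fun φ h1 h2 i => ?_⟩
  have a := fderiv_apply_continuous h1 (basisVec i)
  have b := fderiv_apply_compact h2 (basisVec i)
  have e1 := h.2 φ h1 h2 i
  have e2 := h'.2 φ h1 h2 i
  have key : ∀ x, (fderiv ℝ φ x (basisVec i) : ℂ) * (u + u') x + (φ x : ℂ) * (D + D') i x =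
      ((fderiv ℝ φ x (basisVec i) : ℂ) * u x + (φ x : ℂ) * D i x) +
      ((fderiv ℝ φ x (basisVec i) : ℂ) * u' x + (φ x : ℂ) * D' i x) := fun x => by
    simp only [Pi.add_apply]; ring
  have i1 : Integrable (fun x => (fderiv ℝ φ x (basisVec i) : ℂ) * u x + (φ x : ℂ) * D i x)
      (volume.restrict (rhombus m)) :=
    (hu.integrable_mul a b).add ((hD i).integrable_mul h1.continuous h2)
  have i2 : Integrable (fun x => (fderiv ℝ φ x (basisVec i) : ℂ) * u' x + (φ x : ℂ) * D' i x)
      (volume.restrict (rhombus m)) :=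
    (hu'.integrable_mul a b).add ((hD' i).integrable_mul h1.continuous h2)
  simp only [key]
  rw [integral_add i1 i2, e1, e2, ← Finset.sum_add_distrib]
  refine Finset.sum_congr rfl fun s _ => ?_
  rw [← mul_add, ← integral_add (trace_integrable (h.1 s) h1 m s)
    (trace_integrable (h'.1 s) h1 m s)]
  simp only [Pi.add_apply, mul_add]

theorem IsTrace.smul {m : ℤ} {u : Plane → ℂ} {D : Fin 2 → Plane → ℂ}
    {g : Fin 4 → ℝ → ℂ} (c : ℂ) (h : IsTrace m u D g) :
    IsTrace m (c • u) (c • D) (c • g) := by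
  refine ⟨fun s => (h.1 s).const_smul c, fun φ h1 h2 i => ?_⟩
  have key : ∀ x, (fderiv ℝ φ x (basisVec i) : ℂ) * (c • u) x + (φ x : ℂ) * (c • D) i x =
      c * ((fderiv ℝ φ x (basisVec i) : ℂ) * u x + (φ x : ℂ) * D i x) := fun x => by
    simp only [Pi.smul_apply, smul_eq_mul]; ring
  simp only [key]
  rw [integral_const_mul, h.2 φ h1 h2 i, Finset.mul_sum]
  refine Finset.sum_congr rfl fun s _ => ?_
  simp only [Pi.smul_apply, smul_eq_mul, mul_left_comm _ c]
  rw [integral_const_mul]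
  ring

theorem IsTrace.zero (m : ℤ) : IsTrace m 0 0 0 :=
  ⟨fun _ => MemLp.zero, fun φ _ _ i => by simp⟩

/-- The normal derivative on side `s` (times the common side length) at parameter `t`, where
`G i` is the trace of the `i`-th partial derivative. -/
def normalDeriv (m : ℤ) (G : Fin 2 → Fin 4 → ℝ → ℂ) (s : Fin 4) (t : ℝ) : ℂ :=
  ∑ i, (sideNormal m s i : ℂ) * G i s t

/-- The condition `u|_{s'} = θ u|_s`, `-∂_n u|_{s'} = θ ∂_n u|_s` with the outward normal
derivative, both sides being parametrized from their starting points. -/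
def Glued (m : ℤ) (θ : ℂ) (s s' : Fin 4) (g : Fin 4 → ℝ → ℂ)
    (G : Fin 2 → Fin 4 → ℝ → ℂ) : Prop :=
  ∀ᵐ t ∂(volume.restrict (Ioo (0 : ℝ) 1)), g s' t = θ * g s t ∧
    -normalDeriv m G s' t = θ * normalDeriv m G s t

theorem Glued.add {m : ℤ} {θ : ℂ} {s s' : Fin 4} {g g' : Fin 4 → ℝ → ℂ}
    {G G' : Fin 2 → Fin 4 → ℝ → ℂ} (h : Glued m θ s s' g G) (h' : Glued m θ s s' g' G') :
    Glued m θ s s' (g + g') (G + G') := by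
  filter_upwards [h, h'] with t ht ht'
  have e : ∀ r, normalDeriv m (G + G') r t = normalDeriv m G r t + normalDeriv m G' r t :=
    fun r => by simp [normalDeriv, mul_add]; ring
  refine ⟨?_, ?_⟩
  · simp only [Pi.add_apply, ht.1, ht'.1, mul_add]
  · rw [e, e, neg_add, ht.2, ht'.2, mul_add]

theorem Glued.smul {m : ℤ} {θ : ℂ} {s s' : Fin 4} {g : Fin 4 → ℝ → ℂ}
    {G : Fin 2 → Fin 4 → ℝ → ℂ} (c : ℂ) (h : Glued m θ s s' g G) :
    Glued m θ s s' (c • g) (c • G) := by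
  filter_upwards [h] with t ht
  have e : ∀ r, normalDeriv m (c • G) r t = c * normalDeriv m G r t :=
    fun r => by simp [normalDeriv]; ring
  refine ⟨?_, ?_⟩
  · simp only [Pi.smul_apply, smul_eq_mul, ht.1, mul_left_comm]
  · rw [e, e, mul_left_comm, ← ht.2, mul_neg]

theorem Glued.zero (m : ℤ) (θ : ℂ) (s s' : Fin 4) : Glued m θ s s' 0 0 :=
  ae_of_all _ fun t => by simp [normalDeriv]

/-- The phase between the two inner sides of the rhombus, for the `j`-th operator. -/
def innerPhase (j : Fin 3) : ℂ := tau ^ (j : ℤ)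

/-- The phase between the two outer sides of the rhombus, for the `j`-th operator at the
quasimomentum `σ k*`, `σ = ±1`.  The additional factor `τ^{∓σ}` is the Bloch phase of the
translation that identifies opposite sides of the hexagon. -/
def outerPhase (m σ : ℤ) (j : Fin 3) : ℂ := tau ^ ((j : ℤ) + if Even m then -σ else σ)

/-- Jets of the `H²` functions on the rhombus satisfying the `j`-th twisted boundary conditions:
the inner sides are identified by the rotation about the centre of the hexagon, the outer sides
by the rotation about `vertex m`. -/
def twistedJets (m σ : ℤ) (j : Fin 3) : Submodule ℂ Jet where
  carrier := {J | J ∈ sobolevJets (rhombus m) ∧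
    ∃ (g : Fin 4 → ℝ → ℂ) (G : Fin 2 → Fin 4 → ℝ → ℂ),
      IsTrace m J.1 J.2.1 g ∧ (∀ i, IsTrace m (J.2.1 i) (J.2.2 i) (G i)) ∧
      Glued m (innerPhase j) 0 1 g G ∧ Glued m (outerPhase m σ j) 3 2 g G}
  zero_mem' := ⟨Submodule.zero_mem _, 0, 0, IsTrace.zero m, fun _ => IsTrace.zero m,
    Glued.zero _ _ _ _, Glued.zero _ _ _ _⟩
  add_mem' := fun ⟨h, g, G, h1, h2, h3, h4⟩ ⟨k, g', G', k1, k2, k3, k4⟩ =>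
    ⟨Submodule.add_mem _ h k, g + g', G + G',
      h1.add k1 (MemLp.memL2loc h.1) (fun i => MemLp.memL2loc (h.2.1 i))
        (MemLp.memL2loc k.1) (fun i => MemLp.memL2loc (k.2.1 i)),
      fun i => (h2 i).add (k2 i) (MemLp.memL2loc (h.2.1 i))
        (fun l => MemLp.memL2loc (h.2.2.1 i l)) (MemLp.memL2loc (k.2.1 i))
        (fun l => MemLp.memL2loc (k.2.2.1 i l)),
      h3.add k3, h4.add k4⟩
  smul_mem' := fun c _ ⟨h, g, G, h1, h2, h3, h4⟩ =>
    ⟨Submodule.smul_mem _ c h, c • g, c • G, h1.smul c, fun i => (h2 i).smul c,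
      h3.smul c, h4.smul c⟩

/-! ### Differential operators -/

/-- A second order differential expression `∑ a_ij ∂_i ∂_j + ∑ b_i ∂_i + c` in the plane with
real, bounded, measurable coefficients. -/
structure RealDiffOp where
  a : Fin 2 → Fin 2 → Plane → ℝ
  b : Fin 2 → Plane → ℝ
  c : Plane → ℝ
  measurable_a : ∀ i j, Measurable (a i j)
  measurable_b : ∀ i, Measurable (b i)
  measurable_c : Measurable c
  bounded_a : ∀ i j, ∃ M, ∀ x, |a i j x| ≤ M
  bounded_b : ∀ i, ∃ M, ∀ x, |b i x| ≤ M
  bounded_c : ∃ M, ∀ x, |c x| ≤ M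

namespace RealDiffOp

/-- The differential expression applied to a function, given its derivatives. -/
def onJet (L : RealDiffOp) : Jet →ₗ[ℂ] (Plane → ℂ) where
  toFun J := fun x => ∑ i, ∑ j, (L.a i j x : ℂ) * J.2.2 i j x
    + ∑ i, (L.b i x : ℂ) * J.2.1 i x + (L.c x : ℂ) * J.1 x
  map_add' J J' := by
    funext x
    simp only [Prod.fst_add, Prod.snd_add, Pi.add_apply, mul_add, Finset.sum_add_distrib]
    ring
  map_smul' r J := by
    funext x
    simp only [Prod.smul_fst, Prod.smul_snd, Pi.smul_apply, smul_eq_mul, RingHom.id_apply,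
      mul_add, Finset.mul_sum, mul_left_comm r]

/-- The jet of classical derivatives of a smooth function. -/
def classicalJet (ψ : Plane → ℂ) : Jet :=
  (ψ, fun i x => fderiv ℝ ψ x (basisVec i),
    fun i j x => fderiv ℝ (fun y => fderiv ℝ ψ y (basisVec i)) x (basisVec j))

/-- The differential expression commutes with the operator `ψ ↦ ψ ∘ S`. -/
def InvariantUnder (L : RealDiffOp) (S : Plane → Plane) : Prop :=
  ∀ ψ : Plane → ℂ, ContDiff ℝ ∞ ψ →
    ∀ᵐ x : Plane, L.onJet (classicalJet (ψ ∘ S)) x = L.onJet (classicalJet ψ) (S x)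

/-- The graph of the operator in `L²(Ω)` with the differential expression `L`, whose domain
consists of the functions with a jet in `P`. -/
def graphOn (L : RealDiffOp) (Ω : Set Plane) (P : Submodule ℂ Jet) :
    Submodule ℂ (L2 Ω × L2 Ω) where
  carrier := {p | ∃ J ∈ P, p.1 =ᵐ[volume.restrict Ω] J.1 ∧
    p.2 =ᵐ[volume.restrict Ω] L.onJet J}
  zero_mem' := ⟨0, P.zero_mem, Lp.coeFn_zero _ _ _, by
    rw [map_zero]; exact Lp.coeFn_zero _ _ _⟩
  add_mem' := fun {p q} ⟨J, hJ, h1, h2⟩ ⟨J', hJ', h1', h2'⟩ =>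
    ⟨J + J', P.add_mem hJ hJ', (Lp.coeFn_add _ _).trans (h1.add h1'), by
      rw [map_add]; exact (Lp.coeFn_add _ _).trans (h2.add h2')⟩
  smul_mem' := fun c _ ⟨J, hJ, h1, h2⟩ =>
    ⟨c • J, P.smul_mem c hJ, (Lp.coeFn_smul _ _).trans (h1.const_smul c), by
      rw [map_smul]; exact (Lp.coeFn_smul _ _).trans (h2.const_smul c)⟩

/-- The operator with graph `graphOn`. -/
def operatorOn (L : RealDiffOp) (Ω : Set Plane) (P : Submodule ℂ Jet) :
    L2 Ω →ₗ.[ℂ] L2 Ω := (L.graphOn Ω P).toLinearPMap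

/-- The operator `H` in `L²(ℝ²)`, with domain `H²(ℝ²)`. -/
def planeOp (L : RealDiffOp) : L2 univ →ₗ.[ℂ] L2 univ := L.operatorOn univ (sobolevJets univ)

/-- The operator `H(k)`: the restriction of `H` to Bloch functions, which are identified with
their restrictions to the hexagon. -/
def blochOp (L : RealDiffOp) (k : ℝ × ℝ) : L2 hexagon →ₗ.[ℂ] L2 hexagon :=
  L.operatorOn hexagon (blochJets k)

/-- The operator `Q_j` on the rhombus with the twisted boundary conditions belonging to the
quasimomentum `σ k*`. -/
def twistedOp (L : RealDiffOp) (m σ : ℤ) (j : Fin 3) :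
    L2 (rhombus m) →ₗ.[ℂ] L2 (rhombus m) :=
  L.operatorOn (rhombus m) (twistedJets m σ j)

end RealDiffOp

/-! ### Single-valuedness of the graphs -/

theorem IsWeakDeriv.ae_zero {Ω U : Set Plane} (hU : IsOpen U) (hUΩ : U ⊆ Ω)
    {i : Fin 2} {u w : Plane → ℂ}
    (h : IsWeakDeriv Ω i u w) (hw : MemL2loc Ω w) (hu : u =ᵐ[volume.restrict U] 0) :
    w =ᵐ[volume.restrict U] 0 := by
  have hu' : ∀ᵐ x : Plane, x ∈ U → u x = 0 := (ae_restrict_iff' hU.measurableSet).1 hu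
  have main : ∀ᵐ x : Plane, x ∈ U → w x = 0 := by
    refine hU.ae_eq_zero_of_integral_contDiff_smul_eq_zero ?_ ?_
    · rw [locallyIntegrableOn_iff hU.isLocallyClosed]
      intro K hKU hK
      have h1 : MemLp w 2 (volume.restrict K) := by
        have := hw K hK
        rwa [Measure.restrict_restrict hK.measurableSet,
          inter_eq_left.2 (hKU.trans hUΩ)] at this
      have : IsFiniteMeasure (volume.restrict K) := ⟨by simpa using hK.measure_lt_top⟩
      exact h1.integrable (by norm_num)
    · intro φ h1 h2 h3
      have e := h φ h1 h2 (h3.trans hUΩ)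
      have hz : ∀ x, x ∉ tsupport φ → φ x = 0 := fun x hx => image_eq_zero_of_notMem_tsupport hx
      have hdz : ∀ x, x ∉ tsupport φ → fderiv ℝ φ x = 0 := fun x hx => by
        have := (tsupport_fderiv_subset ℝ (f := φ))
        exact image_eq_zero_of_notMem_tsupport fun hx' => hx (this hx')
      have l0 : ∫ x in Ω, (fderiv ℝ φ x (basisVec i) : ℂ) * u x = 0 := by
        refine integral_eq_zero_of_ae (ae_restrict_of_ae ?_)
        filter_upwards [hu'] with x hx
        by_cases hxs : x ∈ tsupport φ
        · simp [hx (h3 hxs)]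
        · simp [hdz x hxs]
      rw [l0, eq_comm, neg_eq_zero] at e
      rw [← e, setIntegral_eq_integral_of_forall_compl_eq_zero]
      · rfl
      · intro x hx
        simp [hz x fun hx' => hx (hUΩ (h3 hx'))]
  exact (ae_restrict_iff' hU.measurableSet).2 main

theorem RealDiffOp.graph_single_valued (L : RealDiffOp) {Ω Ω' : Set Plane} (hΩ : IsOpen Ω)
    (hsub : Ω ⊆ Ω') {P : Submodule ℂ Jet}
    (hP : ∀ J ∈ P, IsWeakJet Ω' J ∧ (∀ i, MemL2loc Ω' (J.2.1 i)) ∧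
      ∀ i j, MemL2loc Ω' (J.2.2 i j)) :
    ∀ p ∈ L.graphOn Ω P, p.1 = 0 → p.2 = 0 := by
  rintro ⟨u, f⟩ ⟨J, hJ, h1, h2⟩ hu
  obtain ⟨⟨w1, w2⟩, l1, l2⟩ := hP J hJ
  simp only at hu h1 h2 ⊢
  subst hu
  have z0 : J.1 =ᵐ[volume.restrict Ω] 0 := h1.symm.trans (Lp.coeFn_zero _ _ _)
  have z1 : ∀ i, J.2.1 i =ᵐ[volume.restrict Ω] 0 := fun i =>
    (w1 i).ae_zero hΩ hsub (l1 i) z0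
  have z2 : ∀ i j, J.2.2 i j =ᵐ[volume.restrict Ω] 0 := fun i j =>
    (w2 i j).ae_zero hΩ hsub (l2 i j) (z1 i)
  refine Lp.ext ((h2.trans ?_).trans (Lp.coeFn_zero _ _ _).symm)
  filter_upwards [z0, ae_all_iff.2 z1, ae_all_iff.2 fun i => ae_all_iff.2 (z2 i)] with x a b c
  simp [RealDiffOp.onJet, a, b, c]

theorem isOpen_hexagon : IsOpen hexagon := by
  refine IsOpen.and ?_ (IsOpen.and ?_ ?_) <;>
    exact isOpen_lt (by fun_prop) continuous_const

theorem vertex_cross (m : ℤ) :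
    (vertex (m - 1)).1 * (vertex (m + 1)).2 - (vertex (m - 1)).2 * (vertex (m + 1)).1 =
      √3 / 6 := by
  have h3 : (√3 : ℝ) * √3 = 3 := Real.mul_self_sqrt (by norm_num)
  have key : Real.sin (((m + 1 : ℤ) : ℝ) * Real.pi / 3 - ((m - 1 : ℤ) : ℝ) * Real.pi / 3) =
      √3 / 2 := by
    have : ((m + 1 : ℤ) : ℝ) * Real.pi / 3 - ((m - 1 : ℤ) : ℝ) * Real.pi / 3 =
        Real.pi - Real.pi / 3 := by push_cast; ring
    rw [this, Real.sin_pi_sub, Real.sin_pi_div_three]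
  rw [Real.sin_sub] at key
  have e : ∀ x y z w : ℝ, x / √3 * (y / √3) - z / √3 * (w / √3) = (y * x - w * z) / 3 := by
    intro x y z w
    rw [div_mul_div_comm, div_mul_div_comm, h3]
    ring
  simp only [vertex]
  rw [e, key]
  ring

theorem isOpen_rhombus (m : ℤ) : IsOpen (rhombus m) := by
  have hc := vertex_cross m
  set p := vertex (m - 1)
  set r := vertex (m + 1)
  have hpos : (0 : ℝ) < √3 / 6 := by positivity
  have heq : rhombus m = {x : Plane | (x.1 * r.2 - x.2 * r.1) / (√3 / 6) ∈ Ioo (0 : ℝ) 1} ∩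
      {x : Plane | (p.1 * x.2 - p.2 * x.1) / (√3 / 6) ∈ Ioo (0 : ℝ) 1} := by
    ext x
    constructor
    · rintro ⟨s, hs, t, ht, rfl⟩
      constructor
      · refine mem_ofPred_eq ▸ ?_
        convert hs using 1
        rw [div_eq_iff hpos.ne', ← hc]
        simp only [Prod.fst_add, Prod.snd_add, Prod.smul_fst, Prod.smul_snd, smul_eq_mul]
        ring
      · refine mem_ofPred_eq ▸ ?_
        convert ht using 1
        rw [div_eq_iff hpos.ne', ← hc]
        simp only [Prod.fst_add, Prod.snd_add, Prod.smul_fst, Prod.smul_snd, smul_eq_mul]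
        ring
    · rintro ⟨h1, h2⟩
      refine ⟨_, h1, _, h2, ?_⟩
      ext <;> simp only [Prod.fst_add, Prod.snd_add, Prod.smul_fst, Prod.smul_snd, smul_eq_mul]
      · rw [div_mul_eq_mul_div, div_mul_eq_mul_div, ← add_div, eq_div_iff hpos.ne', ← hc]; ring
      · rw [div_mul_eq_mul_div, div_mul_eq_mul_div, ← add_div, eq_div_iff hpos.ne', ← hc]; ring
  rw [heq]
  exact (isOpen_Ioo.preimage (by fun_prop)).inter (isOpen_Ioo.preimage (by fun_prop))

theorem RealDiffOp.planeOp_graph (L : RealDiffOp) :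
    L.planeOp.graph = L.graphOn univ (sobolevJets univ) :=
  Submodule.toLinearPMap_graph_eq _ (L.graph_single_valued isOpen_univ
    subset_rfl fun _ hJ => ⟨hJ.2.2.2, fun i => MemLp.memL2loc (hJ.2.1 i),
      fun i j => MemLp.memL2loc (hJ.2.2.1 i j)⟩)

theorem RealDiffOp.blochOp_graph (L : RealDiffOp) (k : ℝ × ℝ) :
    (L.blochOp k).graph = L.graphOn hexagon (blochJets k) :=
  Submodule.toLinearPMap_graph_eq _ (L.graph_single_valued isOpen_hexagon
    (subset_univ _) fun _ hJ => ⟨hJ.2.2.2.1, hJ.2.1, hJ.2.2.1⟩)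

theorem RealDiffOp.twistedOp_graph (L : RealDiffOp) (m σ : ℤ) (j : Fin 3) :
    (L.twistedOp m σ j).graph = L.graphOn (rhombus m) (twistedJets m σ j) :=
  Submodule.toLinearPMap_graph_eq _ (L.graph_single_valued (isOpen_rhombus m)
    subset_rfl fun _ hJ => ⟨hJ.1.2.2.2,
      fun i => MemLp.memL2loc (hJ.1.2.1 i), fun i j => MemLp.memL2loc (hJ.1.2.2.1 i j)⟩)

/-! ### The maps `T_j` and isospectrality -/

/-- The function `(I + τ^j R + (conj τ)^j R²) φ / √3`, where `φ` is extended by zero from the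
rhombus to the plane. -/
def rotSum (m : ℤ) (j : Fin 3) (φ : Plane → ℂ) : Plane → ℂ :=
  let φ₀ := (rhombus m).indicator φ
  fun x => (1 / (√3 : ℝ) : ℂ) * (φ₀ x + tau ^ (j : ℕ) * rotOp φ₀ x
    + (starRingEnd ℂ tau) ^ (j : ℕ) * rotOp (rotOp φ₀) x)

section Spectrum

variable {E : Type*} [NormedAddCommGroup E] [NormedSpace ℂ E]

/-- `z` is in the resolvent set: `A - z` has a bounded everywhere defined inverse. -/
def InResolventSet (A : E →ₗ.[ℂ] E) (z : ℂ) : Prop :=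
  ∃ B : E →L[ℂ] E, (∀ f : E, ∃ h : B f ∈ A.domain, A ⟨B f, h⟩ - z • B f = f) ∧
    ∀ u : A.domain, B (A u - z • (u : E)) = u

def opSpectrum (A : E →ₗ.[ℂ] E) : Set ℂ := {z | ¬ InResolventSet A z}

def opEigenspace (A : E →ₗ.[ℂ] E) (z : ℂ) : Submodule ℂ E :=
  (LinearMap.ker (A.toFun - z • A.domain.subtype)).map A.domain.subtype

/-- Two operators have the same spectrum, and the same eigenvalues with the same
multiplicities. -/
def Isospectral (A B : E →ₗ.[ℂ] E) : Prop :=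
  opSpectrum A = opSpectrum B ∧
    ∀ z : ℂ, Module.rank ℂ (opEigenspace A z) = Module.rank ℂ (opEigenspace B z)

end Spectrum

end

end Honeycomb

open MeasureTheory Set
open scoped ContDiff

namespace Honeycomb

noncomputable section

open RealDiffOp
open scoped NNReal ENNReal

/-! ### Affine maps of the plane -/

/-! The quasimomentum `σ k*` is fixed, modulo the dual lattice, by the rotation by 2π/3: its
character is `τ^(σ(n₁-n₂))`, and the rotation changes n₁-n₂ by a multiple of 3
(`blochChar_kStar_turnIdx`). The rotation therefore acts on the Bloch functions at `σ k*` and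
commutes with the differential expression, and its spectral projections split the Bloch operator
according to the phase θ = τ^j in `u (turn x) = θ * u x`, where `turn` is the inverse of `rotMap`.
Such a `u` is determined by its values on one rhombus, and T_j is, up to the factor 1/√3, the
extension from the rhombus with this phase. Isometry and orthogonality of the ranges express the
orthogonality of the characters of ℤ/3 (`inner_rotSumLin`).

The substance is that restriction to the rhombus matches the H² Bloch functions of phase θ with
exactly the domain of Q_j. The sides of the rhombus are paired by `turn` and by `turn` followed by a
lattice translation. The action of the rotation on gradients is diagonalized: for ι = ±i the
component `∂₀u + ι ∂₁u` has the phase `θ * unityRoot ι`, so each statement about gradients is a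
statement about scalar functions with another cube root of unity.

From the rhombus to the plane, the integral of the extension against a test function is unfolded to
one rhombus, Green's formula is applied there, and the boundary terms telescope over the symmetry
group (`isWeakDeriv_blochExt`). This is used for `u` and for both complex components of its
gradient, whose traces match because the normal derivative is prescribed and the tangential one is
determined by the trace of `u` (`trace_tangential`). The outcome is `extJet_mem`. From the plane to
the rhombus, traces exist by integration along the sides (`exists_isTrace`); testing the weak
derivative near an inner side gives the inner condition (`trace_inner`), and the point reflection of
the rhombus reduces the outer sides to the inner ones (`trace_outer`). The outcome is
`mem_twistedJets`.

For isospectrality, the reflection F reverses rotations and preserves the Bloch condition at `σ k*`,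
so it restricts to a unitary equivalence of Q₁ and Q₂. The inversion V changes k into -k and is
combined with complex conjugation; the resulting equivalence is antilinear and conjugates the
spectral parameter. It then suffices that nonreal numbers lie in both resolvent sets.
Self-adjointness in the plane gives solvability and an H² estimate there (`plane_resolvent`). A
cutoff at scale N commutes with the expression up to O(1/N): absorbing this error gives an a priori
estimate for Bloch functions (`bloch_estimate`), and averaging over about N² cells gives an
approximate right inverse which a Neumann series corrects (`bloch_surjective`). The resolvent of the
Bloch operator then restricts to the summands (`IsOrthogonalSum.inResolventSet`). -/

/-- The affine map of the plane with matrix `M` and translation vector `v`. -/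
def aff (M : Matrix (Fin 2) (Fin 2) ℝ) (v x : Plane) : Plane :=
  (M 0 0 * x.1 + M 0 1 * x.2 + v.1, M 1 0 * x.1 + M 1 1 * x.2 + v.2)

theorem aff_aff (M N : Matrix (Fin 2) (Fin 2) ℝ) (v w x : Plane) :
    aff M v (aff N w x) = aff (M * N) (aff M v w) x := by
  ext <;> simp [aff, Matrix.mul_apply, Fin.sum_univ_two] <;> ring

theorem aff_one (v x : Plane) : aff 1 v x = x + v := by
  ext <;> simp [aff]

theorem aff_eq_add (M : Matrix (Fin 2) (Fin 2) ℝ) (v x : Plane) : aff M v x = aff M 0 x + v := by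
  ext <;> simp [aff]

theorem aff_neg (M : Matrix (Fin 2) (Fin 2) ℝ) (x : Plane) : aff M 0 (-x) = -aff M 0 x := by
  ext <;> simp [aff] <;> ring

/-- The inverse of `aff M v`, for invertible `M`. -/
def affInv (M : Matrix (Fin 2) (Fin 2) ℝ) (v : Plane) : Plane → Plane :=
  aff M⁻¹ (-aff M⁻¹ 0 v)

theorem aff_affInv {M : Matrix (Fin 2) (Fin 2) ℝ} (hM : M.det ≠ 0) (v x : Plane) :
    aff M v (affInv M v x) = x := by
  have h : M * M⁻¹ = 1 := Matrix.mul_nonsing_inv _ hM.isUnit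
  rw [affInv, aff_aff, h, aff_eq_add M v, aff_neg, aff_aff, h, aff_one, aff_one]
  simp [aff]

theorem affInv_aff {M : Matrix (Fin 2) (Fin 2) ℝ} (hM : M.det ≠ 0) (v x : Plane) :
    affInv M v (aff M v x) = x := by
  have h : M⁻¹ * M = 1 := Matrix.nonsing_inv_mul _ hM.isUnit
  rw [affInv, aff_aff, h, aff_eq_add M⁻¹, aff_one]
  simp

theorem contDiff_aff (M : Matrix (Fin 2) (Fin 2) ℝ) (v : Plane) {n : WithTop ℕ∞} :
    ContDiff ℝ n (aff M v) := by
  unfold aff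
  fun_prop

theorem continuous_aff (M : Matrix (Fin 2) (Fin 2) ℝ) (v : Plane) : Continuous (aff M v) :=
  (contDiff_aff M v (n := 0)).continuous

/-- An invertible affine map as a homeomorphism. -/
def affHomeo {M : Matrix (Fin 2) (Fin 2) ℝ} (hM : M.det ≠ 0) (v : Plane) : Plane ≃ₜ Plane where
  toFun := aff M v
  invFun := affInv M v
  left_inv := affInv_aff hM v
  right_inv := aff_affInv hM v
  continuous_toFun := continuous_aff _ _
  continuous_invFun := continuous_aff _ _

theorem measurableEmbedding_aff {M : Matrix (Fin 2) (Fin 2) ℝ} (hM : M.det ≠ 0) (v : Plane) :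
    MeasurableEmbedding (aff M v) :=
  (affHomeo hM v).measurableEmbedding

theorem map_aff_volume {M : Matrix (Fin 2) (Fin 2) ℝ} (hM : M.det ≠ 0) (v : Plane) :
    Measure.map (aff M v) volume = ENNReal.ofReal |M.det⁻¹| • (volume : Measure Plane) := by
  let f := Matrix.toLin (Module.Basis.finTwoProd ℝ) (Module.Basis.finTwoProd ℝ) M
  have hf : LinearMap.det f = M.det := LinearMap.det_toLin _ _
  have e : aff M v = (fun x => x + v) ∘ f := by
    funext x
    have : M = !![M 0 0, M 0 1; M 1 0, M 1 1] := Matrix.eta_fin_two M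
    simp only [Function.comp, f]
    rw [this, Matrix.toLin_finTwoProd_apply]
    ext <;> simp [aff]
  have hfm : Measurable f := (LinearMap.continuous_of_finiteDimensional f).measurable
  rw [e, ← Measure.map_map (measurable_add_const v) hfm,
    Measure.map_linearMap_addHaar_eq_smul_addHaar volume (by rwa [hf]), hf, Measure.map_smul,
    map_add_right_eq_self]

theorem ae_aff {M : Matrix (Fin 2) (Fin 2) ℝ} (hM : M.det ≠ 0) (v : Plane) {P : Plane → Prop}
    (h : ∀ᵐ x : Plane, P x) : ∀ᵐ x : Plane, P (aff M v x) := by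
  refine (measurableEmbedding_aff hM v).ae_map_iff.1 ?_
  rw [map_aff_volume hM v]
  exact Measure.smul_absolutelyContinuous.ae_le h

theorem setIntegral_aff {M : Matrix (Fin 2) (Fin 2) ℝ} (hM : M.det ≠ 0) (v : Plane)
    (Ω : Set Plane) (f : Plane → ℂ) :
    ∫ x in aff M v ⁻¹' Ω, f (aff M v x) = |M.det⁻¹| • ∫ x in Ω, f x := by
  rw [← (measurableEmbedding_aff hM v).setIntegral_map, map_aff_volume hM v,
    Measure.restrict_smul, integral_smul_measure, ENNReal.toReal_ofReal (abs_nonneg _)]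

theorem memLp_aff {M : Matrix (Fin 2) (Fin 2) ℝ} (hM : M.det ≠ 0) (v : Plane)
    {Ω : Set Plane} {f : Plane → ℂ} (h : MemLp f 2 (volume.restrict Ω)) :
    MemLp (f ∘ aff M v) 2 (volume.restrict (aff M v ⁻¹' Ω)) := by
  rw [← (measurableEmbedding_aff hM v).memLp_map_measure_iff,
    ← (measurableEmbedding_aff hM v).restrict_map, map_aff_volume hM v, Measure.restrict_smul]
  exact h.smul_measure ENNReal.ofReal_ne_top

theorem MemL2loc.comp_aff {M : Matrix (Fin 2) (Fin 2) ℝ} (hM : M.det ≠ 0) (v : Plane)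
    {Ω : Set Plane} {f : Plane → ℂ} (h : MemL2loc Ω f) :
    MemL2loc (aff M v ⁻¹' Ω) (f ∘ aff M v) := by
  intro K hK
  have h1 := h _ (hK.image (continuous_aff M v))
  rw [Measure.restrict_restrict (hK.image (continuous_aff M v)).measurableSet] at h1
  have h2 := memLp_aff hM v h1
  rw [Measure.restrict_restrict hK.measurableSet]
  refine h2.mono_measure (Measure.restrict_mono ?_ le_rfl)
  rintro x ⟨hx, hx'⟩
  exact ⟨mem_image_of_mem _ hx, hx'⟩

theorem fderiv_comp_aff (M : Matrix (Fin 2) (Fin 2) ℝ) (v : Plane) {E : Type*}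
    [NormedAddCommGroup E] [NormedSpace ℝ E] {φ : Plane → E}
    (h : Differentiable ℝ φ) (x : Plane) (i : Fin 2) :
    fderiv ℝ (φ ∘ aff M v) x (basisVec i) =
      ∑ l, M l i • fderiv ℝ φ (aff M v x) (basisVec l) := by
  have hd : HasFDerivAt (aff M v)
      (((M 0 0 • ContinuousLinearMap.fst ℝ ℝ ℝ + M 0 1 • ContinuousLinearMap.snd ℝ ℝ ℝ)).prod
        (M 1 0 • ContinuousLinearMap.fst ℝ ℝ ℝ + M 1 1 • ContinuousLinearMap.snd ℝ ℝ ℝ)) x := by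
    refine HasFDerivAt.prodMk ?_ ?_
    · exact (((hasFDerivAt_fst.const_mul _).add (hasFDerivAt_snd.const_mul _)).add_const _)
    · exact (((hasFDerivAt_fst.const_mul _).add (hasFDerivAt_snd.const_mul _)).add_const _)
  rw [((h _).hasFDerivAt.comp x hd).fderiv, ContinuousLinearMap.comp_apply]
  simp only [← map_smul, ← map_sum]
  congr 1
  fin_cases i <;> ext <;> simp [basisVec, Fin.sum_univ_two]

/-! ### Calculus of weak derivatives -/

theorem MemL2loc.mono {Ω U : Set Plane} {f : Plane → ℂ} (h : MemL2loc Ω f) (hU : U ⊆ Ω) :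
    MemL2loc U f := fun K hK =>
  (h K hK).mono_measure (Measure.restrict_mono_measure (Measure.restrict_mono hU le_rfl) K)

/-- `MemL2loc` tests compact subsets of the plane, not of `Ω`. Square integrability therefore holds
up to the boundary of `Ω`, and a bounded subset is controlled through its compact closure. -/
theorem MemL2loc.memLp {Ω U : Set Plane} {f : Plane → ℂ} (h : MemL2loc Ω f) (hU : U ⊆ Ω)
    (hb : Bornology.IsBounded U) : MemLp f 2 (volume.restrict U) := by
  have h1 := h _ hb.isCompact_closure
  rw [Measure.restrict_restrict isClosed_closure.measurableSet] at h1
  exact h1.mono_measure (Measure.restrict_mono (subset_inter subset_closure hU) le_rfl)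

theorem MemL2loc.add {Ω : Set Plane} {f g : Plane → ℂ} (hf : MemL2loc Ω f)
    (hg : MemL2loc Ω g) : MemL2loc Ω (f + g) := fun K hK => (hf K hK).add (hg K hK)

theorem MemL2loc.smul {Ω : Set Plane} {f : Plane → ℂ} (c : ℂ) (hf : MemL2loc Ω f) :
    MemL2loc Ω (c • f) := fun K hK => (hf K hK).const_smul c

theorem MemL2loc.sub {Ω : Set Plane} {f g : Plane → ℂ} (hf : MemL2loc Ω f)
    (hg : MemL2loc Ω g) : MemL2loc Ω (f - g) := fun K hK => (hf K hK).sub (hg K hK)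

theorem IsWeakDeriv.sub {Ω : Set Plane} {i : Fin 2} {u w u' w' : Plane → ℂ}
    (h : IsWeakDeriv Ω i u w) (h' : IsWeakDeriv Ω i u' w')
    (hu : MemL2loc Ω u) (hw : MemL2loc Ω w) (hu' : MemL2loc Ω u') (hw' : MemL2loc Ω w') :
    IsWeakDeriv Ω i (u - u') (w - w') := by
  have := h.add (h'.smul (-1)) hu hw (hu'.smul (-1)) (hw'.smul (-1))
  simpa [sub_eq_add_neg] using this

theorem IsWeakDeriv.congr {Ω : Set Plane} {i : Fin 2} {u w u' w' : Plane → ℂ}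
    (h : IsWeakDeriv Ω i u w) (hu : u =ᵐ[volume.restrict Ω] u')
    (hw : w =ᵐ[volume.restrict Ω] w') : IsWeakDeriv Ω i u' w' := by
  intro φ h1 h2 h3
  have e := h φ h1 h2 h3
  have e1 : (fun x => (fderiv ℝ φ x (basisVec i) : ℂ) * u x) =ᵐ[volume.restrict Ω]
      fun x => (fderiv ℝ φ x (basisVec i) : ℂ) * u' x := hu.mono fun x hx => by simp [hx]
  have e2 : (fun x => (φ x : ℂ) * w x) =ᵐ[volume.restrict Ω] fun x => (φ x : ℂ) * w' x :=
    hw.mono fun x hx => by simp [hx]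
  rwa [integral_congr_ae e1, integral_congr_ae e2] at e

theorem fderiv_eq_zero_of_notMem_tsupport {φ : Plane → ℝ} {x : Plane} (hx : x ∉ tsupport φ) :
    fderiv ℝ φ x = 0 :=
  image_eq_zero_of_notMem_tsupport fun h => hx (tsupport_fderiv_subset ℝ h)

theorem IsWeakDeriv.mono {Ω U : Set Plane} (hU : U ⊆ Ω) {i : Fin 2}
    {u w : Plane → ℂ} (h : IsWeakDeriv Ω i u w) : IsWeakDeriv U i u w := by
  intro φ h1 h2 h3
  have e := h φ h1 h2 (h3.trans hU)
  have hz : ∀ x, x ∉ U → φ x = 0 := fun x hx =>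
    image_eq_zero_of_notMem_tsupport fun h => hx (h3 h)
  have hdz : ∀ x, x ∉ U → fderiv ℝ φ x = 0 := fun x hx =>
    fderiv_eq_zero_of_notMem_tsupport fun h => hx (h3 h)
  have z1 : ∀ V : Set Plane, U ⊆ V → ∫ x in V, (fderiv ℝ φ x (basisVec i) : ℂ) * u x =
      ∫ x, (fderiv ℝ φ x (basisVec i) : ℂ) * u x := fun V hV =>
    setIntegral_eq_integral_of_forall_compl_eq_zero fun x hx => by simp [hdz x fun h => hx (hV h)]
  have z2 : ∀ V : Set Plane, U ⊆ V → ∫ x in V, (φ x : ℂ) * w x =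
      ∫ x, (φ x : ℂ) * w x := fun V hV =>
    setIntegral_eq_integral_of_forall_compl_eq_zero fun x hx => by simp [hz x fun h => hx (hV h)]
  rw [z1 Ω hU, z2 Ω hU] at e
  rw [z1 U subset_rfl, z2 U subset_rfl, e]

/-- Weak derivatives are determined almost everywhere on open sets by the function. -/
theorem IsWeakDeriv.ae_unique {Ω : Set Plane} (hΩ : IsOpen Ω) {i : Fin 2}
    {u w u' w' : Plane → ℂ} (h : IsWeakDeriv Ω i u w) (h' : IsWeakDeriv Ω i u' w')
    (hu : MemL2loc Ω u) (hw : MemL2loc Ω w) (hu' : MemL2loc Ω u') (hw' : MemL2loc Ω w')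
    (e : u =ᵐ[volume.restrict Ω] u') : w =ᵐ[volume.restrict Ω] w' := by
  have := (h.sub h' hu hw hu' hw').ae_zero hΩ subset_rfl (hw.sub hw')
    (e.mono fun x hx => by simp [hx])
  exact this.mono fun x hx => by simpa [sub_eq_zero] using hx

/-- Weak derivatives pull back under invertible affine maps by the chain rule. -/
theorem IsWeakDeriv.comp_aff {M : Matrix (Fin 2) (Fin 2) ℝ} (hM : M.det ≠ 0) (v : Plane)
    {Ω : Set Plane} {u : Plane → ℂ} {w : Fin 2 → Plane → ℂ}
    (h : ∀ l, IsWeakDeriv Ω l u (w l)) (hu : MemL2loc Ω u) (hw : ∀ l, MemL2loc Ω (w l))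
    (i : Fin 2) :
    IsWeakDeriv (aff M v ⁻¹' Ω) i (u ∘ aff M v) (fun x => ∑ l, (M l i : ℂ) * w l (aff M v x)) := by
  intro φ h1 h2 h3
  -- The weak derivative is only known against test functions on `Ω`, so the given test function is
  -- first carried there by the inverse map.
  set ψ : Plane → ℝ := φ ∘ affInv M v with hψ
  have hφψ : φ = ψ ∘ aff M v := by
    funext x; simp [hψ, affInv_aff hM]
  have c1 : ContDiff ℝ ∞ ψ := h1.comp (contDiff_aff _ _)
  have c2 : HasCompactSupport ψ := h2.comp_homeomorph (affHomeo hM v).symm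
  have c3 : tsupport ψ ⊆ Ω := by
    have : tsupport ψ = (affHomeo hM v).symm ⁻¹' tsupport φ := by
      rw [hψ]
      exact tsupport_comp_eq_preimage φ (affHomeo hM v).symm
    rw [this]
    intro y hy
    have h4 : aff M v (affInv M v y) ∈ Ω := h3 hy
    rwa [aff_affInv hM] at h4
  have d : ∀ x, (fderiv ℝ φ x (basisVec i) : ℂ) * (u ∘ aff M v) x =
      (fun y => ∑ l, (M l i : ℂ) * ((fderiv ℝ ψ y (basisVec l) : ℂ) * u y)) (aff M v x) := by
    intro x
    rw [hφψ, fderiv_comp_aff M v (c1.differentiable (by simp))]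
    simp only [Function.comp, Complex.ofReal_sum, smul_eq_mul, Complex.ofReal_mul, Finset.sum_mul,
      mul_assoc]
  have d' : ∀ x, (φ x : ℂ) * ∑ l, (M l i : ℂ) * w l (aff M v x) =
      (fun y => ∑ l, (M l i : ℂ) * ((ψ y : ℂ) * w l y)) (aff M v x) := by
    intro x
    simp only [hφψ, Function.comp, Finset.mul_sum, mul_left_comm]
  rw [integral_congr_ae (ae_of_all _ d), integral_congr_ae (ae_of_all _ d')]
  -- The Jacobian is the same constant on both sides, so it plays no role.
  rw [setIntegral_aff hM v Ω (fun y => ∑ l, (M l i : ℂ) * ((fderiv ℝ ψ y (basisVec l) : ℂ) * u y)),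
    setIntegral_aff hM v Ω (fun y => ∑ l, (M l i : ℂ) * ((ψ y : ℂ) * w l y)),
    integral_finsetSum, integral_finsetSum, ← smul_neg, ← Finset.sum_neg_distrib]
  · congr 1
    refine Finset.sum_congr rfl fun l _ => ?_
    rw [integral_const_mul, integral_const_mul, h l ψ c1 c2 c3, mul_neg]
  · exact fun l _ => ((hw l).integrable_mul c1.continuous c2).const_mul _
  · exact fun l _ => (hu.integrable_mul (fderiv_apply_continuous c1 _)
      (fderiv_apply_compact c2 _)).const_mul _

/-- The pull-back of a jet under an affine map. -/
def pullJet (M : Matrix (Fin 2) (Fin 2) ℝ) (v : Plane) (J : Jet) : Jet :=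
  (J.1 ∘ aff M v, fun i x => ∑ l, (M l i : ℂ) * J.2.1 l (aff M v x),
    fun i j x => ∑ l, (M l i : ℂ) * ∑ k, (M k j : ℂ) * J.2.2 l k (aff M v x))

/-- All entries of a jet are locally square integrable. -/
def JetL2loc (Ω : Set Plane) (J : Jet) : Prop :=
  MemL2loc Ω J.1 ∧ (∀ i, MemL2loc Ω (J.2.1 i)) ∧ ∀ i j, MemL2loc Ω (J.2.2 i j)

theorem MemL2loc.lincomb {Ω : Set Plane} {w : Fin 2 → Plane → ℂ} (c : Fin 2 → ℂ)
    (h : ∀ l, MemL2loc Ω (w l)) : MemL2loc Ω (fun x => ∑ l, c l * w l x) := by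
  have := ((h 0).smul (c 0)).add ((h 1).smul (c 1))
  convert this using 1
  funext x
  simp [Fin.sum_univ_two]

theorem IsWeakDeriv.lincomb {Ω : Set Plane} {i : Fin 2} {u w : Fin 2 → Plane → ℂ} (c : Fin 2 → ℂ)
    (h : ∀ l, IsWeakDeriv Ω i (u l) (w l)) (hu : ∀ l, MemL2loc Ω (u l))
    (hw : ∀ l, MemL2loc Ω (w l)) :
    IsWeakDeriv Ω i (fun x => ∑ l, c l * u l x) (fun x => ∑ l, c l * w l x) := by
  have := ((h 0).smul (c 0)).add ((h 1).smul (c 1)) ((hu 0).smul _) ((hw 0).smul _)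
    ((hu 1).smul _) ((hw 1).smul _)
  convert this using 1 <;> funext x <;> simp [Fin.sum_univ_two]

theorem JetL2loc.pull {M : Matrix (Fin 2) (Fin 2) ℝ} (hM : M.det ≠ 0) (v : Plane)
    {Ω : Set Plane} {J : Jet} (h : JetL2loc Ω J) : JetL2loc (aff M v ⁻¹' Ω) (pullJet M v J) :=
  ⟨h.1.comp_aff hM v,
    fun i => MemL2loc.lincomb (w := fun l => J.2.1 l ∘ aff M v) (fun l => (M l i : ℂ))
      fun l => (h.2.1 l).comp_aff hM v,
    fun i j => MemL2loc.lincomb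
      (w := fun l x => ∑ k, (M k j : ℂ) * J.2.2 l k (aff M v x)) (fun l => (M l i : ℂ)) fun l =>
      MemL2loc.lincomb (w := fun k => J.2.2 l k ∘ aff M v) (fun k => (M k j : ℂ))
        fun k => (h.2.2 l k).comp_aff hM v⟩

theorem IsWeakJet.pull {M : Matrix (Fin 2) (Fin 2) ℝ} (hM : M.det ≠ 0) (v : Plane)
    {Ω : Set Plane} {J : Jet} (hJ : IsWeakJet Ω J) (h : JetL2loc Ω J) :
    IsWeakJet (aff M v ⁻¹' Ω) (pullJet M v J) := by
  refine ⟨fun i => IsWeakDeriv.comp_aff hM v hJ.1 h.1 h.2.1 i, fun i j => ?_⟩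
  exact IsWeakDeriv.lincomb (u := fun l => J.2.1 l ∘ aff M v)
    (w := fun l x => ∑ k, (M k j : ℂ) * J.2.2 l k (aff M v x)) (fun l => (M l i : ℂ))
    (fun l => IsWeakDeriv.comp_aff hM v (hJ.2 l) (h.2.1 l) (h.2.2 l) j)
    (fun l => (h.2.1 l).comp_aff hM v)
    (fun l => MemL2loc.lincomb (w := fun k => J.2.2 l k ∘ aff M v) (fun k => (M k j : ℂ))
      fun k => (h.2.2 l k).comp_aff hM v)

/-- Weak jets of almost everywhere equal functions on an open set agree almost everywhere. -/
theorem IsWeakJet.ae_unique {Ω : Set Plane} (hΩ : IsOpen Ω) {J J' : Jet} (hJ : IsWeakJet Ω J)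
    (hJ' : IsWeakJet Ω J') (h : JetL2loc Ω J) (h' : JetL2loc Ω J')
    (e : J.1 =ᵐ[volume.restrict Ω] J'.1) :
    ∀ᵐ x ∂(volume.restrict Ω), J.1 x = J'.1 x ∧ (∀ i, J.2.1 i x = J'.2.1 i x) ∧
      ∀ i j, J.2.2 i j x = J'.2.2 i j x := by
  have e1 : ∀ i, J.2.1 i =ᵐ[volume.restrict Ω] J'.2.1 i := fun i =>
    (hJ.1 i).ae_unique hΩ (hJ'.1 i) h.1 (h.2.1 i) h'.1 (h'.2.1 i) e
  have e2 : ∀ i j, J.2.2 i j =ᵐ[volume.restrict Ω] J'.2.2 i j := fun i j =>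
    (hJ.2 i j).ae_unique hΩ (hJ'.2 i j) (h.2.1 i) (h.2.2 i j) (h'.2.1 i) (h'.2.2 i j) (e1 i)
  filter_upwards [e, ae_all_iff.2 e1, ae_all_iff.2 fun i => ae_all_iff.2 (e2 i)] with x a b c
  exact ⟨a, b, c⟩

/-- The weak Hessian is symmetric. -/
theorem IsWeakJet.hessian_symm {Ω : Set Plane} (hΩ : IsOpen Ω) {J : Jet} (hJ : IsWeakJet Ω J)
    (h : JetL2loc Ω J) :
    ∀ᵐ x ∂(volume.restrict Ω), ∀ i j, J.2.2 i j x = J.2.2 j i x := by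
  refine ae_all_iff.2 fun i => ae_all_iff.2 fun j => ?_
  -- The antisymmetric part of the Hessian is presented as a weak derivative of the zero function,
  -- in an arbitrarily chosen direction; uniqueness of weak derivatives then makes it vanish. The
  -- integrals are zero because second derivatives of the test function commute.
  have hz : IsWeakDeriv Ω 0 (0 : Plane → ℂ) (J.2.2 i j - J.2.2 j i) := by
    intro φ h1 h2 h3
    have hc : ∀ l, ContDiff ℝ ∞ (fun x => fderiv ℝ φ x (basisVec l)) := fun l =>
      (h1.fderiv_right (m := ∞) (by simp)).clm_apply contDiff_const
    have hs : ∀ l, HasCompactSupport (fun x => fderiv ℝ φ x (basisVec l)) := fun l =>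
      fderiv_apply_compact h2 _
    have ht : ∀ l, tsupport (fun x => fderiv ℝ φ x (basisVec l)) ⊆ Ω := fun l => by
      refine (closure_mono ?_).trans ((tsupport_fderiv_subset ℝ (f := φ)).trans h3)
      intro x hx h0
      exact hx (by simp [h0])
    have key : ∀ k l, ∫ x in Ω, (φ x : ℂ) * J.2.2 k l x = ∫ x in Ω,
        (fderiv ℝ (fun y => fderiv ℝ φ y (basisVec l)) x (basisVec k) : ℂ) * J.1 x := by
      intro k l
      have a := hJ.2 k l φ h1 h2 h3
      have b := hJ.1 k _ (hc l) (hs l) (ht l)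
      rw [b, a, neg_neg]
    have sy : ∀ x, fderiv ℝ (fun y => fderiv ℝ φ y (basisVec j)) x (basisVec i) =
        fderiv ℝ (fun y => fderiv ℝ φ y (basisVec i)) x (basisVec j) := by
      intro x
      have hd : DifferentiableAt ℝ (fderiv ℝ φ) x :=
        ((h1.fderiv_right (m := ∞) (by simp)).differentiable (by simp)) x
      have e : ∀ v w : Plane, fderiv ℝ (fun y => fderiv ℝ φ y v) x w =
          fderiv ℝ (fderiv ℝ φ) x w v := fun v w => by
        rw [fderiv_clm_apply hd (differentiableAt_const _)]
        simp
      rw [e, e]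
      exact (h1.contDiffAt.isSymmSndFDerivAt (by simpa using WithTop.coe_le_coe.2 (le_top : (2 : ℕ∞) ≤ ⊤))).eq _ _
    simp only [Pi.zero_apply, mul_zero, integral_zero, Pi.sub_apply, mul_sub]
    rw [integral_sub ((h.2.2 i j).integrable_mul h1.continuous h2)
      ((h.2.2 j i).integrable_mul h1.continuous h2), key i j, key j i]
    simp only [sy, sub_self, neg_zero]
  have := hz.ae_zero hΩ subset_rfl ((h.2.2 i j).sub (h.2.2 j i)) Filter.EventuallyEq.rfl
  exact this.mono fun x hx => by simpa [sub_eq_zero] using hx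

/-- The complex conjugate of a jet. -/
def conjJet (J : Jet) : Jet :=
  (fun x => starRingEnd ℂ (J.1 x), fun i x => starRingEnd ℂ (J.2.1 i x),
    fun i j x => starRingEnd ℂ (J.2.2 i j x))

theorem MemL2loc.conj {Ω : Set Plane} {f : Plane → ℂ} (h : MemL2loc Ω f) :
    MemL2loc Ω (fun x => starRingEnd ℂ (f x)) := fun K hK => (h K hK).star

theorem IsWeakDeriv.conj {Ω : Set Plane} {i : Fin 2} {u w : Plane → ℂ}
    (h : IsWeakDeriv Ω i u w) :
    IsWeakDeriv Ω i (fun x => starRingEnd ℂ (u x)) (fun x => starRingEnd ℂ (w x)) := by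
  intro φ h1 h2 h3
  have e := congrArg (starRingEnd ℂ) (h φ h1 h2 h3)
  rw [map_neg, ← integral_conj, ← integral_conj] at e
  simpa using e

theorem JetL2loc.conj {Ω : Set Plane} {J : Jet} (h : JetL2loc Ω J) : JetL2loc Ω (conjJet J) :=
  ⟨h.1.conj, fun i => (h.2.1 i).conj, fun i j => (h.2.2 i j).conj⟩

theorem IsWeakJet.conj {Ω : Set Plane} {J : Jet} (h : IsWeakJet Ω J) : IsWeakJet Ω (conjJet J) :=
  ⟨fun i => (h.1 i).conj, fun i j => (h.2 i j).conj⟩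


/-! ### Geometry of the hexagon and the rhombi -/

/-- The rotation by `2π/3`; its square is `rotMap`. -/
def turn (x : Plane) : Plane :=
  (-(1 / 2) * x.1 - √3 / 2 * x.2, √3 / 2 * x.1 - 1 / 2 * x.2)

def turnMatrix : Matrix (Fin 2) (Fin 2) ℝ := !![-(1 / 2), -(√3 / 2); √3 / 2, -(1 / 2)]

theorem sqrt3_mul_self : (√3 : ℝ) * √3 = 3 := Real.mul_self_sqrt (by norm_num)

theorem turn_eq_aff : turn = aff turnMatrix 0 := by
  funext x
  ext <;> simp [turn, aff, turnMatrix] <;> ring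

theorem det_turnMatrix : turnMatrix.det = 1 := by
  have := sqrt3_mul_self
  simp only [turnMatrix, Matrix.det_fin_two_of]
  nlinarith

theorem turn_turn (x : Plane) : turn (turn x) = rotMap x := by
  have h := sqrt3_mul_self
  ext <;> simp only [turn, rotMap] <;> ring_nf <;> rw [Real.sq_sqrt (by norm_num)] <;> ring

theorem turn_rotMap (x : Plane) : turn (rotMap x) = x := by
  ext <;> simp only [turn, rotMap] <;> ring_nf <;> rw [Real.sq_sqrt (by norm_num)] <;> ring

theorem rotMap_turn (x : Plane) : rotMap (turn x) = x := by
  rw [← turn_turn, turn_turn x, turn_rotMap]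

theorem rotMap_rotMap (x : Plane) : rotMap (rotMap x) = turn x := by
  rw [← turn_turn x, rotMap_turn]

theorem turn_add (x y : Plane) : turn (x + y) = turn x + turn y := by
  ext <;> simp [turn] <;> ring

theorem turn_sub (x y : Plane) : turn (x - y) = turn x - turn y := by
  ext <;> simp [turn] <;> ring

theorem turn_smul (c : ℝ) (x : Plane) : turn (c • x) = c • turn x := by
  ext <;> simp [turn] <;> ring

theorem continuous_turn : Continuous turn := turn_eq_aff ▸ continuous_aff _ _

theorem measurePreserving_turn : MeasurePreserving turn (volume : Measure Plane) volume := by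
  refine ⟨continuous_turn.measurable, ?_⟩
  rw [turn_eq_aff, map_aff_volume (by rw [det_turnMatrix]; norm_num), det_turnMatrix]
  simp

theorem measurePreserving_rotMap : MeasurePreserving rotMap (volume : Measure Plane) volume := by
  have : rotMap = turn ∘ turn := by funext x; simp [turn_turn]
  rw [this]
  exact measurePreserving_turn.comp measurePreserving_turn

theorem vertex_add_two (m : ℤ) : vertex (m + 2) = turn (vertex m) := by
  have hc : Real.cos (2 * Real.pi / 3) = -(1 / 2) := by
    rw [show 2 * Real.pi / 3 = Real.pi - Real.pi / 3 by ring, Real.cos_pi_sub,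
      Real.cos_pi_div_three]
  have hs : Real.sin (2 * Real.pi / 3) = √3 / 2 := by
    rw [show 2 * Real.pi / 3 = Real.pi - Real.pi / 3 by ring, Real.sin_pi_sub,
      Real.sin_pi_div_three]
  have e : ((m + 2 : ℤ) : ℝ) * Real.pi / 3 = m * Real.pi / 3 + 2 * Real.pi / 3 := by
    push_cast; ring
  ext <;> simp only [vertex, turn, e, Real.cos_add, Real.sin_add, hc, hs] <;> ring

theorem vertex_add_three (m : ℤ) : vertex (m + 3) = -vertex m := by
  have e : ((m + 3 : ℤ) : ℝ) * Real.pi / 3 = m * Real.pi / 3 + Real.pi := by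
    push_cast; ring
  ext <;> simp only [vertex, e, Real.cos_add_pi, Real.sin_add_pi, Prod.fst_neg, Prod.snd_neg] <;>
    ring

theorem vertex_add_six (m q : ℤ) : vertex (m + 6 * q) = vertex m := by
  have e : ((m + 6 * q : ℤ) : ℝ) * Real.pi / 3 = m * Real.pi / 3 + q * (2 * Real.pi) := by
    push_cast; ring
  simp only [vertex, e, Real.cos_add_int_mul_two_pi, Real.sin_add_int_mul_two_pi]

theorem vertex_succ (m : ℤ) : vertex (m + 1) = turn (vertex (m - 1)) := by
  rw [← vertex_add_two]; congr 1; ring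

theorem vertex_self (m : ℤ) : vertex m = vertex (m - 1) + vertex (m + 1) := by
  have h1 : vertex (m - 1) = -vertex (m + 2) := by
    rw [← vertex_add_three, show m + 2 + 3 = m - 1 + 6 * 1 by ring, vertex_add_six]
  have h2 : vertex (m + 1) = -turn (turn (vertex m)) := by
    rw [← vertex_add_two, ← vertex_add_two, ← vertex_add_three,
      show m + 2 + 2 + 3 = m + 1 + 6 * 1 by ring, vertex_add_six]
  rw [h1, h2, vertex_add_two, turn_turn]
  ext <;> simp [turn, rotMap] <;> ring

theorem vertex_zero : vertex 0 = (√3 / 3, 0) := by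
  have h := sqrt3_mul_self
  have hp : (0 : ℝ) < √3 := by positivity
  ext
  · simp only [vertex]
    simp
    field_simp
    nlinarith
  · simp [vertex]

/-- The six possible positions of the rhombus. -/
theorem vertex_cases (m : ℤ) :
    (Even m ∧ (vertex (m - 1) = (√3 / 6, -(1 / 2)) ∨ vertex (m - 1) = (√3 / 6, 1 / 2) ∨
      vertex (m - 1) = (-(√3 / 3), 0))) ∨
    (¬ Even m ∧ (vertex (m - 1) = (√3 / 3, 0) ∨ vertex (m - 1) = (-(√3 / 6), 1 / 2) ∨
      vertex (m - 1) = (-(√3 / 6), -(1 / 2)))) := by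
  have h3 := sqrt3_mul_self
  have v0 := vertex_zero
  have v2 : vertex 2 = (-(√3 / 6), 1 / 2) := by
    rw [show (2 : ℤ) = 0 + 2 by norm_num, vertex_add_two, v0]
    ext <;> simp only [turn] <;> nlinarith
  have v4 : vertex 4 = (-(√3 / 6), -(1 / 2)) := by
    rw [show (4 : ℤ) = 2 + 2 by norm_num, vertex_add_two, v2]
    ext <;> simp only [turn] <;> nlinarith
  have v3 : vertex 3 = (-(√3 / 3), 0) := by
    rw [show (3 : ℤ) = 0 + 3 by norm_num, vertex_add_three, v0]
    simp
  have v5 : vertex 5 = (√3 / 6, -(1 / 2)) := by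
    rw [show (5 : ℤ) = 2 + 3 by norm_num, vertex_add_three, v2]
    simp
  have v1 : vertex 1 = (√3 / 6, 1 / 2) := by
    have := vertex_add_three 1
    rw [show (1 : ℤ) + 3 = 4 by norm_num, v4, eq_comm, neg_eq_iff_eq_neg] at this
    rw [this]
    simp
  have key : ∀ i, (m - 1) % 6 = i → vertex (m - 1) = vertex i := by
    intro i hi
    rw [show m - 1 = i + 6 * ((m - 1) / 6) by omega, vertex_add_six]
  have hr : (m - 1) % 6 = 0 ∨ (m - 1) % 6 = 1 ∨ (m - 1) % 6 = 2 ∨ (m - 1) % 6 = 3 ∨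
    (m - 1) % 6 = 4 ∨ (m - 1) % 6 = 5 := by omega
  rw [Int.even_iff]
  rcases hr with h | h | h | h | h | h <;> have hk := key _ h
  · exact Or.inr ⟨by omega, Or.inl (hk.trans v0)⟩
  · exact Or.inl ⟨by omega, Or.inr (Or.inl (hk.trans v1))⟩
  · exact Or.inr ⟨by omega, Or.inr (Or.inl (hk.trans v2))⟩
  · exact Or.inl ⟨by omega, Or.inr (Or.inr (hk.trans v3))⟩
  · exact Or.inr ⟨by omega, Or.inr (Or.inr (hk.trans v4))⟩
  · exact Or.inl ⟨by omega, Or.inl (hk.trans v5)⟩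

/-- First coordinate with respect to the basis `vertex (m - 1)`, `vertex (m + 1)`. -/
def coordA (m : ℤ) (x : Plane) : ℝ :=
  (x.1 * (vertex (m + 1)).2 - x.2 * (vertex (m + 1)).1) / (√3 / 6)

/-- Second coordinate with respect to the basis `vertex (m - 1)`, `vertex (m + 1)`. -/
def coordB (m : ℤ) (x : Plane) : ℝ :=
  ((vertex (m - 1)).1 * x.2 - (vertex (m - 1)).2 * x.1) / (√3 / 6)

theorem coordA_comb (m : ℤ) (s t : ℝ) :
    coordA m (s • vertex (m - 1) + t • vertex (m + 1)) = s := by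
  have hpos : (0 : ℝ) < √3 / 6 := by positivity
  rw [coordA, div_eq_iff hpos.ne', ← vertex_cross m]
  simp only [Prod.fst_add, Prod.snd_add, Prod.smul_fst, Prod.smul_snd, smul_eq_mul]
  ring

theorem coordB_comb (m : ℤ) (s t : ℝ) :
    coordB m (s • vertex (m - 1) + t • vertex (m + 1)) = t := by
  have hpos : (0 : ℝ) < √3 / 6 := by positivity
  rw [coordB, div_eq_iff hpos.ne', ← vertex_cross m]
  simp only [Prod.fst_add, Prod.snd_add, Prod.smul_fst, Prod.smul_snd, smul_eq_mul]
  ring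

theorem comb_coord (m : ℤ) (x : Plane) :
    coordA m x • vertex (m - 1) + coordB m x • vertex (m + 1) = x := by
  have hpos : (0 : ℝ) < √3 / 6 := by positivity
  unfold coordA coordB
  ext <;> simp only [Prod.fst_add, Prod.snd_add, Prod.smul_fst, Prod.smul_snd, smul_eq_mul]
  · rw [div_mul_eq_mul_div, div_mul_eq_mul_div, ← add_div, div_eq_iff hpos.ne', ← vertex_cross m]
    ring
  · rw [div_mul_eq_mul_div, div_mul_eq_mul_div, ← add_div, div_eq_iff hpos.ne', ← vertex_cross m]
    ring

theorem mem_rhombus_iff (m : ℤ) (x : Plane) :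
    x ∈ rhombus m ↔ coordA m x ∈ Ioo (0 : ℝ) 1 ∧ coordB m x ∈ Ioo (0 : ℝ) 1 := by
  constructor
  · rintro ⟨s, hs, t, ht, rfl⟩
    rw [coordA_comb, coordB_comb]
    exact ⟨hs, ht⟩
  · rintro ⟨h1, h2⟩
    exact ⟨_, h1, _, h2, (comb_coord m x).symm⟩

/-- `turn` sends the first basis vector to the second and the second to minus their sum. In these
coordinates all questions about rhombi, rotated rhombi and the hexagon become linear inequalities
with integer coefficients. -/
theorem turn_comb (m : ℤ) (s t : ℝ) :
    turn (s • vertex (m - 1) + t • vertex (m + 1)) =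
      (-t) • vertex (m - 1) + (s - t) • vertex (m + 1) := by
  rw [vertex_succ, turn_add, turn_smul, turn_smul, turn_turn]
  ext <;> simp [turn, rotMap] <;> ring

theorem coordA_turn (m : ℤ) (x : Plane) : coordA m (turn x) = -coordB m x := by
  conv_lhs => rw [← comb_coord m x, turn_comb, coordA_comb]

theorem coordB_turn (m : ℤ) (x : Plane) : coordB m (turn x) = coordA m x - coordB m x := by
  conv_lhs => rw [← comb_coord m x, turn_comb, coordB_comb]

theorem coordA_rotMap (m : ℤ) (x : Plane) : coordA m (rotMap x) = coordB m x - coordA m x := by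
  rw [← turn_turn, coordA_turn, coordB_turn]; ring

theorem coordB_rotMap (m : ℤ) (x : Plane) : coordB m (rotMap x) = -coordA m x := by
  rw [← turn_turn, coordB_turn, coordB_turn, coordA_turn]; ring

/-- In each of the six positions of the rhombus, `coordA`, `coordB` and their difference are, up to
order and sign, the forms 2x₂, √3x₁+x₂ and √3x₁-x₂ that bound the hexagon. -/
theorem mem_hexagon_iff (m : ℤ) (x : Plane) :
    x ∈ hexagon ↔ |coordA m x| < 1 ∧ |coordB m x| < 1 ∧ |coordA m x - coordB m x| < 1 := by
  have h3 := sqrt3_mul_self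
  have hpos : (0 : ℝ) < √3 := by positivity
  have hA : ∀ y z : ℝ, (√3 / 6) * y = z → ∀ w : ℝ, √3 * w = 6 * z → y = w := by
    intro y z h w h'
    have : √3 * y = √3 * w := by linarith
    exact mul_left_cancel₀ hpos.ne' this
  have a : (√3 / 6) * coordA m x =
      x.1 * (turn (vertex (m - 1))).2 - x.2 * (turn (vertex (m - 1))).1 := by
    rw [coordA, vertex_succ]; field_simp
  have b : (√3 / 6) * coordB m x = (vertex (m - 1)).1 * x.2 - (vertex (m - 1)).2 * x.1 := by
    rw [coordB]; field_simp
  have hex : x ∈ hexagon ↔ |2 * x.2| < 1 ∧ |√3 * x.1 + x.2| < 1 ∧ |√3 * x.1 - x.2| < 1 := by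
    simp only [hexagon, mem_ofPred_eq, abs_lt]
    constructor
    · rintro ⟨⟨h1, h2⟩, ⟨h4, h5⟩, h6, h7⟩
      refine ⟨⟨?_, ?_⟩, ⟨?_, ?_⟩, ?_, ?_⟩ <;> linarith
    · rintro ⟨⟨h1, h2⟩, ⟨h4, h5⟩, h6, h7⟩
      refine ⟨⟨?_, ?_⟩, ⟨?_, ?_⟩, ?_, ?_⟩ <;> linarith
  rw [hex]
  rcases vertex_cases m with ⟨_, h | h | h⟩ | ⟨_, h | h | h⟩ <;> rw [h] at a b <;>
    simp only [turn] at a b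
  · have a' := hA _ _ a (√3 * x.1 - x.2) (by linear_combination (x.1 / 2) * h3)
    have b' := hA _ _ b (√3 * x.1 + x.2) (by linear_combination (x.1) * h3)
    rw [a', b', show √3 * x.1 - x.2 - (√3 * x.1 + x.2) = -(2 * x.2) by ring, abs_neg]
    tauto
  · have a' := hA _ _ a (2 * x.2) (by linear_combination (-x.1 / 2) * h3)
    have b' := hA _ _ b (-(√3 * x.1 - x.2)) (by linear_combination (-x.1) * h3)
    rw [a', b', show 2 * x.2 - -(√3 * x.1 - x.2) = √3 * x.1 + x.2 by ring, abs_neg]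
    tauto
  · have a' := hA _ _ a (-(√3 * x.1 + x.2)) (by ring)
    have b' := hA _ _ b (-(2 * x.2)) (by ring)
    rw [a', b', show -(√3 * x.1 + x.2) - -(2 * x.2) = -(√3 * x.1 - x.2) by ring, abs_neg, abs_neg,
      abs_neg]
    tauto
  · have a' := hA _ _ a (√3 * x.1 + x.2) (by ring)
    have b' := hA _ _ b (2 * x.2) (by ring)
    rw [a', b', show √3 * x.1 + x.2 - 2 * x.2 = √3 * x.1 - x.2 by ring]
    tauto
  · have a' := hA _ _ a (-(√3 * x.1 - x.2)) (by linear_combination (-x.1 / 2) * h3)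
    have b' := hA _ _ b (-(√3 * x.1 + x.2)) (by linear_combination (-x.1) * h3)
    rw [a', b', show -(√3 * x.1 - x.2) - -(√3 * x.1 + x.2) = 2 * x.2 by ring, abs_neg, abs_neg]
    tauto
  · have a' := hA _ _ a (-(2 * x.2)) (by linear_combination (x.1 / 2) * h3)
    have b' := hA _ _ b (√3 * x.1 - x.2) (by linear_combination (x.1) * h3)
    rw [a', b', show -(2 * x.2) - (√3 * x.1 - x.2) = -(√3 * x.1 + x.2) by ring, abs_neg, abs_neg]
    tauto

theorem turn_mem_hexagon {x : Plane} : turn x ∈ hexagon ↔ x ∈ hexagon := by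
  rw [mem_hexagon_iff 0, mem_hexagon_iff 0 x, coordA_turn, coordB_turn, abs_neg,
    show -coordB 0 x - (coordA 0 x - coordB 0 x) = -coordA 0 x by ring, abs_neg]
  tauto

theorem rotMap_mem_hexagon {x : Plane} : rotMap x ∈ hexagon ↔ x ∈ hexagon := by
  rw [← turn_turn, turn_mem_hexagon, turn_mem_hexagon]

theorem rhombus_subset_hexagon (m : ℤ) : rhombus m ⊆ hexagon := by
  intro x hx
  obtain ⟨⟨a, b⟩, c, d⟩ := (mem_rhombus_iff m x).1 hx
  rw [mem_hexagon_iff m]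
  refine ⟨?_, ?_, ?_⟩ <;> rw [abs_lt] <;> constructor <;> linarith

theorem turn_notMem_rhombus {m : ℤ} {x : Plane} (hx : x ∈ rhombus m) : turn x ∉ rhombus m := by
  rw [mem_rhombus_iff, coordA_turn]
  obtain ⟨⟨a, b⟩, c, d⟩ := (mem_rhombus_iff m x).1 hx
  rintro ⟨⟨h, _⟩, _⟩
  linarith

theorem rotMap_notMem_rhombus {m : ℤ} {x : Plane} (hx : x ∈ rhombus m) :
    rotMap x ∉ rhombus m := fun h => turn_notMem_rhombus h (by rwa [turn_rotMap])

/-- The norm of `Plane` is the maximum norm. The crude radius 1 suffices for all later counting of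
cells. -/
theorem norm_le_of_mem_hexagon {x : Plane} (hx : x ∈ hexagon) : ‖x‖ ≤ 1 := by
  have h3 := sqrt3_mul_self
  have hpos : (1 : ℝ) ≤ √3 := by
    rw [Real.one_le_sqrt]; norm_num
  obtain ⟨h1, h2, h4⟩ := hx
  rw [abs_lt] at h1 h2 h4
  rw [Prod.norm_def, Real.norm_eq_abs, Real.norm_eq_abs, max_le_iff, abs_le, abs_le]
  refine ⟨⟨?_, ?_⟩, ?_, ?_⟩
  · by_contra! h; nlinarith
  · by_contra! h; nlinarith
  · linarith
  · linarith

theorem isBounded_hexagon : Bornology.IsBounded hexagon :=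
  (Metric.isBounded_closedBall (x := (0 : Plane)) (r := 1)).subset fun x hx => by
    simpa using norm_le_of_mem_hexagon hx

theorem isBounded_rhombus (m : ℤ) : Bornology.IsBounded (rhombus m) :=
  isBounded_hexagon.subset (rhombus_subset_hexagon m)

theorem measurableSet_hexagon : MeasurableSet hexagon := isOpen_hexagon.measurableSet

theorem measurableSet_rhombus (m : ℤ) : MeasurableSet (rhombus m) := (isOpen_rhombus m).measurableSet

/-- A vertical line is a null set, and the similarity with rows (c, d) and (-d, c), of determinant
c²+d², carries the given line to a vertical one. -/
theorem ae_linear_ne (c d e : ℝ) (h : c ^ 2 + d ^ 2 ≠ 0) :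
    ∀ᵐ x : Plane, c * x.1 + d * x.2 ≠ e := by
  have h0 : ∀ᵐ x : Plane, x.1 ≠ e := by
    rw [ae_iff, Measure.volume_eq_prod]
    have : {a : Plane | ¬a.1 ≠ e} = {e} ×ˢ univ := by ext; simp
    rw [this, Measure.prod_prod]
    simp
  have := ae_aff (M := !![c, d; -d, c]) (by
    rw [Matrix.det_fin_two_of]; convert h using 1; ring) 0 h0
  refine this.mono fun x hx => ?_
  simpa [aff] using hx

/-- The three lines through the centre that carry the sides shared by the rotated rhombi. One of
them is null as a line, and the others are its preimages under `turn` and its square. -/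
theorem ae_coord_ne (m : ℤ) : ∀ᵐ x : Plane, coordA m x ≠ 0 ∧ coordB m x ≠ 0 ∧
    coordA m x - coordB m x ≠ 0 := by
  have hpos : (0 : ℝ) < √3 / 6 := by positivity
  have hne : vertex (m - 1) ≠ 0 := by
    intro h
    have := vertex_cross m
    rw [h] at this
    simp only [Prod.fst_zero, Prod.snd_zero, zero_mul, sub_zero] at this
    exact hpos.ne this
  have sq : ∀ x : Plane, x ≠ 0 → (-x.2) ^ 2 + x.1 ^ 2 ≠ 0 := by
    intro x hx h
    apply hx
    ext
    · have : x.1 ^ 2 = 0 := by nlinarith [sq_nonneg x.1, sq_nonneg x.2]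
      simpa using this
    · have : x.2 ^ 2 = 0 := by nlinarith [sq_nonneg x.1, sq_nonneg x.2]
      simpa using this
  have hB : ∀ᵐ x : Plane, coordB m x ≠ 0 := by
    filter_upwards [ae_linear_ne _ _ 0 (sq _ hne)] with x hx h
    rw [coordB, div_eq_zero_iff] at h
    rcases h with h | h
    · exact hx (by linarith)
    · exact hpos.ne' h
  have hdet : turnMatrix.det ≠ 0 := by rw [det_turnMatrix]; norm_num
  have hB' := ae_aff hdet 0 hB
  have hB'' := ae_aff hdet 0 hB'
  rw [← turn_eq_aff] at hB' hB''
  filter_upwards [hB, hB', hB''] with x h1 h2 h3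
  rw [coordB_turn] at h2 h3
  rw [coordA_turn, coordB_turn] at h3
  exact ⟨fun h => h3 (by linarith), h1, h2⟩

/-- Up to a null set, the hexagon is covered by three rhombi. -/
theorem ae_mem_rhombi (m : ℤ) : ∀ᵐ x ∂(volume.restrict hexagon),
    x ∈ rhombus m ∨ rotMap x ∈ rhombus m ∨ turn x ∈ rhombus m := by
  rw [ae_restrict_iff' measurableSet_hexagon]
  filter_upwards [ae_coord_ne m] with x hx hh
  obtain ⟨ha, hb, hab⟩ := hx
  obtain ⟨h1, h2, h3⟩ := (mem_hexagon_iff m x).1 hh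
  rw [abs_lt] at h1 h2 h3
  rw [mem_rhombus_iff, mem_rhombus_iff, mem_rhombus_iff, coordA_turn, coordB_turn, coordA_rotMap,
    coordB_rotMap]
  simp only [mem_Ioo]
  -- The three lines cut the plane into six sectors, two for each of the three rotated rhombi; the
  -- signs of `coordA`, `coordB` and their difference decide which rotate of `x` lies in the
  -- rhombus.
  rcases lt_or_gt_of_ne ha with ha | ha
  · rcases lt_or_gt_of_ne hab with hab | hab
    · refine Or.inr (Or.inl ⟨⟨?_, ?_⟩, ?_, ?_⟩) <;> linarith
    · refine Or.inr (Or.inr ⟨⟨?_, ?_⟩, ?_, ?_⟩) <;> linarith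
  · rcases lt_or_gt_of_ne hb with hb | hb
    · refine Or.inr (Or.inr ⟨⟨?_, ?_⟩, ?_, ?_⟩) <;> linarith
    · exact Or.inl ⟨⟨ha, h1.2⟩, hb, h2.2⟩

/-- A property holds almost everywhere on the hexagon if its three rotated versions hold
almost everywhere on a rhombus. -/
theorem ae_hexagon_of_rhombus (m : ℤ) {P : Plane → Prop}
    (h0 : ∀ᵐ x ∂(volume.restrict (rhombus m)), P x)
    (h1 : ∀ᵐ x ∂(volume.restrict (rhombus m)), P (turn x))
    (h2 : ∀ᵐ x ∂(volume.restrict (rhombus m)), P (rotMap x)) :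
    ∀ᵐ x ∂(volume.restrict hexagon), P x := by
  rw [ae_restrict_iff' (measurableSet_rhombus m)] at h0 h1 h2
  filter_upwards [ae_mem_rhombi m, ae_restrict_of_ae h0,
    ae_restrict_of_ae (measurePreserving_rotMap.quasiMeasurePreserving.ae h1),
    ae_restrict_of_ae (measurePreserving_turn.quasiMeasurePreserving.ae h2)] with x hx a b c
  rcases hx with hx | hx | hx
  · exact a hx
  · have := b hx; rwa [turn_rotMap] at this
  · have := c hx; rwa [rotMap_turn] at this

/-! ### The lattice -/

/-- The lattice point with index `n`. -/
def lat (n : ℤ × ℤ) : Plane := (n.1 : ℝ) • latticeA1 + (n.2 : ℝ) • latticeA2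

theorem lat_fst (n : ℤ × ℤ) : (lat n).1 = √3 / 2 * (n.1 + n.2) := by
  simp [lat, latticeA1, latticeA2]; ring

theorem lat_snd (n : ℤ × ℤ) : (lat n).2 = (n.1 - n.2) / 2 := by
  simp [lat, latticeA1, latticeA2]; ring

theorem lat_add (n n' : ℤ × ℤ) : lat (n + n') = lat n + lat n' := by
  ext
  · simp only [lat_fst, Prod.fst_add, Prod.snd_add, Int.cast_add]; ring
  · simp only [lat_snd, Prod.fst_add, Prod.snd_add, Int.cast_add]; ring

theorem lat_zero : lat 0 = 0 := by simp [lat]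

theorem lat_neg (n : ℤ × ℤ) : lat (-n) = -lat n := by
  ext
  · simp only [lat_fst, Prod.fst_neg, Prod.snd_neg, Int.cast_neg]; ring
  · simp only [lat_snd, Prod.snd_neg, Prod.fst_neg, Int.cast_neg]; ring

/-- The action of `turn` on the indices of the lattice points. -/
def turnIdx : (ℤ × ℤ) ≃+ (ℤ × ℤ) where
  toFun n := (n.2, -n.1 - n.2)
  invFun n := (-n.1 - n.2, n.1)
  left_inv n := Prod.ext (by simp only; ring) rfl
  right_inv n := by ext <;> simp
  map_add' n n' := by ext <;> simp; ring

theorem turn_lat (n : ℤ × ℤ) : turn (lat n) = lat (turnIdx n) := by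
  have h := sqrt3_mul_self
  ext
  · simp only [turn, lat_fst, lat_snd, turnIdx, AddEquiv.coe_mk, Equiv.coe_fn_mk]
    push_cast
    ring
  · simp only [turn, lat_fst, lat_snd, turnIdx, AddEquiv.coe_mk, Equiv.coe_fn_mk]
    push_cast
    linear_combination (n.1 + n.2 : ℝ) / 4 * h

/-- The translation which maps the image of an outer side of the rhombus under `turn` to the
other outer side. -/
theorem exists_lat_eq_vertex_sub (m : ℤ) : ∃ d : ℤ × ℤ, vertex m - turn (vertex m) = lat d ∧
    ∃ q : ℤ, d.1 - d.2 = (if Even m then -1 else 1) + 3 * q := by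
  have h3 := sqrt3_mul_self
  -- Everything is expressed by `vertex (m - 1)`, for which there are six explicit values. Only the
  -- class of `d.1 - d.2` modulo 3 matters for the Bloch phase at `k*`, and it depends only on the
  -- parity of `m`.
  have e : vertex m - turn (vertex m) = (2 : ℝ) • vertex (m - 1) + turn (vertex (m - 1)) := by
    rw [vertex_self m, vertex_succ, turn_add, turn_turn]
    ext <;> simp [turn, rotMap] <;> ring
  rw [e]
  rcases vertex_cases m with ⟨hm, h | h | h⟩ | ⟨hm, h | h | h⟩ <;> rw [h] <;> simp only [hm, if_true,
    if_false]
  · refine ⟨(0, 1), ?_, 0, by norm_num⟩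
    ext
    · simp [turn, lat_fst]; nlinarith
    · simp [turn, lat_snd]; nlinarith
  · refine ⟨(1, -1), ?_, 1, by norm_num⟩
    ext
    · simp [turn, lat_fst]; nlinarith
    · simp [turn, lat_snd]; nlinarith
  · refine ⟨(-1, 0), ?_, 0, by norm_num⟩
    ext
    · simp [turn, lat_fst]; nlinarith
    · simp [turn, lat_snd]; nlinarith
  · refine ⟨(1, 0), ?_, 0, by norm_num⟩
    ext
    · simp [turn, lat_fst]; nlinarith
    · simp [turn, lat_snd]; nlinarith
  · refine ⟨(0, -1), ?_, 0, by norm_num⟩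
    ext
    · simp [turn, lat_fst]; nlinarith
    · simp [turn, lat_snd]; nlinarith
  · refine ⟨(-1, 1), ?_, -1, by norm_num⟩
    ext
    · simp [turn, lat_fst]; nlinarith
    · simp [turn, lat_snd]; nlinarith

/-- Different lattice translates of the hexagon are disjoint. -/
theorem eq_zero_of_mem_hexagon_add_lat {x : Plane} {n : ℤ × ℤ} (hx : x ∈ hexagon)
    (hn : x + lat n ∈ hexagon) : n = 0 := by
  have h3 := sqrt3_mul_self
  obtain ⟨a1, a2, a3⟩ := hx
  obtain ⟨b1, b2, b3⟩ := hn
  simp only [Prod.fst_add, Prod.snd_add, lat_fst, lat_snd] at b1 b2 b3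
  rw [abs_lt] at a1 a2 a3 b1 b2 b3
  -- Doubled, the three forms of the hexagon take integer values at lattice points, and here they
  -- are smaller than 2 in absolute value. The sum of the last two is 3(n₁+n₂), so n₁+n₂ = 0; the
  -- first is then 2n₁, so n₁ = 0.
  have c1 : |((n.1 - n.2 : ℤ) : ℝ)| < 2 := by
    push_cast; rw [abs_lt]; constructor <;> linarith
  have c2 : |((2 * n.1 + n.2 : ℤ) : ℝ)| < 2 := by
    push_cast; rw [abs_lt]; constructor <;> nlinarith
  have c3 : |((n.1 + 2 * n.2 : ℤ) : ℝ)| < 2 := by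
    push_cast; rw [abs_lt]; constructor <;> nlinarith
  have d1 : |n.1 - n.2| < 2 := by exact_mod_cast c1
  have d2 : |2 * n.1 + n.2| < 2 := by exact_mod_cast c2
  have d3 : |n.1 + 2 * n.2| < 2 := by exact_mod_cast c3
  rw [abs_lt] at d1 d2 d3
  ext
  · simp; omega
  · simp; omega

/-- Up to a null set, the lattice translates of the hexagon cover the plane. -/
theorem ae_exists_sub_lat_mem_hexagon : ∀ᵐ x : Plane, ∃ n : ℤ × ℤ, x - lat n ∈ hexagon := by
  have h3 := sqrt3_mul_self
  have hpos : (0 : ℝ) < √3 := by positivity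
  have l1 : ∀ᵐ x : Plane, ∀ k : ℤ, 2 * x.2 ≠ k := ae_all_iff.2 fun k => by
    simpa using ae_linear_ne 0 2 k (by norm_num)
  have l2 : ∀ᵐ x : Plane, ∀ k : ℤ, √3 * x.1 + x.2 ≠ k := ae_all_iff.2 fun k => by
    simpa using ae_linear_ne (√3) 1 k (by positivity)
  have l3 : ∀ᵐ x : Plane, ∀ k : ℤ, √3 * x.1 - x.2 ≠ k := ae_all_iff.2 fun k => by
    have := ae_linear_ne (√3) (-1) k (by positivity)
    refine this.mono fun x hx h => hx (by linarith)
  filter_upwards [l1, l2, l3] with x h1 h2 h4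
  -- The coordinates of `x` in the basis `latticeA1`, `latticeA2`.
  set α := √3 * x.1 / 3 + x.2 with hα
  set β := √3 * x.1 / 3 - x.2 with hβ
  have key : ∀ n : ℤ × ℤ, |(α - n.1) - (β - n.2)| < 1 → |2 * (α - n.1) + (β - n.2)| < 1 →
      |(α - n.1) + 2 * (β - n.2)| < 1 → x - lat n ∈ hexagon := by
    intro n k1 k2 k3
    rw [abs_lt] at k1 k2 k3
    have e : √3 / 2 * (x.1 - √3 / 2 * (n.1 + n.2)) = √3 * x.1 / 2 - 3 / 4 * (n.1 + n.2) := by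
      linear_combination (-(n.1 + n.2 : ℝ) / 4) * h3
    refine ⟨?_, ?_, ?_⟩ <;> simp only [Prod.fst_sub, Prod.snd_sub, lat_fst, lat_snd, e] <;>
      rw [abs_lt] <;> constructor <;> linarith
  set a := Int.fract α with ha
  set b := Int.fract β with hb
  have fa : α = ⌊α⌋ + a := (Int.floor_add_fract α).symm
  have fb : β = ⌊β⌋ + b := (Int.floor_add_fract β).symm
  have ra := Int.fract_nonneg α
  have ra' := Int.fract_lt_one α
  have rb := Int.fract_nonneg β
  have rb' := Int.fract_lt_one β
  rw [← ha] at ra ra'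
  rw [← hb] at rb rb'
  have e1 : a ≠ b := fun h => h1 (⌊α⌋ - ⌊β⌋) (by push_cast; linarith)
  have e2 : ∀ k : ℤ, 2 * a + b ≠ k := fun k h => h2 (2 * ⌊α⌋ + ⌊β⌋ + k) (by push_cast; linarith)
  have e3 : ∀ k : ℤ, a + 2 * b ≠ k := fun k h => h4 (⌊α⌋ + 2 * ⌊β⌋ + k) (by push_cast; linarith)
  have e2a := e2 1
  have e2b := e2 2
  have e3a := e3 1
  have e3b := e3 2
  push_cast at e2a e2b e3a e3b
  -- The unit cell of the fractional parts is divided among the hexagons centred at its four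
  -- corners. The dividing lines are 2a+b = 1, 2a+b = 2, a+2b = 1, a+2b = 2 and a = b, all avoided
  -- by the excluded null sets.
  by_cases c0 : 2 * a + b < 1 ∧ a + 2 * b < 1
  · refine ⟨(⌊α⌋, ⌊β⌋), key _ ?_ ?_ ?_⟩ <;> rw [abs_lt] <;> constructor <;> simp only <;> linarith
  by_cases c1 : 2 < 2 * a + b ∧ 2 < a + 2 * b
  · refine ⟨(⌊α⌋ + 1, ⌊β⌋ + 1), key _ ?_ ?_ ?_⟩ <;> rw [abs_lt] <;> constructor <;> push_cast <;>
      linarith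
  rcases lt_or_gt_of_ne e1 with hab | hab
  · have i1 : 1 < a + 2 * b := lt_of_le_of_ne (by
      by_contra! h; exact c0 ⟨by linarith, h⟩) (Ne.symm e3a)
    have i2 : 2 * a + b < 2 := lt_of_le_of_ne (by
      by_contra! h; exact c1 ⟨h, by linarith⟩) e2b
    refine ⟨(⌊α⌋, ⌊β⌋ + 1), key _ ?_ ?_ ?_⟩ <;> rw [abs_lt] <;> constructor <;> push_cast <;>
      linarith
  · have i1 : 1 < 2 * a + b := lt_of_le_of_ne (by
      by_contra! h; exact c0 ⟨h, by linarith⟩) (Ne.symm e2a)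
    have i2 : a + 2 * b < 2 := lt_of_le_of_ne (by
      by_contra! h; exact c1 ⟨by linarith, h⟩) e3b
    refine ⟨(⌊α⌋ + 1, ⌊β⌋), key _ ?_ ?_ ?_⟩ <;> rw [abs_lt] <;> constructor <;> push_cast <;>
      linarith

theorem abs_le_norm_lat (n : ℤ × ℤ) : (|n.1| : ℝ) ≤ 2 * ‖lat n‖ ∧ (|n.2| : ℝ) ≤ 2 * ‖lat n‖ := by
  have hpos : (1 : ℝ) ≤ √3 := by
    rw [Real.one_le_sqrt]; norm_num
  have h1 := norm_fst_le (lat n)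
  have h2 := norm_snd_le (lat n)
  rw [Real.norm_eq_abs, lat_fst, abs_mul, abs_of_pos (by positivity)] at h1
  rw [Real.norm_eq_abs, lat_snd, abs_div, abs_of_pos (by norm_num : (0 : ℝ) < 2)] at h2
  have h1' : |(n.1 + n.2 : ℝ)| ≤ 2 * ‖lat n‖ := by
    nlinarith [abs_nonneg (n.1 + n.2 : ℝ)]
  have h2' : |(n.1 - n.2 : ℝ)| ≤ 2 * ‖lat n‖ := by linarith
  rw [abs_le] at h1' h2'
  constructor <;> rw [abs_le] <;> constructor <;> linarith

theorem finite_lat_le (C : ℝ) : {n : ℤ × ℤ | ‖lat n‖ ≤ C}.Finite := by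
  have : {n : ℤ × ℤ | ‖lat n‖ ≤ C} ⊆ Icc (-⌈2 * C⌉) ⌈2 * C⌉ ×ˢ Icc (-⌈2 * C⌉) ⌈2 * C⌉ := by
    intro n hn
    obtain ⟨h1, h2⟩ := abs_le_norm_lat n
    have hn : ‖lat n‖ ≤ C := hn
    have k1 : (|n.1| : ℝ) ≤ ⌈2 * C⌉ := (h1.trans (by linarith)).trans (Int.le_ceil _)
    have k2 : (|n.2| : ℝ) ≤ ⌈2 * C⌉ := (h2.trans (by linarith)).trans (Int.le_ceil _)
    have k1' : |n.1| ≤ ⌈2 * C⌉ := by exact_mod_cast k1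
    have k2' : |n.2| ≤ ⌈2 * C⌉ := by exact_mod_cast k2
    rw [abs_le] at k1' k2'
    exact ⟨k1', k2'⟩
  exact ((finite_Icc _ _).prod (finite_Icc _ _)).subset this


/-! ### Existence of traces -/

/-- Averaging over a probability space contracts L²: on almost every fibre the mean is at most the
L¹ norm, hence at most the L² norm, and Tonelli integrates the fibre bounds. It gives the square
integrability of the explicit traces below. -/
theorem memLp_integral_fst {f : ℝ × ℝ → ℂ} {μ ν : Measure ℝ} [IsProbabilityMeasure μ] [SFinite ν]
    (hf : MemLp f 2 (μ.prod ν)) : MemLp (fun b => ∫ a, f (a, b) ∂μ) 2 ν := by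
  have hm : AEStronglyMeasurable (fun b => ∫ a, f (a, b) ∂μ) ν :=
    hf.1.prod_swap.integral_prod_right'
  refine ⟨hm, ?_⟩
  rw [eLpNorm_lt_top_iff_lintegral_rpow_enorm_lt_top (by norm_num) (by norm_num)]
  have h2 := hf.2
  rw [eLpNorm_lt_top_iff_lintegral_rpow_enorm_lt_top (by norm_num) (by norm_num)] at h2
  rw [lintegral_prod_symm _ (hf.1.enorm.pow_const _)] at h2
  refine lt_of_le_of_lt (lintegral_mono_ae ?_) h2
  have hs : ∀ᵐ b ∂ν, AEStronglyMeasurable (fun a => f (a, b)) μ := hf.1.prod_swap.prodMk_left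
  filter_upwards [hs] with b hb
  have e1 : ‖∫ a, f (a, b) ∂μ‖ₑ ≤ eLpNorm (fun a => f (a, b)) 1 μ := by
    rw [eLpNorm_one_eq_lintegral_enorm]
    exact enorm_integral_le_lintegral_enorm _
  have e2 : eLpNorm (fun a => f (a, b)) 1 μ ≤ eLpNorm (fun a => f (a, b)) 2 μ :=
    eLpNorm_le_eLpNorm_of_exponent_le (by norm_num) hb
  have e3 := ENNReal.rpow_le_rpow (e1.trans e2) (z := (2 : ENNReal).toReal) (by simp)
  refine e3.trans (le_of_eq ?_)
  rw [eLpNorm_eq_lintegral_rpow_enorm_toReal (by norm_num) (by norm_num), ← ENNReal.rpow_mul]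
  simp

/-- With `y = n * a - 1` the weight `y + 1` equals `n * a`, the factor by which rescaling enlarges
the derivative times the distance to the endpoint. The derivative vanishes beyond 1, so compactness
of [-1, 1] gives the bound. -/
theorem exists_bound_deriv_smoothTransition : ∃ B : ℝ, 0 ≤ B ∧
    ∀ y : ℝ, -1 ≤ y → |deriv Real.smoothTransition y| * (y + 1) ≤ B := by
  have hc : Continuous (deriv Real.smoothTransition) :=
    (Real.smoothTransition.contDiff (n := ⊤)).continuous_deriv (by simp)
  obtain ⟨B, hB⟩ := (isCompact_Icc (a := (-1 : ℝ)) (b := 1)).exists_bound_of_continuousOn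
    hc.continuousOn
  have hB0 : 0 ≤ B := (norm_nonneg _).trans (hB 0 (by simp))
  refine ⟨B * 2, by positivity, fun y hy => ?_⟩
  rcases le_or_gt y 1 with h | h
  · have := hB y ⟨hy, h⟩
    rw [Real.norm_eq_abs] at this
    exact mul_le_mul this (by linarith) (by linarith) hB0
  · have : deriv Real.smoothTransition y = 0 := by
      have e : Real.smoothTransition =ᶠ[nhds y] fun _ => 1 :=
        Filter.eventually_of_mem (Ioi_mem_nhds h) fun z hz =>
          Real.smoothTransition.one_of_one_le (le_of_lt hz)
      rw [e.deriv_eq]; simp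
    rw [this]
    simp only [abs_zero, zero_mul]
    positivity

/-- A smooth cut-off function of the unit interval. -/
def cutIoo (n : ℝ) (a : ℝ) : ℝ :=
  Real.smoothTransition (n * a - 1) * Real.smoothTransition (n * (1 - a) - 1)

theorem contDiff_cutIoo (n : ℝ) : ContDiff ℝ ∞ (cutIoo n) := by
  have h : ContDiff ℝ ∞ Real.smoothTransition := Real.smoothTransition.contDiff
  exact (h.comp (by fun_prop)).mul (h.comp (by fun_prop))

theorem abs_cutIoo_le (n a : ℝ) : |cutIoo n a| ≤ 1 := by
  rw [cutIoo, abs_of_nonneg (mul_nonneg (Real.smoothTransition.nonneg _)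
    (Real.smoothTransition.nonneg _))]
  exact mul_le_one₀ (Real.smoothTransition.le_one _) (Real.smoothTransition.nonneg _)
    (Real.smoothTransition.le_one _)

theorem hasDerivAt_cutIoo (n a : ℝ) : HasDerivAt (cutIoo n)
    (deriv Real.smoothTransition (n * a - 1) * n * Real.smoothTransition (n * (1 - a) - 1) +
      Real.smoothTransition (n * a - 1) *
        (deriv Real.smoothTransition (n * (1 - a) - 1) * -n)) a := by
  have hd : Differentiable ℝ Real.smoothTransition :=
    (Real.smoothTransition.contDiff (n := ⊤)).differentiable (by simp)
  have h1 : HasDerivAt (fun a => n * a - 1) n a := by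
    simpa using ((hasDerivAt_id a).const_mul n).sub_const 1
  have h2 : HasDerivAt (fun a => n * (1 - a) - 1) (-n) a := by
    simpa using (((hasDerivAt_id a).const_sub 1).const_mul n).sub_const 1
  exact ((hd _).hasDerivAt.comp a h1).mul ((hd _).hasDerivAt.comp a h2)

theorem cutIoo_eq_one {n a : ℝ} (h1 : 2 ≤ n * a) (h2 : 2 ≤ n * (1 - a)) : cutIoo n a = 1 := by
  rw [cutIoo, Real.smoothTransition.one_of_one_le (by linarith),
    Real.smoothTransition.one_of_one_le (by linarith), one_mul]

theorem cutIoo_eq_zero {n a : ℝ} (h : n * a ≤ 1 ∨ n * (1 - a) ≤ 1) : cutIoo n a = 0 := by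
  rcases h with h | h
  · rw [cutIoo, Real.smoothTransition.zero_of_nonpos (by linarith), zero_mul]
  · rw [cutIoo, Real.smoothTransition.zero_of_nonpos (x := n * (1 - a) - 1) (by linarith), mul_zero]

theorem eventually_cutIoo {a : ℝ} (ha : a ∈ Ioo (0 : ℝ) 1) :
    ∀ᶠ n : ℕ in Filter.atTop, cutIoo n a = 1 ∧ deriv (cutIoo n) a = 0 := by
  have t1 : Filter.Tendsto (fun n : ℕ => (n : ℝ) * a) Filter.atTop Filter.atTop :=
    tendsto_natCast_atTop_atTop.atTop_mul_const ha.1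
  have t2 : Filter.Tendsto (fun n : ℕ => (n : ℝ) * (1 - a)) Filter.atTop Filter.atTop :=
    tendsto_natCast_atTop_atTop.atTop_mul_const (by linarith [ha.2])
  filter_upwards [t1.eventually_gt_atTop 2, t2.eventually_gt_atTop 2] with n h1 h2
  refine ⟨cutIoo_eq_one h1.le h2.le, ?_⟩
  have o1 : ∀ᶠ b in nhds a, 2 < (n : ℝ) * b :=
    (continuous_const.mul continuous_id).continuousAt.eventually (lt_mem_nhds h1)
  have o2 : ∀ᶠ b in nhds a, 2 < (n : ℝ) * (1 - b) :=
    (continuous_const.mul (continuous_const.sub continuous_id)).continuousAt.eventually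
      (lt_mem_nhds h2)
  have e : cutIoo n =ᶠ[nhds a] fun _ => 1 := by
    filter_upwards [o1, o2] with b h3 h4
    exact cutIoo_eq_one h3.le h4.le
  rw [e.deriv_eq]; simp

/-- The derivative of the cutoff is of order `n`, but only at distance of order 1/n from an
endpoint. Against a quantity vanishing linearly at both endpoints the product stays bounded
independently of `n`, which is what dominated convergence needs. -/
theorem exists_bound_deriv_cutIoo : ∃ C : ℝ, 0 ≤ C ∧ ∀ (n : ℕ) (a : ℝ) (z M : ℝ),
    a ∈ Ioo (0 : ℝ) 1 → |z| ≤ M * a → |z| ≤ M * (1 - a) → |deriv (cutIoo n) a * z| ≤ M * C := by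
  obtain ⟨B, hB0, hB⟩ := exists_bound_deriv_smoothTransition
  refine ⟨2 * B, by positivity, fun n a z M ha h1 h2 => ?_⟩
  have hn : (0 : ℝ) ≤ n := n.cast_nonneg
  have hM : 0 ≤ M := by
    by_contra! h
    have := (abs_nonneg z).trans h1
    nlinarith [ha.1]
  have key : ∀ y c w : ℝ, 0 ≤ c → |w| ≤ 1 → |z| ≤ M * c → y = n * c - 1 →
      |deriv Real.smoothTransition y * n * w * z| ≤ M * B := by
    intro y c w hc hw hz hy
    have b := hB y (by rw [hy]; have := mul_nonneg hn hc; linarith)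
    rw [hy, sub_add_cancel] at b
    rw [← hy] at b
    rw [abs_mul, abs_mul, abs_mul, abs_of_nonneg hn]
    calc |deriv Real.smoothTransition y| * n * |w| * |z|
        ≤ |deriv Real.smoothTransition y| * n * 1 * (M * c) := by gcongr
      _ = M * (|deriv Real.smoothTransition y| * (n * c)) := by ring
      _ ≤ M * B := by gcongr
  have st : ∀ y, |Real.smoothTransition y| ≤ 1 := fun y => by
    rw [abs_of_nonneg (Real.smoothTransition.nonneg _)]
    exact Real.smoothTransition.le_one _
  have k1 := key (n * a - 1) a (Real.smoothTransition (n * (1 - a) - 1)) ha.1.le (st _) h1 rfl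
  have k2 := key (n * (1 - a) - 1) (1 - a) (Real.smoothTransition (n * a - 1))
    (by linarith [ha.2]) (st _) h2 rfl
  rw [(hasDerivAt_cutIoo n a).deriv]
  rw [abs_le] at k1 k2 ⊢
  constructor <;> nlinarith

/-! ### Integration by parts on the square, on parallelograms and on the rhombus -/

/-- The open unit square. -/
def unitSquare : Set Plane := Ioo (0 : ℝ) 1 ×ˢ Ioo (0 : ℝ) 1

theorem measurableSet_unitSquare : MeasurableSet unitSquare :=
  measurableSet_Ioo.prod measurableSet_Ioo

instance : IsProbabilityMeasure (volume.restrict (Ioo (0 : ℝ) 1)) := ⟨by simp⟩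

theorem restrict_unitSquare : (volume : Measure Plane).restrict unitSquare =
    (volume.restrict (Ioo (0 : ℝ) 1)).prod (volume.restrict (Ioo (0 : ℝ) 1)) := by
  rw [Measure.prod_restrict]; rfl

instance : IsProbabilityMeasure ((volume : Measure Plane).restrict unitSquare) := by
  rw [restrict_unitSquare]; infer_instance

theorem integrable_mul_unitSquare {f : Plane → ℝ} (hf : Continuous f) {w : Plane → ℂ}
    (hw : MemLp w 2 (volume.restrict unitSquare)) :
    Integrable (fun x => (f x : ℂ) * w x) (volume.restrict unitSquare) := by
  obtain ⟨C, hC⟩ := (isCompact_Icc (a := ((0, 0) : Plane)) (b := (1, 1))).exists_bound_of_continuousOn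
    hf.continuousOn
  refine (hw.integrable (by norm_num)).bdd_mul (c := C)
    (Complex.continuous_ofReal.comp hf).aestronglyMeasurable ?_
  refine (ae_restrict_iff' measurableSet_unitSquare).2 (ae_of_all _ fun x hx => ?_)
  rw [Complex.norm_real]
  exact hC x ⟨⟨hx.1.1.le, hx.2.1.le⟩, ⟨hx.1.2.le, hx.2.2.le⟩⟩

/-- Integration by parts in the first variable on the unit square, for test functions vanishing
on the two sides where the first variable is constant. -/
theorem unitSquare_integral_eq_zero {w w' : Plane → ℂ}
    (hw : MemLp w 2 (volume.restrict unitSquare)) (hw' : MemLp w' 2 (volume.restrict unitSquare))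
    (h : IsWeakDeriv unitSquare 0 w w') {ζ : Plane → ℝ} (hζ : ContDiff ℝ ∞ ζ)
    (h0 : ∀ b, ζ (0, b) = 0) (h1 : ∀ b, ζ (1, b) = 0) :
    ∫ x in unitSquare, ((fderiv ℝ ζ x (basisVec 0) : ℂ) * w x + (ζ x : ℂ) * w' x) = 0 := by
  have hdc : Continuous (fun x => fderiv ℝ ζ x (basisVec 0)) := fderiv_apply_continuous hζ _
  obtain ⟨M, hM⟩ := (isCompact_Icc (a := ((0, 0) : Plane)) (b := (1, 1))).exists_bound_of_continuousOn
    hdc.continuousOn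
  obtain ⟨M', hM'⟩ :=
    (isCompact_Icc (a := ((0, 0) : Plane)) (b := (1, 1))).exists_bound_of_continuousOn
    hζ.continuous.continuousOn
  obtain ⟨C, hC0, hC⟩ := exists_bound_deriv_cutIoo
  have hsq : ∀ x ∈ unitSquare, x ∈ Icc ((0, 0) : Plane) (1, 1) := fun x hx =>
    ⟨⟨hx.1.1.le, hx.2.1.le⟩, ⟨hx.1.2.le, hx.2.2.le⟩⟩
  -- Vanishing on the two sides and the mean value inequality give linear decay towards both sides,
  -- with the slope bounded by the first partial derivative.
  have hb : ∀ x ∈ unitSquare, |ζ x| ≤ M * x.1 ∧ |ζ x| ≤ M * (1 - x.1) := by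
    intro x hx
    have hd : ∀ a ∈ Icc (0 : ℝ) 1, HasDerivWithinAt (fun a => ζ (a, x.2))
        (fderiv ℝ ζ (a, x.2) (basisVec 0)) (Icc 0 1) a := by
      intro a _
      have e : HasDerivAt (fun a : ℝ => ((a, x.2) : Plane)) (basisVec 0) a :=
        (hasDerivAt_id a).prodMk (hasDerivAt_const a x.2)
      exact ((hζ.differentiable (by simp) (a, x.2)).hasFDerivAt.comp_hasDerivAt a e).hasDerivWithinAt
    have hbd : ∀ a ∈ Icc (0 : ℝ) 1, ‖fderiv ℝ ζ (a, x.2) (basisVec 0)‖ ≤ M := fun a ha =>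
      hM _ ⟨⟨ha.1, hx.2.1.le⟩, ⟨ha.2, hx.2.2.le⟩⟩
    have hx1 : x.1 ∈ Icc (0 : ℝ) 1 := ⟨hx.1.1.le, hx.1.2.le⟩
    have a1 := (convex_Icc (0 : ℝ) 1).norm_image_sub_le_of_norm_hasDerivWithin_le hd hbd
      (x := 0) (y := x.1) (by simp) hx1
    have a2 := (convex_Icc (0 : ℝ) 1).norm_image_sub_le_of_norm_hasDerivWithin_le hd hbd
      (x := 1) (y := x.1) (by simp) hx1
    rw [h0, sub_zero, sub_zero, Real.norm_eq_abs, Real.norm_eq_abs, abs_of_pos hx.1.1] at a1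
    rw [h1, sub_zero, Real.norm_eq_abs, Real.norm_eq_abs, abs_sub_comm,
      abs_of_pos (show 0 < 1 - x.1 by linarith [hx.1.2])] at a2
    exact ⟨a1, a2⟩
  -- The cutoff in the second variable is needed for compact support in the open square, but it is
  -- never differentiated and costs nothing.
  let κ : ℕ → Plane → ℝ := fun n x => cutIoo n x.1 * cutIoo n x.2
  let ζn : ℕ → Plane → ℝ := fun n x => κ n x * ζ x
  have hκ : ∀ n, ContDiff ℝ ∞ (κ n) := fun n =>
    ((contDiff_cutIoo n).comp contDiff_fst).mul ((contDiff_cutIoo n).comp contDiff_snd)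
  have hζn : ∀ n, ContDiff ℝ ∞ (ζn n) := fun n => (hκ n).mul hζ
  have hκd : ∀ n x, fderiv ℝ (κ n) x (basisVec 0) = deriv (cutIoo n) x.1 * cutIoo n x.2 := by
    intro n x
    have e1 : HasFDerivAt (fun x : Plane => cutIoo n x.1)
        (deriv (cutIoo n) x.1 • ContinuousLinearMap.fst ℝ ℝ ℝ) x := by
      have := ((contDiff_cutIoo n).differentiable (by simp) x.1).hasDerivAt.comp_hasFDerivAt x
        (hasFDerivAt_fst (𝕜 := ℝ) (p := x))
      exact this
    have e2 : HasFDerivAt (fun x : Plane => cutIoo n x.2)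
        (deriv (cutIoo n) x.2 • ContinuousLinearMap.snd ℝ ℝ ℝ) x := by
      have := ((contDiff_cutIoo n).differentiable (by simp) x.2).hasDerivAt.comp_hasFDerivAt x
        (hasFDerivAt_snd (𝕜 := ℝ) (p := x))
      exact this
    have e : HasFDerivAt (κ n) _ x := e1.mul e2
    rw [e.fderiv]
    simp [basisVec, mul_comm]
  have hζd : ∀ n x, fderiv ℝ (ζn n) x (basisVec 0) =
      deriv (cutIoo n) x.1 * ζ x * cutIoo n x.2 + κ n x * fderiv ℝ ζ x (basisVec 0) := by
    intro n x
    have := fderiv_fun_mul ((hκ n).differentiable (by simp) x) (hζ.differentiable (by simp) x)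
    change fderiv ℝ (fun x => κ n x * ζ x) x (basisVec 0) = _
    rw [this]
    simp [hκd]
    ring
  have hκ1 : ∀ n x, |κ n x| ≤ 1 := fun n x => by
    simp only [κ, abs_mul]
    exact mul_le_one₀ (abs_cutIoo_le _ _) (abs_nonneg _) (abs_cutIoo_le _ _)
  have hsupp : ∀ n : ℕ, 0 < n → tsupport (ζn n) ⊆
      Icc (1 / (n : ℝ)) (1 - 1 / n) ×ˢ Icc (1 / (n : ℝ)) (1 - 1 / n) := by
    intro n hn
    have hn' : (0 : ℝ) < n := by exact_mod_cast hn
    refine closure_minimal ?_ (isClosed_Icc.prod isClosed_Icc)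
    intro x hx
    by_contra hxn
    apply hx
    have : ∀ a, a ∉ Icc (1 / (n : ℝ)) (1 - 1 / n) → cutIoo n a = 0 := by
      intro a ha
      apply cutIoo_eq_zero
      by_contra! hh
      apply ha
      constructor
      · rw [div_le_iff₀ hn']; linarith [hh.1]
      · have : 1 / (n : ℝ) ≤ 1 - a := by rw [div_le_iff₀ hn']; linarith [hh.2]
        linarith
    have h2 : x.1 ∉ Icc (1 / (n : ℝ)) (1 - 1 / n) ∨ x.2 ∉ Icc (1 / (n : ℝ)) (1 - 1 / n) := by
      by_contra! hh; exact hxn hh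
    rcases h2 with h2 | h2 <;> simp [ζn, κ, this _ h2]
  have hzero : ∀ n : ℕ, 0 < n → ∫ x in unitSquare,
      ((fderiv ℝ (ζn n) x (basisVec 0) : ℂ) * w x + (ζn n x : ℂ) * w' x) = 0 := by
    intro n hn
    have hn' : (0 : ℝ) < n := by exact_mod_cast hn
    have e := h (ζn n) (hζn n) ((isCompact_Icc.prod isCompact_Icc).of_isClosed_subset
      (isClosed_tsupport _) (hsupp n hn)) ((hsupp n hn).trans (by
        have hp : 0 < 1 / (n : ℝ) := by positivity
        refine prod_mono ?_ ?_ <;> exact fun a ha => ⟨by linarith [ha.1], by linarith [ha.2]⟩))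
    rw [integral_add (integrable_mul_unitSquare (fderiv_apply_continuous (hζn n) _) hw)
      (integrable_mul_unitSquare (hζn n).continuous hw'), e]
    ring
  have hlim : Filter.Tendsto (fun n : ℕ => ∫ x in unitSquare,
      ((fderiv ℝ (ζn n) x (basisVec 0) : ℂ) * w x + (ζn n x : ℂ) * w' x)) Filter.atTop
      (nhds (∫ x in unitSquare, ((fderiv ℝ ζ x (basisVec 0) : ℂ) * w x + (ζ x : ℂ) * w' x))) := by
    -- The summand `M * C` bounds the derivative of the cutoff times `ζ`, uniformly in `n`. At a
    -- fixed point of the open square the cutoff is eventually 1 with zero derivative.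
    refine tendsto_integral_of_dominated_convergence
      (fun x => (M * C + M) * ‖w x‖ + M' * ‖w' x‖) ?_ ?_ ?_ ?_
    · intro n
      exact ((integrable_mul_unitSquare (fderiv_apply_continuous (hζn n) _) hw).add
        (integrable_mul_unitSquare (hζn n).continuous hw')).aestronglyMeasurable
    · exact ((hw.integrable (by norm_num)).norm.const_mul _).add
        ((hw'.integrable (by norm_num)).norm.const_mul _)
    · intro n
      refine (ae_restrict_iff' measurableSet_unitSquare).2 (ae_of_all _ fun x hx => ?_)
      have b1 : |fderiv ℝ (ζn n) x (basisVec 0)| ≤ M * C + M := by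
        rw [hζd]
        refine (abs_add_le _ _).trans (add_le_add ?_ ?_)
        · rw [abs_mul]
          have := hC n x.1 (ζ x) M hx.1 (hb x hx).1 (hb x hx).2
          have k := abs_cutIoo_le n x.2
          calc _ ≤ (M * C) * 1 := by
                exact mul_le_mul this k (abs_nonneg _) ((abs_nonneg _).trans this)
            _ = _ := mul_one _
        · rw [abs_mul]
          have := hM x (hsq x hx)
          rw [Real.norm_eq_abs] at this
          calc _ ≤ 1 * M := by
                exact mul_le_mul (hκ1 n x) this (abs_nonneg _) (by norm_num)
            _ = _ := one_mul _
      have b2 : |ζn n x| ≤ M' := by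
        have := hM' x (hsq x hx)
        rw [Real.norm_eq_abs] at this
        simp only [ζn, abs_mul]
        calc _ ≤ 1 * M' := mul_le_mul (hκ1 n x) this (abs_nonneg _) (by norm_num)
          _ = _ := one_mul _
      refine (norm_add_le _ _).trans (add_le_add ?_ ?_)
      · rw [norm_mul, Complex.norm_real, Real.norm_eq_abs]
        gcongr
      · rw [norm_mul, Complex.norm_real, Real.norm_eq_abs]
        gcongr
    · refine (ae_restrict_iff' measurableSet_unitSquare).2 (ae_of_all _ fun x hx => ?_)
      refine tendsto_const_nhds.congr' ?_
      filter_upwards [eventually_cutIoo hx.1, eventually_cutIoo hx.2] with n h3 h4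
      rw [hζd]
      simp [ζn, κ, h3.1, h3.2, h4.1]
  refine (tendsto_nhds_unique hlim (tendsto_const_nhds.congr' ?_))
  filter_upwards [Filter.eventually_gt_atTop 0] with n hn
  exact (hzero n hn).symm

theorem integral_unitSquare_mul {f : Plane → ℂ} (hf : MemLp f 2 (volume.restrict unitSquare))
    {q : ℝ → ℝ} (hq : Continuous q) :
    ∫ x in unitSquare, (q x.2 : ℂ) * f x =
      ∫ b in Ioo (0 : ℝ) 1, (q b : ℂ) * ∫ a in Ioo (0 : ℝ) 1, f (a, b) := by
  have hi := integrable_mul_unitSquare (f := fun x => q x.2) (hq.comp continuous_snd) hf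
  rw [restrict_unitSquare] at hi ⊢
  rw [integral_prod_symm _ hi]
  simp only [integral_const_mul]

/-- Integration by parts in the first variable on the unit square, with boundary terms. -/
theorem exists_trace_unitSquare {w w' : Plane → ℂ}
    (hw : MemLp w 2 (volume.restrict unitSquare)) (hw' : MemLp w' 2 (volume.restrict unitSquare))
    (h : IsWeakDeriv unitSquare 0 w w') :
    ∃ t₀ t₁ : ℝ → ℂ, MemLp t₀ 2 (volume.restrict (Ioo 0 1)) ∧
      MemLp t₁ 2 (volume.restrict (Ioo 0 1)) ∧
      ∀ ψ : Plane → ℝ, ContDiff ℝ ∞ ψ →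
        ∫ x in unitSquare, ((fderiv ℝ ψ x (basisVec 0) : ℂ) * w x + (ψ x : ℂ) * w' x) =
          (∫ b in Ioo (0 : ℝ) 1, (ψ (1, b) : ℂ) * t₁ b) -
            ∫ b in Ioo (0 : ℝ) 1, (ψ (0, b) : ℂ) * t₀ b := by
  have bd : ∀ f : Plane → ℝ, Continuous f → MemLp (fun x => (f x : ℂ) * w' x) 2
      (volume.restrict unitSquare) := by
    intro f hf
    obtain ⟨C, hC⟩ :=
      (isCompact_Icc (a := ((0, 0) : Plane)) (b := (1, 1))).exists_bound_of_continuousOn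
      hf.continuousOn
    refine MemLp.of_le_mul (c := C) hw'
      ((Complex.continuous_ofReal.comp hf).aestronglyMeasurable.mul hw'.1) ?_
    refine (ae_restrict_iff' measurableSet_unitSquare).2 (ae_of_all _ fun x hx => ?_)
    have := hC x ⟨⟨hx.1.1.le, hx.2.1.le⟩, ⟨hx.1.2.le, hx.2.2.le⟩⟩
    rw [norm_mul, Complex.norm_real]
    gcongr
  have m0 : MemLp (fun x : Plane => w x - ((1 - x.1 : ℝ) : ℂ) * w' x) 2
      (volume.restrict unitSquare) := hw.sub (bd _ (by fun_prop))
  have m1 : MemLp (fun x : Plane => w x + ((x.1 : ℝ) : ℂ) * w' x) 2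
      (volume.restrict unitSquare) := hw.add (bd _ (by fun_prop))
  -- The boundary values are written as integrals over the square: for smooth `w`, integrating ∂ₐ(a
  -- w) = w + a w' gives w(1, b), and integrating -∂ₐ((1-a) w) = w - (1-a) w' gives w(0, b).
  refine ⟨fun b => ∫ a in Ioo (0 : ℝ) 1, (w (a, b) - ((1 - a : ℝ) : ℂ) * w' (a, b)),
    fun b => ∫ a in Ioo (0 : ℝ) 1, (w (a, b) + ((a : ℝ) : ℂ) * w' (a, b)), ?_, ?_, ?_⟩
  · have := m0
    rw [restrict_unitSquare] at this
    exact memLp_integral_fst this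
  · have := m1
    rw [restrict_unitSquare] at this
    exact memLp_integral_fst this
  intro ψ hψ
  have c0 : ContDiff ℝ ∞ (fun b : ℝ => ψ (0, b)) := hψ.comp (by fun_prop)
  have c1 : ContDiff ℝ ∞ (fun b : ℝ => ψ (1, b)) := hψ.comp (by fun_prop)
  -- Subtracting the linear interpolation of the boundary values makes the test function vanish on
  -- both sides; the subtracted part produces the two boundary integrals.
  let ζ : Plane → ℝ := fun x => ψ x - (1 - x.1) * ψ (0, x.2) - x.1 * ψ (1, x.2)
  have hζ : ContDiff ℝ ∞ ζ :=
    (hψ.sub ((contDiff_const.sub contDiff_fst).mul (c0.comp contDiff_snd))).sub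
      (contDiff_fst.mul (c1.comp contDiff_snd))
  have hd : ∀ x, fderiv ℝ ζ x (basisVec 0) =
      fderiv ℝ ψ x (basisVec 0) + ψ (0, x.2) - ψ (1, x.2) := by
    intro x
    have along : ∀ f : Plane → ℝ, DifferentiableAt ℝ f x →
        fderiv ℝ f x (basisVec 0) = deriv (fun a : ℝ => f (a, x.2)) x.1 := by
      intro f hf
      have e : HasDerivAt (fun a : ℝ => ((a, x.2) : Plane)) (basisVec 0) x.1 :=
        (hasDerivAt_id x.1).prodMk (hasDerivAt_const x.1 x.2)
      exact (hf.hasFDerivAt.comp_hasDerivAt x.1 e).deriv.symm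
    rw [along ζ (hζ.differentiable (by simp) x), along ψ (hψ.differentiable (by simp) x)]
    have e1 : DifferentiableAt ℝ (fun a : ℝ => ψ (a, x.2)) x.1 :=
      (hψ.comp (by fun_prop : ContDiff ℝ ∞ (fun a : ℝ => ((a, x.2) : Plane)))).differentiable
        (by simp) x.1
    have e2 : HasDerivAt (fun a : ℝ => ψ (a, x.2) - (1 - a) * ψ (0, x.2) - a * ψ (1, x.2))
        (deriv (fun a : ℝ => ψ (a, x.2)) x.1 - (-1) * ψ (0, x.2) - 1 * ψ (1, x.2)) x.1 :=
      (e1.hasDerivAt.sub (((hasDerivAt_id x.1).const_sub 1).mul_const _)).sub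
        ((hasDerivAt_id x.1).mul_const _)
    rw [e2.deriv]
    ring
  have key := unitSquare_integral_eq_zero hw hw' h hζ (fun b => by simp [ζ]) (fun b => by simp [ζ])
  have i0 := integrable_mul_unitSquare (f := fun x => ψ (0, x.2))
    (c0.continuous.comp continuous_snd) m0
  have i1 := integrable_mul_unitSquare (f := fun x => ψ (1, x.2))
    (c1.continuous.comp continuous_snd) m1
  have iψ := (integrable_mul_unitSquare (fderiv_apply_continuous hψ (basisVec 0)) hw).add
    (integrable_mul_unitSquare hψ.continuous hw')
  have split : ∀ x : Plane, (fderiv ℝ ζ x (basisVec 0) : ℂ) * w x + (ζ x : ℂ) * w' x =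
      (((fderiv ℝ ψ x (basisVec 0) : ℂ) * w x + (ψ x : ℂ) * w' x) +
        (ψ (0, x.2) : ℂ) * (w x - ((1 - x.1 : ℝ) : ℂ) * w' x)) -
        (ψ (1, x.2) : ℂ) * (w x + ((x.1 : ℝ) : ℂ) * w' x) := by
    intro x
    rw [hd]
    simp only [ζ]
    push_cast
    ring
  have c0' := c0.continuous
  have c1' := c1.continuous
  have f0 := integral_unitSquare_mul m0 c0'
  have f1 := integral_unitSquare_mul m1 c1'
  simp only [split] at key
  have k2 := integral_sub (iψ.add i0) i1
  have k3 := integral_add iψ i0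
  simp only [Pi.add_apply] at k2 k3 f0 f1
  rw [k2, k3, f0, f1] at key
  rw [eq_comm, ← sub_eq_zero, ← neg_eq_zero]
  refine Eq.trans ?_ key
  ring

theorem memLp_reflect {f : ℝ → ℂ} (hf : MemLp f 2 (volume.restrict (Ioo (0 : ℝ) 1))) :
    MemLp (fun t => f (1 - t)) 2 (volume.restrict (Ioo (0 : ℝ) 1)) := by
  have := (Measure.measurePreserving_sub_left (volume : Measure ℝ) 1).restrict_preimage
    (measurableSet_Ioo (a := (0 : ℝ)) (b := 1))
  simp only [preimage_const_sub_Ioo, sub_self, sub_zero] at this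
  exact hf.comp_measurePreserving this

theorem integral_reflect (f : ℝ → ℂ) :
    ∫ t in Ioo (0 : ℝ) 1, f (1 - t) = ∫ t in Ioo (0 : ℝ) 1, f t := by
  have := (Measure.measurePreserving_sub_left (volume : Measure ℝ) 1).setIntegral_preimage_emb
    (measurableEmbedding_subLeft (1 : ℝ)) f (Ioo 0 1)
  simpa using this

/-- Integration by parts on a parallelogram, the image of the unit square under a linear map, in
the direction of its first side. -/
theorem exists_trace_aff {M : Matrix (Fin 2) (Fin 2) ℝ} (hM : M.det ≠ 0) {Ω : Set Plane}
    (hΩ : aff M 0 ⁻¹' Ω = unitSquare)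
    {u : Plane → ℂ} {D : Fin 2 → Plane → ℂ} (hu : MemLp u 2 (volume.restrict Ω))
    (hD : ∀ i, MemLp (D i) 2 (volume.restrict Ω)) (h : ∀ i, IsWeakDeriv Ω i u (D i)) :
    ∃ t₀ t₁ : ℝ → ℂ, MemLp t₀ 2 (volume.restrict (Ioo 0 1)) ∧
      MemLp t₁ 2 (volume.restrict (Ioo 0 1)) ∧
      ∀ φ : Plane → ℝ, ContDiff ℝ ∞ φ →
        ∫ x in Ω, (∑ l, (M l 0 : ℂ) * ((fderiv ℝ φ x (basisVec l) : ℂ) * u x + (φ x : ℂ) * D l x))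
          = |M.det| * ((∫ b in Ioo (0 : ℝ) 1, (φ (aff M 0 (1, b)) : ℂ) * t₁ b) -
            ∫ b in Ioo (0 : ℝ) 1, (φ (aff M 0 (0, b)) : ℂ) * t₀ b) := by
  have hw := memLp_aff hM 0 hu
  have hw' : MemLp (fun x => ∑ l, (M l 0 : ℂ) * D l (aff M 0 x)) 2
      (volume.restrict (aff M 0 ⁻¹' Ω)) :=
    memLp_finsetSum _ fun l _ => (memLp_aff hM 0 (hD l)).const_mul (M l 0 : ℂ)
  have hd := IsWeakDeriv.comp_aff hM 0 h (MemLp.memL2loc hu) (fun l => MemLp.memL2loc (hD l)) 0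
  rw [hΩ] at hw hw' hd
  obtain ⟨t₀, t₁, m0, m1, hg⟩ := exists_trace_unitSquare hw hw' hd
  refine ⟨t₀, t₁, m0, m1, fun φ hφ => ?_⟩
  have e := hg (φ ∘ aff M 0) (hφ.comp (contDiff_aff _ _))
  have d : ∀ x, (fderiv ℝ (φ ∘ aff M 0) x (basisVec 0) : ℂ) * (u ∘ aff M 0) x +
      ((φ ∘ aff M 0) x : ℂ) * ∑ l, (M l 0 : ℂ) * D l (aff M 0 x) =
      (fun y => ∑ l, (M l 0 : ℂ) * ((fderiv ℝ φ y (basisVec l) : ℂ) * u y + (φ y : ℂ) * D l y))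
        (aff M 0 x) := by
    intro x
    rw [fderiv_comp_aff M 0 (hφ.differentiable (by simp))]
    simp only [Function.comp, Fin.sum_univ_two, smul_eq_mul]
    push_cast
    ring
  rw [integral_congr_ae (ae_of_all _ d), ← hΩ, setIntegral_aff hM 0 Ω
    (fun y => ∑ l, (M l 0 : ℂ) * ((fderiv ℝ φ y (basisVec l) : ℂ) * u y + (φ y : ℂ) * D l y))] at e
  simp only [Function.comp] at e
  rw [← e, abs_inv, Complex.real_smul, ← mul_assoc]
  have : ((|M.det| : ℝ) : ℂ) ≠ 0 := by exact_mod_cast abs_ne_zero.2 hM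
  push_cast
  rw [mul_inv_cancel₀ this, one_mul]

/-- A component of a normal is the determinant of a coordinate vector with an edge of the rhombus,
and so are `coordA` and `coordB` up to the area √3/6. This lets Green's formula for `∂_i` be
assembled from the integrations by parts along the two edges. -/
theorem sideNormal_eq (m : ℤ) (i : Fin 2) :
    sideNormal m 0 i = -(√3 / 6 * coordB m (basisVec i)) ∧
    sideNormal m 1 i = -(√3 / 6 * coordA m (basisVec i)) ∧
    sideNormal m 2 i = √3 / 6 * coordA m (basisVec i) ∧
    sideNormal m 3 i = √3 / 6 * coordB m (basisVec i) := by
  have hpos : (0 : ℝ) < √3 := by positivity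
  have hA : ∀ x, √3 / 6 * coordA m x = x.1 * (vertex (m + 1)).2 - x.2 * (vertex (m + 1)).1 := by
    intro x; rw [coordA]; field_simp
  have hB : ∀ x, √3 / 6 * coordB m x = (vertex (m - 1)).1 * x.2 - (vertex (m - 1)).2 * x.1 := by
    intro x; rw [coordB]; field_simp
  rw [hA, hB]
  have hv := vertex_self m
  fin_cases i <;> simp [sideNormal, sideSign, sideEnd, sideStart, basisVec, hv]

/-- The outer sides issue from `vertex m`, hence the parameter `1 - t` there. -/
theorem sidePoint_eq (m : ℤ) (t : ℝ) :
    sidePoint m 0 t = t • vertex (m - 1) + (0 : ℝ) • vertex (m + 1) ∧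
    sidePoint m 1 t = (0 : ℝ) • vertex (m - 1) + t • vertex (m + 1) ∧
    sidePoint m 2 t = (1 : ℝ) • vertex (m - 1) + (1 - t) • vertex (m + 1) ∧
    sidePoint m 3 t = (1 - t) • vertex (m - 1) + (1 : ℝ) • vertex (m + 1) := by
  have hv := vertex_self m
  refine ⟨?_, ?_, ?_, ?_⟩ <;> ext <;>
    simp [sidePoint, sideEnd, sideStart, hv] <;> ring

/-- Functions in `H¹` of the rhombus have a trace. -/
theorem exists_isTrace (m : ℤ) {u : Plane → ℂ} {D : Fin 2 → Plane → ℂ}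
    (hu : MemLp u 2 (volume.restrict (rhombus m)))
    (hD : ∀ i, MemLp (D i) 2 (volume.restrict (rhombus m)))
    (h : ∀ i, IsWeakDeriv (rhombus m) i u (D i)) : ∃ g, IsTrace m u D g := by
  have hc := vertex_cross m
  have hpos : (0 : ℝ) < √3 / 6 := by positivity
  set p := vertex (m - 1) with hp
  set r := vertex (m + 1) with hr
  -- The edges in their two orders: `M` integrates by parts along `p`, `N` along `r`.
  let M : Matrix (Fin 2) (Fin 2) ℝ := !![p.1, r.1; p.2, r.2]
  let N : Matrix (Fin 2) (Fin 2) ℝ := !![r.1, p.1; r.2, p.2]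
  have dM : M.det = √3 / 6 := by simp only [M, Matrix.det_fin_two_of]; linarith
  have dN : N.det = -(√3 / 6) := by simp only [N, Matrix.det_fin_two_of]; linarith
  have aM : ∀ x, aff M 0 x = x.1 • p + x.2 • r := by
    intro x; ext <;> simp [aff, M] <;> ring
  have aN : ∀ x, aff N 0 x = x.2 • p + x.1 • r := by
    intro x; ext <;> simp [aff, N] <;> ring
  have pM : aff M 0 ⁻¹' rhombus m = unitSquare := by
    ext x
    rw [mem_preimage, mem_rhombus_iff, aM, coordA_comb, coordB_comb]; rfl
  have pN : aff N 0 ⁻¹' rhombus m = unitSquare := by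
    ext x
    rw [mem_preimage, mem_rhombus_iff, aN, coordA_comb, coordB_comb, and_comm]; rfl
  obtain ⟨a0, a1, ma0, ma1, ha⟩ := exists_trace_aff (by rw [dM]; exact hpos.ne') pM hu hD h
  obtain ⟨b0, b1, mb0, mb1, hb⟩ := exists_trace_aff (by rw [dN]; exact (neg_lt_zero.2 hpos).ne) pN
    hu hD h
  -- Integration along `r` ends at side 0 and integration along `p` at side 1, both at parameter
  -- zero; on the outer sides the parametrization has to be reversed.
  refine ⟨![b0, a0, fun t => a1 (1 - t), fun t => b1 (1 - t)], ?_, ?_⟩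
  · intro s
    fin_cases s
    · exact mb0
    · exact ma0
    · exact memLp_reflect ma1
    · exact memLp_reflect mb1
  intro φ h1 h2 i
  have ea := ha φ h1
  have eb := hb φ h1
  rw [dM, abs_of_pos hpos] at ea
  rw [dN, abs_neg, abs_of_pos hpos] at eb
  simp only [aM] at ea
  simp only [aN] at eb
  have L2u := MemLp.memL2loc hu
  have ii : ∀ l, Integrable (fun x => (fderiv ℝ φ x (basisVec l) : ℂ) * u x + (φ x : ℂ) * D l x)
      (volume.restrict (rhombus m)) := fun l =>
    (L2u.integrable_mul (fderiv_apply_continuous h1 _) (fderiv_apply_compact h2 _)).add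
      ((MemLp.memL2loc (hD l)).integrable_mul h1.continuous h2)
  rw [integral_finsetSum _ fun l _ => (ii l).const_mul _] at ea eb
  simp only [integral_const_mul, Fin.sum_univ_two] at ea eb
  obtain ⟨n0, n1, n2, n3⟩ := sideNormal_eq m i
  rw [Fin.sum_univ_four, n0, n1, n2, n3]
  have r2 := integral_reflect fun t => (φ ((1 : ℝ) • p + t • r) : ℂ) * a1 t
  have r3 := integral_reflect fun t => (φ (t • p + (1 : ℝ) • r) : ℂ) * b1 t
  simp only [(sidePoint_eq m _).1, (sidePoint_eq m _).2.1, (sidePoint_eq m _).2.2.1,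
    (sidePoint_eq m _).2.2.2, Matrix.cons_val]
  simp only [← hp, ← hr]
  rw [r2, r3]
  have hcomb := comb_coord m (basisVec i)
  rw [← hp, ← hr] at hcomb
  set α := coordA m (basisVec i)
  set β := coordB m (basisVec i)
  -- The coordinate vector is `α • p + β • r`, so the formula for `∂_i` is the same combination of
  -- the formulas along the two edges.
  have hsum : ∀ I : Fin 2 → ℂ, I i = α * ((M 0 0 : ℝ) * I 0) + α * ((M 1 0 : ℝ) * I 1) +
      β * ((N 0 0 : ℝ) * I 0) + β * ((N 1 0 : ℝ) * I 1) := by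
    intro I
    have q1 := congrArg Prod.fst hcomb
    have q2 := congrArg Prod.snd hcomb
    simp only [Prod.fst_add, Prod.snd_add, Prod.smul_fst, Prod.smul_snd, smul_eq_mul] at q1 q2
    have q1' : (α : ℂ) * (p.1 : ℝ) + β * (r.1 : ℝ) = ((basisVec i).1 : ℝ) := by exact_mod_cast q1
    have q2' : (α : ℂ) * (p.2 : ℝ) + β * (r.2 : ℝ) = ((basisVec i).2 : ℝ) := by exact_mod_cast q2
    simp only [M, N, Matrix.of_apply, Matrix.cons_val_zero, Matrix.cons_val_one,
      Matrix.cons_val', Matrix.cons_val_fin_one]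
    fin_cases i
    · simp only [basisVec, Fin.zero_eta, Matrix.cons_val_zero] at q1' q2' ⊢
      push_cast at q1' q2'
      linear_combination (-I 0) * q1' - I 1 * q2'
    · simp only [basisVec, Fin.mk_one, Matrix.cons_val_one,
        Matrix.cons_val_fin_one] at q1' q2' ⊢
      push_cast at q1' q2'
      linear_combination (-I 0) * q1' - I 1 * q2'
  rw [hsum fun i => ∫ x in rhombus m, ((fderiv ℝ φ x (basisVec i) : ℂ) * u x + (φ x : ℂ) * D i x)]
  push_cast at ea eb ⊢
  linear_combination (α : ℂ) * ea + (β : ℂ) * eb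


/-! ### Bloch periodization -/

/-- The phase of the lattice translation with index `n` at quasimomentum `k`. -/
def blochChar (k : ℝ × ℝ) (n : ℤ × ℤ) : ℂ :=
  Complex.exp (Complex.I * (n.1 * k.1 + n.2 * k.2))

theorem blochChar_add (k : ℝ × ℝ) (n n' : ℤ × ℤ) :
    blochChar k (n + n') = blochChar k n * blochChar k n' := by
  rw [blochChar, blochChar, blochChar, ← Complex.exp_add]
  congr 1
  push_cast [Prod.fst_add, Prod.snd_add]
  ring

theorem blochChar_zero (k : ℝ × ℝ) : blochChar k 0 = 1 := by simp [blochChar]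

theorem blochChar_mul_neg (k : ℝ × ℝ) (n : ℤ × ℤ) : blochChar k n * blochChar k (-n) = 1 := by
  rw [← blochChar_add, add_neg_cancel, blochChar_zero]

theorem conj_blochChar (k : ℝ × ℝ) (n : ℤ × ℤ) :
    starRingEnd ℂ (blochChar k n) = blochChar k (-n) := by
  rw [blochChar, blochChar, ← Complex.exp_conj]
  congr 1
  simp
  ring

theorem norm_blochChar (k : ℝ × ℝ) (n : ℤ × ℤ) : ‖blochChar k n‖ = 1 := by
  rw [blochChar, mul_comm]
  have : ((n.1 : ℂ) * k.1 + n.2 * k.2) = ((n.1 * k.1 + n.2 * k.2 : ℝ) : ℂ) := by push_cast; ring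
  rw [this, Complex.norm_exp_ofReal_mul_I]

theorem isBloch_iff (k : ℝ × ℝ) (ψ : Plane → ℂ) :
    IsBloch k ψ ↔ ∀ n, ∀ᵐ x : Plane, ψ (x + lat n) = blochChar k n * ψ x := by
  unfold IsBloch blochChar lat
  simp only [add_assoc]
  exact ⟨fun h n => h n.1 n.2, fun h n₁ n₂ => h (n₁, n₂)⟩

/-- The Bloch periodization of a function, meant for functions of bounded support. -/
def per (k : ℝ × ℝ) (F : Plane → ℂ) (x : Plane) : ℂ := ∑' n, blochChar k n * F (x - lat n)

/-- The indices of the lattice points of norm at most `C`. -/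
def latBall (C : ℝ) : Finset (ℤ × ℤ) := (finite_lat_le C).toFinset

theorem norm_lat_of_notMem {C : ℝ} {n : ℤ × ℤ} (h : n ∉ latBall C) : C < ‖lat n‖ := by
  simpa [latBall] using h

/-- Only lattice points at distance at most `C` from `x` contribute. All uses of the infinite sum go
through this locally finite form. -/
theorem per_eq_sum (k : ℝ × ℝ) {F : Plane → ℂ} {C R : ℝ} (hF : ∀ x, C < ‖x‖ → F x = 0)
    {x : Plane} (hx : ‖x‖ ≤ R) :
    per k F x = ∑ n ∈ latBall (C + R), blochChar k n * F (x - lat n) := by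
  refine tsum_eq_sum fun n hn => ?_
  rw [hF, mul_zero]
  have h1 := norm_lat_of_notMem hn
  have h2 := norm_sub_norm_le (lat n) x
  rw [norm_sub_rev] at h2
  linarith

theorem per_add_lat (k : ℝ × ℝ) (F : Plane → ℂ) (x : Plane) (n : ℤ × ℤ) :
    per k F (x + lat n) = blochChar k n * per k F x := by
  unfold per
  rw [← tsum_mul_left, ← (Equiv.addRight n).tsum_eq]
  refine tsum_congr fun l => ?_
  rw [Equiv.coe_addRight, blochChar_add, lat_add, add_sub_add_right_eq_sub]
  ring

theorem isBloch_per (k : ℝ × ℝ) (F : Plane → ℂ) : IsBloch k (per k F) :=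
  (isBloch_iff k _).2 fun n => ae_of_all _ fun x => per_add_lat k F x n

theorem memLp_comp_sub {F : Plane → ℂ} (hF : MemLp F 2 volume) (v : Plane) :
    MemLp (fun x => F (x - v)) 2 (volume : Measure Plane) :=
  hF.comp_measurePreserving (measurePreserving_sub_right volume v)

theorem memLp_comp_add {F : Plane → ℂ} (hF : MemLp F 2 volume) (v : Plane) :
    MemLp (fun x => F (x + v)) 2 (volume : Measure Plane) :=
  hF.comp_measurePreserving (measurePreserving_add_right volume v)

theorem memL2loc_per (k : ℝ × ℝ) {F : Plane → ℂ} {C : ℝ} (hF : ∀ x, C < ‖x‖ → F x = 0)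
    (hF2 : MemLp F 2 volume) : MemL2loc univ (per k F) := by
  intro K hK
  obtain ⟨R, hR⟩ := hK.isBounded.exists_norm_le
  have h1 : MemLp (fun x => ∑ n ∈ latBall (C + R), blochChar k n * F (x - lat n)) 2
      (volume : Measure Plane) :=
    memLp_finsetSum _ fun n _ => (memLp_comp_sub hF2 (lat n)).const_mul _
  rw [Measure.restrict_univ]
  refine (h1.restrict K).ae_eq ?_
  refine (ae_restrict_iff' hK.measurableSet).2 (ae_of_all _ fun x hx => ?_)
  exact (per_eq_sum k hF (hR x hx)).symm

theorem integral_mul_eq_zero_of_notMem {ψ F : Plane → ℂ} {C R : ℝ}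
    (hψ : ∀ x, R < ‖x‖ → ψ x = 0) (hF : ∀ x, C < ‖x‖ → F x = 0) {n : ℤ × ℤ}
    (hn : n ∉ latBall (C + R)) : ∫ x, ψ (x + lat n) * F x = 0 := by
  refine integral_eq_zero_of_ae (ae_of_all _ fun x => ?_)
  have h1 := norm_lat_of_notMem hn
  have h2 := norm_sub_norm_le (lat n) (-x)
  rw [sub_neg_eq_add, norm_neg, add_comm] at h2
  rcases le_or_gt ‖x‖ C with hx | hx
  · simp [hψ (x + lat n) (by linarith)]
  · simp [hF x hx]

/-- Unfolding of an integral against a periodization. -/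
theorem integral_mul_per (k : ℝ × ℝ) {ψ F : Plane → ℂ} {C R : ℝ}
    (hψ : ∀ x, R < ‖x‖ → ψ x = 0) (hF : ∀ x, C < ‖x‖ → F x = 0)
    (hψ2 : MemLp ψ 2 volume) (hF2 : MemLp F 2 volume) :
    ∫ x, ψ x * per k F x = ∑' n, blochChar k n * ∫ x, ψ (x + lat n) * F x := by
  rw [tsum_eq_sum (s := latBall (C + R)) fun n hn => by
    rw [integral_mul_eq_zero_of_notMem hψ hF hn, mul_zero]]
  have e : ∀ x, ψ x * per k F x =
      ∑ n ∈ latBall (C + R), blochChar k n * (ψ x * F (x - lat n)) := by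
    intro x
    rcases le_or_gt ‖x‖ R with hx | hx
    · rw [per_eq_sum k hF hx, Finset.mul_sum]
      exact Finset.sum_congr rfl fun n _ => by ring
    · simp [hψ x hx]
  simp only [e]
  rw [integral_finsetSum]
  swap
  · exact fun n _ => (hψ2.integrable_mul (memLp_comp_sub hF2 (lat n))).const_mul _
  refine Finset.sum_congr rfl fun n _ => ?_
  rw [integral_const_mul, ← integral_add_right_eq_self _ (lat n)]
  simp only [add_sub_cancel_right]

theorem summable_blochChar_mul (k : ℝ × ℝ) {B : ℤ × ℤ → ℂ} {C : ℝ}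
    (h : ∀ n, n ∉ latBall C → B n = 0) : Summable fun n => blochChar k n * B n :=
  summable_of_ne_finset_zero (s := latBall C) fun n hn => by rw [h n hn, mul_zero]

/-- Periodization of weak derivatives. -/
theorem IsWeakDeriv.per (k : ℝ × ℝ) {F W : Plane → ℂ} {C : ℝ} {i : Fin 2}
    (hF : ∀ x, C < ‖x‖ → F x = 0) (hW : ∀ x, C < ‖x‖ → W x = 0)
    (hF2 : MemLp F 2 volume) (hW2 : MemLp W 2 volume) (h : IsWeakDeriv univ i F W) :
    IsWeakDeriv univ i (per k F) (per k W) := by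
  intro φ h1 h2 h3
  obtain ⟨R, hR⟩ := h2.isBounded.exists_norm_le
  have z1 : ∀ x, R < ‖x‖ → (φ x : ℂ) = 0 := fun x hx => by
    rw [image_eq_zero_of_notMem_tsupport fun hh => absurd (hR x hh) (not_le.2 hx)]; simp
  have z2 : ∀ x, R < ‖x‖ → (fderiv ℝ φ x (basisVec i) : ℂ) = 0 := fun x hx => by
    rw [fderiv_eq_zero_of_notMem_tsupport fun hh => absurd (hR x hh) (not_le.2 hx)]; simp
  have m1 : MemLp (fun x => (φ x : ℂ)) 2 (volume : Measure Plane) :=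
    (Complex.continuous_ofReal.comp h1.continuous).memLp_of_hasCompactSupport
      (h2.comp_left (g := fun r : ℝ => (r : ℂ)) (by simp))
  have m2 : MemLp (fun x => (fderiv ℝ φ x (basisVec i) : ℂ)) 2 (volume : Measure Plane) :=
    (Complex.continuous_ofReal.comp (fderiv_apply_continuous h1 _)).memLp_of_hasCompactSupport
      ((fderiv_apply_compact h2 _).comp_left (g := fun r : ℝ => (r : ℂ)) (by simp))
  rw [setIntegral_univ, setIntegral_univ, integral_mul_per k z2 hF m2 hF2,
    integral_mul_per k z1 hW m1 hW2, ← tsum_neg]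
  refine tsum_congr fun n => ?_
  rw [← mul_neg]
  congr 1
  have e := h (fun x => φ (x + lat n)) (h1.comp (by fun_prop))
    (h2.comp_homeomorph (Homeomorph.addRight (lat n))) (subset_univ _)
  simp only [setIntegral_univ, fderiv_comp_add_right] at e
  exact e

/-! ### Extension of functions from the rhombus to the plane -/

/-- The function on three rhombi which is multiplied by `θ` under `turn`. -/
def rotSpread (m : ℤ) (θ : ℂ) (f : Plane → ℂ) (x : Plane) : ℂ :=
  (rhombus m).indicator f x + θ * (rhombus m).indicator f (rotMap x) +
    θ ^ 2 * (rhombus m).indicator f (turn x)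

theorem rotSpread_turn (m : ℤ) {θ : ℂ} (hθ : θ ^ 3 = 1) (f : Plane → ℂ) (x : Plane) :
    rotSpread m θ f (turn x) = θ * rotSpread m θ f x := by
  unfold rotSpread
  rw [rotMap_turn, turn_turn]
  linear_combination -(rhombus m).indicator f (turn x) * hθ

theorem rotSpread_of_notMem_hexagon (m : ℤ) (θ : ℂ) (f : Plane → ℂ) {x : Plane}
    (hx : x ∉ hexagon) : rotSpread m θ f x = 0 := by
  have h0 : ∀ y, y ∉ hexagon → (rhombus m).indicator f y = 0 := fun y hy =>
    indicator_of_notMem (fun h => hy (rhombus_subset_hexagon m h)) f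
  rw [rotSpread, h0 x hx, h0 _ (by rwa [rotMap_mem_hexagon]), h0 _ (by rwa [turn_mem_hexagon])]
  ring

theorem rotSpread_of_norm_gt (m : ℤ) (θ : ℂ) (f : Plane → ℂ) (x : Plane) (hx : 1 < ‖x‖) :
    rotSpread m θ f x = 0 :=
  rotSpread_of_notMem_hexagon m θ f fun h => absurd (norm_le_of_mem_hexagon h) (not_le.2 hx)

theorem rotSpread_of_mem (m : ℤ) (θ : ℂ) (f : Plane → ℂ) {x : Plane} (hx : x ∈ rhombus m) :
    rotSpread m θ f x = f x := by
  rw [rotSpread, indicator_of_mem hx, indicator_of_notMem (rotMap_notMem_rhombus hx),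
    indicator_of_notMem (turn_notMem_rhombus hx)]
  ring

theorem memLp_indicator_rhombus {m : ℤ} {f : Plane → ℂ}
    (hf : MemLp f 2 (volume.restrict (rhombus m))) :
    MemLp ((rhombus m).indicator f) 2 volume :=
  (memLp_indicator_iff_restrict (measurableSet_rhombus m)).2 hf

theorem memLp_rotSpread {m : ℤ} (θ : ℂ) {f : Plane → ℂ}
    (hf : MemLp f 2 (volume.restrict (rhombus m))) : MemLp (rotSpread m θ f) 2 volume := by
  have h := memLp_indicator_rhombus hf
  exact (h.add ((h.comp_measurePreserving measurePreserving_rotMap).const_mul θ)).add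
    ((h.comp_measurePreserving measurePreserving_turn).const_mul (θ ^ 2))

/-- The Bloch function which is multiplied by `θ` under `turn`, with given values on the
rhombus. -/
def blochExt (k : ℝ × ℝ) (m : ℤ) (θ : ℂ) (f : Plane → ℂ) : Plane → ℂ := per k (rotSpread m θ f)

theorem memL2loc_ext (k : ℝ × ℝ) {m : ℤ} (θ : ℂ) {f : Plane → ℂ}
    (hf : MemLp f 2 (volume.restrict (rhombus m))) : MemL2loc univ (blochExt k m θ f) :=
  memL2loc_per k (rotSpread_of_norm_gt m θ f) (memLp_rotSpread θ hf)

theorem per_of_mem_hexagon (k : ℝ × ℝ) {F : Plane → ℂ} (hF : ∀ x, x ∉ hexagon → F x = 0)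
    {x : Plane} (hx : x ∈ hexagon) : per k F x = F x := by
  unfold per
  rw [tsum_eq_single 0]
  · rw [blochChar_zero, lat_zero, one_mul, sub_zero]
  · intro n hn
    rw [hF, mul_zero]
    intro h
    refine hn (neg_eq_zero.1 (eq_zero_of_mem_hexagon_add_lat hx (n := -n) ?_))
    rwa [lat_neg, ← sub_eq_add_neg]

theorem ext_of_mem (k : ℝ × ℝ) (m : ℤ) (θ : ℂ) (f : Plane → ℂ) {x : Plane} (hx : x ∈ rhombus m) :
    blochExt k m θ f x = f x := by
  rw [blochExt, per_of_mem_hexagon k (fun y => rotSpread_of_notMem_hexagon m θ f)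
    (rhombus_subset_hexagon m hx), rotSpread_of_mem m θ f hx]

/-- Reindexing the lattice sum by `turn` leaves the characters unchanged exactly because the
quasimomentum is fixed by the rotation, which is the hypothesis `hk`; the cells then supply the
factor `θ`. -/
theorem ext_turn {k : ℝ × ℝ} (hk : ∀ n, blochChar k (turnIdx n) = blochChar k n) (m : ℤ) {θ : ℂ}
    (hθ : θ ^ 3 = 1) (f : Plane → ℂ) (x : Plane) : blochExt k m θ f (turn x) = θ * blochExt k m θ f x := by
  unfold blochExt per
  rw [← tsum_mul_left, ← turnIdx.toEquiv.tsum_eq]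
  refine tsum_congr fun n => ?_
  have e : turnIdx.toEquiv n = turnIdx n := rfl
  rw [e, hk, ← turn_lat, ← turn_sub, rotSpread_turn m hθ]
  ring

theorem integral_mul_indicator (m : ℤ) (ψ f : Plane → ℂ) :
    ∫ x, ψ x * (rhombus m).indicator f x = ∫ x in rhombus m, ψ x * f x := by
  rw [← integral_indicator (measurableSet_rhombus m)]
  congr 1
  funext x
  by_cases hx : x ∈ rhombus m <;> simp [hx]

theorem measurableEmbedding_turn : MeasurableEmbedding turn := by
  rw [turn_eq_aff]
  exact measurableEmbedding_aff (by rw [det_turnMatrix]; norm_num) 0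

theorem integral_turn (f : Plane → ℂ) : ∫ x, f (turn x) = ∫ x, f x :=
  measurePreserving_turn.integral_comp measurableEmbedding_turn f

theorem integral_rotMap (f : Plane → ℂ) : ∫ x, f (rotMap x) = ∫ x, f x := by
  simp only [← turn_turn]
  rw [integral_turn fun x => f (turn x), integral_turn]

/-- The two rotated copies are moved back to the rhombus by measure preserving substitutions, which
puts powers of `turn` into the argument of `ψ`. -/
theorem integral_mul_rotSpread (m : ℤ) (θ : ℂ) {ψ f : Plane → ℂ}
    (hψ : MemLp ψ 2 volume) (hf : MemLp f 2 (volume.restrict (rhombus m))) :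
    ∫ x, ψ x * rotSpread m θ f x =
      ∑ a ∈ Finset.range 3, θ ^ a * ∫ x in rhombus m, ψ (turn^[a] x) * f x := by
  have h := memLp_indicator_rhombus hf
  have i0 := hψ.integrable_mul h
  have i1 := (hψ.integrable_mul (h.comp_measurePreserving measurePreserving_rotMap)).const_mul θ
  have i2 := (hψ.integrable_mul (h.comp_measurePreserving measurePreserving_turn)).const_mul (θ ^ 2)
  have e : ∀ x, ψ x * rotSpread m θ f x = (ψ x * (rhombus m).indicator f x +
      θ * (ψ x * (rhombus m).indicator f (rotMap x))) +
      θ ^ 2 * (ψ x * (rhombus m).indicator f (turn x)) := fun x => by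
    rw [rotSpread]; ring
  simp only [e]
  have k1 := integral_add (i0.add i1) i2
  have k2 := integral_add i0 i1
  simp only [Pi.add_apply, Pi.mul_apply, Function.comp] at k1 k2
  rw [k1, k2, integral_const_mul, integral_const_mul, integral_mul_indicator]
  have j1 : ∫ x, ψ x * (rhombus m).indicator f (rotMap x) = ∫ x in rhombus m, ψ (turn x) * f x := by
    rw [← integral_mul_indicator, ← integral_turn]
    simp only [rotMap_turn]
  have j2 : ∫ x, ψ x * (rhombus m).indicator f (turn x) =
      ∫ x in rhombus m, ψ (turn (turn x)) * f x := by
    simp only [turn_turn]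
    rw [← integral_mul_indicator m fun x => ψ (rotMap x), ← integral_rotMap]
    simp only [turn_rotMap]
  rw [j1, j2]
  simp [Finset.sum_range_succ]

/-- The pairing with the extended function becomes a sum over the symmetry group of pairings on one
rhombus. This is the form in which Green's formula can be applied term by term. -/
theorem integral_mul_ext (k : ℝ × ℝ) (m : ℤ) (θ : ℂ) {ψ f : Plane → ℂ} {R : ℝ}
    (hψ0 : ∀ x, R < ‖x‖ → ψ x = 0)
    (hψ : MemLp ψ 2 volume) (hf : MemLp f 2 (volume.restrict (rhombus m))) :
    ∫ x, ψ x * blochExt k m θ f x = ∑' n, blochChar k n * ∑ a ∈ Finset.range 3,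
      θ ^ a * ∫ x in rhombus m, ψ (turn^[a] x + lat n) * f x := by
  unfold blochExt
  rw [integral_mul_per k hψ0 (rotSpread_of_norm_gt m θ f) hψ (memLp_rotSpread θ hf)]
  refine tsum_congr fun n => ?_
  rw [integral_mul_rotSpread m θ (memLp_comp_add hψ (lat n)) hf]

theorem summable_ext (k : ℝ × ℝ) (m : ℤ) (θ : ℂ) {ψ f : Plane → ℂ} {R : ℝ}
    (hψ0 : ∀ x, R < ‖x‖ → ψ x = 0)
    (hψ : MemLp ψ 2 volume) (hf : MemLp f 2 (volume.restrict (rhombus m))) :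
    Summable fun n => blochChar k n * ∑ a ∈ Finset.range 3,
      θ ^ a * ∫ x in rhombus m, ψ (turn^[a] x + lat n) * f x := by
  refine summable_blochChar_mul k (C := 1 + R) fun n hn => ?_
  rw [← integral_mul_rotSpread m θ (memLp_comp_add hψ (lat n)) hf]
  exact integral_mul_eq_zero_of_notMem hψ0 (rotSpread_of_norm_gt m θ f) hn


/-! ### Gluing across the sides of the rhombus -/

theorem sidePoint_one (m : ℤ) (t : ℝ) : sidePoint m 1 t = turn (sidePoint m 0 t) := by
  rw [(sidePoint_eq m t).1, (sidePoint_eq m t).2.1, turn_comb]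
  simp

theorem sidePoint_two {m : ℤ} {d : ℤ × ℤ} (hd : vertex m - turn (vertex m) = lat d) (t : ℝ) :
    sidePoint m 2 t = turn (sidePoint m 3 t) + lat d := by
  rw [(sidePoint_eq m t).2.2.1, (sidePoint_eq m t).2.2.2, turn_comb, ← hd, vertex_self m]
  have := turn_comb m 1 1
  simp only [one_smul] at this
  rw [this]
  ext <;> simp <;> ring

/-- The third root of unity `(-1 + √3 ι) / 2`, for a square root `ι` of `-1`. -/
def unityRoot (ι : ℂ) : ℂ := (-1 + √3 * ι) / 2

theorem sqrt3_sq_complex : ((√3 : ℝ) : ℂ) ^ 2 = 3 := by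
  rw [← Complex.ofReal_pow, Real.sq_sqrt (by norm_num)]
  norm_num

/-- The complex number formed from the components of a vector, for a square root `ι` of `-1`. -/
def cplx (ι : ℂ) (v : Fin 2 → ℝ) : ℂ := (v 0 : ℂ) + ι * v 1

/-- The rotation carries side 0 to side 1 and, up to a translation, side 3 to side 2, and multiplies
`cplx ι v` by `unityRoot ι`. The minus sign appears because the rotated rhombus lies on the other
side of the common edge. -/
theorem cplx_sideNormal (m : ℤ) {ι : ℂ} (hι : ι ^ 2 = -1) :
    cplx ι (sideNormal m 1) = -unityRoot ι * cplx ι (sideNormal m 0) ∧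
    cplx ι (sideNormal m 2) = -unityRoot ι * cplx ι (sideNormal m 3) := by
  have hp := vertex_succ m
  have hv := vertex_self m
  constructor
  · simp only [unityRoot, cplx, sideNormal, sideSign, sideEnd, sideStart, hp, turn]
    simp
    linear_combination (-√3 / 2 * (vertex (m - 1)).1 : ℂ) * hι
  · simp only [unityRoot, cplx, sideNormal, sideSign, sideEnd, sideStart, hv, hp, turn]
    simp
    linear_combination (√3 / 2 * (vertex (m - 1)).1 : ℂ) * hι

/-- The complex directional derivative `∂₀ + ι ∂₁`. -/
def dbar (ι : ℂ) (φ : Plane → ℝ) (x : Plane) : ℂ :=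
  (fderiv ℝ φ x (basisVec 0) : ℂ) + ι * (fderiv ℝ φ x (basisVec 1) : ℂ)

/-- The direction (1, ι) is an eigenvector of the rotation, so `∂₀ + ι ∂₁` is only rescaled by it.
For ι = ±i these are, up to a factor, the Cauchy–Riemann operators. -/
theorem dbar_comp_turn {ι : ℂ} (hι : ι ^ 2 = -1) {φ : Plane → ℝ} (hφ : Differentiable ℝ φ)
    (x : Plane) :
    dbar ι φ (turn x) = unityRoot ι * dbar ι (fun y => φ (turn y)) x := by
  have h : ∀ i, fderiv ℝ (fun y => φ (turn y)) x (basisVec i) =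
      ∑ l, turnMatrix l i • fderiv ℝ φ (turn x) (basisVec l) := fun i => by
    rw [turn_eq_aff]
    exact fderiv_comp_aff turnMatrix 0 hφ x i
  have h3 := sqrt3_sq_complex
  rw [dbar, dbar, h, h, unityRoot]
  simp only [turnMatrix, Fin.sum_univ_two, Matrix.of_apply, Matrix.cons_val', Matrix.cons_val_zero,
    Matrix.cons_val_one, Matrix.cons_val_fin_one, smul_eq_mul]
  push_cast
  set a := ((fderiv ℝ φ (turn x)) (basisVec 0) : ℂ)
  set b := ((fderiv ℝ φ (turn x)) (basisVec 1) : ℂ)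
  linear_combination ((1 / 4 : ℂ) * a * (√3 : ℂ) ^ 2 - (√3 : ℂ) / 4 * b * (1 - √3 * ι)
    + b * √3 / 2 - ι * b * √3 ^ 2 / 4) * hι + (-(1 / 4 : ℂ) * a - ι * b / 4) * h3

theorem contDiff_iterate_turn (a : ℕ) (v : Plane) : ContDiff ℝ ∞ (fun x => turn^[a] x + v) := by
  induction a with
  | zero => exact contDiff_id.add contDiff_const
  | succ a ih =>
    have := ih.comp (contDiff_aff turnMatrix 0)
    rw [← turn_eq_aff] at this
    exact this

theorem dbar_comp_iterate {ι : ℂ} (hι : ι ^ 2 = -1) {φ : Plane → ℝ} (hφ : ContDiff ℝ ∞ φ)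
    (v : Plane) (a : ℕ) (x : Plane) :
    dbar ι φ (turn^[a] x + v) =
      unityRoot ι ^ a * dbar ι (fun y => φ (turn^[a] y + v)) x := by
  induction a generalizing x with
  | zero => simp [dbar, fderiv_comp_add_right]
  | succ a ih =>
    have hs : ContDiff ℝ ∞ (fun y => φ (turn^[a] y + v)) := hφ.comp (contDiff_iterate_turn a v)
    rw [Function.iterate_succ_apply, ih,
      dbar_comp_turn hι (hs.differentiable (by simp)) x, pow_succ]
    simp only [Function.iterate_succ_apply]
    ring

theorem turn_iterate_three (x : Plane) : turn^[3] x = x := by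
  rw [show (3 : ℕ) = 2 + 1 by rfl, Function.iterate_succ_apply]
  change turn (turn (turn x)) = x
  rw [turn_turn, rotMap_turn]

theorem turn_iterate_add (a : ℕ) (x : Plane) (d : ℤ × ℤ) :
    turn^[a] (x + lat d) = turn^[a] x + lat (turnIdx^[a] d) := by
  induction a generalizing x d with
  | zero => simp
  | succ a ih => rw [Function.iterate_succ_apply, turn_add, turn_lat, ih]; rfl

theorem exists_norm_turn_iterate_le (a : ℕ) {K : Set Plane} (hK : IsCompact K) :
    ∃ C : ℝ, ∀ x ∈ K, ‖turn^[a] x‖ ≤ C := by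
  obtain ⟨C, hC⟩ := hK.exists_bound_of_continuousOn (continuous_turn.iterate a).continuousOn
  exact ⟨C, hC⟩

theorem continuous_sidePoint (m : ℤ) (s : Fin 4) : Continuous (sidePoint m s) := by
  unfold sidePoint
  fun_prop

theorem hasCompactSupport_comp_iterate {φ : Plane → ℝ} (h : HasCompactSupport φ) (a : ℕ)
    (v : Plane) : HasCompactSupport (fun x => φ (turn^[a] x + v)) := by
  have hd : turnMatrix.det ≠ 0 := by rw [det_turnMatrix]; norm_num
  induction a with
  | zero => exact h.comp_homeomorph (Homeomorph.addRight v)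
  | succ a ih =>
    have := ih.comp_homeomorph (affHomeo hd 0)
    convert this using 1
    funext x
    rw [Function.iterate_succ_apply, turn_eq_aff]
    rfl

/-- The boundary integrals along the images of a side under the symmetry group cancel. -/
theorem integral_dbar_mul_blochExt {k : ℝ × ℝ}
    (hk : ∀ n, blochChar k (turnIdx n) = blochChar k n) {m : ℤ} {d : ℤ × ℤ}
    (hd : vertex m - turn (vertex m) = lat d) {θ ι : ℂ} (hι : ι ^ 2 = -1)
    (hθ : (θ * unityRoot ι) ^ 3 = 1) {u : Plane → ℂ} {D : Fin 2 → Plane → ℂ}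
    {g : Fin 4 → ℝ → ℂ} (hu : MemLp u 2 (volume.restrict (rhombus m)))
    (hD : ∀ i, MemLp (D i) 2 (volume.restrict (rhombus m))) (hg : IsTrace m u D g)
    (h01 : ∀ᵐ t ∂(volume.restrict (Ioo (0 : ℝ) 1)), g 1 t = θ * g 0 t)
    (h32 : ∀ᵐ t ∂(volume.restrict (Ioo (0 : ℝ) 1)), g 2 t = θ * blochChar k d * g 3 t)
    {φ : Plane → ℝ} (h1 : ContDiff ℝ ∞ φ) (h2 : HasCompactSupport φ) :
    (∫ x, dbar ι φ x * blochExt k m θ u x) +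
      ∫ x, (φ x : ℂ) * blochExt k m (θ * unityRoot ι) (fun x => D 0 x + ι * D 1 x) x = 0 := by
  obtain ⟨R, hR⟩ := h2.isBounded.exists_norm_le
  set ρ : ℂ := unityRoot ι with hρ
  have zφ : ∀ x, R < ‖x‖ → φ x = 0 := fun x hx =>
    image_eq_zero_of_notMem_tsupport fun hh => absurd (hR x hh) (not_le.2 hx)
  have z1 : ∀ x, R < ‖x‖ → (φ x : ℂ) = 0 := fun x hx => by rw [zφ x hx]; simp
  have z2 : ∀ x, R < ‖x‖ → dbar ι φ x = 0 := fun x hx => by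
    rw [dbar, fderiv_eq_zero_of_notMem_tsupport fun hh => absurd (hR x hh) (not_le.2 hx)]; simp
  have m1 : MemLp (fun x => (φ x : ℂ)) 2 (volume : Measure Plane) :=
    (Complex.continuous_ofReal.comp h1.continuous).memLp_of_hasCompactSupport
      (h2.comp_left (g := fun r : ℝ => (r : ℂ)) (by simp))
  have md : ∀ i, MemLp (fun x => (fderiv ℝ φ x (basisVec i) : ℂ)) 2 (volume : Measure Plane) :=
    fun i => (Complex.continuous_ofReal.comp
      (fderiv_apply_continuous h1 _)).memLp_of_hasCompactSupport
      ((fderiv_apply_compact h2 _).comp_left (g := fun r : ℝ => (r : ℂ)) (by simp))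
  have m2 : MemLp (dbar ι φ) 2 (volume : Measure Plane) := (md 0).add ((md 1).const_mul ι)
  have hDι : MemLp (fun x => D 0 x + ι * D 1 x) 2 (volume.restrict (rhombus m)) :=
    (hD 0).add ((hD 1).const_mul ι)
  rw [integral_mul_ext k m θ z2 m2 hu, integral_mul_ext k m _ z1 m1 hDι,
    ← (summable_ext k m θ z2 m2 hu).tsum_add (summable_ext k m _ z1 m1 hDι)]
  -- the boundary integrals
  let B : ℕ → Fin 4 → ℤ × ℤ → ℂ := fun a s n =>
    ∫ t in Ioo (0 : ℝ) 1, (φ (turn^[a] (sidePoint m s t) + lat n) : ℂ) * g s t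
  have hB0 : ∀ a s, ∃ C, ∀ n, n ∉ latBall C → B a s n = 0 := by
    intro a s
    obtain ⟨C, hC⟩ := exists_norm_turn_iterate_le a
      ((isCompact_Icc (a := (0 : ℝ)) (b := 1)).image (continuous_sidePoint m s))
    refine ⟨C + R, fun n hn => setIntegral_eq_zero_of_forall_eq_zero fun t ht => ?_⟩
    have k1 := norm_lat_of_notMem hn
    have k2 := hC _ (mem_image_of_mem _ ⟨ht.1.le, ht.2.le⟩)
    have k3 := norm_sub_norm_le (lat n) (-turn^[a] (sidePoint m s t))
    rw [sub_neg_eq_add, norm_neg, add_comm (lat n)] at k3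
    rw [z1 _ (by linarith), zero_mul]
  have hBs : ∀ a s, Summable fun n => blochChar k n * B a s n := fun a s => by
    obtain ⟨C, hC⟩ := hB0 a s
    exact summable_blochChar_mul k hC
  let S : ℕ → Fin 4 → ℂ := fun a s => ∑' n, blochChar k n * B a s n
  -- Green's formula on the rhombus for the transported test function. Transporting the operator
  -- costs `ρ ^ a`, which is why the derivative has to be extended with the phase `θ * ρ`.
  have green : ∀ n a, θ ^ a * (∫ x in rhombus m, dbar ι φ (turn^[a] x + lat n) * u x) +
      (θ * ρ) ^ a * ∫ x in rhombus m, (φ (turn^[a] x + lat n) : ℂ) * (D 0 x + ι * D 1 x) =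
      (θ * ρ) ^ a * ∑ s, cplx ι (sideNormal m s) * B a s n := by
    intro n a
    have c1 : ContDiff ℝ ∞ (fun x => φ (turn^[a] x + lat n)) := h1.comp (contDiff_iterate_turn a _)
    have c2 := hasCompactSupport_comp_iterate h2 a (lat n)
    have e0 := hg.2 _ c1 c2 0
    have e1 := hg.2 _ c1 c2 1
    have i0 := fun i => ((MemLp.memL2loc hu).integrable_mul
      (fderiv_apply_continuous c1 (basisVec i)) (fderiv_apply_compact c2 (basisVec i)))
    have i1 := fun i => ((MemLp.memL2loc (hD i)).integrable_mul c1.continuous c2)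
    rw [integral_add (i0 0) (i1 0)] at e0
    rw [integral_add (i0 1) (i1 1)] at e1
    simp only [dbar_comp_iterate hι h1]
    have s1 : ∫ x in rhombus m, ρ ^ a * dbar ι (fun y => φ (turn^[a] y + lat n)) x * u x =
        ρ ^ a * ((∫ x in rhombus m, (fderiv ℝ (fun x => φ (turn^[a] x + lat n)) x (basisVec 0) : ℂ)
          * u x) + ι * ∫ x in rhombus m,
          (fderiv ℝ (fun x => φ (turn^[a] x + lat n)) x (basisVec 1) : ℂ) * u x) := by
      rw [← integral_const_mul ι, ← integral_add (i0 0) ((i0 1).const_mul ι), ← integral_const_mul]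
      congr 1
      funext x
      simp only [dbar]
      ring
    have s2 : ∫ x in rhombus m, (φ (turn^[a] x + lat n) : ℂ) * (D 0 x + ι * D 1 x) =
        (∫ x in rhombus m, (φ (turn^[a] x + lat n) : ℂ) * D 0 x) +
          ι * ∫ x in rhombus m, (φ (turn^[a] x + lat n) : ℂ) * D 1 x := by
      rw [← integral_const_mul ι, ← integral_add (i1 0) ((i1 1).const_mul ι)]
      congr 1
      funext x
      ring
    rw [s1, s2]
    simp only [Fin.sum_univ_four] at e0 e1 ⊢
    simp only [cplx, B]
    rw [mul_pow]
    linear_combination (θ ^ a * ρ ^ a) * e0 + (θ ^ a * ρ ^ a * ι) * e1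
  have total : (∑' n, (blochChar k n * (∑ a ∈ Finset.range 3,
      θ ^ a * ∫ x in rhombus m, dbar ι φ (turn^[a] x + lat n) * u x) +
      blochChar k n * ∑ a ∈ Finset.range 3, (θ * ρ) ^ a *
        ∫ x in rhombus m, (φ (turn^[a] x + lat n) : ℂ) * (D 0 x + ι * D 1 x))) =
      ∑ a ∈ Finset.range 3, ∑ s, (θ * ρ) ^ a * cplx ι (sideNormal m s) * S a s := by
    have e : ∀ n, blochChar k n * (∑ a ∈ Finset.range 3,
        θ ^ a * ∫ x in rhombus m, dbar ι φ (turn^[a] x + lat n) * u x) +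
        blochChar k n * (∑ a ∈ Finset.range 3, (θ * ρ) ^ a *
          ∫ x in rhombus m, (φ (turn^[a] x + lat n) : ℂ) * (D 0 x + ι * D 1 x)) =
        ∑ a ∈ Finset.range 3, ∑ s, (θ * ρ) ^ a * cplx ι (sideNormal m s) *
          (blochChar k n * B a s n) := by
      intro n
      rw [← mul_add, ← Finset.sum_add_distrib, Finset.mul_sum]
      refine Finset.sum_congr rfl fun a _ => ?_
      rw [green, Finset.mul_sum, Finset.mul_sum]
      exact Finset.sum_congr rfl fun s _ => by ring
    rw [tsum_congr e, Summable.tsum_finsetSum fun a _ => summable_sum fun s _ =>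
      (hBs a s).mul_left _]
    refine Finset.sum_congr rfl fun a _ => ?_
    rw [Summable.tsum_finsetSum fun s _ => (hBs a s).mul_left _]
    exact Finset.sum_congr rfl fun s _ => tsum_mul_left
  have hturn : ∀ a, blochChar k (turnIdx^[a] d) = blochChar k d := by
    intro a
    induction a with
    | zero => rfl
    | succ a ih => rw [Function.iterate_succ_apply', hk, ih]
  -- The `a`-th image of side 1 is the next image of side 0, and the matching of traces contributes
  -- `θ`.
  have r1 : ∀ a, S a 1 = θ * S (a + 1) 0 := by
    intro a
    simp only [S]
    rw [← tsum_mul_left]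
    refine tsum_congr fun n => ?_
    have : B a 1 n = θ * B (a + 1) 0 n := by
      simp only [B]
      rw [← integral_const_mul]
      refine integral_congr_ae (h01.mono fun t ht => ?_)
      simp only [ht, sidePoint_one, Function.iterate_succ_apply]
      ring
    rw [this]
    ring
  -- The outer sides are also related by a translation. The sum over the lattice is shifted
  -- accordingly, and the Bloch phase in the matching condition is the one that the shift produces.
  have r2 : ∀ a, S a 2 = θ * S (a + 1) 3 := by
    intro a
    simp only [S]
    rw [← tsum_mul_left, ← (Equiv.addRight (turnIdx^[a] d)).tsum_eq
      fun n => θ * (blochChar k n * B (a + 1) 3 n)]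
    refine tsum_congr fun n => ?_
    have : B a 2 n = θ * blochChar k d * B (a + 1) 3 (n + turnIdx^[a] d) := by
      simp only [B]
      rw [← integral_const_mul]
      refine integral_congr_ae (h32.mono fun t ht => ?_)
      simp only [ht, sidePoint_two hd, Function.iterate_succ_apply, turn_iterate_add, lat_add]
      rw [add_assoc, add_comm (lat _) (lat n)]
      ring
    rw [this, Equiv.coe_addRight, blochChar_add, hturn]
    ring
  have r3 : ∀ s, S 3 s = S 0 s := fun s => by
    simp only [S, B, turn_iterate_three, Function.iterate_zero, id]
  refine total.trans ?_
  obtain ⟨n1, n2⟩ := cplx_sideNormal m hι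
  simp only [Finset.sum_range_succ, Finset.sum_range_zero, Fin.sum_univ_four, r1, r2, n1, n2,
    zero_add, r3, ← hρ, Nat.reduceAdd]
  -- With the normals related by `-ρ`, both pairs of sides leave a sum over `a` that telescopes;
  -- since the third image of a side is the side itself, what remains is the factor 1 - (θρ)³.
  linear_combination (-(cplx ι (sideNormal m 0)) * S 0 0 - cplx ι (sideNormal m 3) * S 0 3) * hθ

/-- The components of the gradient of a function which is multiplied by `θ` under `turn`. -/
def gradExt (k : ℝ × ℝ) (m : ℤ) (θ : ℂ) (D : Fin 2 → Plane → ℂ) (i : Fin 2) (x : Plane) : ℂ :=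
  ![(1 / 2 : ℂ), -Complex.I / 2] i *
      blochExt k m (θ * unityRoot Complex.I) (fun x => D 0 x + Complex.I * D 1 x) x +
    ![(1 / 2 : ℂ), Complex.I / 2] i *
      blochExt k m (θ * unityRoot (-Complex.I)) (fun x => D 0 x + -Complex.I * D 1 x) x

theorem unityRoot_pow_three {ι : ℂ} (hι : ι ^ 2 = -1) : unityRoot ι ^ 3 = 1 := by
  have h := sqrt3_sq_complex
  unfold unityRoot
  linear_combination (3 / 8 * (√3 : ℂ) * ι + 3 / 8 - √3 * ι / 2) * h +
    (√3 ^ 3 * ι / 8 - 3 / 8 * √3 ^ 2) * hι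

theorem memL2loc_gradExt (k : ℝ × ℝ) {m : ℤ} (θ : ℂ) {D : Fin 2 → Plane → ℂ}
    (hD : ∀ i, MemLp (D i) 2 (volume.restrict (rhombus m))) (i : Fin 2) :
    MemL2loc univ (gradExt k m θ D i) :=
  ((memL2loc_ext k _ ((hD 0).add ((hD 1).const_mul Complex.I))).smul _).add
    ((memL2loc_ext k _ ((hD 0).add ((hD 1).const_mul (-Complex.I)))).smul _)

/-- A function with matching traces extends to a weakly differentiable function. -/
theorem isWeakDeriv_blochExt {k : ℝ × ℝ}
    (hk : ∀ n, blochChar k (turnIdx n) = blochChar k n) {m : ℤ} {d : ℤ × ℤ}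
    (hd : vertex m - turn (vertex m) = lat d) {θ : ℂ} (hθ : θ ^ 3 = 1)
    {u : Plane → ℂ} {D : Fin 2 → Plane → ℂ}
    {g : Fin 4 → ℝ → ℂ} (hu : MemLp u 2 (volume.restrict (rhombus m)))
    (hD : ∀ i, MemLp (D i) 2 (volume.restrict (rhombus m))) (hg : IsTrace m u D g)
    (h01 : ∀ᵐ t ∂(volume.restrict (Ioo (0 : ℝ) 1)), g 1 t = θ * g 0 t)
    (h32 : ∀ᵐ t ∂(volume.restrict (Ioo (0 : ℝ) 1)), g 2 t = θ * blochChar k d * g 3 t)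
    (i : Fin 2) : IsWeakDeriv univ i (blochExt k m θ u) (gradExt k m θ D i) := by
  intro φ h1 h2 _
  have hI : Complex.I ^ 2 = -1 := Complex.I_sq
  have hI' : (-Complex.I) ^ 2 = -1 := by rw [neg_sq, Complex.I_sq]
  -- The identities for ι = i and ι = -i together are equivalent to those for the two partial
  -- derivatives.
  have e1 := integral_dbar_mul_blochExt hk hd hI (by rw [mul_pow, hθ, unityRoot_pow_three hI, one_mul])
    hu hD hg h01 h32 h1 h2
  have e2 := integral_dbar_mul_blochExt hk hd hI'
    (by rw [mul_pow, hθ, unityRoot_pow_three hI', one_mul]) hu hD hg h01 h32 h1 h2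
  have mu := memL2loc_ext k θ hu
  have mp := memL2loc_ext k (θ * unityRoot Complex.I)
    (f := fun x => D 0 x + Complex.I * D 1 x) ((hD 0).add ((hD 1).const_mul Complex.I))
  have mm := memL2loc_ext k (θ * unityRoot (-Complex.I))
    (f := fun x => D 0 x + -Complex.I * D 1 x) ((hD 0).add ((hD 1).const_mul (-Complex.I)))
  have iu := fun i => mu.integrable_mul (fderiv_apply_continuous h1 (basisVec i))
    (fderiv_apply_compact h2 (basisVec i))
  have ip := mp.integrable_mul h1.continuous h2
  have im := mm.integrable_mul h1.continuous h2
  rw [Measure.restrict_univ] at ip im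
  simp only [Measure.restrict_univ] at iu
  have split : ∀ ι : ℂ, ∫ x, dbar ι φ x * blochExt k m θ u x =
      (∫ x, (fderiv ℝ φ x (basisVec 0) : ℂ) * blochExt k m θ u x) +
        ι * ∫ x, (fderiv ℝ φ x (basisVec 1) : ℂ) * blochExt k m θ u x := by
    intro ι
    rw [← integral_const_mul, ← integral_add (iu 0) ((iu 1).const_mul ι)]
    congr 1
    funext x
    simp only [dbar]
    ring
  have split2 : ∀ c c' : ℂ, ∫ x, (φ x : ℂ) *
      (c * blochExt k m (θ * unityRoot Complex.I) (fun x => D 0 x + Complex.I * D 1 x) x +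
        c' * blochExt k m (θ * unityRoot (-Complex.I)) (fun x => D 0 x + -Complex.I * D 1 x) x) =
      c * (∫ x, (φ x : ℂ) *
        blochExt k m (θ * unityRoot Complex.I) (fun x => D 0 x + Complex.I * D 1 x) x) +
      c' * ∫ x, (φ x : ℂ) *
        blochExt k m (θ * unityRoot (-Complex.I)) (fun x => D 0 x + -Complex.I * D 1 x) x := by
    intro c c'
    rw [← integral_const_mul, ← integral_const_mul, ← integral_add (ip.const_mul c) (im.const_mul c')]
    congr 1
    funext x
    ring
  rw [split] at e1 e2
  rw [setIntegral_univ, setIntegral_univ]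
  simp only [gradExt]
  rw [split2]
  fin_cases i
  · simp only [Fin.zero_eta, Matrix.cons_val_zero]
    linear_combination (1 / 2 : ℂ) * e1 + (1 / 2 : ℂ) * e2
  · simp only [Fin.mk_one, Matrix.cons_val_one, Matrix.cons_val_fin_one]
    linear_combination (-Complex.I / 2) * e1 + (Complex.I / 2) * e2 +
      (∫ x, (fderiv ℝ φ x (basisVec 1) : ℂ) * blochExt k m θ u x) * hI


/-! ### Test functions concentrated at a side of the rhombus -/

/-- Product test functions in the coordinates of the rhombus. -/
def prodTest (m : ℤ) (η β : ℝ → ℝ) (x : Plane) : ℝ := η (coordA m x) * β (coordB m x)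

theorem contDiff_coordA (m : ℤ) {n : WithTop ℕ∞} : ContDiff ℝ n (coordA m) := by
  unfold coordA; fun_prop

theorem contDiff_coordB (m : ℤ) {n : WithTop ℕ∞} : ContDiff ℝ n (coordB m) := by
  unfold coordB; fun_prop

theorem contDiff_prodTest (m : ℤ) {η β : ℝ → ℝ} (hη : ContDiff ℝ ∞ η) (hβ : ContDiff ℝ ∞ β) :
    ContDiff ℝ ∞ (prodTest m η β) :=
  (hη.comp (contDiff_coordA m)).mul (hβ.comp (contDiff_coordB m))

theorem hasCompactSupport_prodTest (m : ℤ) {η β : ℝ → ℝ} (hη : HasCompactSupport η)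
    (hβ : HasCompactSupport β) : HasCompactSupport (prodTest m η β) := by
  have hc : Continuous fun y : ℝ × ℝ => y.1 • vertex (m - 1) + y.2 • vertex (m + 1) := by fun_prop
  refine HasCompactSupport.of_support_subset_isCompact
    ((IsCompact.prod hη hβ).image hc) fun x hx => ?_
  refine ⟨(coordA m x, coordB m x), ⟨?_, ?_⟩, comb_coord m x⟩
  · exact subset_tsupport _ fun h => hx (by simp [prodTest, h])
  · exact subset_tsupport _ fun h => hx (by simp [prodTest, h])

/-- A smooth function of one variable which is `1` at `0` and supported near `0`. -/
theorem exists_bump (δ : ℝ) (hδ : 0 < δ) : ∃ β : ℝ → ℝ, ContDiff ℝ ∞ β ∧ HasCompactSupport β ∧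
    β 0 = 1 ∧ ∀ y, δ ≤ |y| → β y = 0 := by
  let b : ContDiffBump (0 : ℝ) := ⟨δ / 2, δ, by positivity, by linarith⟩
  refine ⟨b, b.contDiff, b.hasCompactSupport, b.one_of_mem_closedBall (by simp [b]; positivity),
    fun y hy => b.zero_of_le_dist (by simpa [b] using hy)⟩

theorem eq_zero_of_tsupport {η : ℝ → ℝ} (h : tsupport η ⊆ Ioo 0 1) {y : ℝ}
    (hy : y ≤ 0 ∨ 1 ≤ y) : η y = 0 :=
  image_eq_zero_of_notMem_tsupport fun hh => by
    have := h hh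
    rcases hy with hy | hy
    · linarith [this.1]
    · linarith [this.2]

/-- Test functions with prescribed values on one side, vanishing on the other sides. -/
theorem exists_sideTest (m : ℤ) (s : Fin 4) {η : ℝ → ℝ} (hη : ContDiff ℝ ∞ η)
    (hc : HasCompactSupport η) (hs : tsupport η ⊆ Ioo 0 1) :
    ∃ φ : Plane → ℝ, ContDiff ℝ ∞ φ ∧ HasCompactSupport φ ∧
      ∀ s' t, φ (sidePoint m s' t) = if s' = s then η t else 0 := by
  -- Radius 1 makes `β` vanish at 1, hence the product on the opposite side; on the adjacent sides
  -- it vanishes because `η` is zero at both endpoints.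
  obtain ⟨β, b1, b2, b3, b4⟩ := exists_bump 1 one_pos
  have z0 : η 0 = 0 := eq_zero_of_tsupport hs (Or.inl le_rfl)
  have z1 : η 1 = 0 := eq_zero_of_tsupport hs (Or.inr le_rfl)
  have z2 : β 1 = 0 := b4 1 (by simp)
  have r1 : ∀ {f : ℝ → ℝ}, ContDiff ℝ ∞ f → ContDiff ℝ ∞ fun y => f (1 - y) := fun h =>
    h.comp (by fun_prop)
  have r2 : ∀ {f : ℝ → ℝ}, HasCompactSupport f → HasCompactSupport fun y => f (1 - y) := fun h =>
    h.comp_homeomorph (Homeomorph.subLeft 1)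
  have c0 : ∀ t, coordA m (sidePoint m 0 t) = t ∧ coordB m (sidePoint m 0 t) = 0 := fun t => by
    rw [(sidePoint_eq m t).1, coordA_comb, coordB_comb]; exact ⟨rfl, rfl⟩
  have c1 : ∀ t, coordA m (sidePoint m 1 t) = 0 ∧ coordB m (sidePoint m 1 t) = t := fun t => by
    rw [(sidePoint_eq m t).2.1, coordA_comb, coordB_comb]; exact ⟨rfl, rfl⟩
  have c2 : ∀ t, coordA m (sidePoint m 2 t) = 1 ∧ coordB m (sidePoint m 2 t) = 1 - t := fun t => by
    rw [(sidePoint_eq m t).2.2.1, coordA_comb, coordB_comb]; exact ⟨rfl, rfl⟩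
  have c3 : ∀ t, coordA m (sidePoint m 3 t) = 1 - t ∧ coordB m (sidePoint m 3 t) = 1 := fun t => by
    rw [(sidePoint_eq m t).2.2.2, coordA_comb, coordB_comb]; exact ⟨rfl, rfl⟩
  fin_cases s
  · refine ⟨prodTest m η β, contDiff_prodTest m hη b1, hasCompactSupport_prodTest m hc b2,
      fun s' t => ?_⟩
    fin_cases s' <;> simp [prodTest, c0, c1, c2, c3, z0, z1, z2, b3]
  · refine ⟨prodTest m β η, contDiff_prodTest m b1 hη, hasCompactSupport_prodTest m b2 hc,
      fun s' t => ?_⟩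
    fin_cases s' <;> simp [prodTest, c0, c1, c2, c3, z0, z1, z2, b3]
  · refine ⟨prodTest m (fun y => β (1 - y)) fun y => η (1 - y), contDiff_prodTest m (r1 b1) (r1 hη),
      hasCompactSupport_prodTest m (r2 b2) (r2 hc), fun s' t => ?_⟩
    fin_cases s' <;> simp [prodTest, c0, c1, c2, c3, z0, z1, z2, b3]
  · refine ⟨prodTest m (fun y => η (1 - y)) fun y => β (1 - y), contDiff_prodTest m (r1 hη) (r1 b1),
      hasCompactSupport_prodTest m (r2 hc) (r2 b2), fun s' t => ?_⟩
    fin_cases s' <;> simp [prodTest, c0, c1, c2, c3, z0, z1, z2, b3]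

theorem integrable_mul_Ioo {η : ℝ → ℝ} (hη : Continuous η) {f : ℝ → ℂ}
    (hf : MemLp f 2 (volume.restrict (Ioo (0 : ℝ) 1))) :
    Integrable (fun t => (η t : ℂ) * f t) (volume.restrict (Ioo (0 : ℝ) 1)) := by
  obtain ⟨C, hC⟩ := (isCompact_Icc (a := (0 : ℝ)) (b := 1)).exists_bound_of_continuousOn
    hη.continuousOn
  refine (hf.integrable (by norm_num)).bdd_mul (c := C)
    (Complex.continuous_ofReal.comp hη).aestronglyMeasurable ?_
  refine (ae_restrict_iff' measurableSet_Ioo).2 (ae_of_all _ fun t ht => ?_)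
  rw [Complex.norm_real]
  exact hC t ⟨ht.1.le, ht.2.le⟩

/-- The fundamental lemma of the calculus of variations. It turns the integral identities for traces
into pointwise matching conditions. -/
theorem ae_eq_of_forall_test {f f' : ℝ → ℂ} (hf : MemLp f 2 (volume.restrict (Ioo (0 : ℝ) 1)))
    (hf' : MemLp f' 2 (volume.restrict (Ioo (0 : ℝ) 1)))
    (h : ∀ η : ℝ → ℝ, ContDiff ℝ ∞ η → HasCompactSupport η → tsupport η ⊆ Ioo 0 1 →
      ∫ t in Ioo (0 : ℝ) 1, (η t : ℂ) * f t = ∫ t in Ioo (0 : ℝ) 1, (η t : ℂ) * f' t) :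
    ∀ᵐ t ∂(volume.restrict (Ioo (0 : ℝ) 1)), f t = f' t := by
  rw [ae_restrict_iff' measurableSet_Ioo]
  have key := (isOpen_Ioo (a := (0 : ℝ)) (b := 1)).ae_eq_zero_of_integral_contDiff_smul_eq_zero
    (μ := volume) (f := fun t => f t - f' t) ?_ ?_
  · filter_upwards [key] with t ht ht'
    exact sub_eq_zero.1 (ht ht')
  · exact IntegrableOn.locallyIntegrableOn ((hf.sub hf').integrable (by norm_num))
  · intro η h1 h2 h3
    have e : ∫ t, η t • (f t - f' t) = ∫ t in Ioo (0 : ℝ) 1, η t • (f t - f' t) := by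
      rw [setIntegral_eq_integral_of_forall_compl_eq_zero]
      intro t ht
      rw [image_eq_zero_of_notMem_tsupport fun hh => ht (h3 hh), zero_smul]
    rw [e]
    simp only [Complex.real_smul, mul_sub]
    rw [integral_sub (integrable_mul_Ioo h1.continuous hf) (integrable_mul_Ioo h1.continuous hf'),
      h η h1 h2 h3, sub_self]

/-! ### Tangential derivatives of traces -/

/-- The direction vector of a side. -/
def sideVec (m : ℤ) (s : Fin 4) : Plane := sideEnd m s - sideStart m s

theorem sideNormal_zero (m : ℤ) (s : Fin 4) : sideNormal m s 0 = sideSign s * (sideVec m s).2 := rfl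

theorem sideNormal_one (m : ℤ) (s : Fin 4) : sideNormal m s 1 = -(sideSign s * (sideVec m s).1) :=
  rfl

theorem fderiv_add_eq_deriv_sidePoint (m : ℤ) (s : Fin 4) {φ : Plane → ℝ} (h : ContDiff ℝ ∞ φ)
    (t : ℝ) : (sideVec m s).1 * fderiv ℝ φ (sidePoint m s t) (basisVec 0) +
      (sideVec m s).2 * fderiv ℝ φ (sidePoint m s t) (basisVec 1) =
      deriv (fun t => φ (sidePoint m s t)) t := by
  have e : HasDerivAt (sidePoint m s) (sideVec m s) t := by
    have := ((hasDerivAt_id t).smul_const (sideVec m s)).const_add (sideStart m s)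
    rw [one_smul] at this
    exact this
  rw [show (fun t => φ (sidePoint m s t)) = φ ∘ sidePoint m s from rfl,
    ((h.differentiable (by simp) _).hasFDerivAt.comp_hasDerivAt t e).deriv, ← smul_eq_mul,
    ← smul_eq_mul, ← map_smul, ← map_smul, ← map_add]
  congr 1
  ext <;> simp [basisVec]

/-- The integral of the tangential derivative of `φ u` over the closed boundary is zero. Green's
formula is applied to `u` with test functions `∂₁φ` and `∂₀φ`, and to the components of the gradient
with `φ`; all interior terms cancel since the second derivatives of `φ` commute and the weak Hessian
is symmetric. -/
theorem trace_tangential_sum {m : ℤ} {u : Plane → ℂ} {D : Fin 2 → Plane → ℂ}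
    {H : Fin 2 → Fin 2 → Plane → ℂ} {g : Fin 4 → ℝ → ℂ} {G : Fin 2 → Fin 4 → ℝ → ℂ}
    (hu : MemL2loc (rhombus m) u) (hD : ∀ i, MemL2loc (rhombus m) (D i))
    (hH : ∀ i j, MemL2loc (rhombus m) (H i j))
    (hsym : ∀ᵐ x ∂(volume.restrict (rhombus m)), H 0 1 x = H 1 0 x)
    (hg : IsTrace m u D g) (hG : ∀ i, IsTrace m (D i) (H i) (G i))
    {φ : Plane → ℝ} (h1 : ContDiff ℝ ∞ φ) (h2 : HasCompactSupport φ) :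
    ∑ s, (sideSign s : ℂ) * ((∫ t in Ioo (0 : ℝ) 1,
        ((deriv (fun t => φ (sidePoint m s t)) t : ℝ) : ℂ) * g s t) +
      ∫ t in Ioo (0 : ℝ) 1, (φ (sidePoint m s t) : ℂ) *
        ((sideVec m s).1 * G 0 s t + (sideVec m s).2 * G 1 s t)) = 0 := by
  have dc : ∀ l, ContDiff ℝ ∞ (fun x => fderiv ℝ φ x (basisVec l)) := fun l =>
    (h1.fderiv_right (m := ∞) (by simp)).clm_apply contDiff_const
  have ds : ∀ l, HasCompactSupport (fun x => fderiv ℝ φ x (basisVec l)) := fun l =>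
    fderiv_apply_compact h2 _
  have ea := hg.2 _ (dc 1) (ds 1) 0
  have eb := hg.2 _ (dc 0) (ds 0) 1
  have ec := (hG 0).2 φ h1 h2 1
  have ed := (hG 1).2 φ h1 h2 0
  have sy : ∀ x, fderiv ℝ (fun y => fderiv ℝ φ y (basisVec 1)) x (basisVec 0) =
      fderiv ℝ (fun y => fderiv ℝ φ y (basisVec 0)) x (basisVec 1) := by
    intro x
    have hd : DifferentiableAt ℝ (fderiv ℝ φ) x :=
      ((h1.fderiv_right (m := ∞) (by simp)).differentiable (by simp)) x
    have e : ∀ v w : Plane, fderiv ℝ (fun y => fderiv ℝ φ y v) x w =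
        fderiv ℝ (fderiv ℝ φ) x w v := fun v w => by
      rw [fderiv_clm_apply hd (differentiableAt_const _)]
      simp
    rw [e, e]
    exact (h1.contDiffAt.isSymmSndFDerivAt
      (by simpa using WithTop.coe_le_coe.2 (le_top : (2 : ℕ∞) ≤ ⊤))).eq _ _
  have iu : ∀ l k, Integrable (fun x => (fderiv ℝ (fun y => fderiv ℝ φ y (basisVec l)) x
      (basisVec k) : ℂ) * u x) (volume.restrict (rhombus m)) := fun l k =>
    hu.integrable_mul (fderiv_apply_continuous (dc l) _) (fderiv_apply_compact (ds l) _)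
  have iD : ∀ l k, Integrable (fun x => (fderiv ℝ φ x (basisVec l) : ℂ) * D k x)
      (volume.restrict (rhombus m)) := fun l k =>
    (hD k).integrable_mul (dc l).continuous (ds l)
  have iH : ∀ l k, Integrable (fun x => (φ x : ℂ) * H l k x)
      (volume.restrict (rhombus m)) := fun l k => (hH l k).integrable_mul h1.continuous h2
  rw [integral_add (iu 1 0) (iD 1 0)] at ea
  rw [integral_add (iu 0 1) (iD 0 1)] at eb
  rw [integral_add (iD 1 0) (iH 0 1)] at ec
  rw [integral_add (iD 0 1) (iH 1 0)] at ed
  simp only [sy] at ea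
  have hHH : ∫ x in rhombus m, (φ x : ℂ) * H 0 1 x = ∫ x in rhombus m, (φ x : ℂ) * H 1 0 x :=
    integral_congr_ae (hsym.mono fun x hx => by simp only [hx])
  rw [hHH] at ec
  have side : ∀ s, (∫ t in Ioo (0 : ℝ) 1,
      ((deriv (fun t => φ (sidePoint m s t)) t : ℝ) : ℂ) * g s t) +
      (∫ t in Ioo (0 : ℝ) 1, (φ (sidePoint m s t) : ℂ) *
        ((sideVec m s).1 * G 0 s t + (sideVec m s).2 * G 1 s t)) =
      (sideVec m s).1 * (∫ t in Ioo (0 : ℝ) 1,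
        (fderiv ℝ φ (sidePoint m s t) (basisVec 0) : ℂ) * g s t) +
      (sideVec m s).2 * (∫ t in Ioo (0 : ℝ) 1,
        (fderiv ℝ φ (sidePoint m s t) (basisVec 1) : ℂ) * g s t) +
      ((sideVec m s).1 * (∫ t in Ioo (0 : ℝ) 1, (φ (sidePoint m s t) : ℂ) * G 0 s t) +
      (sideVec m s).2 * (∫ t in Ioo (0 : ℝ) 1, (φ (sidePoint m s t) : ℂ) * G 1 s t)) := by
    intro s
    have j1 := fun l => trace_integrable (hg.1 s) (dc l) m s
    have j2 := fun l => trace_integrable ((hG l).1 s) h1 m s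
    congr 1
    · rw [← integral_const_mul, ← integral_const_mul,
        ← integral_add ((j1 0).const_mul _) ((j1 1).const_mul _)]
      congr 1
      funext t
      rw [← fderiv_add_eq_deriv_sidePoint m s h1]
      push_cast
      ring
    · rw [← integral_const_mul, ← integral_const_mul,
        ← integral_add ((j2 0).const_mul _) ((j2 1).const_mul _)]
      congr 1
      funext t
      ring
  simp only [side]
  simp only [sideNormal_zero, sideNormal_one, Fin.sum_univ_four] at ea eb ec ed ⊢
  push_cast at ea eb ec ed
  linear_combination -ea + eb + ec - ed

/-- The tangential derivative of the trace is the tangential component of the trace of the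
gradient. -/
theorem trace_tangential {m : ℤ} {u : Plane → ℂ} {D : Fin 2 → Plane → ℂ}
    {H : Fin 2 → Fin 2 → Plane → ℂ} {g : Fin 4 → ℝ → ℂ} {G : Fin 2 → Fin 4 → ℝ → ℂ}
    (hu : MemL2loc (rhombus m) u) (hD : ∀ i, MemL2loc (rhombus m) (D i))
    (hH : ∀ i j, MemL2loc (rhombus m) (H i j))
    (hsym : ∀ᵐ x ∂(volume.restrict (rhombus m)), H 0 1 x = H 1 0 x)
    (hg : IsTrace m u D g) (hG : ∀ i, IsTrace m (D i) (H i) (G i)) (s : Fin 4)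
    {η : ℝ → ℝ} (hη : ContDiff ℝ ∞ η) (hc : HasCompactSupport η) (hs : tsupport η ⊆ Ioo 0 1) :
    ∫ t in Ioo (0 : ℝ) 1, (η t : ℂ) * ((sideVec m s).1 * G 0 s t + (sideVec m s).2 * G 1 s t) =
      -∫ t in Ioo (0 : ℝ) 1, ((deriv η t : ℝ) : ℂ) * g s t := by
  obtain ⟨φ, h1, h2, h3⟩ := exists_sideTest m s hη hc hs
  have key := trace_tangential_sum hu hD hH hsym hg hG h1 h2
  rw [Finset.sum_eq_single s] at key
  · simp only [h3, if_true] at key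
    have hsg : (sideSign s : ℂ) ≠ 0 := by
      fin_cases s <;> simp [sideSign]
    have := (mul_eq_zero.1 key).resolve_left hsg
    rw [add_comm] at this
    exact eq_neg_of_add_eq_zero_left this
  · intro s' _ hs'
    simp [h3, hs']
  · simp

theorem memLp_tangential {m : ℤ} {s : Fin 4} {G : Fin 2 → Fin 4 → ℝ → ℂ}
    (hG : ∀ i, MemLp (G i s) 2 (volume.restrict (Ioo (0 : ℝ) 1))) :
    MemLp (fun t => ((sideVec m s).1 : ℂ) * G 0 s t + (sideVec m s).2 * G 1 s t) 2
      (volume.restrict (Ioo (0 : ℝ) 1)) :=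
  ((hG 0).const_mul _).add ((hG 1).const_mul _)

/-- The matching of the traces is differentiated along the side, in the sense of distributions.
Hence a boundary condition on `u` and its normal derivative controls the whole gradient. -/
theorem tangential_glued {m : ℤ} {u : Plane → ℂ} {D : Fin 2 → Plane → ℂ}
    {H : Fin 2 → Fin 2 → Plane → ℂ} {g : Fin 4 → ℝ → ℂ} {G : Fin 2 → Fin 4 → ℝ → ℂ}
    (hu : MemL2loc (rhombus m) u) (hD : ∀ i, MemL2loc (rhombus m) (D i))
    (hH : ∀ i j, MemL2loc (rhombus m) (H i j))
    (hsym : ∀ᵐ x ∂(volume.restrict (rhombus m)), H 0 1 x = H 1 0 x)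
    (hg : IsTrace m u D g) (hG : ∀ i, IsTrace m (D i) (H i) (G i)) {s s' : Fin 4} {θ : ℂ}
    (h : ∀ᵐ t ∂(volume.restrict (Ioo (0 : ℝ) 1)), g s' t = θ * g s t) :
    ∀ᵐ t ∂(volume.restrict (Ioo (0 : ℝ) 1)),
      (sideVec m s').1 * G 0 s' t + (sideVec m s').2 * G 1 s' t =
        θ * ((sideVec m s).1 * G 0 s t + (sideVec m s).2 * G 1 s t) := by
  refine ae_eq_of_forall_test (memLp_tangential fun i => (hG i).1 s')
    ((memLp_tangential fun i => (hG i).1 s).const_mul θ) fun η h1 h2 h3 => ?_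
  have e1 := trace_tangential hu hD hH hsym hg hG s' h1 h2 h3
  have e2 := trace_tangential hu hD hH hsym hg hG s h1 h2 h3
  rw [e1]
  simp only [mul_left_comm _ θ]
  rw [integral_const_mul, e2, mul_neg, ← integral_const_mul]
  congr 1
  refine integral_congr_ae (h.mono fun t ht => ?_)
  simp only [ht]
  ring

/-! ### Normal and tangential components in complex form -/

/-- Normal and tangential conditions for a pair of vectors, in terms of the complex components. -/
theorem components_of_normal_tangential {T : Plane} (hT : T ≠ 0) {ι θ : ℂ} (hι : ι ^ 2 = -1)
    {G₀ G₁ G₀' G₁' : ℂ}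
    (ht : ((turn T).1 : ℂ) * G₀' + (turn T).2 * G₁' = θ * (T.1 * G₀ + T.2 * G₁))
    (hn : ((turn T).2 : ℂ) * G₀' - (turn T).1 * G₁' = θ * (T.2 * G₀ - T.1 * G₁)) :
    G₀' + ι * G₁' = θ * unityRoot ι * (G₀ + ι * G₁) := by
  have h3 := sqrt3_sq_complex
  -- The product (T₁ - ιT₂)(G₀ + ιG₁) is the tangential component minus ι times the normal one, so
  -- the two conditions amount to one complex identity. The factor can be cancelled because its
  -- product with T₁ + ιT₂ is |T|².
  have hq : ((T.1 : ℂ) - ι * T.2) ≠ 0 := by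
    intro h
    have h0 : ((T.1 : ℂ) - ι * T.2) * (T.1 + ι * T.2) = 0 := by rw [h, zero_mul]
    have h1 : ((T.1 ^ 2 + T.2 ^ 2 : ℝ) : ℂ) = 0 := by
      push_cast
      linear_combination h0 + (T.2 : ℂ) ^ 2 * hι
    have h2 : T.1 ^ 2 + T.2 ^ 2 = 0 := by exact_mod_cast h1
    apply hT
    ext
    · have : T.1 ^ 2 = 0 := by nlinarith [sq_nonneg T.1, sq_nonneg T.2]
      simpa using this
    · have : T.2 ^ 2 = 0 := by nlinarith [sq_nonneg T.1, sq_nonneg T.2]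
      simpa using this
  apply mul_left_cancel₀ hq
  have hu : unityRoot (-ι) * unityRoot ι = 1 := by
    unfold unityRoot
    linear_combination (1 / 4 : ℂ) * h3 - (√3 : ℂ) ^ 2 / 4 * hι
  have hq' : ((turn T).1 : ℂ) - ι * (turn T).2 = unityRoot (-ι) * (T.1 - ι * T.2) := by
    simp only [turn, unityRoot]
    push_cast
    linear_combination (-(√3 : ℂ) / 2 * T.2) * hι
  have e : (((turn T).1 : ℂ) - ι * (turn T).2) * (G₀' + ι * G₁') =
      θ * ((T.1 - ι * T.2) * (G₀ + ι * G₁)) := by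
    linear_combination ht - ι * hn + (-((turn T).2 : ℂ) * G₁' + θ * T.2 * G₁) * hι
  rw [hq'] at e
  linear_combination unityRoot ι * e - ((T.1 : ℂ) - ι * T.2) * (G₀' + ι * G₁') * hu

/-- Having the relation for both ι = ±i says that the second gradient is θ times the rotated first
one; taking normal components commutes with the rotation. -/
theorem normal_of_components {T : Plane} {θ : ℂ} {G₀ G₁ G₀' G₁' : ℂ}
    (h : ∀ ι : ℂ, ι ^ 2 = -1 → G₀' + ι * G₁' = θ * unityRoot ι * (G₀ + ι * G₁)) :
    ((turn T).2 : ℂ) * G₀' - (turn T).1 * G₁' = θ * (T.2 * G₀ - T.1 * G₁) := by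
  have h3 := sqrt3_sq_complex
  have hI := Complex.I_sq
  have e1 := h Complex.I hI
  have e2 := h (-Complex.I) (by rw [neg_sq, hI])
  have e0 : G₀' = θ * (-(1 / 2) * G₀ - √3 / 2 * G₁) := by
    simp only [unityRoot] at e1 e2
    linear_combination (1 / 2 : ℂ) * e1 + (1 / 2 : ℂ) * e2 + (√3 / 2 * θ * G₁) * hI
  have e0' : G₁' = θ * (√3 / 2 * G₀ - 1 / 2 * G₁) := by
    simp only [unityRoot] at e1 e2
    linear_combination (-Complex.I / 2 : ℂ) * e1 + (Complex.I / 2 : ℂ) * e2 +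
      (G₁' - √3 / 2 * θ * G₀ + 1 / 2 * θ * G₁) * hI
  rw [e0, e0']
  simp only [turn]
  push_cast
  linear_combination (θ / 4 * (T.2 * G₀ - T.1 * G₁)) * h3

theorem sideVec_pairs (m : ℤ) : sideVec m 1 = turn (sideVec m 0) ∧
    sideVec m 2 = turn (sideVec m 3) ∧ sideVec m 0 ≠ 0 ∧ sideVec m 3 ≠ 0 := by
  have hp := vertex_succ m
  have hv := vertex_self m
  have hne : vertex (m - 1) ≠ 0 := by
    intro h
    have := vertex_cross m
    rw [h] at this
    simp only [Prod.fst_zero, Prod.snd_zero, zero_mul, sub_zero] at this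
    exact (by positivity : (0 : ℝ) < √3 / 6).ne this
  refine ⟨by simp [sideVec, sideEnd, sideStart, hp], ?_, by simpa [sideVec, sideEnd, sideStart], ?_⟩
  · simp only [sideVec, sideEnd, sideStart, hv, hp]
    ext <;> simp [turn] <;> ring
  · simpa [sideVec, sideEnd, sideStart, hv] using hne


/-! ### The phases -/

theorem tau_eq : tau = unityRoot Complex.I := by
  have h : (2 * Real.pi * Complex.I / 3 : ℂ) = ((Real.pi - Real.pi / 3 : ℝ) : ℂ) * Complex.I := by
    push_cast; ring
  rw [tau, h, Complex.exp_mul_I, ← Complex.ofReal_cos, ← Complex.ofReal_sin, Real.cos_pi_sub,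
    Real.sin_pi_sub, Real.cos_pi_div_three, Real.sin_pi_div_three, unityRoot]
  push_cast
  ring

theorem tau_pow_three : tau ^ 3 = 1 := by rw [tau_eq, unityRoot_pow_three Complex.I_sq]

theorem tau_ne_zero : tau ≠ 0 := Complex.exp_ne_zero _

theorem tau_zpow_three_mul (q : ℤ) : tau ^ (3 * q) = 1 := by
  rw [zpow_mul]
  norm_cast
  rw [tau_pow_three, one_zpow]

theorem innerPhase_pow_three (j : Fin 3) : innerPhase j ^ 3 = 1 := by
  rw [innerPhase, ← zpow_natCast, ← zpow_mul, mul_comm]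
  exact tau_zpow_three_mul _

theorem blochChar_kStar (σ : ℤ) (n : ℤ × ℤ) :
    blochChar ((σ : ℝ) • kStar) n = tau ^ (σ * (n.1 - n.2)) := by
  rw [tau, ← Complex.exp_int_mul, blochChar]
  congr 1
  simp [kStar]
  ring

/-- The special property of `k*`: the rotation adds 3n₂ to n₁-n₂, which a third root of unity does
not see. -/
theorem blochChar_kStar_turnIdx (σ : ℤ) (n : ℤ × ℤ) :
    blochChar ((σ : ℝ) • kStar) (turnIdx n) = blochChar ((σ : ℝ) • kStar) n := by
  rw [blochChar_kStar, blochChar_kStar]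
  have : σ * ((turnIdx n).1 - (turnIdx n).2) = σ * (n.1 - n.2) + 3 * (σ * n.2) := by
    simp only [turnIdx, AddEquiv.coe_mk, Equiv.coe_fn_mk]
    ring
  rw [this, zpow_add₀ tau_ne_zero, tau_zpow_three_mul, mul_one]

/-- The outer sides are identified by the translation `d` of `exists_lat_eq_vertex_sub`, for which
n₁-n₂ is -1 or 1 modulo 3 according to the parity of `m`. This is the origin of the parity in the
boundary condition. -/
theorem outerPhase_eq {m : ℤ} {d : ℤ × ℤ}
    (hd : ∃ q : ℤ, d.1 - d.2 = (if Even m then -1 else 1) + 3 * q) (σ : ℤ) (j : Fin 3) :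
    outerPhase m σ j = innerPhase j * blochChar ((σ : ℝ) • kStar) d := by
  obtain ⟨q, hq⟩ := hd
  have : σ * (d.1 - d.2) = (if Even m then -σ else σ) + 3 * (σ * q) := by
    rw [hq]; split_ifs <;> ring
  rw [blochChar_kStar, this, zpow_add₀ tau_ne_zero, tau_zpow_three_mul, mul_one, innerPhase,
    ← zpow_add₀ tau_ne_zero, outerPhase]

theorem blochChar_kStar_pow_three (σ : ℤ) (n : ℤ × ℤ) :
    blochChar ((σ : ℝ) • kStar) n ^ 3 = 1 := by
  rw [blochChar_kStar, ← zpow_natCast, ← zpow_mul, mul_comm]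
  exact tau_zpow_three_mul _

/-! ### Extension of a twisted function on the rhombus to a Bloch function -/

/-- The extension of a jet on the rhombus to a jet on the plane. -/
def extJet (k : ℝ × ℝ) (m : ℤ) (θ : ℂ) (J : Jet) : Jet :=
  (blochExt k m θ J.1, gradExt k m θ J.2.1, fun i l x =>
    ![(1 / 2 : ℂ), -Complex.I / 2] i * gradExt k m (θ * unityRoot Complex.I)
        (fun l x => J.2.2 0 l x + Complex.I * J.2.2 1 l x) l x +
      ![(1 / 2 : ℂ), Complex.I / 2] i * gradExt k m (θ * unityRoot (-Complex.I))
        (fun l x => J.2.2 0 l x + -Complex.I * J.2.2 1 l x) l x)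

theorem IsTrace.combine {m : ℤ} {D : Fin 2 → Plane → ℂ} {H : Fin 2 → Fin 2 → Plane → ℂ}
    {G : Fin 2 → Fin 4 → ℝ → ℂ} (hG : ∀ i, IsTrace m (D i) (H i) (G i))
    (hD : ∀ i, MemL2loc (rhombus m) (D i)) (hH : ∀ i j, MemL2loc (rhombus m) (H i j)) (ι : ℂ) :
    IsTrace m (fun x => D 0 x + ι * D 1 x) (fun l x => H 0 l x + ι * H 1 l x)
      (fun s t => G 0 s t + ι * G 1 s t) :=
  (hG 0).add ((hG 1).smul ι) (hD 0) (hH 0) ((hD 1).smul ι) fun l => (hH 1 l).smul ι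

/-- A pair of glued sides: the complex components of the gradient are glued as well. -/
theorem Glued.components {m : ℤ} {u : Plane → ℂ} {D : Fin 2 → Plane → ℂ}
    {H : Fin 2 → Fin 2 → Plane → ℂ} {g : Fin 4 → ℝ → ℂ} {G : Fin 2 → Fin 4 → ℝ → ℂ}
    (hu : MemL2loc (rhombus m) u) (hD : ∀ i, MemL2loc (rhombus m) (D i))
    (hH : ∀ i j, MemL2loc (rhombus m) (H i j))
    (hsym : ∀ᵐ x ∂(volume.restrict (rhombus m)), H 0 1 x = H 1 0 x)
    (hg : IsTrace m u D g) (hG : ∀ i, IsTrace m (D i) (H i) (G i)) {s s' : Fin 4} {θ ι : ℂ}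
    (hι : ι ^ 2 = -1) (hs : sideVec m s' = turn (sideVec m s)) (hs0 : sideVec m s ≠ 0)
    (hsign : sideSign s' = -sideSign s) (hsign0 : sideSign s ≠ 0) (h : Glued m θ s s' g G) :
    ∀ᵐ t ∂(volume.restrict (Ioo (0 : ℝ) 1)),
      G 0 s' t + ι * G 1 s' t = θ * unityRoot ι * (G 0 s t + ι * G 1 s t) := by
  filter_upwards [h, tangential_glued hu hD hH hsym hg hG (h.mono fun t ht => ht.1)] with t h1 h2
  refine components_of_normal_tangential hs0 hι (by rw [← hs]; exact h2) ?_
  have h3 := h1.2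
  simp only [normalDeriv, Fin.sum_univ_two, sideNormal_zero, sideNormal_one, hsign, hs] at h3
  have h0 : (sideSign s : ℂ) ≠ 0 := by exact_mod_cast hsign0
  apply mul_left_cancel₀ h0
  push_cast at h3
  linear_combination h3

/-- The scalar gluing theorem is applied three times: to the function with phase θ, and to the
components `∂₀ + ι ∂₁` of its gradient for ι = ±i with phase `θ * unityRoot ι`. The traces of the
latter match by `Glued.components`. -/
theorem extJet_mem {m σ : ℤ} {j : Fin 3} {J : Jet} (hJ : J ∈ twistedJets m σ j) :
    extJet ((σ : ℝ) • kStar) m (innerPhase j) J ∈ blochJets ((σ : ℝ) • kStar) := by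
  obtain ⟨⟨m0, m1, m2, hw⟩, g, G, hg, hG, h01, h32⟩ := hJ
  obtain ⟨d, hd, hq⟩ := exists_lat_eq_vertex_sub m
  have hk := blochChar_kStar_turnIdx σ
  rw [outerPhase_eq hq] at h32
  set k := (σ : ℝ) • kStar
  set θ := innerPhase j
  have hθ : θ ^ 3 = 1 := innerPhase_pow_three j
  have hI : Complex.I ^ 2 = -1 := Complex.I_sq
  have hI' : (-Complex.I) ^ 2 = -1 := by rw [neg_sq, Complex.I_sq]
  have l0 := MemLp.memL2loc m0
  have l1 := fun i => MemLp.memL2loc (m1 i)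
  have l2 := fun i l => MemLp.memL2loc (m2 i l)
  have hsym := (hw.hessian_symm (isOpen_rhombus m) ⟨l0, l1, l2⟩).mono fun x hx => hx 0 1
  obtain ⟨v1, v2, v3, v4⟩ := sideVec_pairs m
  have w1 : ∀ ι : ℂ, ι ^ 2 = -1 → ∀ l, IsWeakDeriv univ l
      (blochExt k m (θ * unityRoot ι) fun x => J.2.1 0 x + ι * J.2.1 1 x)
      (gradExt k m (θ * unityRoot ι) (fun l x => J.2.2 0 l x + ι * J.2.2 1 l x) l) := by
    intro ι hι l
    refine isWeakDeriv_blochExt hk hd (by rw [mul_pow, hθ, unityRoot_pow_three hι, one_mul])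
      ((m1 0).add ((m1 1).const_mul ι)) (fun l => (m2 0 l).add ((m2 1 l).const_mul ι))
      (IsTrace.combine hG l1 l2 ι)
      (h01.components l0 l1 l2 hsym hg hG hι v1 v3 (by simp [sideSign]) (by simp [sideSign])) ?_ l
    filter_upwards [h32.components l0 l1 l2 hsym hg hG hι v2 v4 (by simp [sideSign])
      (by simp [sideSign])] with t ht
    rw [ht]
    ring
  have b1 : ∀ ι : ℂ, MemL2loc univ
      (blochExt k m (θ * unityRoot ι) fun x => J.2.1 0 x + ι * J.2.1 1 x) := fun ι =>
    memL2loc_ext k _ ((m1 0).add ((m1 1).const_mul ι))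
  have b2 : ∀ (ι : ℂ) l, MemL2loc univ
      (gradExt k m (θ * unityRoot ι) (fun l x => J.2.2 0 l x + ι * J.2.2 1 l x) l) := fun ι l =>
    memL2loc_gradExt k _ (fun l => (m2 0 l).add ((m2 1 l).const_mul ι)) l
  refine ⟨memL2loc_ext k θ m0, memL2loc_gradExt k θ m1, fun i l => ?_, ⟨?_, fun i l => ?_⟩,
    isBloch_per _ _⟩
  · exact ((b2 Complex.I l).smul _).add ((b2 (-Complex.I) l).smul _)
  · exact isWeakDeriv_blochExt hk hd hθ m0 m1 hg (h01.mono fun t ht => ht.1)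
      (h32.mono fun t ht => ht.1)
  · exact ((w1 _ hI l).smul _).add ((w1 _ hI' l).smul _) ((b1 Complex.I).smul _)
      ((b2 Complex.I l).smul _) ((b1 (-Complex.I)).smul _) ((b2 (-Complex.I) l).smul _)

/-! ### Traces of functions with a rotational symmetry -/

theorem IsTrace.dbar {m : ℤ} {u : Plane → ℂ} {D : Fin 2 → Plane → ℂ} {g : Fin 4 → ℝ → ℂ}
    (hu : MemL2loc (rhombus m) u) (hD : ∀ i, MemL2loc (rhombus m) (D i))
    (hg : IsTrace m u D g) (ι : ℂ) {φ : Plane → ℝ} (h1 : ContDiff ℝ ∞ φ)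
    (h2 : HasCompactSupport φ) :
    ∫ x in rhombus m, (dbar ι φ x * u x + (φ x : ℂ) * (D 0 x + ι * D 1 x)) =
      ∑ s, cplx ι (sideNormal m s) * ∫ t in Ioo (0 : ℝ) 1, (φ (sidePoint m s t) : ℂ) * g s t := by
  have i0 : ∀ i, Integrable (fun x => (fderiv ℝ φ x (basisVec i) : ℂ) * u x + (φ x : ℂ) * D i x)
      (volume.restrict (rhombus m)) := fun i => (hu.integrable_mul
    (fderiv_apply_continuous h1 (basisVec i)) (fderiv_apply_compact h2 (basisVec i))).add
      ((hD i).integrable_mul h1.continuous h2)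
  have e : ∀ x, Honeycomb.dbar ι φ x * u x + (φ x : ℂ) * (D 0 x + ι * D 1 x) =
      ((fderiv ℝ φ x (basisVec 0) : ℂ) * u x + (φ x : ℂ) * D 0 x) +
      ι * ((fderiv ℝ φ x (basisVec 1) : ℂ) * u x + (φ x : ℂ) * D 1 x) := fun x => by
    rw [Honeycomb.dbar]; ring
  simp only [e]
  rw [integral_add (i0 0) ((i0 1).const_mul ι), integral_const_mul]
  have e0 := hg.2 φ h1 h2 0
  have e1 := hg.2 φ h1 h2 1
  rw [e0, e1, Finset.mul_sum, ← Finset.sum_add_distrib]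
  refine Finset.sum_congr rfl fun s _ => ?_
  rw [cplx]
  ring

/-- The complex components of the gradient of a function which is multiplied by `θ` under
`turn`. -/
theorem weakDeriv_turn {u : Plane → ℂ} {D : Fin 2 → Plane → ℂ} (hu : MemL2loc univ u)
    (hD : ∀ i, MemL2loc univ (D i)) (h : ∀ i, IsWeakDeriv univ i u (D i)) {θ : ℂ}
    (ht : ∀ᵐ x : Plane, u (turn x) = θ * u x) {ι : ℂ} (hι : ι ^ 2 = -1) :
    ∀ᵐ x : Plane, D 0 (turn x) + ι * D 1 (turn x) =
      θ * unityRoot ι * (D 0 x + ι * D 1 x) := by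
  have hd : turnMatrix.det ≠ 0 := by rw [det_turnMatrix]; norm_num
  -- The function `u ∘ turn` has one weak gradient by the chain rule and another as a multiple of
  -- `u`; uniqueness identifies them.
  have key : ∀ i, ∀ᵐ x : Plane, ∑ l, (turnMatrix l i : ℂ) * D l (turn x) = θ * D i x := by
    intro i
    have e1 := IsWeakDeriv.comp_aff hd 0 h hu hD i
    rw [preimage_univ, ← turn_eq_aff] at e1
    have m1 : MemL2loc univ (u ∘ turn) := by
      have := hu.comp_aff hd 0
      rwa [preimage_univ, ← turn_eq_aff] at this
    have m2 : ∀ l, MemL2loc univ (D l ∘ turn) := fun l => by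
      have := (hD l).comp_aff hd 0
      rwa [preimage_univ, ← turn_eq_aff] at this
    have := e1.ae_unique isOpen_univ ((h i).smul θ) m1
      (MemL2loc.lincomb (fun l => (turnMatrix l i : ℂ)) m2) (hu.smul θ) ((hD i).smul θ)
      (by rw [Measure.restrict_univ]; exact ht)
    rw [Measure.restrict_univ] at this
    exact this
  filter_upwards [key 0, key 1] with x h0 h1
  simp only [turnMatrix, Fin.sum_univ_two, Matrix.of_apply, Matrix.cons_val', Matrix.cons_val_zero,
    Matrix.cons_val_one, Matrix.cons_val_fin_one] at h0 h1
  push_cast at h0 h1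
  have h3 := sqrt3_sq_complex
  rw [unityRoot]
  linear_combination (-(1 / 2 : ℂ) + √3 / 2 * ι) * h0 + (-(√3 / 2 : ℂ) - ι / 2) * h1 +
    (-(√3 : ℂ) / 2 * θ * D 1 x) * hι + (-(D 0 (turn x)) / 4 - ι * D 1 (turn x) / 4) * h3

theorem ae_turn {P : Plane → Prop} (h : ∀ᵐ x : Plane, P x) : ∀ᵐ x : Plane, P (turn x) :=
  measurePreserving_turn.quasiMeasurePreserving.ae h

theorem ae_rotMap {P : Plane → Prop} (h : ∀ᵐ x : Plane, P x) : ∀ᵐ x : Plane, P (rotMap x) :=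
  measurePreserving_rotMap.quasiMeasurePreserving.ae h

/-- The margin determines how thin a test function concentrated at a side has to be in order to miss
the other sides. -/
theorem exists_margin {η : ℝ → ℝ} (hc : HasCompactSupport η) (hs : tsupport η ⊆ Ioo 0 1) :
    ∃ ε : ℝ, 0 < ε ∧ ε ≤ 1 / 2 ∧ ∀ y, y < ε ∨ 1 - ε < y → η y = 0 := by
  obtain ⟨δ, hδ, hsub⟩ := IsCompact.exists_cthickening_subset_open hc isOpen_Ioo hs
  refine ⟨min δ (1 / 2), by positivity, min_le_right _ _, fun y hy => ?_⟩
  by_contra h0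
  have hy' : y ∈ tsupport η := subset_tsupport _ h0
  have hb := (Metric.closedBall_subset_cthickening hy' δ).trans hsub
  have b1 := hb (show y - δ ∈ _ by simp [abs_of_pos hδ])
  have b2 := hb (show y + δ ∈ _ by simp [abs_of_pos hδ])
  have := min_le_left δ (1 / 2)
  rcases hy with hy | hy
  · linarith [b1.1]
  · linarith [b2.2]

/-- The integral of a function supported near the common side of the rhombus and its image. -/
theorem integral_eq_two_rhombi {m : ℤ} {F : Plane → ℂ} (hF : Integrable F)
    (h : ∀ᵐ x : Plane, F x ≠ 0 → x ∈ rhombus m ∨ turn x ∈ rhombus m) :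
    ∫ x, F x = (∫ x in rhombus m, F x) + ∫ x in rhombus m, F (rotMap x) := by
  have hm := measurableSet_rhombus m
  have hF' : Integrable (fun x => F (rotMap x)) :=
    measurePreserving_rotMap.integrable_comp_of_integrable hF
  have e : F =ᵐ[volume] fun x => (rhombus m).indicator F x +
      (rhombus m).indicator (fun y => F (rotMap y)) (turn x) := by
    filter_upwards [h] with x hx
    by_cases h0 : x ∈ rhombus m
    · rw [indicator_of_mem h0, indicator_of_notMem (turn_notMem_rhombus h0), add_zero]
    · rw [indicator_of_notMem h0, zero_add]
      by_cases h1 : turn x ∈ rhombus m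
      · rw [indicator_of_mem h1, rotMap_turn]
      · rw [indicator_of_notMem h1]
        by_contra h2
        rcases hx h2 with h3 | h3
        · exact h0 h3
        · exact h1 h3
  have i1 : Integrable ((rhombus m).indicator F) := hF.indicator hm
  have i2 : Integrable ((rhombus m).indicator (fun y => F (rotMap y))) := hF'.indicator hm
  have i3 : Integrable (fun x => (rhombus m).indicator (fun y => F (rotMap y)) (turn x)) :=
    measurePreserving_turn.integrable_comp_of_integrable i2
  rw [integral_congr_ae e, integral_add i1 i3, integral_turn, integral_indicator hm,
    integral_indicator hm]

/-- The integral of `(∂₀ + i ∂₁)(φ u)` over the plane vanishes for `φ` concentrated at side 0. Its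
support meets only two rotated rhombi; the second is rotated back, and Green's formula on the
rhombus then yields one boundary term on side 0 and one on side 1, which must cancel. -/
theorem trace_inner {m : ℤ} {u : Plane → ℂ} {D : Fin 2 → Plane → ℂ} {g : Fin 4 → ℝ → ℂ}
    (hu : MemL2loc univ u) (hD : ∀ i, MemL2loc univ (D i)) (h : ∀ i, IsWeakDeriv univ i u (D i))
    {θ : ℂ} (hθ : θ ^ 3 = 1) (ht : ∀ᵐ x : Plane, u (turn x) = θ * u x) (hg : IsTrace m u D g) :
    ∀ᵐ t ∂(volume.restrict (Ioo (0 : ℝ) 1)), g 1 t = θ * g 0 t := by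
  refine ae_eq_of_forall_test (hg.1 1) ((hg.1 0).const_mul θ) fun η n1 n2 n3 => ?_
  obtain ⟨ε, ε0, ε1, hε⟩ := exists_margin n2 n3
  -- The width ε/2 against the margin ε keeps the support inside the two rhombi adjacent to side 0
  -- and the rotated test function off all sides but side 1.
  obtain ⟨β, b1, b2, b3, b4⟩ := exists_bump (ε / 2) (by positivity)
  have hI : Complex.I ^ 2 = -1 := Complex.I_sq
  have c1 := contDiff_prodTest m n1 b1
  have c2 := hasCompactSupport_prodTest m n2 b2
  set φ := prodTest m η β with hφ
  -- This is `φ ∘ rotMap`, in the form to which `dbar_comp_iterate` applies.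
  let ψ : Plane → ℝ := fun y => φ (turn^[2] y + 0)
  have ψ1 : ContDiff ℝ ∞ ψ := c1.comp (contDiff_iterate_turn 2 0)
  have ψ2 : HasCompactSupport ψ := hasCompactSupport_comp_iterate c2 2 0
  have hturn2 : ∀ y, turn^[2] y + 0 = rotMap y := fun y => by rw [add_zero]; exact turn_turn y
  have hψ : ∀ y, ψ y = η (coordB m y - coordA m y) * β (-coordA m y) := fun y => by
    simp only [ψ, hφ, prodTest]
    rw [hturn2, coordA_rotMap, coordB_rotMap]
  set ρ := unityRoot Complex.I with hρ
  have hρ3 : ρ ^ 3 = 1 := unityRoot_pow_three hI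
  set p : Plane → ℂ := fun x => D 0 x + Complex.I * D 1 x with hp
  have ml : MemL2loc univ p := (hD 0).add ((hD 1).smul Complex.I)
  let F : Plane → ℂ := fun x => dbar Complex.I φ x * u x + (φ x : ℂ) * p x
  have iu : ∀ i, Integrable fun x => (fderiv ℝ φ x (basisVec i) : ℂ) * u x := fun i => by
    have := hu.integrable_mul (fderiv_apply_continuous c1 (basisVec i))
      (fderiv_apply_compact c2 (basisVec i))
    rwa [Measure.restrict_univ] at this
  have iD : ∀ i, Integrable fun x => (φ x : ℂ) * D i x := fun i => by
    have := (hD i).integrable_mul c1.continuous c2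
    rwa [Measure.restrict_univ] at this
  have eF : F = fun x => ((fderiv ℝ φ x (basisVec 0) : ℂ) * u x + (φ x : ℂ) * D 0 x) +
      Complex.I * ((fderiv ℝ φ x (basisVec 1) : ℂ) * u x + (φ x : ℂ) * D 1 x) := by
    funext x
    simp only [F, dbar, hp]
    ring
  have i0 : ∀ i, Integrable fun x => (fderiv ℝ φ x (basisVec i) : ℂ) * u x + (φ x : ℂ) * D i x :=
    fun i => (iu i).add (iD i)
  have iF : Integrable F := by
    rw [eF]
    exact (i0 0).add ((i0 1).const_mul _)
  have zF : ∫ x, F x = 0 := by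
    have w : ∀ i, ∫ x, ((fderiv ℝ φ x (basisVec i) : ℂ) * u x + (φ x : ℂ) * D i x) = 0 := by
      intro i
      have := h i φ c1 c2 (subset_univ _)
      rw [setIntegral_univ, setIntegral_univ] at this
      rw [integral_add (iu i) (iD i), this, neg_add_cancel]
    rw [eF, integral_add (i0 0) ((i0 1).const_mul _), integral_const_mul, w 0, w 1]
    simp
  have hsupp : tsupport φ ⊆ {x | (ε ≤ coordA m x ∧ coordA m x ≤ 1 - ε) ∧
      |coordB m x| ≤ ε / 2} := by
    have ca : Continuous (coordA m) := (contDiff_coordA m (n := 0)).continuous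
    have cb : Continuous (coordB m) := (contDiff_coordB m (n := 0)).continuous
    refine closure_minimal (fun x hx => ?_) (((isClosed_le continuous_const ca).and
      (isClosed_le ca continuous_const)).and (isClosed_le cb.abs continuous_const))
    refine ⟨⟨?_, ?_⟩, ?_⟩ <;> by_contra hh <;> push Not at hh <;> apply hx
    · simp [hφ, prodTest, hε _ (Or.inl hh)]
    · simp [hφ, prodTest, hε _ (Or.inr hh)]
    · simp [hφ, prodTest, b4 _ hh.le]
  have split := integral_eq_two_rhombi (m := m) iF (by
    filter_upwards [ae_coord_ne m] with x hx hFx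
    have hmem : x ∈ tsupport φ := by
      by_contra hh
      apply hFx
      simp only [F, dbar]
      rw [fderiv_eq_zero_of_notMem_tsupport hh, image_eq_zero_of_notMem_tsupport hh]
      simp
    obtain ⟨⟨k1, k2⟩, k3⟩ := hsupp hmem
    obtain ⟨k4, k5⟩ := abs_le.1 k3
    rcases lt_or_gt_of_ne hx.2.1 with hb | hb
    · right
      rw [mem_rhombus_iff, coordA_turn, coordB_turn]
      exact ⟨⟨by linarith, by linarith⟩, by linarith, by linarith⟩
    · left
      rw [mem_rhombus_iff]
      exact ⟨⟨by linarith, by linarith⟩, by linarith, by linarith⟩)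
  have g1 := IsTrace.dbar (hu.mono (subset_univ _)) (fun i => (hD i).mono (subset_univ _)) hg
    Complex.I c1 c2
  have g2 := IsTrace.dbar (hu.mono (subset_univ _)) (fun i => (hD i).mono (subset_univ _)) hg
    Complex.I ψ1 ψ2
  -- Under `rotMap`, the square of `turn`, the function acquires θ², its complex derivative (θρ)²,
  -- and the derivative of the test function ρ². All terms therefore carry the same factor.
  have second : ∫ x in rhombus m, F (rotMap x) = (θ * ρ) ^ 2 *
      ∫ x in rhombus m, (dbar Complex.I ψ x * u x + (ψ x : ℂ) * p x) := by
    rw [← integral_const_mul]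
    refine integral_congr_ae (ae_restrict_of_ae ?_)
    have hpt := weakDeriv_turn hu hD h ht hI
    filter_upwards [ht, ae_turn ht, hpt, ae_turn hpt] with x h1 h2 h3 h4
    have e1 : u (rotMap x) = θ ^ 2 * u x := by rw [← turn_turn, h2, h1]; ring
    have e2 : p (rotMap x) = (θ * ρ) ^ 2 * p x := by
      simp only [hp]
      rw [← turn_turn, h4, h3]
      ring
    have e3 : dbar Complex.I φ (rotMap x) = ρ ^ 2 * dbar Complex.I ψ x := by
      rw [← hturn2]
      exact dbar_comp_iterate hI c1 0 2 x
    have e4 : φ (rotMap x) = ψ x := by simp only [ψ, hturn2]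
    simp only [F]
    rw [e1, e2, e3, e4]
    ring
  have s0 : ∀ s, ∫ t in Ioo (0 : ℝ) 1, (φ (sidePoint m s t) : ℂ) * g s t =
      if s = 0 then ∫ t in Ioo (0 : ℝ) 1, (η t : ℂ) * g 0 t else 0 := by
    intro s
    have z0 : η 0 = 0 := hε 0 (Or.inl ε0)
    have z1 : η 1 = 0 := hε 1 (Or.inr (by linarith))
    have z2 : β 1 = 0 := b4 1 (by rw [abs_one]; linarith)
    fin_cases s <;> simp only [hφ, prodTest]
    · simp only [(sidePoint_eq m _).1, coordA_comb, coordB_comb, b3, mul_one, Fin.zero_eta, if_true]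
    · simp [(sidePoint_eq m _).2.1, coordA_comb, coordB_comb, z0, -zero_smul]
    · simp [(sidePoint_eq m _).2.2.1, coordA_comb, coordB_comb, z1, -one_smul]
    · simp [(sidePoint_eq m _).2.2.2, coordA_comb, coordB_comb, z2, -one_smul]
  have s1 : ∀ s, ∫ t in Ioo (0 : ℝ) 1, (ψ (sidePoint m s t) : ℂ) * g s t =
      if s = 1 then ∫ t in Ioo (0 : ℝ) 1, (η t : ℂ) * g 1 t else 0 := by
    intro s
    have z2 : β (-1) = 0 := b4 (-1) (by rw [abs_neg, abs_one]; linarith)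
    fin_cases s <;> simp only [hψ]
    · rw [if_neg (by decide)]
      refine setIntegral_eq_zero_of_forall_eq_zero fun t ht => ?_
      simp only [Fin.zero_eta, (sidePoint_eq m _).1, coordA_comb, coordB_comb]
      rw [hε _ (Or.inl (by linarith [ht.1])), zero_mul, Complex.ofReal_zero, zero_mul]
    · simp only [Fin.mk_one, (sidePoint_eq m _).2.1, coordA_comb, coordB_comb, sub_zero, neg_zero,
        b3, mul_one, if_true]
    · simp [(sidePoint_eq m _).2.2.1, coordA_comb, coordB_comb, z2, -one_smul]
    · rw [if_neg (by decide)]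
      refine setIntegral_eq_zero_of_forall_eq_zero fun t ht => ?_
      simp only [Fin.reduceFinMk, (sidePoint_eq m _).2.2.2, coordA_comb, coordB_comb]
      by_cases hh : 1 - ε < t
      · rw [hε _ (Or.inr (by linarith)), zero_mul, Complex.ofReal_zero, zero_mul]
      · rw [b4 _ (by rw [abs_neg, abs_of_pos (by linarith)]; linarith), mul_zero,
          Complex.ofReal_zero, zero_mul]
  rw [zF, second, g2] at split
  rw [show (∫ x in rhombus m, F x) = _ from g1] at split
  simp only [s0, s1, mul_ite, mul_zero, Finset.sum_ite_eq', Finset.mem_univ, if_true] at split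
  rw [(cplx_sideNormal m hI).1, ← hρ] at split
  -- One complex equation replaces the two real ones, so that the normal can be cancelled as a
  -- nonzero number; either partial derivative alone could have a vanishing normal component.
  have hn : cplx Complex.I (sideNormal m 0) ≠ 0 := by
    intro h0
    have hre := congrArg Complex.re h0
    have him := congrArg Complex.im h0
    simp only [cplx, sideNormal_zero, sideNormal_one] at hre him
    simp [sideSign] at hre him
    exact (sideVec_pairs m).2.2.1 (Prod.ext him hre)
  have fin : θ * ∫ t in Ioo (0 : ℝ) 1, (η t : ℂ) * g 0 t = ∫ t in Ioo (0 : ℝ) 1, (η t : ℂ) * g 1 t := by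
    apply mul_left_cancel₀ hn
    set A := ∫ t in Ioo (0 : ℝ) 1, (η t : ℂ) * g 0 t
    set B := ∫ t in Ioo (0 : ℝ) 1, (η t : ℂ) * g 1 t
    set c := cplx Complex.I (sideNormal m 0)
    -- The cancellation reads c A = (θρ)² ρ c B; with ρ³ = θ³ = 1, multiplication by θ gives the
    -- matching condition.
    linear_combination -θ * split + c * B * θ ^ 3 * hρ3 + c * B * hθ
  rw [← fin, ← integral_const_mul]
  congr 1
  funext t
  ring

/-! ### The outer sides, by the point reflection of the rhombus -/

theorem pointMatrix_det : (-1 : Matrix (Fin 2) (Fin 2) ℝ).det ≠ 0 := by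
  rw [Matrix.det_neg]; simp

theorem aff_neg_one (v x : Plane) : aff (-1) v x = v - x := by
  ext <;> simp [aff, Matrix.neg_apply] <;> ring

/-- Exchange of the inner and the outer sides. -/
def swapSide : Fin 4 → Fin 4 := ![3, 2, 1, 0]

/-- The reflection about the centre of the rhombus preserves it and exchanges side 0 with 3 and 1
with 2, respecting the parametrizations. The sign of the gradient is compensated by the reversal of
the normals. -/
theorem IsTrace.comp_point {m : ℤ} {u : Plane → ℂ} {D : Fin 2 → Plane → ℂ} {g : Fin 4 → ℝ → ℂ}
    (hg : IsTrace m u D g) :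
    IsTrace m (fun x => u (vertex m - x)) (fun i x => -D i (vertex m - x))
      (fun s => g (swapSide s)) := by
  refine ⟨fun s => hg.1 _, fun φ h1 h2 i => ?_⟩
  have hd := pointMatrix_det
  have e1 : ContDiff ℝ ∞ (φ ∘ aff (-1) (vertex m)) := h1.comp (contDiff_aff _ _)
  have e2 : HasCompactSupport (φ ∘ aff (-1) (vertex m)) := h2.comp_homeomorph (affHomeo hd _)
  have key := hg.2 _ e1 e2 i
  have hpre : aff (-1) (vertex m) ⁻¹' rhombus m = rhombus m := by
    ext x
    rw [mem_preimage, aff_neg_one, vertex_self m]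
    nth_rw 1 [← comb_coord m x]
    rw [show vertex (m - 1) + vertex (m + 1) - (coordA m x • vertex (m - 1) +
      coordB m x • vertex (m + 1)) = (1 - coordA m x) • vertex (m - 1) +
      (1 - coordB m x) • vertex (m + 1) by module, mem_rhombus_iff, mem_rhombus_iff, coordA_comb,
      coordB_comb]
    simp only [mem_Ioo]
    constructor <;> rintro ⟨⟨a, b⟩, c, d⟩ <;> exact ⟨⟨by linarith, by linarith⟩, by linarith, by linarith⟩
  have hinv : ∀ x, aff (-1) (vertex m) (aff (-1) (vertex m) x) = x := fun x => by
    rw [aff_neg_one, aff_neg_one, sub_sub_cancel]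
  have hpull := setIntegral_aff hd (vertex m) (rhombus m) (fun x =>
    (fderiv ℝ (φ ∘ aff (-1) (vertex m)) x (basisVec i) : ℂ) * u x +
      ((φ ∘ aff (-1) (vertex m)) x : ℂ) * D i x)
  rw [hpre, key] at hpull
  have hdet : |(-1 : Matrix (Fin 2) (Fin 2) ℝ).det⁻¹| = 1 := by rw [Matrix.det_neg]; simp
  rw [hdet, one_smul] at hpull
  have hfd : ∀ x, fderiv ℝ (φ ∘ aff (-1) (vertex m)) (aff (-1) (vertex m) x) (basisVec i) =
      -fderiv ℝ φ x (basisVec i) := by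
    intro x
    rw [fderiv_comp_aff _ _ (h1.differentiable (by simp)), hinv]
    fin_cases i <;> simp [Matrix.neg_apply]
  have lhs : ∫ x in rhombus m, ((fderiv ℝ φ x (basisVec i) : ℂ) * u (vertex m - x) +
      (φ x : ℂ) * -D i (vertex m - x)) = -∫ x in rhombus m,
      ((fderiv ℝ (φ ∘ aff (-1) (vertex m)) (aff (-1) (vertex m) x) (basisVec i) : ℂ) *
        u (aff (-1) (vertex m) x) + ((φ ∘ aff (-1) (vertex m)) (aff (-1) (vertex m) x) : ℂ) *
        D i (aff (-1) (vertex m) x)) := by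
    rw [← integral_neg]
    congr 1
    funext x
    rw [hfd, Function.comp_apply, hinv, aff_neg_one]
    push_cast
    ring
  rw [lhs, hpull]
  obtain ⟨n0, n1, n2, n3⟩ := sideNormal_eq m i
  have hsp : ∀ s t, (φ ∘ aff (-1) (vertex m)) (sidePoint m s t) = φ (sidePoint m (swapSide s) t) := by
    intro s t
    rw [Function.comp_apply, aff_neg_one]
    obtain ⟨p0, p1, p2, p3⟩ := sidePoint_eq m t
    congr 1
    fin_cases s <;> simp only [swapSide, Fin.zero_eta, Fin.mk_one, Fin.reduceFinMk,
      Matrix.cons_val, p0, p1, p2, p3] <;> rw [vertex_self m] <;> module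
  simp only [hsp]
  rw [Fin.sum_univ_four, Fin.sum_univ_four, n0, n1, n2, n3]
  simp only [swapSide, Matrix.cons_val]
  push_cast
  ring

/-- A translate of `u` is a multiple of `u`, so uniqueness makes the translate of its derivative the
same multiple of the derivative. -/
theorem weakDeriv_bloch {k : ℝ × ℝ} {u : Plane → ℂ} {D : Fin 2 → Plane → ℂ}
    (hu : MemL2loc univ u) (hD : ∀ i, MemL2loc univ (D i)) (h : ∀ i, IsWeakDeriv univ i u (D i))
    (hb : IsBloch k u) (i : Fin 2) : IsBloch k (D i) := by
  rw [isBloch_iff] at hb ⊢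
  intro n
  have hd : (1 : Matrix (Fin 2) (Fin 2) ℝ).det ≠ 0 := by simp
  have e1 := IsWeakDeriv.comp_aff hd (lat n) h hu hD i
  have m1 := hu.comp_aff hd (lat n)
  have m2 := fun l => (hD l).comp_aff hd (lat n)
  rw [preimage_univ] at e1 m1
  simp only [preimage_univ] at m2
  have := e1.ae_unique isOpen_univ ((h i).smul (blochChar k n)) m1
    (MemL2loc.lincomb (fun l => ((1 : Matrix (Fin 2) (Fin 2) ℝ) l i : ℂ)) m2) (hu.smul _)
    ((hD i).smul _) (by
      rw [Measure.restrict_univ]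
      filter_upwards [hb n] with x hx
      rw [Function.comp_apply, aff_one, hx]
      rfl)
  rw [Measure.restrict_univ] at this
  filter_upwards [this] with x hx
  simp only [Matrix.one_apply, aff_one] at hx
  fin_cases i <;> simpa using hx

/-- The point reflection reduces this to `trace_inner`. The rotation about `vertex m` is `turn`
followed by the translation `lat d`, so the reflected function has the phase `θ * blochChar k d`,
again a cube root of unity by hypothesis. -/
theorem trace_outer {k : ℝ × ℝ} {m : ℤ} {d : ℤ × ℤ} (hd : vertex m - turn (vertex m) = lat d)
    {u : Plane → ℂ} {D : Fin 2 → Plane → ℂ} {g : Fin 4 → ℝ → ℂ}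
    (hu : MemL2loc univ u) (hD : ∀ i, MemL2loc univ (D i)) (h : ∀ i, IsWeakDeriv univ i u (D i))
    {θ : ℂ} (hθ : (θ * blochChar k d) ^ 3 = 1) (hb : IsBloch k u)
    (ht : ∀ᵐ x : Plane, u (turn x) = θ * u x) (hg : IsTrace m u D g) :
    ∀ᵐ t ∂(volume.restrict (Ioo (0 : ℝ) 1)), g 2 t = θ * blochChar k d * g 3 t := by
  have hM := pointMatrix_det
  have e1 := IsWeakDeriv.comp_aff hM (vertex m) h hu hD
  have m1 := hu.comp_aff hM (vertex m)
  have m2 := fun l => ((hD l).comp_aff hM (vertex m)).smul (-1)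
  rw [preimage_univ] at e1 m1
  simp only [preimage_univ] at m2
  have f1 : u ∘ aff (-1) (vertex m) = fun x => u (vertex m - x) := by
    funext x; simp [aff_neg_one]
  have f2 : ∀ i, (-1 : ℂ) • (D i ∘ aff (-1) (vertex m)) = fun x => -D i (vertex m - x) := fun i => by
    funext x; simp [aff_neg_one]
  have f3 : ∀ i, (fun x => ∑ l, (((-1 : Matrix (Fin 2) (Fin 2) ℝ) l i : ℝ) : ℂ) *
      D l (aff (-1) (vertex m) x)) = fun x => -D i (vertex m - x) := fun i => by
    funext x
    fin_cases i <;> simp [aff_neg_one, Matrix.neg_apply]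
  simp only [f1, f3] at e1
  rw [f1] at m1
  simp only [f2] at m2
  refine trace_inner m1 m2 e1 hθ ?_ hg.comp_point
  rw [isBloch_iff] at hb
  have a1 := ae_aff hM (vertex m) ht
  have a2 := ae_aff hM (vertex m) (ae_turn (hb d))
  filter_upwards [a1, a2] with x h1 h2
  rw [aff_neg_one] at h1 h2
  rw [h1, turn_sub, ← hd, show turn (vertex m) - turn x + (vertex m - turn (vertex m)) =
    vertex m - turn x by abel] at h2
  rw [h2]
  ring

/-- `trace_inner` and `trace_outer` apply to the function and, since the derivatives inherit the
Bloch condition and have a phase as well, to both complex components of its gradient. The normal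
condition is then read off by `normal_of_components`. -/
theorem mem_twistedJets {m σ : ℤ} {j : Fin 3} {J : Jet} (hJ : J ∈ blochJets ((σ : ℝ) • kStar))
    (ht : ∀ᵐ x : Plane, J.1 (turn x) = innerPhase j * J.1 x) : J ∈ twistedJets m σ j := by
  obtain ⟨l0, l1, l2, ⟨w1, w2⟩, hb⟩ := hJ
  obtain ⟨d, hd, hq⟩ := exists_lat_eq_vertex_sub m
  have hbd := isBounded_rhombus m
  have m0 := l0.memLp (subset_univ (rhombus m)) hbd
  have m1 := fun i => (l1 i).memLp (subset_univ (rhombus m)) hbd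
  have m2 := fun i l => (l2 i l).memLp (subset_univ (rhombus m)) hbd
  have v1 := fun i => (w1 i).mono (subset_univ (rhombus m))
  have v2 := fun i l => (w2 i l).mono (subset_univ (rhombus m))
  obtain ⟨g, hg⟩ := exists_isTrace m m0 m1 v1
  choose G hG using fun i => exists_isTrace m (m1 i) (m2 i) (v2 i)
  have hP := blochChar_kStar_pow_three σ d
  have hθ := innerPhase_pow_three j
  have comb : ∀ ι : ℂ, (∀ l, IsWeakDeriv univ l (fun x => J.2.1 0 x + ι * J.2.1 1 x)
      (fun x => J.2.2 0 l x + ι * J.2.2 1 l x)) ∧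
      MemL2loc univ (fun x => J.2.1 0 x + ι * J.2.1 1 x) ∧
      (∀ l, MemL2loc univ (fun x => J.2.2 0 l x + ι * J.2.2 1 l x)) ∧
      IsTrace m (fun x => J.2.1 0 x + ι * J.2.1 1 x) (fun l x => J.2.2 0 l x + ι * J.2.2 1 l x)
        (fun s t => G 0 s t + ι * G 1 s t) := fun ι =>
    ⟨fun l => (w2 0 l).add ((w2 1 l).smul ι) (l1 0) (l2 0 l) ((l1 1).smul ι) ((l2 1 l).smul ι),
      (l1 0).add ((l1 1).smul ι), fun l => (l2 0 l).add ((l2 1 l).smul ι),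
      IsTrace.combine hG (fun i => (l1 i).mono (subset_univ _))
        (fun i l => (l2 i l).mono (subset_univ _)) ι⟩
  have bl : ∀ ι : ℂ, IsBloch ((σ : ℝ) • kStar) (fun x => J.2.1 0 x + ι * J.2.1 1 x) := fun ι => by
    intro n₁ n₂
    filter_upwards [weakDeriv_bloch l0 l1 w1 hb 0 n₁ n₂, weakDeriv_bloch l0 l1 w1 hb 1 n₁ n₂] with
      x h1 h2
    rw [h1, h2]
    ring
  have cube : ∀ ι : ℂ, ι ^ 2 = -1 → (innerPhase j * unityRoot ι) ^ 3 = 1 := fun ι hι => by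
    rw [mul_pow, hθ, unityRoot_pow_three hι, one_mul]
  have inner : ∀ ι : ℂ, ι ^ 2 = -1 → ∀ᵐ t ∂(volume.restrict (Ioo (0 : ℝ) 1)),
      G 0 1 t + ι * G 1 1 t = innerPhase j * unityRoot ι * (G 0 0 t + ι * G 1 0 t) :=
    fun ι hι => trace_inner (comb ι).2.1 (comb ι).2.2.1 (comb ι).1 (cube ι hι)
      (weakDeriv_turn l0 l1 w1 ht hι) (comb ι).2.2.2
  have outer : ∀ ι : ℂ, ι ^ 2 = -1 → ∀ᵐ t ∂(volume.restrict (Ioo (0 : ℝ) 1)),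
      G 0 2 t + ι * G 1 2 t = innerPhase j * unityRoot ι * blochChar ((σ : ℝ) • kStar) d *
        (G 0 3 t + ι * G 1 3 t) :=
    fun ι hι => trace_outer hd (comb ι).2.1 (comb ι).2.2.1 (comb ι).1
      (by rw [mul_pow, cube ι hι, hP, one_mul]) (bl ι)
      (weakDeriv_turn l0 l1 w1 ht hι) (comb ι).2.2.2
  have hI : Complex.I ^ 2 = -1 := Complex.I_sq
  have hI' : (-Complex.I) ^ 2 = -1 := by rw [neg_sq, Complex.I_sq]
  have two : ∀ ι : ℂ, ι ^ 2 = -1 → ι = Complex.I ∨ ι = -Complex.I := fun ι hι =>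
    sq_eq_sq_iff_eq_or_eq_neg.1 (hι.trans hI.symm)
  obtain ⟨s1, s2, -, -⟩ := sideVec_pairs m
  refine ⟨⟨m0, m1, m2, v1, v2⟩, g, G, hg, hG, ?_, ?_⟩
  · filter_upwards [trace_inner l0 l1 w1 hθ ht hg, inner _ hI, inner _ hI'] with t h1 h2 h3
    refine ⟨h1, ?_⟩
    have := normal_of_components (T := sideVec m 0) (θ := innerPhase j) (G₀ := G 0 0 t)
      (G₁ := G 1 0 t) (G₀' := G 0 1 t) (G₁' := G 1 1 t) (fun ι hι => by
        rcases two ι hι with rfl | rfl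
        · exact h2
        · exact h3)
    rw [← s1] at this
    simp only [normalDeriv, Fin.sum_univ_two, sideNormal_zero, sideNormal_one, sideSign,
      Matrix.cons_val]
    push_cast
    linear_combination this
  · rw [outerPhase_eq hq]
    filter_upwards [trace_outer hd l0 l1 w1 (by rw [mul_pow, hθ, hP, one_mul]) hb ht hg,
      outer _ hI, outer _ hI'] with t h1 h2 h3
    refine ⟨h1, ?_⟩
    have := normal_of_components (T := sideVec m 3)
      (θ := innerPhase j * blochChar ((σ : ℝ) • kStar) d) (G₀ := G 0 3 t)
      (G₁ := G 1 3 t) (G₀' := G 0 2 t) (G₁' := G 1 2 t) (fun ι hι => by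
        rcases two ι hι with rfl | rfl
        · rw [h2]; ring
        · rw [h3]; ring)
    rw [← s2] at this
    simp only [normalDeriv, Fin.sum_univ_two, sideNormal_zero, sideNormal_one, sideSign,
      Matrix.cons_val]
    push_cast
    linear_combination this

/-! ### Invariance of the differential expression on jets -/

theorem classicalJet_comp_aff (M : Matrix (Fin 2) (Fin 2) ℝ) (v : Plane) {ψ : Plane → ℂ}
    (h : ContDiff ℝ ∞ ψ) : classicalJet (ψ ∘ aff M v) = pullJet M v (classicalJet ψ) := by
  have hd : Differentiable ℝ ψ := h.differentiable (by simp)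
  have hd2 : ∀ l, Differentiable ℝ fun y => fderiv ℝ ψ y (basisVec l) := fun l =>
    ((h.fderiv_right (m := ∞) (by simp)).clm_apply contDiff_const).differentiable (by simp)
  have e1 : ∀ i, (fun x => fderiv ℝ (ψ ∘ aff M v) x (basisVec i)) =
      fun x => ∑ l, (M l i : ℂ) * fderiv ℝ ψ (aff M v x) (basisVec l) := fun i => by
    funext x
    rw [fderiv_comp_aff M v hd]
    simp
  refine Prod.ext rfl (Prod.ext ?_ ?_)
  · exact funext e1
  · funext i j x
    simp only [classicalJet, pullJet, e1]
    have e2 : ∀ l, DifferentiableAt ℝ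
        (fun x => (M l i : ℂ) * fderiv ℝ ψ (aff M v x) (basisVec l)) x := fun l =>
      (((hd2 l).comp ((contDiff_aff M v (n := 1)).differentiable (by simp))).const_mul _) x
    rw [fderiv_fun_sum fun l _ => e2 l, sum_apply]
    refine Finset.sum_congr rfl fun l _ => ?_
    have hq : Differentiable ℝ ((fun y => fderiv ℝ ψ y (basisVec l)) ∘ aff M v) :=
      (hd2 l).comp ((contDiff_aff M v (n := 1)).differentiable (by simp))
    have := fderiv_comp_aff M v (hd2 l) x j
    generalize (M l i : ℂ) = c
    refine (congrArg (fun T : Plane →L[ℝ] ℂ => T (basisVec j)) (fderiv_const_mul (hq x) c)).trans ?_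
    simp only [smul_apply, smul_eq_mul]
    congr 1

/-! ### Invariance tested on quadratic polynomials -/

/-- The coordinates, as complex valued linear forms. -/
def coordForm (l : Fin 2) : Plane →L[ℝ] ℂ :=
  Complex.ofRealCLM.comp (![ContinuousLinearMap.fst ℝ ℝ ℝ, ContinuousLinearMap.snd ℝ ℝ ℝ] l)

theorem coordForm_basisVec (l i : Fin 2) : coordForm l (basisVec i) = if l = i then 1 else 0 := by
  fin_cases l <;> fin_cases i <;> simp [coordForm, basisVec]

theorem classicalJet_one : classicalJet (fun _ => 1) = (fun _ => 1, 0, 0) := by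
  refine Prod.ext rfl (Prod.ext ?_ ?_)
  · funext i x; simp [classicalJet]
  · funext i j x; simp [classicalJet]

theorem classicalJet_coordForm (l : Fin 2) : classicalJet (coordForm l) =
    ((⇑(coordForm l), fun i _ => if l = i then 1 else 0, 0) : Jet) := by
  refine Prod.ext rfl (Prod.ext ?_ ?_)
  · funext i x; simp [classicalJet, coordForm_basisVec]
  · funext i j x; simp [classicalJet]

theorem classicalJet_coordForm_mul (l k : Fin 2) :
    classicalJet (fun x => coordForm l x * coordForm k x) =
    (fun x => coordForm l x * coordForm k x,
      fun i x => coordForm l x * (if k = i then 1 else 0) + coordForm k x * (if l = i then 1 else 0),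
      fun i j _ => (if l = j then 1 else 0) * (if k = i then 1 else 0) +
        (if k = j then 1 else 0) * (if l = i then 1 else 0)) := by
  have h1 : ∀ i, (fun x => fderiv ℝ (fun x => coordForm l x * coordForm k x) x (basisVec i)) =
      fun x => coordForm l x * (if k = i then 1 else 0) + coordForm k x * (if l = i then 1 else 0) := by
    intro i
    funext x
    rw [fderiv_fun_mul (coordForm l).differentiableAt (coordForm k).differentiableAt]
    simp [coordForm_basisVec]
  refine Prod.ext rfl (Prod.ext (funext h1) ?_)
  funext i j x
  simp only [classicalJet, h1]
  rw [fderiv_fun_add ((coordForm l).differentiableAt.mul_const _)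
    ((coordForm k).differentiableAt.mul_const _), fderiv_mul_const (coordForm l).differentiableAt,
    fderiv_mul_const (coordForm k).differentiableAt]
  simp only [add_apply, smul_apply,
    ContinuousLinearMap.fderiv, coordForm_basisVec, smul_eq_mul]
  ring

theorem onJet_congr (L : RealDiffOp) {J J' : Jet} {x : Plane} (h0 : J.1 x = J'.1 x)
    (h1 : ∀ i, J.2.1 i x = J'.2.1 i x) (h2 : ∀ i j, J.2.2 i j x = J'.2.2 i j x) :
    L.onJet J x = L.onJet J' x := by
  simp only [onJet, LinearMap.coe_mk, AddHom.coe_mk, h0, h1, h2]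

theorem pullJet_add (M : Matrix (Fin 2) (Fin 2) ℝ) (v : Plane) (J J' : Jet) :
    pullJet M v (J + J') = pullJet M v J + pullJet M v J' := by
  refine Prod.ext rfl (Prod.ext ?_ ?_)
  · funext i x; simp [pullJet]; ring
  · funext i j x; simp [pullJet]; ring

theorem pullJet_smul (M : Matrix (Fin 2) (Fin 2) ℝ) (v : Plane) (c : ℂ) (J : Jet) :
    pullJet M v (c • J) = c • pullJet M v J := by
  refine Prod.ext rfl (Prod.ext ?_ ?_)
  · funext i x; simp [pullJet]; ring
  · funext i j x; simp [pullJet]; ring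

/-- A differential expression which commutes with an affine map does so on all jets with
symmetric Hessian. -/
theorem onJet_pullJet {L : RealDiffOp} {M : Matrix (Fin 2) (Fin 2) ℝ} {v : Plane}
    (h : L.InvariantUnder (aff M v)) : ∀ᵐ x : Plane, ∀ J : Jet,
      (∀ i j, J.2.2 i j (aff M v x) = J.2.2 j i (aff M v x)) →
      L.onJet (pullJet M v J) x = L.onJet J (aff M v x) := by
  have h0 : ∀ ψ : Plane → ℂ, ContDiff ℝ ∞ ψ → ∀ᵐ x : Plane,
      L.onJet (pullJet M v (classicalJet ψ)) x = L.onJet (classicalJet ψ) (aff M v x) := by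
    intro ψ hψ
    rw [← classicalJet_comp_aff M v hψ]
    exact h ψ hψ
  -- The exceptional null set may depend on the smooth function. Only finitely many polynomials are
  -- used, so one null set serves all jets at once.
  have a0 := h0 (fun _ => 1) contDiff_const
  have a1 := ae_all_iff.2 fun l => h0 (coordForm l) (coordForm l).contDiff
  have a2 := ae_all_iff.2 fun l => ae_all_iff.2 fun k =>
    h0 (fun x => coordForm l x * coordForm k x) ((coordForm l).contDiff.mul (coordForm k).contDiff)
  filter_upwards [a0, a1, a2] with x b0 b1 b2 J hJ
  set y := aff M v x with hy
  -- The second order Taylor polynomial at `y` with the given jet, expanded in monomials about the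
  -- origin. The expression at one point sees only the jet there; polynomials have symmetric
  -- Hessians, whence the hypothesis on `J`.
  let P : Jet := (∑ l, ∑ k, (J.2.2 l k y / 2) • classicalJet (fun x => coordForm l x * coordForm k x))
    + ((∑ l, (J.2.1 l y - ∑ k, J.2.2 l k y * coordForm k y) • classicalJet (coordForm l)) +
      (J.1 y - ∑ l, (J.2.1 l y - ∑ k, J.2.2 l k y * coordForm k y) * coordForm l y -
        ∑ l, ∑ k, J.2.2 l k y / 2 * (coordForm l y * coordForm k y)) • classicalJet (fun _ => 1))
  have hs := hJ 0 1
  have p0 : P.1 y = J.1 y := by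
    simp only [P, classicalJet_one, classicalJet_coordForm, classicalJet_coordForm_mul,
      Fin.sum_univ_two, Prod.fst_add, Prod.smul_fst, Pi.add_apply, Pi.smul_apply, smul_eq_mul]
    ring
  have p1 : ∀ i, P.2.1 i y = J.2.1 i y := by
    intro i
    fin_cases i <;>
      simp [P, classicalJet_one, classicalJet_coordForm, classicalJet_coordForm_mul,
        Fin.sum_univ_two, hs] <;> ring
  have p2 : ∀ i j, P.2.2 i j y = J.2.2 i j y := by
    intro i j
    fin_cases i <;> fin_cases j <;>
      simp [P, classicalJet_one, classicalJet_coordForm, classicalJet_coordForm_mul,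
        Fin.sum_univ_two, hs] <;> ring
  have e1 : L.onJet J y = L.onJet P y := onJet_congr L p0.symm (fun i => (p1 i).symm)
    fun i j => (p2 i j).symm
  have e2 : L.onJet (pullJet M v J) x = L.onJet (pullJet M v P) x := by
    refine onJet_congr L p0.symm (fun i => ?_) fun i j => ?_
    · simp only [pullJet, ← hy, p1]
    · simp only [pullJet, ← hy, p2]
  rw [e1, e2]
  simp only [P, Fin.sum_univ_two, pullJet_add, pullJet_smul, map_add, map_smul, Pi.add_apply,
    Pi.smul_apply, b0, b1, b2]

/-- Jets of Bloch functions and of functions in `H²` are locally square integrable. -/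
theorem jetL2loc_of_mem_blochJets {k : ℝ × ℝ} {J : Jet} (h : J ∈ blochJets k) : JetL2loc univ J :=
  ⟨h.1, h.2.1, h.2.2.1⟩

theorem onJet_ae_congr (L : RealDiffOp) {Ω : Set Plane} (hΩ : IsOpen Ω) {J J' : Jet}
    (hJ : IsWeakJet Ω J) (hJ' : IsWeakJet Ω J') (h : JetL2loc Ω J) (h' : JetL2loc Ω J')
    (e : J.1 =ᵐ[volume.restrict Ω] J'.1) :
    L.onJet J =ᵐ[volume.restrict Ω] L.onJet J' := by
  filter_upwards [hJ.ae_unique hΩ hJ' h h' e] with x hx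
  exact onJet_congr L hx.1 hx.2.1 hx.2.2

theorem onJet_pullJet_ae {L : RealDiffOp} {M : Matrix (Fin 2) (Fin 2) ℝ} (hM : M.det ≠ 0)
    {v : Plane} (h : L.InvariantUnder (aff M v)) {J : Jet} (hJ : IsWeakJet univ J)
    (hl : JetL2loc univ J) :
    ∀ᵐ x : Plane, L.onJet (pullJet M v J) x = L.onJet J (aff M v x) := by
  have hs := hJ.hessian_symm isOpen_univ hl
  rw [Measure.restrict_univ] at hs
  filter_upwards [onJet_pullJet h, ae_aff hM v hs] with x h1 h2
  exact h1 J h2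

/-! ### Rotation of Bloch jets -/

theorem rotMap_eq_aff : rotMap = aff (turnMatrix * turnMatrix) 0 := by
  funext x
  rw [← turn_turn, turn_eq_aff, aff_aff]
  simp [aff]

theorem det_turnMatrix_ne : turnMatrix.det ≠ 0 := by rw [det_turnMatrix]; norm_num

theorem det_rotMatrix_ne : (turnMatrix * turnMatrix).det ≠ 0 := by
  rw [Matrix.det_mul, det_turnMatrix]; norm_num

theorem pullJet_turn_mem {k : ℝ × ℝ} (hk : ∀ n, blochChar k (turnIdx n) = blochChar k n) {J : Jet}
    (hJ : J ∈ blochJets k) : pullJet turnMatrix 0 J ∈ blochJets k := by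
  have hl := jetL2loc_of_mem_blochJets hJ
  have w := hJ.2.2.2.1.pull det_turnMatrix_ne 0 hl
  obtain ⟨l0, l1, l2⟩ := hl.pull det_turnMatrix_ne 0
  rw [preimage_univ] at w l0
  refine ⟨l0, l1, l2, w, ?_⟩
  have hb := hJ.2.2.2.2
  rw [isBloch_iff] at hb ⊢
  intro n
  filter_upwards [ae_turn (hb (turnIdx n))] with x hx
  simp only [pullJet, ← turn_eq_aff, Function.comp_apply]
  rw [turn_add, turn_lat, hx, hk]

/-- The invariance is assumed for `rotMap`, the square of `turn`, and yields the phase θ². Two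
applications return to `turn`, since its fourth power is `turn` and θ⁴ = θ. -/
theorem onJet_turn_of_phase {L : RealDiffOp} (hR : L.InvariantUnder rotMap) {J : Jet}
    (hJ : IsWeakJet univ J) (hl : JetL2loc univ J) {θ : ℂ} (hθ : θ ^ 3 = 1)
    (ht : ∀ᵐ x : Plane, J.1 (turn x) = θ * J.1 x) :
    ∀ᵐ x : Plane, L.onJet J (turn x) = θ * L.onJet J x := by
  rw [rotMap_eq_aff] at hR
  have w := hJ.pull det_rotMatrix_ne 0 hl
  have l := hl.pull det_rotMatrix_ne 0
  rw [preimage_univ] at w l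
  have hs : IsWeakJet univ ((θ ^ 2) • J) :=
    ⟨fun i => (hJ.1 i).smul _, fun i j => (hJ.2 i j).smul _⟩
  have hsl : JetL2loc univ ((θ ^ 2) • J) :=
    ⟨hl.1.smul _, fun i => (hl.2.1 i).smul _, fun i j => (hl.2.2 i j).smul _⟩
  have key := onJet_ae_congr L isOpen_univ w hs l hsl (by
    rw [Measure.restrict_univ]
    filter_upwards [ht, ae_turn ht] with x h1 h2
    simp only [pullJet, ← rotMap_eq_aff, Function.comp_apply, Prod.smul_fst, Pi.smul_apply,
      smul_eq_mul]
    rw [← turn_turn, h2, h1]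
    ring)
  rw [Measure.restrict_univ] at key
  have r1 : ∀ᵐ x : Plane, L.onJet J (rotMap x) = θ ^ 2 * L.onJet J x := by
    filter_upwards [key, onJet_pullJet_ae det_rotMatrix_ne hR hJ hl] with x h1 h2
    rw [h2, map_smul, ← rotMap_eq_aff] at h1
    exact h1
  filter_upwards [r1, ae_rotMap r1] with x h1 h2
  rw [← rotMap_rotMap, h2, h1]
  linear_combination (θ * L.onJet J x) * hθ

/-! ### The isometries `T_j` -/

theorem conj_tau : starRingEnd ℂ tau = tau ^ 2 := by
  have h := sqrt3_sq_complex
  rw [tau_eq, unityRoot]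
  simp only [map_div₀, map_add, map_neg, map_one, map_mul, Complex.conj_ofReal, Complex.conj_I,
    map_ofNat]
  linear_combination (1 / 4 : ℂ) * h - (√3 : ℂ) ^ 2 / 4 * Complex.I_sq

theorem innerPhase_eq_pow (j : Fin 3) : innerPhase j = tau ^ (j : ℕ) := by
  rw [innerPhase]; exact zpow_natCast tau _

theorem conj_innerPhase (j : Fin 3) : starRingEnd ℂ (innerPhase j) = innerPhase j ^ 2 := by
  rw [innerPhase_eq_pow, map_pow, conj_tau, ← pow_mul, ← pow_mul, mul_comm]

theorem one_add_tau : 1 + tau + tau ^ 2 = 0 := by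
  have h := sqrt3_sq_complex
  rw [tau_eq, unityRoot]
  linear_combination (Complex.I ^ 2 / 4 : ℂ) * h + 3 / 4 * Complex.I_sq

theorem sum_innerPhase : ∑ j, innerPhase j = 0 ∧ ∑ j, innerPhase j ^ 2 = 0 := by
  have h := one_add_tau
  have h3 := tau_pow_three
  constructor <;> simp only [innerPhase_eq_pow, Fin.sum_univ_three, Fin.val_zero, Fin.val_one,
    Fin.val_two]
  · linear_combination h
  · linear_combination h + tau * h3

/-- The inverse of the third root of unity τ^j is its square, and R² is composition with `turn`, so
T_j is the phase extension up to the normalization. -/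
theorem rotSum_eq (m : ℤ) (j : Fin 3) (φ : Plane → ℂ) (x : Plane) :
    rotSum m j φ x = (1 / (√3 : ℝ) : ℂ) * rotSpread m (innerPhase j) φ x := by
  have : starRingEnd ℂ tau ^ (j : ℕ) = innerPhase j ^ 2 := by
    rw [← conj_innerPhase, innerPhase_eq_pow, map_pow]
  simp only [rotSum, rotSpread, rotOp, rotMap_rotMap, this, innerPhase_eq_pow]

theorem memLp_rotSum {m : ℤ} (j : Fin 3) {f : Plane → ℂ}
    (hf : MemLp f 2 (volume.restrict (rhombus m))) :
    MemLp (rotSum m j f) 2 (volume.restrict hexagon) := by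
  have : rotSum m j f = fun x => (1 / (√3 : ℝ) : ℂ) * rotSpread m (innerPhase j) f x :=
    funext fun x => rotSum_eq m j f x
  rw [this]
  exact ((memLp_rotSpread _ hf).const_mul _).restrict _

theorem rotSum_congr {m : ℤ} (j : Fin 3) {f f' : Plane → ℂ}
    (h : f =ᵐ[volume.restrict (rhombus m)] f') :
    rotSum m j f =ᵐ[volume.restrict hexagon] rotSum m j f' := by
  have e : ∀ᵐ x : Plane, (rhombus m).indicator f x = (rhombus m).indicator f' x := by
    filter_upwards [(ae_restrict_iff' (measurableSet_rhombus m)).1 h] with x hx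
    by_cases hm : x ∈ rhombus m
    · simp [hm, hx hm]
    · simp [hm]
  refine ae_restrict_of_ae ?_
  filter_upwards [e, ae_turn e, ae_rotMap e] with x h0 h1 h2
  simp only [rotSum_eq, rotSpread, h0, h1, h2]

/-- The integral over the hexagon as a sum of integrals over the rhombus. -/
theorem integral_hexagon (m : ℤ) {F : Plane → ℂ} (hF : IntegrableOn F hexagon) :
    ∫ x in hexagon, F x = (∫ x in rhombus m, F x) + (∫ x in rhombus m, F (turn x)) +
      ∫ x in rhombus m, F (rotMap x) := by
  have hm := measurableSet_rhombus m
  have hi : Integrable (hexagon.indicator F) := hF.integrable_indicator measurableSet_hexagon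
  let F' := hexagon.indicator F
  have hFt : Integrable (fun x => F' (turn x)) :=
    measurePreserving_turn.integrable_comp_of_integrable hi
  have hFr : Integrable (fun x => F' (rotMap x)) :=
    measurePreserving_rotMap.integrable_comp_of_integrable hi
  have i0 : Integrable ((rhombus m).indicator F') := hi.indicator hm
  have i1 : Integrable ((rhombus m).indicator fun y => F' (turn y)) := hFt.indicator hm
  have i2 : Integrable ((rhombus m).indicator fun y => F' (rotMap y)) := hFr.indicator hm
  have i1' : Integrable (fun x => (rhombus m).indicator (fun y => F' (turn y)) (rotMap x)) :=
    measurePreserving_rotMap.integrable_comp_of_integrable i1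
  have i2' : Integrable (fun x => (rhombus m).indicator (fun y => F' (rotMap y)) (turn x)) :=
    measurePreserving_turn.integrable_comp_of_integrable i2
  have e : F' =ᵐ[volume] fun x => (rhombus m).indicator F' x +
      (rhombus m).indicator (fun y => F' (turn y)) (rotMap x) +
      (rhombus m).indicator (fun y => F' (rotMap y)) (turn x) := by
    filter_upwards [(ae_restrict_iff' measurableSet_hexagon).1 (ae_mem_rhombi m)] with x hx
    by_cases hh : x ∈ hexagon
    · rcases hx hh with h | h | h
      · simp [h, turn_notMem_rhombus h, rotMap_notMem_rhombus h]
      · have a := turn_notMem_rhombus h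
        have b := rotMap_notMem_rhombus h
        rw [turn_rotMap] at a
        rw [rotMap_rotMap] at b
        simp [h, a, b, turn_rotMap]
      · have a := turn_notMem_rhombus h
        have b := rotMap_notMem_rhombus h
        rw [turn_turn] at a
        rw [rotMap_turn] at b
        simp [h, a, b, rotMap_turn]
    · have h0 : x ∉ rhombus m := fun h => hh (rhombus_subset_hexagon m h)
      have h1 : turn x ∉ rhombus m := fun h => hh (turn_mem_hexagon.1 (rhombus_subset_hexagon m h))
      have h2 : rotMap x ∉ rhombus m :=
        fun h => hh (rotMap_mem_hexagon.1 (rhombus_subset_hexagon m h))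
      simp [F', hh, h0, h1, h2]
  have f0 : ∫ x in rhombus m, F' x = ∫ x in rhombus m, F x :=
    setIntegral_congr_fun hm fun x hx => indicator_of_mem (rhombus_subset_hexagon m hx) _
  have f1 : ∫ x in rhombus m, F' (turn x) = ∫ x in rhombus m, F (turn x) :=
    setIntegral_congr_fun hm fun x hx =>
      indicator_of_mem (turn_mem_hexagon.2 (rhombus_subset_hexagon m hx)) _
  have f2 : ∫ x in rhombus m, F' (rotMap x) = ∫ x in rhombus m, F (rotMap x) :=
    setIntegral_congr_fun hm fun x hx =>
      indicator_of_mem (rotMap_mem_hexagon.2 (rhombus_subset_hexagon m hx)) _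
  rw [← integral_indicator measurableSet_hexagon, ← f0, ← f1, ← f2]
  refine (integral_congr_ae e).trans ?_
  have i01 : Integrable (fun x => (rhombus m).indicator F' x +
      (rhombus m).indicator (fun y => F' (turn y)) (rotMap x)) := i0.add i1'
  rw [integral_add i01 i2', integral_add i0 i1', integral_turn, integral_rotMap
    ((rhombus m).indicator fun y => F' (turn y)), integral_indicator hm, integral_indicator hm,
    integral_indicator hm]

/-- The map `T_j`, as a linear map. -/
def rotSumLin (m : ℤ) (j : Fin 3) : L2 (rhombus m) →ₗ[ℂ] L2 hexagon where
  toFun φ := (memLp_rotSum j (Lp.memLp φ)).toLp _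
  map_add' φ ψ := by
    refine Lp.ext ((MemLp.coeFn_toLp _).trans ?_)
    filter_upwards [rotSum_congr j (Lp.coeFn_add φ ψ),
      Lp.coeFn_add ((memLp_rotSum j (Lp.memLp φ)).toLp _) ((memLp_rotSum j (Lp.memLp ψ)).toLp _),
      (memLp_rotSum j (Lp.memLp φ)).coeFn_toLp, (memLp_rotSum j (Lp.memLp ψ)).coeFn_toLp] with
      x h1 h2 h3 h4
    rw [h1, h2, Pi.add_apply, h3, h4]
    simp only [rotSum_eq, rotSpread, indicator_add']
    simp only [Pi.add_apply]
    ring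
  map_smul' c φ := by
    refine Lp.ext ((MemLp.coeFn_toLp _).trans ?_)
    filter_upwards [rotSum_congr j (Lp.coeFn_smul c φ),
      Lp.coeFn_smul c ((memLp_rotSum j (Lp.memLp φ)).toLp _),
      (memLp_rotSum j (Lp.memLp φ)).coeFn_toLp] with x h1 h2 h3
    rw [h1, RingHom.id_apply, h2, Pi.smul_apply, h3]
    have e : ∀ y, (rhombus m).indicator (c • ⇑φ) y = c * (rhombus m).indicator φ y := fun y => by
      by_cases hy : y ∈ rhombus m <;> simp [hy]
    simp only [rotSum_eq, rotSpread, e, smul_eq_mul]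
    ring

theorem rotSumLin_coe (m : ℤ) (j : Fin 3) (φ : L2 (rhombus m)) :
    rotSumLin m j φ =ᵐ[volume.restrict hexagon] rotSum m j φ :=
  (memLp_rotSum j (Lp.memLp φ)).coeFn_toLp

theorem rotSum_of_mem (m : ℤ) (j : Fin 3) (f : Plane → ℂ) {x : Plane} (hx : x ∈ rhombus m) :
    rotSum m j f x = (1 / (√3 : ℝ) : ℂ) * f x := by
  rw [rotSum_eq, rotSpread_of_mem m _ f hx]

theorem rotSum_turn (m : ℤ) (j : Fin 3) (f : Plane → ℂ) (x : Plane) :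
    rotSum m j f (turn x) = innerPhase j * rotSum m j f x := by
  rw [rotSum_eq, rotSum_eq, rotSpread_turn m (innerPhase_pow_three j)]
  ring

/-- Orthogonality of the characters of ℤ/3. -/
theorem phase_sum (i j : Fin 3) : 1 + starRingEnd ℂ (innerPhase i) * innerPhase j +
    (starRingEnd ℂ (innerPhase i) * innerPhase j) ^ 2 = if i = j then 3 else 0 := by
  have h := one_add_tau
  have h3 := tau_pow_three
  rw [conj_innerPhase, innerPhase_eq_pow, innerPhase_eq_pow]
  fin_cases i <;> fin_cases j <;> simp
  · norm_num
  · linear_combination h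
  · linear_combination h + tau * h3
  · linear_combination h + tau * h3
  · linear_combination (1 + tau ^ 3 + 1) * h3
  · linear_combination h + (tau + tau ^ 2 + tau ^ 5) * h3
  · linear_combination h + (tau + tau ^ 2 + tau ^ 5) * h3
  · linear_combination h + (tau ^ 2 + tau * (tau ^ 6 + tau ^ 3 + 1)) * h3
  · linear_combination (1 + tau ^ 3 + (tau ^ 9 + tau ^ 6 + tau ^ 3 + 1)) * h3

/-- Over the three rhombi the integrand is multiplied by 1, z and z², where z is the product of one
phase with the conjugate of the other. The geometric sum is 3 or 0, and the 3 is cancelled by the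
two factors 1/√3. -/
theorem inner_rotSumLin (m : ℤ) (i j : Fin 3) (φ ψ : L2 (rhombus m)) :
    inner ℂ (rotSumLin m i φ) (rotSumLin m j ψ) = if i = j then inner ℂ φ ψ else 0 := by
  have hm := measurableSet_rhombus m
  rw [L2.inner_def, L2.inner_def]
  let F : Plane → ℂ := fun x => rotSum m j ψ x * starRingEnd ℂ (rotSum m i φ x)
  have hF : IntegrableOn F hexagon := by
    have : IntegrableOn (fun x => inner ℂ (rotSumLin m i φ x) (rotSumLin m j ψ x)) hexagon :=
      L2.integrable_inner _ _
    refine this.congr ?_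
    filter_upwards [rotSumLin_coe m i φ, rotSumLin_coe m j ψ] with x h1 h2
    rw [RCLike.inner_apply, h1, h2]
  have e1 : ∫ x in hexagon, inner ℂ (rotSumLin m i φ x) (rotSumLin m j ψ x) =
      ∫ x in hexagon, F x := by
    refine integral_congr_ae ?_
    filter_upwards [rotSumLin_coe m i φ, rotSumLin_coe m j ψ] with x h1 h2
    rw [RCLike.inner_apply, h1, h2]
  set z := starRingEnd ℂ (innerPhase i) * innerPhase j with hz
  have t1 : ∀ x, F (turn x) = z * F x := fun x => by
    simp only [F, rotSum_turn, map_mul, hz]; ring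
  have t2 : ∀ x, F (rotMap x) = z ^ 2 * F x := fun x => by
    rw [← turn_turn, t1, t1]; ring
  rw [e1, integral_hexagon m hF]
  simp only [t1, t2]
  rw [integral_const_mul, integral_const_mul]
  have e2 : ∫ x in rhombus m, F x = (1 / 3 : ℂ) * ∫ x in rhombus m, inner ℂ (φ x) (ψ x) := by
    rw [← integral_const_mul]
    refine setIntegral_congr_fun hm fun x hx => ?_
    have h3 : ((1 / (√3 : ℝ) : ℂ)) * (1 / (√3 : ℝ) : ℂ) = 1 / 3 := by
      rw [div_mul_div_comm, one_mul, ← sq, sqrt3_sq_complex]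
    simp only [F, rotSum_of_mem m _ _ hx, RCLike.inner_apply, map_mul, map_div₀, map_one,
      Complex.conj_ofReal]
    linear_combination (ψ x * starRingEnd ℂ (φ x)) * h3
  rw [e2]
  have hp := phase_sum i j
  rw [← hz] at hp
  set A := ∫ x in rhombus m, inner ℂ (φ x) (ψ x)
  have : 1 / 3 * A + z * (1 / 3 * A) + z ^ 2 * (1 / 3 * A) = (1 + z + z ^ 2) * (1 / 3 * A) := by ring
  rw [this, hp]
  split_ifs <;> ring

/-- The isometry `T_j`. -/
def rotIsom (m : ℤ) (j : Fin 3) : L2 (rhombus m) →ₗᵢ[ℂ] L2 hexagon where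
  toLinearMap := rotSumLin m j
  norm_map' φ := by
    have h := inner_rotSumLin m j j φ φ
    rw [if_pos rfl, inner_self_eq_norm_sq_to_K, inner_self_eq_norm_sq_to_K] at h
    have h' : ‖rotSumLin m j φ‖ ^ 2 = ‖φ‖ ^ 2 := by exact_mod_cast h
    exact (sq_eq_sq₀ (norm_nonneg _) (norm_nonneg _)).1 h'

theorem rotIsom_coe (m : ℤ) (j : Fin 3) (φ : L2 (rhombus m)) :
    rotIsom m j φ =ᵐ[volume.restrict hexagon] rotSum m j φ := rotSumLin_coe m j φ

theorem orthogonalFamily_rotIsom (m : ℤ) :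
    OrthogonalFamily ℂ (fun _ : Fin 3 => L2 (rhombus m)) (rotIsom m) := by
  intro i j hij φ ψ
  exact (inner_rotSumLin m i j φ ψ).trans (if_neg hij)

/-- A function which is multiplied by the phase under rotations is determined by its values on the
rhombus. -/
theorem rotSum_of_phase {m : ℤ} {j : Fin 3} {w φ : Plane → ℂ} {c : ℂ}
    (hw : ∀ᵐ x : Plane, w (turn x) = innerPhase j * w x)
    (hφ : ∀ᵐ x ∂(volume.restrict (rhombus m)), φ x = c * w x) :
    ∀ᵐ x ∂(volume.restrict hexagon), rotSum m j φ x = (1 / (√3 : ℝ) : ℂ) * c * w x := by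
  have hmem := ae_restrict_mem (μ := volume) (measurableSet_rhombus m)
  have h0 : ∀ᵐ x ∂(volume.restrict (rhombus m)),
      rotSum m j φ x = (1 / (√3 : ℝ) : ℂ) * c * w x := by
    filter_upwards [hφ, hmem] with x h1 h2
    rw [rotSum_of_mem m j φ h2, h1, mul_assoc]
  refine ae_hexagon_of_rhombus m h0 ?_ ?_
  · filter_upwards [h0, ae_restrict_of_ae hw] with x h1 h2
    rw [rotSum_turn, h1, h2]
    ring
  · filter_upwards [h0, ae_restrict_of_ae hw, ae_restrict_of_ae (ae_turn hw)] with x h1 h2 h3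
    rw [← turn_turn, rotSum_turn, rotSum_turn, h1, h3, h2]
    ring

/-! ### Spectral projections of the rotation -/

/-- Projection onto the functions which are multiplied by `θ` under `turn`. -/
def phaseProj (θ : ℂ) (f : Plane → ℂ) (x : Plane) : ℂ :=
  (1 / 3 : ℂ) * (f x + θ ^ 2 * f (turn x) + θ * f (rotMap x))

theorem phaseProj_turn {θ : ℂ} (hθ : θ ^ 3 = 1) (f : Plane → ℂ) (x : Plane) :
    phaseProj θ f (turn x) = θ * phaseProj θ f x := by
  simp only [phaseProj, turn_turn, rotMap_turn]
  linear_combination (-(1 / 3 : ℂ) * f (turn x)) * hθ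

/-- The coefficients of the rotated terms are the sums of the three phases and of their squares,
both zero. -/
theorem sum_phaseProj (f : Plane → ℂ) (x : Plane) : ∑ j, phaseProj (innerPhase j) f x = f x := by
  obtain ⟨h1, h2⟩ := sum_innerPhase
  rw [Fin.sum_univ_three] at h1 h2 ⊢
  simp only [phaseProj]
  linear_combination (1 / 3 * f (rotMap x)) * h1 + (1 / 3 * f (turn x)) * h2

theorem memLp_hexagon_turn {f : Plane → ℂ} (hf : MemLp f 2 (volume.restrict hexagon)) :
    MemLp (fun x => f (turn x)) 2 (volume.restrict hexagon) := by
  have := memLp_aff det_turnMatrix_ne 0 hf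
  rw [← turn_eq_aff, show turn ⁻¹' hexagon = hexagon from ext fun x => turn_mem_hexagon] at this
  exact this

theorem memLp_phaseProj (θ : ℂ) {f : Plane → ℂ} (hf : MemLp f 2 (volume.restrict hexagon)) :
    MemLp (phaseProj θ f) 2 (volume.restrict hexagon) := by
  have h1 := memLp_hexagon_turn hf
  have h2 := memLp_hexagon_turn h1
  simp only [turn_turn] at h2
  exact ((hf.add (h1.const_mul _)).add (h2.const_mul _)).const_mul _

/-- A function on the hexagon with the phase of `T_j` under rotations is in the range of `T_j`. -/
theorem rotIsom_toLp {m : ℤ} {j : Fin 3} {w : Plane → ℂ}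
    (hw : ∀ᵐ x : Plane, w (turn x) = innerPhase j * w x)
    (hm : MemLp (fun x => ((√3 : ℝ) : ℂ) * w x) 2 (volume.restrict (rhombus m))) :
    rotIsom m j (hm.toLp _) =ᵐ[volume.restrict hexagon] w := by
  refine (rotIsom_coe m j _).trans ?_
  filter_upwards [rotSum_of_phase hw hm.coeFn_toLp] with x hx
  rw [hx, one_div, inv_mul_cancel₀, one_mul]
  exact_mod_cast (by positivity : (√3 : ℝ) ≠ 0)

theorem iSup_range_rotIsom (m : ℤ) : (⨆ j, LinearMap.range (rotIsom m j).toLinearMap) = ⊤ := by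
  refine eq_top_iff.2 fun f _ => ?_
  have hp : ∀ j, MemLp (phaseProj (innerPhase j) f) 2 (volume.restrict hexagon) := fun j =>
    memLp_phaseProj _ (Lp.memLp f)
  have hm : ∀ j, MemLp (fun x => ((√3 : ℝ) : ℂ) * phaseProj (innerPhase j) f x) 2
      (volume.restrict (rhombus m)) := fun j =>
    ((hp j).mono_measure (Measure.restrict_mono (rhombus_subset_hexagon m) le_rfl)).const_mul _
  have e : f = ∑ j, rotIsom m j ((hm j).toLp _) := by
    refine Lp.ext ?_
    have hs := Lp.coeFn_add (rotIsom m 0 ((hm 0).toLp _) + rotIsom m 1 ((hm 1).toLp _))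
      (rotIsom m 2 ((hm 2).toLp _))
    have hs' := Lp.coeFn_add (rotIsom m 0 ((hm 0).toLp _)) (rotIsom m 1 ((hm 1).toLp _))
    have ht := fun j => rotIsom_toLp (w := phaseProj (innerPhase j) f)
      (ae_of_all _ (phaseProj_turn (innerPhase_pow_three j) f)) (hm j)
    rw [Fin.sum_univ_three]
    filter_upwards [hs, hs', ht 0, ht 1, ht 2] with x h1 h2 h3 h4 h5
    rw [h1, Pi.add_apply, h2, Pi.add_apply, h3, h4, h5, ← sum_phaseProj f x, Fin.sum_univ_three]
  rw [e]
  exact Submodule.sum_mem _ fun j _ => Submodule.mem_iSup_of_mem j ⟨_, rfl⟩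

/-! ### Reduction of the Bloch operator -/

/-- Projection of a Bloch jet onto a phase. -/
def phaseProjJet (θ : ℂ) (J : Jet) : Jet :=
  (1 / 3 : ℂ) • (J + θ ^ 2 • pullJet turnMatrix 0 J +
    θ • pullJet turnMatrix 0 (pullJet turnMatrix 0 J))

theorem phaseProjJet_fst (θ : ℂ) (J : Jet) : (phaseProjJet θ J).1 = phaseProj θ J.1 := by
  funext x
  simp only [phaseProjJet, pullJet, ← turn_eq_aff, Prod.smul_fst, Prod.fst_add, Pi.smul_apply,
    Pi.add_apply, Function.comp_apply, smul_eq_mul, turn_turn, phaseProj]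

theorem mem_domain_operatorOn {L : RealDiffOp} {Ω : Set Plane} {P : Submodule ℂ Jet}
    {A : L2 Ω →ₗ.[ℂ] L2 Ω} (hA : A.graph = L.graphOn Ω P) {u : L2 Ω} :
    u ∈ A.domain ↔ ∃ f : L2 Ω, ∃ J ∈ P, u =ᵐ[volume.restrict Ω] J.1 ∧
      f =ᵐ[volume.restrict Ω] L.onJet J := by
  rw [LinearPMap.mem_domain_iff, hA]
  rfl

theorem memLp_onJet (L : RealDiffOp) {μ : Measure Plane} {J : Jet} (h0 : MemLp J.1 2 μ)
    (h1 : ∀ i, MemLp (J.2.1 i) 2 μ) (h2 : ∀ i j, MemLp (J.2.2 i j) 2 μ) :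
    MemLp (L.onJet J) 2 μ := by
  have key : ∀ (a : Plane → ℝ), Measurable a → (∃ M, ∀ x, |a x| ≤ M) → ∀ f : Plane → ℂ,
      MemLp f 2 μ → MemLp (fun x => (a x : ℂ) * f x) 2 μ := by
    rintro a ha ⟨M, hM⟩ f hf
    refine MemLp.of_le_mul (c := M) hf ((Complex.measurable_ofReal.comp
      ha).aestronglyMeasurable.mul hf.1) (ae_of_all _ fun x => ?_)
    rw [norm_mul, Complex.norm_real]
    exact mul_le_mul_of_nonneg_right (hM x) (norm_nonneg _)
  have := ((memLp_finsetSum Finset.univ fun i _ => memLp_finsetSum Finset.univ fun j _ =>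
    key _ (L.measurable_a i j) (L.bounded_a i j) _ (h2 i j)).add
    (memLp_finsetSum Finset.univ fun i _ => key _ (L.measurable_b i) (L.bounded_b i) _ (h1 i))).add
    (key _ L.measurable_c L.bounded_c _ h0)
  convert this using 1
  funext x
  simp [onJet]

/-- The projections act on jets, and they preserve the Bloch condition because the quasimomentum is
fixed by the rotation. Each projected jet has a phase and hence restricts to a twisted jet. -/
theorem domain_le (L : RealDiffOp) (m σ : ℤ) : (L.blochOp ((σ : ℝ) • kStar)).domain ≤
    ⨆ j, (L.twistedOp m σ j).domain.map (rotIsom m j).toLinearMap := by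
  intro u hu
  obtain ⟨f, J, hJ, hu1, hf⟩ := (mem_domain_operatorOn (L.blochOp_graph _)).1 hu
  have hk := blochChar_kStar_turnIdx σ
  have hP : ∀ j, phaseProjJet (innerPhase j) J ∈ blochJets ((σ : ℝ) • kStar) := fun j =>
    Submodule.smul_mem _ _ (Submodule.add_mem _ (Submodule.add_mem _ hJ
      (Submodule.smul_mem _ _ (pullJet_turn_mem hk hJ)))
      (Submodule.smul_mem _ _ (pullJet_turn_mem hk (pullJet_turn_mem hk hJ))))
  have hph : ∀ j, ∀ᵐ x : Plane, (phaseProjJet (innerPhase j) J).1 (turn x) =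
      innerPhase j * (phaseProjJet (innerPhase j) J).1 x := fun j => by
    rw [phaseProjJet_fst]
    exact ae_of_all _ (phaseProj_turn (innerPhase_pow_three j) _)
  -- The factor √3 compensates the normalization of T_j.
  have hT : ∀ j, ((√3 : ℝ) : ℂ) • phaseProjJet (innerPhase j) J ∈ twistedJets m σ j := fun j =>
    Submodule.smul_mem _ _ (mem_twistedJets (hP j) (hph j))
  have hm : ∀ j, MemLp (fun x => ((√3 : ℝ) : ℂ) * phaseProj (innerPhase j) J.1 x) 2
      (volume.restrict (rhombus m)) := fun j => by
    have := (hT j).1.1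
    rw [Prod.smul_fst, phaseProjJet_fst] at this
    exact this
  have hdom : ∀ j, (hm j).toLp _ ∈ (L.twistedOp m σ j).domain := fun j => by
    refine (mem_domain_operatorOn (L.twistedOp_graph m σ j)).2
      ⟨(memLp_onJet L (hT j).1.1 (hT j).1.2.1 (hT j).1.2.2.1).toLp _, _, hT j, ?_,
        MemLp.coeFn_toLp _⟩
    rw [Prod.smul_fst, phaseProjJet_fst]
    exact (hm j).coeFn_toLp
  have e : u = ∑ j, rotIsom m j ((hm j).toLp _) := by
    refine Lp.ext ?_
    have hs := Lp.coeFn_add (rotIsom m 0 ((hm 0).toLp _) + rotIsom m 1 ((hm 1).toLp _))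
      (rotIsom m 2 ((hm 2).toLp _))
    have hs' := Lp.coeFn_add (rotIsom m 0 ((hm 0).toLp _)) (rotIsom m 1 ((hm 1).toLp _))
    have ht := fun j => rotIsom_toLp (w := phaseProj (innerPhase j) J.1)
      (ae_of_all _ (phaseProj_turn (innerPhase_pow_three j) J.1)) (hm j)
    rw [Fin.sum_univ_three]
    filter_upwards [hs, hs', ht 0, ht 1, ht 2, hu1] with x h1 h2 h3 h4 h5 h6
    rw [h1, Pi.add_apply, h2, Pi.add_apply, h3, h4, h5, h6, ← sum_phaseProj J.1 x,
      Fin.sum_univ_three]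
  rw [e]
  exact Submodule.sum_mem _ fun j _ => Submodule.mem_iSup_of_mem j ⟨_, hdom j, rfl⟩

/-- The twisted jet is extended to a Bloch jet on the plane. The extension and its image under the
expression have the same phase, so T_j maps their restrictions to 1/√3 times themselves on the
hexagon. -/
theorem rotIsom_mem_graph {L : RealDiffOp} (hR : L.InvariantUnder rotMap) {m σ : ℤ} {j : Fin 3}
    {φ f : L2 (rhombus m)} (h : (φ, f) ∈ (L.twistedOp m σ j).graph) :
    (rotIsom m j φ, rotIsom m j f) ∈ (L.blochOp ((σ : ℝ) • kStar)).graph := by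
  rw [L.twistedOp_graph] at h
  obtain ⟨J, hJ, h1, h2⟩ := h
  rw [L.blochOp_graph]
  have hk := blochChar_kStar_turnIdx σ
  have hE := extJet_mem hJ
  set E := extJet ((σ : ℝ) • kStar) m (innerPhase j) J with hEdef
  have hθ := innerPhase_pow_three j
  have hphase : ∀ᵐ x : Plane, E.1 (turn x) = innerPhase j * E.1 x :=
    ae_of_all _ (ext_turn hk m hθ J.1)
  have hphase' := onJet_turn_of_phase hR hE.2.2.2.1 (jetL2loc_of_mem_blochJets hE) hθ hphase
  have hmem := ae_restrict_mem (μ := volume) (measurableSet_rhombus m)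
  have eq1 : J.1 =ᵐ[volume.restrict (rhombus m)] E.1 := by
    filter_upwards [hmem] with x hx
    exact (ext_of_mem _ m _ J.1 hx).symm
  -- The derivatives of the extension need not be compared entry by entry: the functions agree on
  -- the open rhombus, hence so do their weak derivatives almost everywhere.
  have eq2 : L.onJet J =ᵐ[volume.restrict (rhombus m)] L.onJet E := by
    refine onJet_ae_congr L (isOpen_rhombus m) hJ.1.2.2.2 ?_ ?_ ?_ eq1
    · exact ⟨fun i => (hE.2.2.2.1.1 i).mono (subset_univ _),
        fun i l => (hE.2.2.2.1.2 i l).mono (subset_univ _)⟩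
    · exact ⟨MemLp.memL2loc hJ.1.1, fun i => MemLp.memL2loc (hJ.1.2.1 i),
        fun i l => MemLp.memL2loc (hJ.1.2.2.1 i l)⟩
    · exact ⟨hE.1.mono (subset_univ _), fun i => (hE.2.1 i).mono (subset_univ _),
        fun i l => (hE.2.2.1 i l).mono (subset_univ _)⟩
  refine ⟨(1 / (√3 : ℝ) : ℂ) • E, Submodule.smul_mem _ _ hE, ?_, ?_⟩
  · refine (rotIsom_coe m j φ).trans ?_
    filter_upwards [rotSum_of_phase (φ := φ) (c := 1) hphase
      ((h1.trans eq1).mono fun x hx => by rw [one_mul]; exact hx)] with x hx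
    rw [hx, mul_one]
    rfl
  · refine (rotIsom_coe m j f).trans ?_
    filter_upwards [rotSum_of_phase (φ := f) (c := 1) hphase'
      ((h2.trans eq2).mono fun x hx => by rw [one_mul]; exact hx)] with x hx
    rw [hx, mul_one, map_smul]
    rfl

theorem rotIsom_intertwines {L : RealDiffOp} (hR : L.InvariantUnder rotMap) {m σ : ℤ} (j : Fin 3)
    (φ : (L.twistedOp m σ j).domain) :
    ∃ h : rotIsom m j φ ∈ (L.blochOp ((σ : ℝ) • kStar)).domain,
      L.blochOp ((σ : ℝ) • kStar) ⟨rotIsom m j φ, h⟩ = rotIsom m j (L.twistedOp m σ j φ) := by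
  have := rotIsom_mem_graph hR (LinearPMap.mem_graph (L.twistedOp m σ j) φ)
  refine ⟨LinearPMap.mem_domain_of_mem_graph this, ?_⟩
  exact ((LinearPMap.image_iff _).2 this).symm

theorem domain_blochOp {L : RealDiffOp} (hR : L.InvariantUnder rotMap) (m σ : ℤ) :
    (L.blochOp ((σ : ℝ) • kStar)).domain =
      ⨆ j, (L.twistedOp m σ j).domain.map (rotIsom m j).toLinearMap := by
  refine le_antisymm (domain_le L m σ) (iSup_le fun j => ?_)
  rintro _ ⟨φ, hφ, rfl⟩
  exact (rotIsom_intertwines hR j ⟨φ, hφ⟩).1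

/-! ### Resolvent sets -/

section Resolvent

variable {E : Type*} [NormedAddCommGroup E]

theorem inResolventSet_of_surjective [NormedSpace ℂ E] {A : E →ₗ.[ℂ] E} {z : ℂ} {c : ℝ}
    (hlow : ∀ u : A.domain, ‖(u : E)‖ ≤ c * ‖A u - z • (u : E)‖)
    (hs : ∀ f, ∃ u : A.domain, A u - z • (u : E) = f) : InResolventSet A z := by
  let T : A.domain →ₗ[ℂ] E := A.toFun - z • A.domain.subtype
  have hT : ∀ u, T u = A u - z • (u : E) := fun u => rfl
  have hinj : Function.Injective T := by
    rw [← LinearMap.ker_eq_bot, LinearMap.ker_eq_bot']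
    intro u hu
    have := hlow u
    rw [← hT, hu, norm_zero, mul_zero] at this
    exact Subtype.ext (norm_le_zero_iff.1 this)
  let e := LinearEquiv.ofBijective T ⟨hinj, hs⟩
  let B : E →L[ℂ] E := (A.domain.subtype ∘ₗ e.symm.toLinearMap).mkContinuous c fun f => by
    have := hlow (e.symm f)
    rw [← hT, show T (e.symm f) = f from e.apply_symm_apply f] at this
    exact this
  refine ⟨B, fun f => ⟨(e.symm f).2, ?_⟩, fun u => ?_⟩
  · exact e.apply_symm_apply f
  · exact congrArg Subtype.val (e.symm_apply_apply u)

/-- A closed range with trivial orthogonal complement is everything. -/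
theorem surjective_of_dense [InnerProductSpace ℂ E] [CompleteSpace E] {A : E →ₗ.[ℂ] E} {z : ℂ}
    (hcl : ∀ (u : ℕ → A.domain) (f : E),
      Filter.Tendsto (fun n => A (u n) - z • (u n : E)) Filter.atTop (nhds f) →
      ∃ v : A.domain, A v - z • (v : E) = f)
    (hd : ∀ g : E, (∀ u : A.domain, inner ℂ (A u - z • (u : E)) g = 0) → g = 0) (f : E) :
    ∃ u : A.domain, A u - z • (u : E) = f := by
  let T : A.domain →ₗ[ℂ] E := A.toFun - z • A.domain.subtype
  have hclosed : IsClosed (LinearMap.range T : Set E) := by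
    refine IsSeqClosed.isClosed fun x y hx hy => ?_
    choose u hu using hx
    obtain ⟨v, hv⟩ := hcl u y (by
      refine hy.congr fun n => ?_
      exact (hu n).symm)
    exact ⟨v, hv⟩
  have : CompleteSpace (LinearMap.range T) := hclosed.completeSpace_coe
  have htop : LinearMap.range T = ⊤ := by
    rw [← Submodule.orthogonal_eq_bot_iff, Submodule.eq_bot_iff]
    intro g hg
    refine hd g fun u => ?_
    exact (Submodule.mem_orthogonal _ _).1 hg _ ⟨u, rfl⟩
  have hf : f ∈ LinearMap.range T := htop ▸ Submodule.mem_top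
  exact hf

variable [InnerProductSpace ℂ E] [CompleteSpace E]

/-- For symmetric `A` the number ⟨u, A u⟩ is real, so ⟨u, (A - z) u⟩ has imaginary part -Im z ‖u‖²,
and Cauchy–Schwarz applies. -/
theorem norm_le_of_isSelfAdjoint {A : E →ₗ.[ℂ] E} (hA : IsSelfAdjoint A) (z : ℂ) (hz : z.im ≠ 0)
    (u : A.domain) : ‖(u : E)‖ ≤ |z.im|⁻¹ * ‖A u - z • (u : E)‖ := by
  have hf : A.IsFormalAdjoint A := by
    have := LinearPMap.adjoint_isFormalAdjoint hA.dense_domain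
    rwa [LinearPMap.isSelfAdjoint_def.1 hA] at this
  have h1 : inner ℂ (A u) (u : E) = inner ℂ (u : E) (A u) := hf u u
  have him : (inner ℂ (u : E) (A u)).im = 0 := by
    rw [← inner_conj_symm] at h1
    have := congrArg Complex.im h1
    rw [Complex.conj_im] at this
    linarith
  have h2 : (inner ℂ (u : E) (A u - z • (u : E))).im = -(z.im * ‖(u : E)‖ ^ 2) := by
    rw [inner_sub_right, inner_smul_right, inner_self_eq_norm_sq_to_K, Complex.sub_im, him]
    have : (z * ((‖(u : E)‖ ^ 2 : ℝ) : ℂ)).im = z.im * ‖(u : E)‖ ^ 2 := by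
      rw [Complex.im_mul_ofReal]
    rw [Complex.ofReal_pow] at this
    rw [zero_sub]
    exact congrArg Neg.neg this
  have h3 : |z.im| * ‖(u : E)‖ ^ 2 ≤ ‖(u : E)‖ * ‖A u - z • (u : E)‖ := by
    have := (Complex.abs_im_le_norm _).trans (norm_inner_le_norm (𝕜 := ℂ) (u : E) (A u - z • (u : E)))
    rwa [h2, abs_neg, abs_mul, abs_of_nonneg (sq_nonneg ‖(u : E)‖)] at this
  have hz' : 0 < |z.im| := abs_pos.2 hz
  rw [inv_mul_eq_div, le_div_iff₀ hz']
  rcases eq_or_lt_of_le (norm_nonneg (u : E)) with h0 | h0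
  · rw [← h0, zero_mul]; positivity
  · nlinarith

/-- The lower bound and closedness of the graph make the range of A - z closed. A vector orthogonal
to the range lies in the kernel of A* - z̄ = A - z̄, which is trivial by the lower bound at z̄. -/
theorem inResolventSet_of_isSelfAdjoint {A : E →ₗ.[ℂ] E} (hA : IsSelfAdjoint A) {z : ℂ}
    (hz : z.im ≠ 0) : InResolventSet A z := by
  have hlow := norm_le_of_isSelfAdjoint hA z hz
  refine inResolventSet_of_surjective hlow (surjective_of_dense ?_ ?_)
  · intro u f hf
    have hc : CauchySeq fun n => (u n : E) := by
      have hcf := hf.cauchySeq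
      rw [Metric.cauchySeq_iff'] at hcf ⊢
      intro ε hε
      obtain ⟨N, hN⟩ := hcf (|z.im| * ε) (mul_pos (abs_pos.2 hz) hε)
      refine ⟨N, fun n hn => ?_⟩
      have h1 := hN n hn
      rw [dist_eq_norm] at h1 ⊢
      have h2 := hlow (u n - u N)
      rw [LinearPMap.map_sub, AddSubgroupClass.coe_sub, smul_sub, sub_sub_sub_comm] at h2
      refine lt_of_le_of_lt h2 ?_
      rw [inv_mul_lt_iff₀ (abs_pos.2 hz)]
      exact h1
    obtain ⟨v, hv⟩ := cauchySeq_tendsto_of_complete hc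
    have hAu : Filter.Tendsto (fun n => A (u n)) Filter.atTop (nhds (f + z • v)) := by
      have := hf.add (hv.const_smul z)
      simpa using this
    have hg : ((v, f + z • v) : E × E) ∈ (A.graph : Set (E × E)) :=
      hA.isClosed.mem_of_tendsto (hv.prodMk_nhds hAu)
        (Filter.Eventually.of_forall fun n => LinearPMap.mem_graph A (u n))
    refine ⟨⟨v, LinearPMap.mem_domain_of_mem_graph hg⟩, ?_⟩
    rw [← (LinearPMap.image_iff (LinearPMap.mem_domain_of_mem_graph hg)).2 hg]
    exact add_sub_cancel_right _ _
  · intro g hg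
    have hw : ∀ x : A.domain, inner ℂ (starRingEnd ℂ z • g) (x : E) = inner ℂ g (A x) := by
      intro x
      have := hg x
      rw [inner_sub_left, inner_smul_left, sub_eq_zero] at this
      rw [inner_smul_left, Complex.conj_conj, ← inner_conj_symm, ← inner_conj_symm g (A x), this,
        map_mul, Complex.conj_conj]
    have hdom := LinearPMap.mem_adjoint_domain_of_exists g ⟨_, hw⟩
    have happ := LinearPMap.adjoint_apply_eq hA.dense_domain ⟨g, hdom⟩ hw
    have hgr : ((g, starRingEnd ℂ z • g) : E × E) ∈ A.graph := by
      have : ((g, starRingEnd ℂ z • g) : E × E) ∈ A.adjoint.graph := by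
        rw [← happ]
        exact LinearPMap.mem_graph A.adjoint ⟨g, hdom⟩
      rwa [LinearPMap.isSelfAdjoint_def.1 hA] at this
    have := norm_le_of_isSelfAdjoint hA (starRingEnd ℂ z) (by simpa using hz)
      ⟨g, LinearPMap.mem_domain_of_mem_graph hgr⟩
    rw [← (LinearPMap.image_iff (LinearPMap.mem_domain_of_mem_graph hgr)).2 hgr, sub_self,
      norm_zero, mul_zero] at this
    exact norm_le_zero_iff.1 this

end Resolvent

/-! ### Elliptic estimate in the plane -/

/-- The sum of the `L²` norms of the entries of a jet. -/
def jetNorm (Ω : Set Plane) (J : Jet) : ℝ≥0∞ :=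
  eLpNorm J.1 2 (volume.restrict Ω) + ∑ i, eLpNorm (J.2.1 i) 2 (volume.restrict Ω) +
    ∑ i, ∑ j, eLpNorm (J.2.2 i j) 2 (volume.restrict Ω)

theorem memLp_ofReal {φ : Plane → ℝ} (hc : Continuous φ) (hs : HasCompactSupport φ)
    (μ : Measure Plane) [IsFiniteMeasureOnCompacts μ] : MemLp (fun x => (φ x : ℂ)) 2 μ :=
  (Complex.continuous_ofReal.comp hc).memLp_of_hasCompactSupport
    (hs.comp_left (g := fun r : ℝ => (r : ℂ)) (by simp))

theorem tendsto_setIntegral_mul {Ω : Set Plane} {φ : Plane → ℝ} (hc : Continuous φ)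
    (hs : HasCompactSupport φ) {f : ℕ → L2 Ω} {g : L2 Ω}
    (h : Filter.Tendsto f Filter.atTop (nhds g)) :
    Filter.Tendsto (fun n => ∫ x in Ω, (φ x : ℂ) * f n x) Filter.atTop
      (nhds (∫ x in Ω, (φ x : ℂ) * g x)) := by
  have hm := memLp_ofReal hc hs (volume.restrict Ω)
  have e : ∀ f : L2 Ω, ∫ x in Ω, (φ x : ℂ) * f x = inner ℂ (hm.toLp _) f := by
    intro f
    rw [L2.inner_def]
    refine integral_congr_ae ?_
    filter_upwards [hm.coeFn_toLp] with x hx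
    rw [hx, RCLike.inner_apply, Complex.conj_ofReal, mul_comm]
  simp only [e]
  exact Filter.Tendsto.inner tendsto_const_nhds h

/-- Weak derivatives are closed. -/
theorem isWeakDeriv_of_tendsto {Ω : Set Plane} {i : Fin 2} {f w : ℕ → L2 Ω} {g v : L2 Ω}
    (h : ∀ n, IsWeakDeriv Ω i (f n) (w n)) (hf : Filter.Tendsto f Filter.atTop (nhds g))
    (hw : Filter.Tendsto w Filter.atTop (nhds v)) : IsWeakDeriv Ω i g v := by
  intro φ h1 h2 h3
  have e1 := tendsto_setIntegral_mul (fderiv_apply_continuous h1 (basisVec i))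
    (fderiv_apply_compact h2 (basisVec i)) hf
  have e2 := (tendsto_setIntegral_mul h1.continuous h2 hw).neg
  refine tendsto_nhds_unique e1 (e2.congr fun n => ?_)
  exact (h n φ h1 h2 h3).symm

theorem jetL2loc_of_mem_sobolevJets {Ω : Set Plane} {J : Jet} (h : J ∈ sobolevJets Ω) :
    JetL2loc Ω J :=
  ⟨MemLp.memL2loc h.1, fun i => MemLp.memL2loc (h.2.1 i), fun i j => MemLp.memL2loc (h.2.2.1 i j)⟩

theorem sobolevJets_unique {Ω : Set Plane} (hΩ : IsOpen Ω) {J J' : Jet} (h : J ∈ sobolevJets Ω)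
    (h' : J' ∈ sobolevJets Ω) (e : J.1 =ᵐ[volume.restrict Ω] J'.1) :
    (∀ i, J.2.1 i =ᵐ[volume.restrict Ω] J'.2.1 i) ∧
      ∀ i j, J.2.2 i j =ᵐ[volume.restrict Ω] J'.2.2 i j := by
  have key := h.2.2.2.ae_unique hΩ h'.2.2.2 (jetL2loc_of_mem_sobolevJets h)
    (jetL2loc_of_mem_sobolevJets h') e
  exact ⟨fun i => key.mono fun x hx => hx.2.1 i, fun i j => key.mono fun x hx => hx.2.2 i j⟩

/-- A family of linear maps from `L²` to jets in `H²`, continuous in `L²`, is continuous in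
`H²`. -/
theorem exists_jetNorm_le {Ω : Set Plane} (hΩ : IsOpen Ω) (B : L2 Ω →L[ℂ] L2 Ω) (K : L2 Ω → Jet)
    (hK : ∀ f, K f ∈ sobolevJets Ω) (hB : ∀ f, B f =ᵐ[volume.restrict Ω] (K f).1) :
    ∃ C : ℝ≥0, ∀ f, jetNorm Ω (K f) ≤ C * ‖f‖ₑ := by
  have add1 : ∀ f g, (K (f + g)).1 =ᵐ[volume.restrict Ω] (K f + K g).1 := by
    intro f g
    refine (hB _).symm.trans ?_
    rw [map_add]
    exact (Lp.coeFn_add _ _).trans ((hB f).add (hB g))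
  have smul1 : ∀ (c : ℂ) f, (K (c • f)).1 =ᵐ[volume.restrict Ω] (c • K f).1 := by
    intro c f
    refine (hB _).symm.trans ?_
    rw [map_smul]
    exact (Lp.coeFn_smul _ _).trans ((hB f).const_smul c)
  have add2 := fun f g => sobolevJets_unique hΩ (hK (f + g)) (Submodule.add_mem _ (hK f) (hK g))
    (add1 f g)
  have smul2 := fun (c : ℂ) f => sobolevJets_unique hΩ (hK (c • f))
    (Submodule.smul_mem _ c (hK f)) (smul1 c f)
  let G : Fin 2 → L2 Ω →ₗ[ℂ] L2 Ω := fun i =>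
    { toFun := fun f => ((hK f).2.1 i).toLp _
      map_add' := fun f g => by
        rw [← MemLp.toLp_add]
        exact MemLp.toLp_congr _ _ ((add2 f g).1 i)
      map_smul' := fun c f => by
        rw [RingHom.id_apply, ← MemLp.toLp_const_smul]
        exact MemLp.toLp_congr _ _ ((smul2 c f).1 i) }
  let H : Fin 2 → Fin 2 → L2 Ω →ₗ[ℂ] L2 Ω := fun i j =>
    { toFun := fun f => ((hK f).2.2.1 i j).toLp _
      map_add' := fun f g => by
        rw [← MemLp.toLp_add]
        exact MemLp.toLp_congr _ _ ((add2 f g).2 i j)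
      map_smul' := fun c f => by
        rw [RingHom.id_apply, ← MemLp.toLp_const_smul]
        exact MemLp.toLp_congr _ _ ((smul2 c f).2 i j) }
  have hG : ∀ i f, G i f =ᵐ[volume.restrict Ω] (K f).2.1 i := fun i f =>
    ((hK f).2.1 i).coeFn_toLp
  have hH : ∀ i j f, H i j f =ᵐ[volume.restrict Ω] (K f).2.2 i j := fun i j f =>
    ((hK f).2.2.1 i j).coeFn_toLp
  have wG : ∀ i f, IsWeakDeriv Ω i (B f) (G i f) := fun i f =>
    ((hK f).2.2.2.1 i).congr (hB f).symm (hG i f).symm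
  have wH : ∀ i j f, IsWeakDeriv Ω j (G i f) (H i j f) := fun i j f =>
    ((hK f).2.2.2.2 i j).congr (hG i f).symm (hH i j f).symm
  have loc : ∀ f : L2 Ω, MemL2loc Ω f := fun f => MemLp.memL2loc (Lp.memLp f)
  -- The closed graph theorem, first for the gradient and then for the Hessian: weak derivatives
  -- pass to L² limits and are unique.
  have cG : ∀ i, Continuous (G i) := fun i =>
    LinearMap.continuous_of_seq_closed_graph _ fun f x y hx hy => by
      have w := isWeakDeriv_of_tendsto (fun n => wG i (f n)) ((B.continuous.tendsto x).comp hx) hy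
      exact Lp.ext (w.ae_unique hΩ (wG i x) (loc _) (loc _) (loc _) (loc _) (by rfl))
  have cH : ∀ i j, Continuous (H i j) := fun i j =>
    LinearMap.continuous_of_seq_closed_graph _ fun f x y hx hy => by
      have w := isWeakDeriv_of_tendsto (fun n => wH i j (f n)) (((cG i).tendsto x).comp hx) hy
      exact Lp.ext (w.ae_unique hΩ (wH i j x) (loc _) (loc _) (loc _) (loc _) (by rfl))
  let G' : Fin 2 → L2 Ω →L[ℂ] L2 Ω := fun i => ⟨G i, cG i⟩
  let H' : Fin 2 → Fin 2 → L2 Ω →L[ℂ] L2 Ω := fun i j => ⟨H i j, cH i j⟩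
  refine ⟨‖B‖₊ + ∑ i, ‖G' i‖₊ + ∑ i, ∑ j, ‖H' i j‖₊, fun f => ?_⟩
  have e0 : eLpNorm (K f).1 2 (volume.restrict Ω) = ‖B f‖ₑ := by
    rw [Lp.enorm_def]; exact eLpNorm_congr_ae (hB f).symm
  have e1 : ∀ i, eLpNorm ((K f).2.1 i) 2 (volume.restrict Ω) = ‖G' i f‖ₑ := fun i => by
    rw [Lp.enorm_def]; exact eLpNorm_congr_ae (hG i f).symm
  have e2 : ∀ i j, eLpNorm ((K f).2.2 i j) 2 (volume.restrict Ω) = ‖H' i j f‖ₑ := fun i j => by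
    rw [Lp.enorm_def]; exact eLpNorm_congr_ae (hH i j f).symm
  rw [jetNorm, e0]
  simp only [e1, e2]
  push_cast
  rw [add_mul, add_mul, Finset.sum_mul, Finset.sum_mul]
  gcongr with i _ i _
  · exact B.le_opENorm f
  · exact (G' i).le_opENorm f
  · rw [Finset.sum_mul]
    gcongr with j _
    exact (H' i j).le_opENorm f

/-- Solvability and the elliptic estimate in the plane, off the real axis. -/
theorem plane_resolvent {L : RealDiffOp} (hsa : IsSelfAdjoint L.planeOp) {z : ℂ} (hz : z.im ≠ 0) :
    ∃ C : ℝ≥0, (∀ J ∈ sobolevJets univ, jetNorm univ J ≤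
        C * eLpNorm (L.onJet J - z • J.1) 2 (volume.restrict univ)) ∧
      ∀ f : L2 univ, ∃ J ∈ sobolevJets univ, L.onJet J - z • J.1 =ᵐ[volume.restrict univ] f := by
  obtain ⟨B, hB1, hB2⟩ := inResolventSet_of_isSelfAdjoint hsa hz
  have hgr : ∀ f, ∃ J ∈ sobolevJets univ, B f =ᵐ[volume.restrict univ] J.1 ∧
      L.onJet J - z • J.1 =ᵐ[volume.restrict univ] f := by
    intro f
    obtain ⟨hd, he⟩ := hB1 f
    have hm := LinearPMap.mem_graph L.planeOp ⟨B f, hd⟩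
    rw [L.planeOp_graph] at hm
    obtain ⟨J, hJ, h1, h2⟩ := hm
    refine ⟨J, hJ, h1, ?_⟩
    have h3 := Lp.coeFn_sub (L.planeOp ⟨B f, hd⟩) (z • B f)
    have h4 := Lp.coeFn_smul z (B f)
    rw [he] at h3
    filter_upwards [h1, h2, h3, h4] with x k1 k2 k3 k4
    rw [k3]
    simp only [Pi.sub_apply, k4, Pi.smul_apply, k1, k2]
  choose K hK1 hK2 hK3 using hgr
  -- The H² estimate does not come from ellipticity of the coefficients. It follows from the
  -- self-adjointness with domain H²: the resolvent is bounded and takes values in H².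
  obtain ⟨C, hC⟩ := exists_jetNorm_le isOpen_univ B K hK1 hK2
  refine ⟨C, fun J hJ => ?_, fun f => ⟨K f, hK1 f, hK3 f⟩⟩
  have m0 := memLp_onJet L hJ.1 hJ.2.1 hJ.2.2.1
  have m1 : MemLp (L.onJet J - z • J.1) 2 (volume.restrict univ) := m0.sub (hJ.1.const_smul z)
  have hg : ((hJ.1.toLp _, m0.toLp _) : L2 univ × L2 univ) ∈ L.planeOp.graph := by
    rw [L.planeOp_graph]
    exact ⟨J, hJ, hJ.1.coeFn_toLp, m0.coeFn_toLp⟩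
  have hdom := LinearPMap.mem_domain_of_mem_graph hg
  have hBf : B (m1.toLp _) = hJ.1.toLp _ := by
    have := hB2 ⟨_, hdom⟩
    rw [← (LinearPMap.image_iff hdom).2 hg] at this
    rw [MemLp.toLp_sub m0 (hJ.1.const_smul z), MemLp.toLp_const_smul z hJ.1]
    exact this
  have he : (K (m1.toLp _)).1 =ᵐ[volume.restrict univ] J.1 := by
    refine (hK2 _).symm.trans ?_
    rw [hBf]
    exact hJ.1.coeFn_toLp
  have hu := sobolevJets_unique isOpen_univ (hK1 _) hJ he
  have hn : jetNorm univ (K (m1.toLp _)) = jetNorm univ J := by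
    simp only [jetNorm]
    rw [eLpNorm_congr_ae he]
    congr 1
    · congr 1
      exact Finset.sum_congr rfl fun i _ => eLpNorm_congr_ae (hu.1 i)
    · exact Finset.sum_congr rfl fun i _ => Finset.sum_congr rfl fun j _ =>
        eLpNorm_congr_ae (hu.2 i j)
  rw [← hn, ← Lp.enorm_toLp (hf := m1)]
  exact hC _

/-! ### Cutoff functions -/

theorem IsWeakDeriv.mul_smooth {Ω : Set Plane} {i : Fin 2} {u w : Plane → ℂ}
    (h : IsWeakDeriv Ω i u w) (hu : MemL2loc Ω u) (hw : MemL2loc Ω w) {χ : Plane → ℝ}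
    (hχ : ContDiff ℝ ∞ χ) :
    IsWeakDeriv Ω i (fun x => (χ x : ℂ) * u x)
      (fun x => (χ x : ℂ) * w x + (fderiv ℝ χ x (basisVec i) : ℂ) * u x) := by
  intro φ h1 h2 h3
  have c1 : ContDiff ℝ ∞ (fun x => φ x * χ x) := h1.mul hχ
  have c2 : HasCompactSupport (fun x => φ x * χ x) := h2.mul_right
  have key := h _ c1 c2 ((tsupport_mul_subset_left).trans h3)
  have hd : ∀ x, fderiv ℝ (fun x => φ x * χ x) x (basisVec i) =
      φ x * fderiv ℝ χ x (basisVec i) + χ x * fderiv ℝ φ x (basisVec i) := fun x => by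
    rw [fderiv_fun_mul ((h1.differentiable (by simp)) x) ((hχ.differentiable (by simp)) x)]
    simp
  have hc := fderiv_apply_continuous hχ (basisVec i)
  have i1 : Integrable (fun x => (fderiv ℝ φ x (basisVec i) : ℂ) * ((χ x : ℂ) * u x))
      (volume.restrict Ω) := by
    have := hu.integrable_mul (φ := fun x => fderiv ℝ φ x (basisVec i) * χ x)
      ((fderiv_apply_continuous h1 _).mul hχ.continuous) (fderiv_apply_compact h2 _).mul_right
    refine this.congr (ae_of_all _ fun x => ?_)
    push_cast
    ring
  have i2 : Integrable (fun x => (φ x : ℂ) * ((fderiv ℝ χ x (basisVec i) : ℂ) * u x))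
      (volume.restrict Ω) := by
    have := hu.integrable_mul (φ := fun x => φ x * fderiv ℝ χ x (basisVec i))
      (h1.continuous.mul hc) h2.mul_right
    refine this.congr (ae_of_all _ fun x => ?_)
    push_cast
    ring
  have i3 : Integrable (fun x => (φ x : ℂ) * ((χ x : ℂ) * w x)) (volume.restrict Ω) := by
    have := hw.integrable_mul c1.continuous c2
    refine this.congr (ae_of_all _ fun x => ?_)
    push_cast
    ring
  have e1 : ∫ x in Ω, (fderiv ℝ (fun x => φ x * χ x) x (basisVec i) : ℂ) * u x =
      (∫ x in Ω, (φ x : ℂ) * ((fderiv ℝ χ x (basisVec i) : ℂ) * u x)) +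
      ∫ x in Ω, (fderiv ℝ φ x (basisVec i) : ℂ) * ((χ x : ℂ) * u x) := by
    rw [← integral_add i2 i1]
    congr 1
    funext x
    rw [hd]
    push_cast
    ring
  have e2 : ∫ x in Ω, ((φ x * χ x : ℝ) : ℂ) * w x = ∫ x in Ω, (φ x : ℂ) * ((χ x : ℂ) * w x) := by
    congr 1
    funext x
    push_cast
    ring
  rw [e1, e2] at key
  simp only [mul_add]
  rw [integral_add i3 i2]
  linear_combination key

/-- Multiplication of a jet by a smooth function. -/
def mulJet (χ : Plane → ℝ) (J : Jet) : Jet :=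
  (fun x => (χ x : ℂ) * J.1 x,
    fun i x => (χ x : ℂ) * J.2.1 i x + (fderiv ℝ χ x (basisVec i) : ℂ) * J.1 x,
    fun i j x => ((χ x : ℂ) * J.2.2 i j x + (fderiv ℝ χ x (basisVec j) : ℂ) * J.2.1 i x) +
      ((fderiv ℝ χ x (basisVec i) : ℂ) * J.2.1 j x +
        (fderiv ℝ (fun y => fderiv ℝ χ y (basisVec i)) x (basisVec j) : ℂ) * J.1 x))

theorem memLp_mul_compact {f : Plane → ℂ} (hf : MemL2loc univ f) {χ : Plane → ℝ}
    (hc : Continuous χ) (hs : HasCompactSupport χ) :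
    MemLp (fun x => (χ x : ℂ) * f x) 2 (volume.restrict univ) := by
  have h1 := (memLp_indicator_iff_restrict (s := tsupport χ) hs.measurableSet).2 (hf _ hs)
  obtain ⟨C, hC⟩ := hs.exists_bound_of_continuous hc
  have e : (fun x => (χ x : ℂ) * f x) = fun x => (χ x : ℂ) * (tsupport χ).indicator f x := by
    funext x
    by_cases hx : x ∈ tsupport χ
    · rw [indicator_of_mem hx]
    · rw [image_eq_zero_of_notMem_tsupport hx]; simp
  rw [e]
  refine MemLp.of_le_mul (c := C) h1 ((Complex.continuous_ofReal.comp
    hc).aestronglyMeasurable.mul h1.1) (ae_of_all _ fun x => ?_)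
  rw [norm_mul, Complex.norm_real]
  exact mul_le_mul_of_nonneg_right (hC x) (norm_nonneg _)

theorem mulJet_mem {J : Jet} (hJ : IsWeakJet univ J) (hl : JetL2loc univ J) {χ : Plane → ℝ}
    (hχ : ContDiff ℝ ∞ χ) (hs : HasCompactSupport χ) : mulJet χ J ∈ sobolevJets univ := by
  have d1 : ∀ i, ContDiff ℝ ∞ (fun y => fderiv ℝ χ y (basisVec i)) := fun i =>
    (hχ.fderiv_right (m := ∞) (by simp)).clm_apply contDiff_const
  have s1 : ∀ i, HasCompactSupport (fun y => fderiv ℝ χ y (basisVec i)) := fun i =>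
    fderiv_apply_compact hs _
  have s2 : ∀ i j, HasCompactSupport
      (fun x => fderiv ℝ (fun y => fderiv ℝ χ y (basisVec i)) x (basisVec j)) := fun i j =>
    fderiv_apply_compact (s1 i) _
  have c2 : ∀ i j, Continuous
      (fun x => fderiv ℝ (fun y => fderiv ℝ χ y (basisVec i)) x (basisVec j)) := fun i j =>
    fderiv_apply_continuous (d1 i) _
  have m0 := memLp_mul_compact hl.1 hχ.continuous hs
  have m1 := fun i => memLp_mul_compact (hl.2.1 i) hχ.continuous hs
  have m2 := fun i j => memLp_mul_compact (hl.2.2 i j) hχ.continuous hs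
  have n0 := fun i => memLp_mul_compact hl.1 (d1 i).continuous (s1 i)
  have n1 := fun i j => memLp_mul_compact (hl.2.1 j) (d1 i).continuous (s1 i)
  have p0 := fun i j => memLp_mul_compact hl.1 (c2 i j) (s2 i j)
  refine ⟨m0, fun i => (m1 i).add (n0 i), fun i j => ((m2 i j).add (n1 j i)).add
    ((n1 i j).add (p0 i j)), fun i => (hJ.1 i).mul_smooth hl.1 (hl.2.1 i) hχ, fun i j => ?_⟩
  exact ((hJ.2 i j).mul_smooth (hl.2.1 i) (hl.2.2 i j) hχ).add
    ((hJ.1 j).mul_smooth hl.1 (hl.2.1 j) (d1 i)) (MemLp.memL2loc (m1 i))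
    (MemLp.memL2loc ((m2 i j).add (n1 j i))) (MemLp.memL2loc (n0 i))
    (MemLp.memL2loc ((n1 i j).add (p0 i j)))

/-- A smooth cutoff at the scale `N` whose first and second derivatives are bounded by `ε`. -/
structure IsCutoff (N : ℕ) (ε : ℝ) (χ : Plane → ℝ) : Prop where
  smooth : ContDiff ℝ ∞ χ
  compact : HasCompactSupport χ
  abs_le : ∀ x, |χ x| ≤ 1
  eq_one : ∀ x ∈ Metric.ball (0 : Plane) (3 * N), χ x = 1
  tsupport_subset : tsupport χ ⊆ Metric.ball (0 : Plane) (6 * N)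
  deriv_le : ∀ i x, |fderiv ℝ χ x (basisVec i)| ≤ ε
  deriv_deriv_le : ∀ i j x, |fderiv ℝ (fun y => fderiv ℝ χ y (basisVec i)) x (basisVec j)| ≤ ε

/-- A fixed bump is dilated by `N`. First derivatives scale like 1/N and second ones like 1/N²,
which is no larger. -/
theorem exists_cutoff : ∃ C : ℝ, 0 ≤ C ∧ ∀ N : ℕ, 1 ≤ N → ∃ χ, IsCutoff N (C / N) χ := by
  -- The outer radius 5 keeps the closed support inside the open ball of radius `6 * N` after
  -- dilation.
  let b : ContDiffBump (0 : Plane) := ⟨3, 5, by norm_num, by norm_num⟩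
  have hb : ContDiff ℝ ∞ b := b.contDiff
  have hs : HasCompactSupport b := b.hasCompactSupport
  have d1 : ∀ i, ContDiff ℝ ∞ (fun y => fderiv ℝ b y (basisVec i)) := fun i =>
    (hb.fderiv_right (m := ∞) (by simp)).clm_apply contDiff_const
  have s1 : ∀ i, HasCompactSupport (fun y => fderiv ℝ b y (basisVec i)) := fun i =>
    fderiv_apply_compact hs _
  choose C₁ hC₁ using fun i => (s1 i).exists_bound_of_continuous (d1 i).continuous
  choose C₂ hC₂ using fun i j => (fderiv_apply_compact (s1 i) (basisVec j)).exists_bound_of_continuous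
    (fderiv_apply_continuous (d1 i) (basisVec j))
  have p1 : ∀ i, 0 ≤ C₁ i := fun i => (norm_nonneg _).trans (hC₁ i 0)
  have p2 : ∀ i j, 0 ≤ C₂ i j := fun i j => (norm_nonneg _).trans (hC₂ i j 0)
  have q1 : ∀ i, C₁ i ≤ ∑ i, C₁ i := fun i =>
    Finset.single_le_sum (fun i _ => p1 i) (Finset.mem_univ i)
  have q2 : ∀ i j, C₂ i j ≤ ∑ i, ∑ j, C₂ i j := fun i j =>
    (Finset.single_le_sum (fun j _ => p2 i j) (Finset.mem_univ j)).trans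
      (Finset.single_le_sum (f := fun i => ∑ j, C₂ i j)
        (fun i _ => Finset.sum_nonneg fun j _ => p2 i j) (Finset.mem_univ i))
  have r1 : 0 ≤ ∑ i, C₁ i := Finset.sum_nonneg fun i _ => p1 i
  have r2 : 0 ≤ ∑ i, ∑ j, C₂ i j := Finset.sum_nonneg fun i _ => Finset.sum_nonneg fun j _ => p2 i j
  refine ⟨∑ i, C₁ i + ∑ i, ∑ j, C₂ i j, by positivity, fun N hN => ?_⟩
  have hN0 : (0 : ℝ) < N := by exact_mod_cast hN
  have hN1 : (1 : ℝ) ≤ N := by exact_mod_cast hN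
  have hscale : ∀ {φ : Plane → ℝ}, Differentiable ℝ φ → ∀ i x,
      fderiv ℝ (fun y => φ ((N : ℝ)⁻¹ • y)) x (basisVec i) =
        (N : ℝ)⁻¹ * fderiv ℝ φ ((N : ℝ)⁻¹ • x) (basisVec i) := by
    intro φ hφ i x
    have h1 : HasFDerivAt (fun y : Plane => (N : ℝ)⁻¹ • y)
        ((N : ℝ)⁻¹ • ContinuousLinearMap.id ℝ Plane) x :=
      ((N : ℝ)⁻¹ • ContinuousLinearMap.id ℝ Plane).hasFDerivAt
    have := ((hφ ((N : ℝ)⁻¹ • x)).hasFDerivAt.comp x h1).fderiv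
    rw [show (fun y => φ ((N : ℝ)⁻¹ • y)) = φ ∘ fun y => (N : ℝ)⁻¹ • y from rfl, this]
    simp
  have hd := hb.differentiable (by simp)
  have hnorm : ∀ x : Plane, ‖(N : ℝ)⁻¹ • x‖ = ‖x‖ / N := fun x => by
    rw [norm_smul, norm_inv, Real.norm_natCast, inv_mul_eq_div]
  have hsupp : tsupport (fun y => b ((N : ℝ)⁻¹ • y)) ⊆ Metric.closedBall (0 : Plane) (5 * N) := by
    refine closure_minimal (fun x hx => ?_) Metric.isClosed_closedBall
    have hx' : (N : ℝ)⁻¹ • x ∈ Function.support b := hx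
    rw [b.support_eq, Metric.mem_ball, dist_zero_right, hnorm, div_lt_iff₀ hN0] at hx'
    rw [Metric.mem_closedBall, dist_zero_right]
    exact hx'.le
  have hinv : (N : ℝ)⁻¹ * (N : ℝ)⁻¹ ≤ (N : ℝ)⁻¹ := by
    have : (N : ℝ)⁻¹ ≤ 1 := inv_le_one_of_one_le₀ hN1
    nlinarith [inv_pos.2 hN0]
  refine ⟨fun y => b ((N : ℝ)⁻¹ • y), hb.comp (contDiff_const_smul _), ?_, fun x => ?_, fun x hx => ?_,
    hsupp.trans (Metric.closedBall_subset_ball (by linarith)), fun i x => ?_, fun i j x => ?_⟩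
  · exact IsCompact.of_isClosed_subset (isCompact_closedBall _ _) (isClosed_tsupport _) hsupp
  · rw [abs_of_nonneg b.nonneg]
    exact b.le_one
  · refine b.one_of_mem_closedBall ?_
    rw [Metric.mem_ball, dist_zero_right] at hx
    rw [Metric.mem_closedBall, dist_zero_right, hnorm, div_le_iff₀ hN0]
    exact hx.le
  · rw [hscale hd, abs_mul, abs_of_pos (inv_pos.2 hN0), inv_mul_eq_div]
    gcongr
    have := hC₁ i ((N : ℝ)⁻¹ • x)
    rw [Real.norm_eq_abs] at this
    linarith [q1 i]
  · have e : (fun y => fderiv ℝ (fun y => b ((N : ℝ)⁻¹ • y)) y (basisVec i)) =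
        fun y => (N : ℝ)⁻¹ * (fun y => fderiv ℝ b y (basisVec i)) ((N : ℝ)⁻¹ • y) := by
      funext y
      exact hscale hd i y
    have hd' : Differentiable ℝ fun y : Plane => fderiv ℝ b ((N : ℝ)⁻¹ • y) (basisVec i) :=
      ((d1 i).comp (contDiff_const_smul ((N : ℝ)⁻¹))).differentiable (by simp)
    rw [e, fderiv_const_mul (hd' x)]
    rw [smul_apply, hscale ((d1 i).differentiable (by simp)), smul_eq_mul, ← mul_assoc, abs_mul,
      abs_of_pos (by positivity), div_eq_inv_mul]
    have := hC₂ i j ((N : ℝ)⁻¹ • x)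
    rw [Real.norm_eq_abs] at this
    exact mul_le_mul hinv (by linarith [q2 i j]) (abs_nonneg _) (by positivity)

/-- The commutator of the differential expression with a cutoff. -/
theorem exists_commutator_le (L : RealDiffOp) : ∃ K : ℝ, 0 ≤ K ∧ ∀ {N : ℕ} {ε : ℝ} {χ : Plane → ℝ},
    IsCutoff N ε χ → ∀ J : Jet, JetL2loc univ J →
      eLpNorm (fun x => L.onJet (mulJet χ J) x - (χ x : ℂ) * L.onJet J x) 2 (volume.restrict univ) ≤
        ENNReal.ofReal (K * ε) * jetNorm (Metric.ball 0 (6 * N)) J := by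
  choose A hA using L.bounded_a
  choose B hB using L.bounded_b
  have A0 : ∀ i j, 0 ≤ A i j := fun i j => (abs_nonneg _).trans (hA i j 0)
  have B0 : ∀ i, 0 ≤ B i := fun i => (abs_nonneg _).trans (hB i 0)
  have AB0 : 0 ≤ ∑ i, ∑ j, 2 * A i j + ∑ i, B i := add_nonneg
    (Finset.sum_nonneg fun i _ => Finset.sum_nonneg fun j _ => by linarith [A0 i j])
    (Finset.sum_nonneg fun i _ => B0 i)
  refine ⟨∑ i, ∑ j, 2 * A i j + ∑ i, B i, AB0, fun {N ε χ} hχ J hl => ?_⟩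
  set K := ∑ i, ∑ j, 2 * A i j + ∑ i, B i with hK
  have hε : 0 ≤ ε := (abs_nonneg _).trans (hχ.deriv_le 0 0)
  set R : Plane → ℂ := fun x => L.onJet (mulJet χ J) x - (χ x : ℂ) * L.onJet J x with hR
  -- In the commutator every term carries a derivative of the cutoff, so only the function and its
  -- gradient enter, each with a factor at most ε.
  have eR : ∀ x, R x = ∑ i, ∑ j, (L.a i j x : ℂ) * ((fderiv ℝ χ x (basisVec j) : ℂ) * J.2.1 i x +
      ((fderiv ℝ χ x (basisVec i) : ℂ) * J.2.1 j x +
        (fderiv ℝ (fun y => fderiv ℝ χ y (basisVec i)) x (basisVec j) : ℂ) * J.1 x)) +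
      ∑ i, (L.b i x : ℂ) * ((fderiv ℝ χ x (basisVec i) : ℂ) * J.1 x) := by
    intro x
    simp only [hR, onJet, mulJet, LinearMap.coe_mk, AddHom.coe_mk, Fin.sum_univ_two]
    ring
  have hsupp : Function.support R ⊆ Metric.ball 0 (6 * N) := by
    intro x hx
    by_contra hh
    have hx' : x ∉ tsupport χ := fun h => hh (hχ.tsupport_subset h)
    have z1 : fderiv ℝ χ x = 0 := fderiv_eq_zero_of_notMem_tsupport hx'
    have z2 : ∀ i, fderiv ℝ (fun y => fderiv ℝ χ y (basisVec i)) x = 0 := fun i => by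
      refine fderiv_eq_zero_of_notMem_tsupport fun h => hx' ?_
      have : tsupport (fun y => fderiv ℝ χ y (basisVec i)) ⊆ tsupport (fderiv ℝ χ) :=
        closure_mono fun y hy h0 => hy (by simp [h0])
      exact (this.trans (tsupport_fderiv_subset ℝ)) h
    apply hx
    rw [eR]
    simp [z1, z2]
  let g : Plane → ℝ := fun x => ‖J.1 x‖ + (‖J.2.1 0 x‖ + ‖J.2.1 1 x‖)
  have g0 : ∀ x, 0 ≤ g x := fun x => by positivity
  have hbound : ∀ x, ‖R x‖ ≤ K * ε * ‖g x‖ := by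
    intro x
    rw [Real.norm_of_nonneg (g0 x), eR]
    have b0 : ∀ i, ‖(fderiv ℝ χ x (basisVec i) : ℂ)‖ ≤ ε := fun i => by
      rw [Complex.norm_real]; exact hχ.deriv_le i x
    have b1 : ∀ i j, ‖(fderiv ℝ (fun y => fderiv ℝ χ y (basisVec i)) x (basisVec j) : ℂ)‖ ≤ ε :=
      fun i j => by rw [Complex.norm_real]; exact hχ.deriv_deriv_le i j x
    have D0 : ∀ i, ‖J.2.1 i x‖ ≤ ‖J.2.1 0 x‖ + ‖J.2.1 1 x‖ := fun i => by
      fin_cases i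
      · simp
      · simp
    have t1 : ∀ i j, ‖(L.a i j x : ℂ) * ((fderiv ℝ χ x (basisVec j) : ℂ) * J.2.1 i x +
      ((fderiv ℝ χ x (basisVec i) : ℂ) * J.2.1 j x +
        (fderiv ℝ (fun y => fderiv ℝ χ y (basisVec i)) x (basisVec j) : ℂ) * J.1 x))‖ ≤
        2 * A i j * (ε * g x) := by
      intro i j
      rw [norm_mul, Complex.norm_real, Real.norm_eq_abs]
      have : ‖(fderiv ℝ χ x (basisVec j) : ℂ) * J.2.1 i x +
          ((fderiv ℝ χ x (basisVec i) : ℂ) * J.2.1 j x +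
          (fderiv ℝ (fun y => fderiv ℝ χ y (basisVec i)) x (basisVec j) : ℂ) * J.1 x)‖ ≤
          ε * (‖J.2.1 0 x‖ + ‖J.2.1 1 x‖) + (ε * (‖J.2.1 0 x‖ + ‖J.2.1 1 x‖) + ε * ‖J.1 x‖) := by
        refine norm_add_le_of_le ?_ (norm_add_le_of_le ?_ ?_) <;> rw [norm_mul]
        · exact mul_le_mul (b0 j) (D0 i) (norm_nonneg _) hε
        · exact mul_le_mul (b0 i) (D0 j) (norm_nonneg _) hε
        · exact mul_le_mul_of_nonneg_right (b1 i j) (norm_nonneg _)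
      have h2 : ε * (‖J.2.1 0 x‖ + ‖J.2.1 1 x‖) + (ε * (‖J.2.1 0 x‖ + ‖J.2.1 1 x‖) + ε * ‖J.1 x‖) ≤
          2 * (ε * g x) := by
        have := mul_nonneg hε (norm_nonneg (J.1 x))
        simp only [g]
        linarith
      calc _ ≤ A i j * (2 * (ε * g x)) :=
            mul_le_mul (hA i j x) (this.trans h2) (norm_nonneg _) (A0 i j)
        _ = _ := by ring
    have t2 : ∀ i, ‖(L.b i x : ℂ) * ((fderiv ℝ χ x (basisVec i) : ℂ) * J.1 x)‖ ≤
        B i * (ε * g x) := by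
      intro i
      rw [norm_mul, norm_mul, Complex.norm_real, Real.norm_eq_abs]
      refine mul_le_mul (hB i x) (mul_le_mul (b0 i) ?_ (norm_nonneg _) hε) (by positivity) (B0 i)
      simp only [g]
      have := norm_nonneg (J.2.1 0 x)
      have := norm_nonneg (J.2.1 1 x)
      linarith
    calc _ ≤ ∑ i, ∑ j, 2 * A i j * (ε * g x) + ∑ i, B i * (ε * g x) :=
          norm_add_le_of_le (norm_sum_le_of_le _ fun i _ => norm_sum_le_of_le _ fun j _ => t1 i j)
            (norm_sum_le_of_le _ fun i _ => t2 i)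
      _ = _ := by
        rw [hK]
        simp only [← Finset.sum_mul]
        ring
  rw [Measure.restrict_univ, ← eLpNorm_restrict_eq_of_support_subset hsupp]
  refine (eLpNorm_le_mul_eLpNorm_of_ae_le_mul (ae_of_all _ hbound) 2).trans ?_
  gcongr
  set μ := volume.restrict (Metric.ball (0 : Plane) (6 * N))
  have hb : Bornology.IsBounded (Metric.ball (0 : Plane) (6 * N)) := Metric.isBounded_ball
  have m0 := (hl.1.memLp (subset_univ _) hb).1.norm
  have m1 := fun i => ((hl.2.1 i).memLp (subset_univ _) hb).1.norm
  calc eLpNorm g 2 μ ≤ eLpNorm (fun x => ‖J.1 x‖) 2 μ +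
        eLpNorm (fun x => ‖J.2.1 0 x‖ + ‖J.2.1 1 x‖) 2 μ :=
        eLpNorm_add_le m0 ((m1 0).add (m1 1)) (by norm_num)
    _ ≤ eLpNorm (fun x => ‖J.1 x‖) 2 μ + (eLpNorm (fun x => ‖J.2.1 0 x‖) 2 μ +
        eLpNorm (fun x => ‖J.2.1 1 x‖) 2 μ) := by
        gcongr
        exact eLpNorm_add_le (m1 0) (m1 1) (by norm_num)
    _ ≤ jetNorm (Metric.ball 0 (6 * N)) J := by
        rw [eLpNorm_norm, eLpNorm_norm, eLpNorm_norm, jetNorm, Fin.sum_univ_two]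
        exact le_self_add

/-! ### Growth of Bloch functions -/

theorem ae_add {P : Plane → Prop} (v : Plane) (h : ∀ᵐ x : Plane, P x) : ∀ᵐ x : Plane, P (x + v) :=
  (measurePreserving_add_right volume v).quasiMeasurePreserving.ae h

/-- The translations that leave the expression invariant form a subgroup of the lattice, and it
contains both generators. -/
theorem invariantUnder_lat {L : RealDiffOp} (ha₁ : L.InvariantUnder fun x => x + latticeA1)
    (ha₂ : L.InvariantUnder fun x => x + latticeA2) (n : ℤ × ℤ) :
    L.InvariantUnder fun x => x + lat n := by
  have l1 : lat (1, 0) = latticeA1 := by simp [lat]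
  have l2 : lat (0, 1) = latticeA2 := by simp [lat]
  let S : AddSubgroup (ℤ × ℤ) :=
    { carrier := {n | L.InvariantUnder fun x => x + lat n}
      zero_mem' := fun ψ hψ => ae_of_all _ fun x => by
        simp only [lat_zero, add_zero]
        rfl
      add_mem' := fun {n n'} hn hn' ψ hψ => by
        filter_upwards [ae_add (lat n') (hn ψ hψ),
          hn' (ψ ∘ fun x => x + lat n) (hψ.comp (contDiff_id.add contDiff_const))] with x a b
        have e : (ψ ∘ fun x => x + lat (n + n')) =
            (ψ ∘ fun x => x + lat n) ∘ fun x => x + lat n' := by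
          funext y
          simp only [Function.comp_apply, lat_add, add_comm (lat n), add_assoc]
        rw [e, b, a, lat_add, add_comm (lat n), ← add_assoc]
      neg_mem' := fun {n} hn ψ hψ => by
        have h := hn (ψ ∘ fun x => x + lat (-n)) (hψ.comp (contDiff_id.add contDiff_const))
        filter_upwards [ae_add (lat (-n)) h] with x a
        rw [lat_neg, neg_add_cancel_right, ← lat_neg] at a
        have e : (ψ ∘ fun x => x + lat (-n)) ∘ (fun x => x + lat n) = ψ := by
          funext y
          simp only [Function.comp_apply, add_assoc]
          rw [← lat_add, add_neg_cancel, lat_zero, add_zero]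
        rw [e] at a
        exact a.symm }
  have m1 : ((1, 0) : ℤ × ℤ) ∈ S := by
    change L.InvariantUnder _
    rw [l1]
    exact ha₁
  have m2 : ((0, 1) : ℤ × ℤ) ∈ S := by
    change L.InvariantUnder _
    rw [l2]
    exact ha₂
  have : n ∈ S := by
    have e : n = n.1 • ((1, 0) : ℤ × ℤ) + n.2 • ((0, 1) : ℤ × ℤ) := by ext <;> simp
    rw [e]
    exact S.add_mem (S.zsmul_mem m1 _) (S.zsmul_mem m2 _)
  exact this

theorem onJet_bloch {L : RealDiffOp} (ha₁ : L.InvariantUnder fun x => x + latticeA1)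
    (ha₂ : L.InvariantUnder fun x => x + latticeA2) {k : ℝ × ℝ} {J : Jet} (hJ : J ∈ blochJets k) :
    IsBloch k (L.onJet J) := by
  have hd : (1 : Matrix (Fin 2) (Fin 2) ℝ).det ≠ 0 := by simp
  have hl := jetL2loc_of_mem_blochJets hJ
  have hb := (isBloch_iff k _).1 hJ.2.2.2.2
  have key : ∀ n, L.InvariantUnder (fun x => x + lat n) →
      ∀ᵐ x : Plane, L.onJet J (x + lat n) = blochChar k n * L.onJet J x := by
    intro n hn
    have e : (fun x => x + lat n) = aff 1 (lat n) := funext fun x => (aff_one _ _).symm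
    rw [e] at hn
    have w := hJ.2.2.2.1.pull hd (lat n) hl
    have l := hl.pull hd (lat n)
    rw [preimage_univ] at w l
    have hs : IsWeakJet univ (blochChar k n • J) :=
      ⟨fun i => (hJ.2.2.2.1.1 i).smul _, fun i j => (hJ.2.2.2.1.2 i j).smul _⟩
    have hsl : JetL2loc univ (blochChar k n • J) :=
      ⟨hl.1.smul _, fun i => (hl.2.1 i).smul _, fun i j => (hl.2.2 i j).smul _⟩
    have h1 := onJet_ae_congr L isOpen_univ w hs l hsl (by
      rw [Measure.restrict_univ]
      filter_upwards [hb n] with x hx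
      simp only [pullJet, Function.comp_apply, aff_one]
      exact hx)
    rw [Measure.restrict_univ] at h1
    filter_upwards [h1, onJet_pullJet_ae hd hn hJ.2.2.2.1 hl] with x h1 h2
    rw [h2, map_smul, aff_one] at h1
    exact h1
  exact (isBloch_iff k _).2 fun n => key n (invariantUnder_lat ha₁ ha₂ n)

theorem eLpNorm_two_sq {f : Plane → ℂ} (μ : Measure Plane) :
    eLpNorm f 2 μ ^ 2 = ∫⁻ x, ‖f x‖ₑ ^ 2 ∂μ := by
  have := eLpNorm_nnreal_pow_eq_lintegral (f := f) (μ := μ) (p := 2) (by norm_num)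
  norm_num at this
  exact_mod_cast this

/-- Bloch phases have modulus 1, so each translated cell carries the same integral of |f|². This
makes the L² norm of a Bloch function on a ball grow linearly with the radius, from above and below.
-/
theorem lintegral_sum_translates {k : ℝ × ℝ} {f : Plane → ℂ} (hm : AEStronglyMeasurable f volume)
    (hf : IsBloch k f) (S : Finset (ℤ × ℤ)) :
    ∫⁻ x, ∑ n ∈ S, hexagon.indicator 1 (x - lat n) * ‖f x‖ₑ ^ 2 =
      S.card * ∫⁻ x in hexagon, ‖f x‖ₑ ^ 2 := by
  rw [isBloch_iff] at hf
  have hme : AEMeasurable (fun x => ‖f x‖ₑ ^ 2) volume := hm.enorm.pow_const 2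
  have hind : Measurable (hexagon.indicator (1 : Plane → ℝ≥0∞)) :=
    measurable_one.indicator measurableSet_hexagon
  have hme' : ∀ n ∈ S, AEMeasurable
      (fun x => hexagon.indicator 1 (x - lat n) * ‖f x‖ₑ ^ 2) volume := fun n _ =>
    ((hind.comp (measurable_id.sub_const (lat n))).aemeasurable).mul hme
  rw [lintegral_finsetSum' _ hme']
  have e : ∀ n, ∫⁻ x, hexagon.indicator 1 (x - lat n) * ‖f x‖ₑ ^ 2 =
      ∫⁻ x in hexagon, ‖f x‖ₑ ^ 2 := by
    intro n
    rw [← lintegral_add_right_eq_self _ (lat n), ← lintegral_indicator measurableSet_hexagon]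
    refine lintegral_congr_ae ?_
    filter_upwards [hf n] with x hx
    rw [add_sub_cancel_right, hx, enorm_mul, ← ofReal_norm (blochChar k n), norm_blochChar,
      ENNReal.ofReal_one, one_mul]
    by_cases hh : x ∈ hexagon <;> simp [hh]
  simp only [e, Finset.sum_const, nsmul_eq_mul]

/-- In the maximum norm the worst case is √3 N. The value 9/5 is chosen so that 9/5 N + 1 is still
below 3N for N ≥ 1. -/
theorem norm_lat_le (n : ℤ × ℤ) (N : ℕ) (h1 : |n.1| ≤ N) (h2 : |n.2| ≤ N) :
    ‖lat n‖ ≤ 9 / 5 * N := by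
  have h3 : √3 < 9 / 5 := by rw [Real.sqrt_lt' (by norm_num)]; norm_num
  have h0 : 0 ≤ √3 := Real.sqrt_nonneg 3
  obtain ⟨a1, a2⟩ := abs_le.1 h1
  obtain ⟨b1, b2⟩ := abs_le.1 h2
  have a1' : (-N : ℝ) ≤ n.1 := by exact_mod_cast a1
  have a2' : (n.1 : ℝ) ≤ N := by exact_mod_cast a2
  have b1' : (-N : ℝ) ≤ n.2 := by exact_mod_cast b1
  have b2' : (n.2 : ℝ) ≤ N := by exact_mod_cast b2
  have hN : (0 : ℝ) ≤ N := Nat.cast_nonneg N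
  rw [Prod.norm_def, lat_fst, lat_snd, Real.norm_eq_abs, Real.norm_eq_abs]
  refine max_le (abs_le.2 ⟨?_, ?_⟩) (abs_le.2 ⟨by linarith, by linarith⟩) <;> nlinarith

theorem card_square (M : ℕ) :
    (Finset.Icc (-(M : ℤ)) M ×ˢ Finset.Icc (-(M : ℤ)) M).card = (2 * M + 1) ^ 2 := by
  rw [Finset.card_product, Int.card_Icc]
  have : ((M : ℤ) + 1 - -(M : ℤ)).toNat = 2 * M + 1 := by omega
  rw [this, sq]

/-- A cell meeting the ball of radius 6N is centred at distance at most 6N + 1 ≤ 7N, so its indices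
are at most 14N in absolute value; there are (28N + 1)² ≤ (29N)² such cells. -/
theorem eLpNorm_ball_le {k : ℝ × ℝ} {f : Plane → ℂ} (hm : AEStronglyMeasurable f volume)
    (hf : IsBloch k f) {N : ℕ} (hN : 1 ≤ N) :
    eLpNorm f 2 (volume.restrict (Metric.ball 0 (6 * N))) ≤
      ENNReal.ofReal (29 * N) * eLpNorm f 2 (volume.restrict hexagon) := by
  have hN1 : (1 : ℝ) ≤ N := by exact_mod_cast hN
  rw [← ENNReal.pow_le_pow_left_iff (n := 2) (by norm_num), mul_pow, eLpNorm_two_sq, eLpNorm_two_sq]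
  let S := Finset.Icc (-((14 * N : ℕ) : ℤ)) (14 * N : ℕ) ×ˢ Finset.Icc (-((14 * N : ℕ) : ℤ)) (14 * N : ℕ)
  calc ∫⁻ x in Metric.ball 0 (6 * N), ‖f x‖ₑ ^ 2
      ≤ ∫⁻ x, ∑ n ∈ S, hexagon.indicator 1 (x - lat n) * ‖f x‖ₑ ^ 2 := by
        rw [← lintegral_indicator Metric.isOpen_ball.measurableSet]
        refine lintegral_mono_ae ?_
        filter_upwards [ae_exists_sub_lat_mem_hexagon] with x hx
        by_cases hb : x ∈ Metric.ball (0 : Plane) (6 * N)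
        · rw [indicator_of_mem hb]
          obtain ⟨n, hn⟩ := hx
          have hnS : n ∈ S := by
            have h1 := norm_le_of_mem_hexagon hn
            rw [Metric.mem_ball, dist_zero_right] at hb
            have h2 := norm_sub_norm_le (lat n) x
            rw [norm_sub_rev] at h2
            obtain ⟨h3, h4⟩ := abs_le_norm_lat n
            have h5 : ‖lat n‖ ≤ 7 * N := by linarith
            have h6 : (|n.1| : ℝ) ≤ ((14 * N : ℕ) : ℝ) := by push_cast; linarith
            have h7 : (|n.2| : ℝ) ≤ ((14 * N : ℕ) : ℝ) := by push_cast; linarith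
            have h8 : |n.1| ≤ ((14 * N : ℕ) : ℤ) := by exact_mod_cast h6
            have h9 : |n.2| ≤ ((14 * N : ℕ) : ℤ) := by exact_mod_cast h7
            exact Finset.mem_product.2 ⟨Finset.mem_Icc.2 (abs_le.1 h8), Finset.mem_Icc.2 (abs_le.1 h9)⟩
          refine le_trans ?_ (Finset.single_le_sum
            (f := fun n => hexagon.indicator (1 : Plane → ℝ≥0∞) (x - lat n) * ‖f x‖ₑ ^ 2)
            (fun _ _ => zero_le) hnS)
          simp [hn]
        · rw [indicator_of_notMem hb]
          exact zero_le
    _ = S.card * ∫⁻ x in hexagon, ‖f x‖ₑ ^ 2 := lintegral_sum_translates hm hf S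
    _ ≤ _ := by
        gcongr
        rw [card_square, ← ENNReal.ofReal_natCast, ← ENNReal.ofReal_pow (by positivity)]
        refine ENNReal.ofReal_le_ofReal ?_
        push_cast
        nlinarith

/-- The disjoint cells with indices at most N in absolute value lie in the ball of radius 3N, and
their number (2N + 1)² is at least N². -/
theorem le_eLpNorm_ball {k : ℝ × ℝ} {f : Plane → ℂ} (hm : AEStronglyMeasurable f volume)
    (hf : IsBloch k f) {N : ℕ} (hN : 1 ≤ N) :
    ENNReal.ofReal N * eLpNorm f 2 (volume.restrict hexagon) ≤
      eLpNorm f 2 (volume.restrict (Metric.ball 0 (3 * N))) := by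
  have hN1 : (1 : ℝ) ≤ N := by exact_mod_cast hN
  rw [← ENNReal.pow_le_pow_left_iff (n := 2) (by norm_num), mul_pow, eLpNorm_two_sq, eLpNorm_two_sq]
  let S := Finset.Icc (-(N : ℤ)) N ×ˢ Finset.Icc (-(N : ℤ)) N
  calc _ ≤ S.card * ∫⁻ x in hexagon, ‖f x‖ₑ ^ 2 := by
        gcongr
        rw [card_square, ← ENNReal.ofReal_natCast, ← ENNReal.ofReal_pow (by positivity)]
        refine ENNReal.ofReal_le_ofReal ?_
        push_cast
        nlinarith
    _ = ∫⁻ x, ∑ n ∈ S, hexagon.indicator 1 (x - lat n) * ‖f x‖ₑ ^ 2 :=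
        (lintegral_sum_translates hm hf S).symm
    _ ≤ ∫⁻ x in Metric.ball 0 (3 * N), ‖f x‖ₑ ^ 2 := by
        rw [← lintegral_indicator Metric.isOpen_ball.measurableSet]
        refine lintegral_mono fun x => ?_
        by_cases hx : ∃ n ∈ S, x - lat n ∈ hexagon
        · obtain ⟨n, hnS, hn⟩ := hx
          rw [Finset.sum_eq_single n]
          · have hb : x ∈ Metric.ball (0 : Plane) (3 * N) := by
              rw [Metric.mem_ball, dist_zero_right]
              have h1 := norm_le_of_mem_hexagon hn
              obtain ⟨h2, h3⟩ := Finset.mem_product.1 hnS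
              have h4 := norm_lat_le n N (abs_le.2 (Finset.mem_Icc.1 h2))
                (abs_le.2 (Finset.mem_Icc.1 h3))
              have h5 := norm_add_le (x - lat n) (lat n)
              rw [sub_add_cancel] at h5
              linarith
            rw [indicator_of_mem hb, indicator_of_mem hn]
            simp
          · intro n' _ hne
            rw [indicator_of_notMem, zero_mul]
            intro h
            apply hne
            have := eq_zero_of_mem_hexagon_add_lat (n := n' - n) h (by
              rw [sub_eq_add_neg n', lat_add, lat_neg]
              convert hn using 1
              abel)
            exact sub_eq_zero.1 this
          · exact fun h => absurd hnS h
        · push Not at hx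
          rw [Finset.sum_eq_zero]
          · exact zero_le
          · intro n hn
            rw [indicator_of_notMem (hx n hn), zero_mul]

/-! ### A priori estimate for Bloch functions -/

theorem mulJet_of_mem_ball {N : ℕ} {ε : ℝ} {χ : Plane → ℝ} (hχ : IsCutoff N ε χ) (J : Jet)
    {x : Plane} (hx : x ∈ Metric.ball (0 : Plane) (3 * N)) :
    (mulJet χ J).1 x = J.1 x ∧ (∀ i, (mulJet χ J).2.1 i x = J.2.1 i x) ∧
      ∀ i j, (mulJet χ J).2.2 i j x = J.2.2 i j x := by
  have h0 : ∀ y ∈ Metric.ball (0 : Plane) (3 * N), fderiv ℝ χ y = 0 := fun y hy => by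
    have : χ =ᶠ[nhds y] fun _ => (1 : ℝ) :=
      Filter.eventuallyEq_of_mem (Metric.isOpen_ball.mem_nhds hy) hχ.eq_one
    rw [this.fderiv_eq]
    simp
  have h1 : ∀ i, fderiv ℝ (fun y => fderiv ℝ χ y (basisVec i)) x = 0 := fun i => by
    have : (fun y => fderiv ℝ χ y (basisVec i)) =ᶠ[nhds x] fun _ => (0 : ℝ) :=
      Filter.eventuallyEq_of_mem (Metric.isOpen_ball.mem_nhds hx) fun y hy => by simp [h0 y hy]
    rw [this.fderiv_eq]
    simp
  refine ⟨?_, fun i => ?_, fun i j => ?_⟩ <;> simp [mulJet, hχ.eq_one x hx, h0 x hx, h1]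

theorem jetNorm_congr {Ω : Set Plane} {J J' : Jet} (hΩ : MeasurableSet Ω)
    (h : ∀ x ∈ Ω, J.1 x = J'.1 x ∧ (∀ i, J.2.1 i x = J'.2.1 i x) ∧
      ∀ i j, J.2.2 i j x = J'.2.2 i j x) : jetNorm Ω J = jetNorm Ω J' := by
  have hm := ae_restrict_mem (μ := volume) hΩ
  simp only [jetNorm]
  congr 1
  · congr 1
    · exact eLpNorm_congr_ae (hm.mono fun x hx => (h x hx).1)
    · exact Finset.sum_congr rfl fun i _ => eLpNorm_congr_ae (hm.mono fun x hx => (h x hx).2.1 i)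
  · exact Finset.sum_congr rfl fun i _ => Finset.sum_congr rfl fun j _ =>
      eLpNorm_congr_ae (hm.mono fun x hx => (h x hx).2.2 i j)

theorem jetNorm_mono {Ω Ω' : Set Plane} (h : Ω ⊆ Ω') (J : Jet) : jetNorm Ω J ≤ jetNorm Ω' J := by
  have hm := Measure.restrict_mono h (le_refl (volume : Measure Plane))
  simp only [jetNorm]
  gcongr

theorem jet_components_bloch {k : ℝ × ℝ} {J : Jet} (hJ : J ∈ blochJets k) :
    IsBloch k J.1 ∧ (∀ i, IsBloch k (J.2.1 i)) ∧ ∀ i j, IsBloch k (J.2.2 i j) := by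
  have h1 := weakDeriv_bloch hJ.1 hJ.2.1 hJ.2.2.2.1.1 hJ.2.2.2.2
  exact ⟨hJ.2.2.2.2, h1, fun i j => weakDeriv_bloch (hJ.2.1 i) (hJ.2.2.1 i) (hJ.2.2.2.1.2 i) (h1 i) j⟩

theorem MemL2loc.aestronglyMeasurable {f : Plane → ℂ} (h : MemL2loc univ f) :
    AEStronglyMeasurable f volume := by
  have hU : (⋃ N : ℕ, Metric.closedBall (0 : Plane) N) = univ := by
    refine eq_univ_of_forall fun x => ?_
    obtain ⟨N, hN⟩ := exists_nat_ge ‖x‖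
    exact mem_iUnion.2 ⟨N, by simpa using hN⟩
  rw [← Measure.restrict_univ (μ := (volume : Measure Plane)), ← hU, aestronglyMeasurable_iUnion_iff]
  intro N
  have := (h _ (isCompact_closedBall (0 : Plane) N)).1
  rwa [Measure.restrict_univ] at this

theorem jetNorm_ball_le {k : ℝ × ℝ} {J : Jet} (hJ : J ∈ blochJets k) {N : ℕ} (hN : 1 ≤ N) :
    jetNorm (Metric.ball 0 (6 * N)) J ≤ ENNReal.ofReal (29 * N) * jetNorm hexagon J := by
  obtain ⟨b0, b1, b2⟩ := jet_components_bloch hJ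
  simp only [jetNorm, mul_add, Finset.mul_sum]
  gcongr with i _ i _ j _
  · exact eLpNorm_ball_le hJ.1.aestronglyMeasurable b0 hN
  · exact eLpNorm_ball_le (hJ.2.1 i).aestronglyMeasurable (b1 i) hN
  · exact eLpNorm_ball_le (hJ.2.2.1 i j).aestronglyMeasurable (b2 i j) hN

theorem le_jetNorm_ball {k : ℝ × ℝ} {J : Jet} (hJ : J ∈ blochJets k) {N : ℕ} (hN : 1 ≤ N) :
    ENNReal.ofReal N * jetNorm hexagon J ≤ jetNorm (Metric.ball 0 (3 * N)) J := by
  obtain ⟨b0, b1, b2⟩ := jet_components_bloch hJ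
  simp only [jetNorm, mul_add, Finset.mul_sum]
  gcongr with i _ i _ j _
  · exact le_eLpNorm_ball hJ.1.aestronglyMeasurable b0 hN
  · exact le_eLpNorm_ball (hJ.2.1 i).aestronglyMeasurable (b1 i) hN
  · exact le_eLpNorm_ball (hJ.2.2.1 i j).aestronglyMeasurable (b2 i j) hN

theorem jetNorm_hexagon_ne_top {J : Jet} (hl : JetL2loc univ J) : jetNorm hexagon J ≠ ⊤ := by
  have hb := isBounded_hexagon
  rw [jetNorm]
  refine ENNReal.add_ne_top.2 ⟨ENNReal.add_ne_top.2 ⟨?_, ?_⟩, ?_⟩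
  · exact (hl.1.memLp (subset_univ _) hb).2.ne
  · exact ENNReal.sum_ne_top.2 fun i _ => ((hl.2.1 i).memLp (subset_univ _) hb).2.ne
  · exact ENNReal.sum_ne_top.2 fun i _ => ENNReal.sum_ne_top.2 fun j _ =>
      ((hl.2.2 i j).memLp (subset_univ _) hb).2.ne

theorem memL2loc_onJet (L : RealDiffOp) {J : Jet} (hl : JetL2loc univ J) :
    MemL2loc univ (L.onJet J) := fun K hK =>
  memLp_onJet L (hl.1 K hK) (fun i => hl.2.1 i K hK) fun i j => hl.2.2 i j K hK

theorem eLpNorm_cutoff_mul_le {N : ℕ} {ε : ℝ} {χ : Plane → ℝ} (hχ : IsCutoff N ε χ)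
    (f : Plane → ℂ) : eLpNorm (fun x => (χ x : ℂ) * f x) 2 (volume.restrict univ) ≤
      eLpNorm f 2 (volume.restrict (Metric.ball 0 (6 * N))) := by
  have hsupp : Function.support (fun x => (χ x : ℂ) * f x) ⊆ Metric.ball 0 (6 * N) := by
    intro x hx
    refine hχ.tsupport_subset (subset_tsupport _ fun h0 => hx ?_)
    simp [h0]
  rw [Measure.restrict_univ, ← eLpNorm_restrict_eq_of_support_subset hsupp]
  refine eLpNorm_mono fun x => ?_
  rw [norm_mul, Complex.norm_real]
  exact mul_le_of_le_one_left (norm_nonneg _) (hχ.abs_le x)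

/-- The estimate in the plane is applied to a cut-off Bloch function. Both sides grow like N times
norms over one cell, but the commutator carries an additional 1/N and is absorbed for large N. -/
theorem bloch_estimate {L : RealDiffOp} (hsa : IsSelfAdjoint L.planeOp)
    (ha₁ : L.InvariantUnder fun x => x + latticeA1)
    (ha₂ : L.InvariantUnder fun x => x + latticeA2) {z : ℂ} (hz : z.im ≠ 0) (k : ℝ × ℝ) :
    ∃ C : ℝ≥0, ∀ J ∈ blochJets k, jetNorm hexagon J ≤
      C * eLpNorm (L.onJet J - z • J.1) 2 (volume.restrict hexagon) := by
  obtain ⟨C₀, hC₀, -⟩ := plane_resolvent hsa hz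
  obtain ⟨K, hK0, hK⟩ := exists_commutator_le L
  obtain ⟨C₁, hC₁, hcut⟩ := exists_cutoff
  -- The inequality to be closed is N X ≤ 29 C₀ K C₁ X + 29 C₀ N Y, so 58 = 2 · 29 makes the first
  -- term at most half of the left side.
  obtain ⟨N, hN⟩ := exists_nat_ge (max 1 (58 * C₀ * K * C₁))
  have hN1' : (1 : ℝ) ≤ N := (le_max_left _ _).trans hN
  have hN1 : 1 ≤ N := by exact_mod_cast hN1'
  have hN2 : 58 * C₀ * K * C₁ ≤ N := (le_max_right _ _).trans hN
  obtain ⟨χ, hχ⟩ := hcut N hN1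
  refine ⟨58 * C₀, fun J hJ => ?_⟩
  have hl := jetL2loc_of_mem_blochJets hJ
  set F : Plane → ℂ := L.onJet J - z • J.1 with hF
  have hFl : MemL2loc univ F := (memL2loc_onJet L hl).sub (hl.1.smul z)
  have hFb : IsBloch k F := by
    intro n₁ n₂
    filter_upwards [onJet_bloch ha₁ ha₂ hJ n₁ n₂, hJ.2.2.2.2 n₁ n₂] with x h1 h2
    simp only [hF, Pi.sub_apply, Pi.smul_apply, smul_eq_mul, h1, h2]
    ring
  set X := jetNorm hexagon J with hX
  set Y := eLpNorm F 2 (volume.restrict hexagon) with hY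
  have hXt : X ≠ ⊤ := jetNorm_hexagon_ne_top hl
  have hYt : Y ≠ ⊤ := (hFl.memLp (subset_univ _) isBounded_hexagon).2.ne
  have hmul := mulJet_mem hJ.2.2.2.1 hl hχ.smooth hχ.compact
  have s1 : ENNReal.ofReal N * X ≤ jetNorm univ (mulJet χ J) := by
    refine (le_jetNorm_ball hJ hN1).trans ?_
    rw [← jetNorm_congr Metric.isOpen_ball.measurableSet fun x hx => mulJet_of_mem_ball hχ J hx]
    exact jetNorm_mono (subset_univ _) _
  have s2 := hC₀ _ hmul
  have s3 : eLpNorm (L.onJet (mulJet χ J) - z • (mulJet χ J).1) 2 (volume.restrict univ) ≤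
      ENNReal.ofReal (K * (C₁ / N)) * (ENNReal.ofReal (29 * N) * X) +
        ENNReal.ofReal (29 * N) * Y := by
    have e : L.onJet (mulJet χ J) - z • (mulJet χ J).1 =
        (fun x => L.onJet (mulJet χ J) x - (χ x : ℂ) * L.onJet J x) +
          fun x => (χ x : ℂ) * F x := by
      funext x
      simp only [hF, mulJet, Pi.sub_apply, Pi.add_apply, Pi.smul_apply, smul_eq_mul]
      ring
    have mJ := (memLp_onJet L hmul.1 hmul.2.1 hmul.2.2.1).1
    have mχ := (memLp_mul_compact (memL2loc_onJet L hl) hχ.smooth.continuous hχ.compact).1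
    have mF := (memLp_mul_compact hFl hχ.smooth.continuous hχ.compact).1
    rw [e]
    refine (eLpNorm_add_le (mJ.sub mχ) mF (by norm_num)).trans (add_le_add ?_ ?_)
    · refine (hK hχ J hl).trans ?_
      gcongr
      exact jetNorm_ball_le hJ hN1
    · exact (eLpNorm_cutoff_mul_le hχ F).trans (eLpNorm_ball_le hFl.aestronglyMeasurable hFb hN1)
  have tot := s1.trans (s2.trans (mul_le_mul_right s3 (C₀ : ℝ≥0∞)))
  have tot' : ENNReal.ofReal (N * X.toReal) ≤ ENNReal.ofReal (C₀ * (K * (C₁ / N) *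
      (29 * N * X.toReal) + 29 * N * Y.toReal)) := by
    rw [ENNReal.ofReal_mul (by positivity), ENNReal.ofReal_mul (by positivity),
      ENNReal.ofReal_add (by positivity) (by positivity), ENNReal.ofReal_mul (by positivity),
      ENNReal.ofReal_mul (p := 29 * N) (by positivity), ENNReal.ofReal_mul (p := 29 * N)
      (by positivity), ENNReal.ofReal_toReal hXt, ENNReal.ofReal_toReal hYt,
      ENNReal.ofReal_coe_nnreal]
    exact tot
  rw [ENNReal.ofReal_le_ofReal_iff (by positivity)] at tot'
  have hN0 : (0 : ℝ) < N := by linarith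
  have e2 : C₀ * (K * (C₁ / N) * (29 * N * X.toReal) + 29 * N * Y.toReal) =
      29 * C₀ * K * C₁ * X.toReal + 29 * C₀ * N * Y.toReal := by
    field_simp
  rw [e2] at tot'
  have hX0 : 0 ≤ X.toReal := ENNReal.toReal_nonneg
  have fin : X.toReal ≤ 58 * C₀ * Y.toReal := by
    have := mul_le_mul_of_nonneg_right hN2 hX0
    have h5 : N * X.toReal ≤ N * (58 * C₀ * Y.toReal) := by nlinarith
    exact le_of_mul_le_mul_left h5 hN0
  rw [← ENNReal.ofReal_toReal hXt, ← ENNReal.ofReal_toReal hYt, ← ENNReal.ofReal_coe_nnreal,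
    ← ENNReal.ofReal_mul (by positivity)]
  refine ENNReal.ofReal_le_ofReal ?_
  push_cast
  exact fin

/-! ### An approximate resolvent of the Bloch operator -/

/-- A relation which is close to the identity is onto. -/
theorem exists_mem_of_norm_sub_le {E : Type*} [NormedAddCommGroup E] [NormedSpace ℂ E]
    [CompleteSpace E] (S : Submodule ℂ (E × E)) (ht : ∀ f, ∃ g, (f, g) ∈ S)
    (hs : ∀ p ∈ S, ‖p.1 - p.2‖ ≤ 1 / 2 * ‖p.1‖) (f : E) : ∃ F, (F, f) ∈ S := by
  choose A hA using ht
  -- The closeness to the identity, applied to a difference with first entry zero, makes the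
  -- relation single valued; it is then the graph of an operator at distance at most 1/2 from the
  -- identity, and the Neumann series inverts it.
  have uniq : ∀ {x y y'}, (x, y) ∈ S → (x, y') ∈ S → y = y' := fun {x y y'} h h' => by
    have := hs _ (S.sub_mem h h')
    simp only [Prod.mk_sub_mk, sub_self, zero_sub, norm_neg, norm_zero, mul_zero] at this
    exact sub_eq_zero.1 (norm_le_zero_iff.1 this)
  let T : E →ₗ[ℂ] E :=
    { toFun := fun x => x - A x
      map_add' := fun x y => by
        rw [uniq (hA (x + y)) (S.add_mem (hA x) (hA y))]
        abel
      map_smul' := fun c x => by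
        rw [uniq (hA (c • x)) (S.smul_mem c (hA x)), RingHom.id_apply, smul_sub] }
  let T' : E →L[ℂ] E := T.mkContinuous (1 / 2) fun x => hs _ (hA x)
  have hT : ‖T'‖ < 1 := (T.mkContinuous_norm_le (by norm_num) _).trans_lt (by norm_num)
  obtain ⟨U, hU⟩ := isUnit_one_sub_of_norm_lt_one hT
  refine ⟨(↑U⁻¹ : E →L[ℂ] E) f, ?_⟩
  set F := (↑U⁻¹ : E →L[ℂ] E) f with hF
  have e : A F = f := by
    have h1 : (U : E →L[ℂ] E) F = f := by
      rw [hF, ← mul_apply_eq_comp, U.mul_inv, one_apply_eq_self]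
    rw [hU] at h1
    have h2 : (1 - T') F = F - (F - A F) := rfl
    rw [h2, sub_sub_cancel] at h1
    exact h1
  rw [← e]
  exact hA F

/-! ### Spreading over many cells and folding back -/

/-- The square of the indices of absolute value at most `M`. -/
def square (M : ℕ) : Finset (ℤ × ℤ) := Finset.Icc (-(M : ℤ)) M ×ˢ Finset.Icc (-(M : ℤ)) M

theorem mem_square {M : ℕ} {n : ℤ × ℤ} : n ∈ square M ↔ |n.1| ≤ M ∧ |n.2| ≤ M := by
  simp only [square, Finset.mem_product, Finset.mem_Icc, abs_le]

/-- A partial sum of the Bloch periodization. -/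
def foldSum (k : ℝ × ℝ) (S : Finset (ℤ × ℤ)) (F : Plane → ℂ) (x : Plane) : ℂ :=
  ∑ n ∈ S, blochChar k n * F (x - lat n)

theorem foldSum_add (k : ℝ × ℝ) (S : Finset (ℤ × ℤ)) (F G : Plane → ℂ) :
    foldSum k S (F + G) = foldSum k S F + foldSum k S G := by
  funext x
  simp only [foldSum, Pi.add_apply, mul_add, Finset.sum_add_distrib]

theorem foldSum_smul (k : ℝ × ℝ) (S : Finset (ℤ × ℤ)) (c : ℂ) (F : Plane → ℂ) :
    foldSum k S (c • F) = c • foldSum k S F := by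
  funext x
  simp only [foldSum, Pi.smul_apply, smul_eq_mul, Finset.mul_sum, mul_left_comm c]

theorem foldSum_zero (k : ℝ × ℝ) (S : Finset (ℤ × ℤ)) : foldSum k S 0 = 0 := by
  funext x
  simp [foldSum]

theorem foldSum_congr (k : ℝ × ℝ) (S : Finset (ℤ × ℤ)) {F G : Plane → ℂ} (h : F =ᵐ[volume] G) :
    foldSum k S F =ᵐ[volume] foldSum k S G := by
  have h' : ∀ᵐ x : Plane, ∀ n, F (x - lat n) = G (x - lat n) := ae_all_iff.2 fun n => by
    have := ae_add (-lat n) h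
    simpa only [← sub_eq_add_neg] using this
  filter_upwards [h'] with x hx
  simp only [foldSum, hx]

theorem mem_square_of_mem_ball {N : ℕ} (hN : 1 ≤ N) {x : Plane} {n : ℤ × ℤ} (hx : x ∈ hexagon)
    (h : x - lat n ∈ Metric.ball (0 : Plane) (6 * N)) : n ∈ square (14 * N) := by
  have hN1 : (1 : ℝ) ≤ N := by exact_mod_cast hN
  have h1 := norm_le_of_mem_hexagon hx
  rw [Metric.mem_ball, dist_zero_right] at h
  have h2 := norm_sub_norm_le (lat n) x
  rw [norm_sub_rev] at h2
  obtain ⟨h3, h4⟩ := abs_le_norm_lat n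
  have h6 : (|n.1| : ℝ) ≤ ((14 * N : ℕ) : ℝ) := by push_cast; linarith
  have h7 : (|n.2| : ℝ) ≤ ((14 * N : ℕ) : ℝ) := by push_cast; linarith
  exact mem_square.2 ⟨by exact_mod_cast h6, by exact_mod_cast h7⟩

theorem per_eq_foldSum (k : ℝ × ℝ) {F : Plane → ℂ} {N : ℕ} (hN : 1 ≤ N)
    (hF : ∀ x, x ∉ Metric.ball (0 : Plane) (6 * N) → F x = 0) {x : Plane} (hx : x ∈ hexagon) :
    per k F x = foldSum k (square (14 * N)) F x := by
  refine tsum_eq_sum fun n hn => ?_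
  rw [hF _ fun h => hn (mem_square_of_mem_ball hN hx h), mul_zero]

theorem sum_indicator_hexagon_le (S : Finset (ℤ × ℤ)) (x : Plane) :
    ∑ n ∈ S, hexagon.indicator (1 : Plane → ℝ≥0∞) (x + lat n) ≤ 1 := by
  by_cases hx : ∃ n ∈ S, x + lat n ∈ hexagon
  · obtain ⟨n, hnS, hn⟩ := hx
    rw [Finset.sum_eq_single_of_mem n hnS, indicator_of_mem hn, Pi.one_apply]
    intro n' _ hne
    refine indicator_of_notMem (fun h => hne ?_) _
    have := eq_zero_of_mem_hexagon_add_lat (n := n' - n) hn (by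
      rwa [add_assoc, ← lat_add, add_sub_cancel])
    exact sub_eq_zero.1 this
  · push Not at hx
    rw [Finset.sum_eq_zero fun n hn => indicator_of_notMem (hx n hn) _]
    exact zero_le

theorem enorm_sum_sq_le (S : Finset (ℤ × ℤ)) (g : ℤ × ℤ → ℂ) :
    ‖∑ n ∈ S, g n‖ₑ ^ 2 ≤ S.card * ∑ n ∈ S, ‖g n‖ₑ ^ 2 := by
  have h1 : ‖∑ n ∈ S, g n‖₊ ^ 2 ≤ (S.card : ℝ≥0) * ∑ n ∈ S, ‖g n‖₊ ^ 2 :=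
    (pow_le_pow_left₀ (zero_le) (nnnorm_sum_le S g) 2).trans
      (sq_sum_le_card_mul_sum_sq (s := S) (f := fun n => ‖g n‖₊))
  simp only [enorm]
  exact_mod_cast h1

/-- Cauchy–Schwarz over the (2M + 1)² terms costs this number in the squared norm. Summing the cells
costs nothing more, because translates of the hexagon are disjoint. -/
theorem eLpNorm_foldSum_le (k : ℝ × ℝ) (M : ℕ) {F : Plane → ℂ} (hF : AEStronglyMeasurable F volume) :
    eLpNorm (foldSum k (square M) F) 2 (volume.restrict hexagon) ≤
      ENNReal.ofReal (2 * M + 1) * eLpNorm F 2 volume := by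
  have hind : Measurable (hexagon.indicator (1 : Plane → ℝ≥0∞)) :=
    measurable_one.indicator measurableSet_hexagon
  have hme : AEMeasurable (fun x => ‖F x‖ₑ ^ 2) volume := hF.enorm.pow_const 2
  have hsub : ∀ n : ℤ × ℤ, AEMeasurable (fun x => ‖F (x - lat n)‖ₑ ^ 2) volume := fun n =>
    hme.comp_quasiMeasurePreserving
      (measurePreserving_sub_right volume (lat n)).quasiMeasurePreserving
  rw [← ENNReal.pow_le_pow_left_iff (n := 2) (by norm_num), mul_pow, eLpNorm_two_sq, eLpNorm_two_sq]
  calc ∫⁻ x in hexagon, ‖foldSum k (square M) F x‖ₑ ^ 2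
      ≤ ∫⁻ x in hexagon, (square M).card * ∑ n ∈ square M, ‖F (x - lat n)‖ₑ ^ 2 := by
        refine lintegral_mono fun x => (enorm_sum_sq_le _ _).trans_eq ?_
        simp only [enorm_mul, ← ofReal_norm (blochChar k _), norm_blochChar, ENNReal.ofReal_one,
          one_mul]
    _ = (square M).card * ∑ n ∈ square M, ∫⁻ x in hexagon, ‖F (x - lat n)‖ₑ ^ 2 := by
        rw [lintegral_const_mul' _ _ (ENNReal.natCast_ne_top _),
          lintegral_finsetSum' _ fun n _ => (hsub n).restrict]
    _ = (square M).card * ∑ n ∈ square M,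
          ∫⁻ x, hexagon.indicator 1 (x + lat n) * ‖F x‖ₑ ^ 2 := by
        congr 1
        refine Finset.sum_congr rfl fun n _ => ?_
        rw [← lintegral_indicator measurableSet_hexagon, ← lintegral_add_right_eq_self _ (lat n)]
        refine lintegral_congr fun x => ?_
        by_cases hh : x + lat n ∈ hexagon <;> simp [hh]
    _ = (square M).card * ∫⁻ x, (∑ n ∈ square M, hexagon.indicator 1 (x + lat n)) * ‖F x‖ₑ ^ 2 := by
        have hme' : ∀ n ∈ square M, AEMeasurable
            (fun x => hexagon.indicator 1 (x + lat n) * ‖F x‖ₑ ^ 2) volume := fun n _ =>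
          ((hind.comp (measurable_id.add_const (lat n))).aemeasurable).mul hme
        rw [← lintegral_finsetSum' _ hme']
        simp only [Finset.sum_mul]
    _ ≤ (square M).card * ∫⁻ x, ‖F x‖ₑ ^ 2 := by
        gcongr with x
        exact mul_le_of_le_one_left zero_le (sum_indicator_hexagon_le _ _)
    _ = _ := by
        rw [square, card_square, ← ENNReal.ofReal_pow (by positivity), ← ENNReal.ofReal_natCast]
        push_cast
        rfl

/-- The translates of a function on the hexagon over a square of indices. -/
theorem eLpNorm_translates_le (k : ℝ × ℝ) (M : ℕ) {F : Plane → ℂ}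
    (h0 : ∀ x, x ∉ hexagon → F x = 0) (hF : AEStronglyMeasurable F volume) :
    eLpNorm (foldSum k (square M) F) 2 volume ≤ ENNReal.ofReal (2 * M + 1) * eLpNorm F 2 volume := by
  have hme : AEMeasurable (fun x => ‖F x‖ₑ ^ 2) volume := hF.enorm.pow_const 2
  have hsub : ∀ n : ℤ × ℤ, AEMeasurable (fun x => ‖F (x - lat n)‖ₑ ^ 2) volume := fun n =>
    hme.comp_quasiMeasurePreserving
      (measurePreserving_sub_right volume (lat n)).quasiMeasurePreserving
  rw [← ENNReal.pow_le_pow_left_iff (n := 2) (by norm_num), mul_pow, eLpNorm_two_sq, eLpNorm_two_sq]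
  calc ∫⁻ x, ‖foldSum k (square M) F x‖ₑ ^ 2
      ≤ ∫⁻ x, ∑ n ∈ square M, ‖F (x - lat n)‖ₑ ^ 2 := by
        refine lintegral_mono fun x => ?_
        by_cases hx : ∃ n ∈ square M, x - lat n ∈ hexagon
        · obtain ⟨n, hnS, hn⟩ := hx
          rw [foldSum, Finset.sum_eq_single_of_mem n hnS]
          · rw [enorm_mul, ← ofReal_norm (blochChar k n), norm_blochChar, ENNReal.ofReal_one,
              one_mul]
            exact Finset.single_le_sum (f := fun n => ‖F (x - lat n)‖ₑ ^ 2)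
              (fun _ _ => zero_le) hnS
          · intro n' _ hne
            rw [h0 _ fun h => hne ?_, mul_zero]
            have := eq_zero_of_mem_hexagon_add_lat (n := n' - n) h (by
              rwa [sub_eq_add_neg n', lat_add, lat_neg, ← add_assoc, sub_add_cancel,
                ← sub_eq_add_neg])
            exact sub_eq_zero.1 this
        · push Not at hx
          rw [foldSum, Finset.sum_eq_zero fun n hn => by rw [h0 _ (hx n hn), mul_zero]]
          simp
    _ = ∑ n ∈ square M, ∫⁻ x, ‖F (x - lat n)‖ₑ ^ 2 := lintegral_finsetSum' _ fun n _ => hsub n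
    _ = _ := by
        simp only [lintegral_sub_right_eq_self (fun x => ‖F x‖ₑ ^ 2), Finset.sum_const,
          nsmul_eq_mul]
        rw [square, card_square, ← ENNReal.ofReal_pow (by positivity), ← ENNReal.ofReal_natCast]
        push_cast
        rfl

/-- On the hexagon the translate by `n` is brought back only by `-n`, with the inverse phase, so
each of the (2M + 1)² translates returns `F` once. The condition `M ≤ M'` makes `-n` available. -/
theorem foldSum_foldSum (k : ℝ × ℝ) {M M' : ℕ} (hM : M ≤ M') {F : Plane → ℂ}
    (h0 : ∀ x, x ∉ hexagon → F x = 0) {x : Plane} (hx : x ∈ hexagon) :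
    foldSum k (square M') (foldSum k (square M) F) x = (2 * M + 1 : ℂ) ^ 2 * F x := by
  have key : ∀ n ∈ square M, ∑ l ∈ square M', blochChar k l * (blochChar k n *
      F (x - lat l - lat n)) = F x := by
    intro n hn
    have hn' : -n ∈ square M' := by
      obtain ⟨h1, h2⟩ := mem_square.1 hn
      have : (M : ℤ) ≤ M' := by exact_mod_cast hM
      exact mem_square.2 ⟨by simpa using h1.trans this, by simpa using h2.trans this⟩
    rw [Finset.sum_eq_single_of_mem _ hn']
    · rw [← mul_assoc, mul_comm (blochChar k (-n)), blochChar_mul_neg, one_mul, lat_neg,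
        sub_neg_eq_add, add_sub_cancel_right]
    · intro l _ hl
      rw [h0 _ fun h => hl ?_, mul_zero, mul_zero]
      have := eq_zero_of_mem_hexagon_add_lat (n := -l - n) hx (by
        rwa [sub_eq_add_neg (-l), lat_add, lat_neg, lat_neg, ← add_assoc, ← sub_eq_add_neg,
          ← sub_eq_add_neg])
      rw [← neg_eq_iff_eq_neg]
      exact sub_eq_zero.1 this
  calc foldSum k (square M') (foldSum k (square M) F) x
      = ∑ n ∈ square M, ∑ l ∈ square M', blochChar k l * (blochChar k n *
          F (x - lat l - lat n)) := by
        simp only [foldSum, Finset.mul_sum]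
        rw [Finset.sum_comm]
    _ = _ := by
        rw [Finset.sum_congr rfl key, Finset.sum_const, square, card_square, nsmul_eq_mul]
        push_cast
        rfl

/-- The translates stay in the ball on which the cutoff equals 1, so the cutoff does not alter the
right hand side of the equation in the plane. -/
theorem foldSum_eq_zero (k : ℝ × ℝ) {N : ℕ} (hN : 1 ≤ N) {F : Plane → ℂ}
    (h0 : ∀ x, x ∉ hexagon → F x = 0) {x : Plane} (hx : x ∉ Metric.ball (0 : Plane) (3 * N)) :
    foldSum k (square N) F x = 0 := by
  have hN1 : (1 : ℝ) ≤ N := by exact_mod_cast hN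
  refine Finset.sum_eq_zero fun n hn => ?_
  rw [h0 _ fun h => hx ?_, mul_zero]
  rw [Metric.mem_ball, dist_zero_right]
  obtain ⟨h2, h3⟩ := mem_square.1 hn
  have h1 := norm_le_of_mem_hexagon h
  have h4 := norm_lat_le n N h2 h3
  have h5 := norm_add_le (x - lat n) (lat n)
  rw [sub_add_cancel] at h5
  linarith

theorem mulJet_of_notMem {N : ℕ} {ε : ℝ} {χ : Plane → ℝ} (hχ : IsCutoff N ε χ) (J : Jet)
    {x : Plane} (hx : x ∉ Metric.ball (0 : Plane) (6 * N)) :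
    (mulJet χ J).1 x = 0 ∧ (∀ i, (mulJet χ J).2.1 i x = 0) ∧
      ∀ i j, (mulJet χ J).2.2 i j x = 0 := by
  have hx' : x ∉ tsupport χ := fun h => hx (hχ.tsupport_subset h)
  have z0 : χ x = 0 := image_eq_zero_of_notMem_tsupport hx'
  have z1 : fderiv ℝ χ x = 0 := fderiv_eq_zero_of_notMem_tsupport hx'
  have z2 : ∀ i, fderiv ℝ (fun y => fderiv ℝ χ y (basisVec i)) x = 0 := fun i => by
    refine fderiv_eq_zero_of_notMem_tsupport fun h => hx' ?_
    have : tsupport (fun y => fderiv ℝ χ y (basisVec i)) ⊆ tsupport (fderiv ℝ χ) :=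
      closure_mono fun y hy h0 => hy (by simp [h0])
    exact (this.trans (tsupport_fderiv_subset ℝ)) h
  refine ⟨?_, fun i => ?_, fun i j => ?_⟩ <;> simp [mulJet, z0, z1, z2]

/-- The Bloch periodization of a jet. -/
def perJet (k : ℝ × ℝ) (J : Jet) : Jet :=
  (per k J.1, fun i => per k (J.2.1 i), fun i j => per k (J.2.2 i j))

theorem perJet_mem (k : ℝ × ℝ) {J : Jet} (hJ : J ∈ sobolevJets univ) {C : ℝ}
    (h : ∀ x, C < ‖x‖ → J.1 x = 0 ∧ (∀ i, J.2.1 i x = 0) ∧ ∀ i j, J.2.2 i j x = 0) :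
    perJet k J ∈ blochJets k := by
  obtain ⟨m0, m1, m2, w1, w2⟩ := hJ
  rw [Measure.restrict_univ] at m0
  simp only [Measure.restrict_univ] at m1 m2
  have z0 := fun x hx => (h x hx).1
  have z1 := fun i x hx => (h x hx).2.1 i
  have z2 := fun i j x hx => (h x hx).2.2 i j
  exact ⟨memL2loc_per k z0 m0, fun i => memL2loc_per k (z1 i) (m1 i),
    fun i j => memL2loc_per k (z2 i j) (m2 i j),
    ⟨fun i => (w1 i).per k z0 (z1 i) m0 (m1 i),
      fun i j => (w2 i j).per k (z1 i) (z2 i j) (m1 i) (m2 i j)⟩, isBloch_per k _⟩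

/-- On the hexagon the periodization is a finite sum of translated jets, and the expression commutes
with each translation. -/
theorem onJet_perJet {L : RealDiffOp} (ha₁ : L.InvariantUnder fun x => x + latticeA1)
    (ha₂ : L.InvariantUnder fun x => x + latticeA2) (k : ℝ × ℝ) {J : Jet}
    (hJ : J ∈ sobolevJets univ) {N : ℕ} (hN : 1 ≤ N)
    (h : ∀ x, x ∉ Metric.ball (0 : Plane) (6 * N) →
      J.1 x = 0 ∧ (∀ i, J.2.1 i x = 0) ∧ ∀ i j, J.2.2 i j x = 0) :
    L.onJet (perJet k J) =ᵐ[volume.restrict hexagon] foldSum k (square (14 * N)) (L.onJet J) := by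
  have hd : (1 : Matrix (Fin 2) (Fin 2) ℝ).det ≠ 0 := by simp
  have hl := jetL2loc_of_mem_sobolevJets hJ
  have h1 : ∀ᵐ x : Plane, ∀ n, L.onJet (pullJet 1 (-lat n) J) x = L.onJet J (x - lat n) := by
    refine ae_all_iff.2 fun n => ?_
    have hn := invariantUnder_lat ha₁ ha₂ (-n)
    have e : (fun x => x + lat (-n)) = aff 1 (-lat n) :=
      funext fun x => by rw [aff_one, lat_neg]
    rw [e] at hn
    filter_upwards [onJet_pullJet_ae hd hn hJ.2.2.2 hl] with x hx
    rw [hx, aff_one, sub_eq_add_neg]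
  filter_upwards [ae_restrict_of_ae h1, ae_restrict_mem measurableSet_hexagon] with x hx hxh
  have e : L.onJet (perJet k J) x =
      L.onJet (∑ n ∈ square (14 * N), blochChar k n • pullJet 1 (-lat n) J) x := by
    have p0 : ∀ v : Plane, (pullJet 1 v J).1 x = J.1 (x + v) := fun v => by
      simp [pullJet, aff_one]
    have p1 : ∀ (v : Plane) i, (pullJet 1 v J).2.1 i x = J.2.1 i (x + v) := fun v i => by
      fin_cases i <;> simp [pullJet, aff_one]
    have p2 : ∀ (v : Plane) i j, (pullJet 1 v J).2.2 i j x = J.2.2 i j (x + v) := fun v i j => by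
      fin_cases i <;> fin_cases j <;> simp [pullJet, aff_one]
    refine onJet_congr L ?_ (fun i => ?_) fun i j => ?_
    · simp only [perJet, Prod.fst_sum, Finset.sum_apply, Prod.smul_fst, Pi.smul_apply, p0,
        ← sub_eq_add_neg, smul_eq_mul]
      exact per_eq_foldSum k hN (fun y hy => (h y hy).1) hxh
    · simp only [perJet, Prod.fst_sum, Prod.snd_sum, Finset.sum_apply, Prod.smul_fst,
        Prod.smul_snd, Pi.smul_apply, p1, ← sub_eq_add_neg, smul_eq_mul]
      exact per_eq_foldSum k hN (fun y hy => (h y hy).2.1 i) hxh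
    · simp only [perJet, Prod.snd_sum, Finset.sum_apply,
        Prod.smul_snd, Pi.smul_apply, p2, ← sub_eq_add_neg, smul_eq_mul]
      exact per_eq_foldSum k hN (fun y hy => (h y hy).2.2 i j) hxh
  rw [e, map_sum]
  simp only [map_smul, Finset.sum_apply, Pi.smul_apply, smul_eq_mul, hx, foldSum]

/-! ### The resolvent set of the Bloch operator -/

theorem mulJet_add (χ : Plane → ℝ) (J J' : Jet) : mulJet χ (J + J') = mulJet χ J + mulJet χ J' := by
  refine Prod.ext ?_ (Prod.ext ?_ ?_)
  · funext x
    simp only [mulJet, Prod.fst_add, Pi.add_apply]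
    ring
  · funext i x
    simp only [mulJet, Prod.fst_add, Prod.snd_add, Pi.add_apply]
    ring
  · funext i j x
    simp only [mulJet, Prod.fst_add, Prod.snd_add, Pi.add_apply]
    ring

theorem mulJet_smul (χ : Plane → ℝ) (c : ℂ) (J : Jet) : mulJet χ (c • J) = c • mulJet χ J := by
  refine Prod.ext ?_ (Prod.ext ?_ ?_)
  · funext x
    simp only [mulJet, Prod.smul_fst, Pi.smul_apply, smul_eq_mul]
    ring
  · funext i x
    simp only [mulJet, Prod.smul_fst, Prod.smul_snd, Pi.smul_apply, smul_eq_mul]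
    ring
  · funext i j x
    simp only [mulJet, Prod.smul_fst, Prod.smul_snd, Pi.smul_apply, smul_eq_mul]
    ring

/-- The differential expression of `H - z`, on jets. -/
def shiftOp (L : RealDiffOp) (z : ℂ) : Jet →ₗ[ℂ] (Plane → ℂ) :=
  L.onJet - z • LinearMap.fst ℂ (Plane → ℂ) _

theorem shiftOp_apply (L : RealDiffOp) (z : ℂ) (J : Jet) :
    shiftOp L z J = L.onJet J - z • J.1 := rfl

theorem indicator_coeFn_add {Ω : Set Plane} (hΩ : MeasurableSet Ω) (f g : L2 Ω) :
    Ω.indicator (f + g : L2 Ω) =ᵐ[volume] Ω.indicator f + Ω.indicator g := by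
  filter_upwards [(ae_restrict_iff' hΩ).1 (Lp.coeFn_add f g)] with x hx
  by_cases h : x ∈ Ω
  · simpa [h] using hx h
  · simp [h]

theorem indicator_coeFn_smul {Ω : Set Plane} (hΩ : MeasurableSet Ω) (c : ℂ) (f : L2 Ω) :
    Ω.indicator (c • f : L2 Ω) =ᵐ[volume] c • Ω.indicator f := by
  filter_upwards [(ae_restrict_iff' hΩ).1 (Lp.coeFn_smul c f)] with x hx
  by_cases h : x ∈ Ω
  · simpa [h] using hx h
  · simp [h]

/-- The pairs `(f, (H(k) - z) u)`, where `u` is the periodization of a cut-off solution in the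
plane with right hand side given by finitely many translates of `f`. -/
def approxGraph (L : RealDiffOp) (z : ℂ) (k : ℝ × ℝ) (N : ℕ) (χ : Plane → ℝ) :
    Submodule ℂ (L2 hexagon × L2 hexagon) where
  carrier := {p | ∃ J ∈ sobolevJets univ,
    (shiftOp L z J =ᵐ[volume] foldSum k (square N) (hexagon.indicator p.1)) ∧
    p.2 =ᵐ[volume.restrict hexagon] ((2 * N + 1 : ℂ) ^ 2)⁻¹ •
      foldSum k (square (14 * N)) (shiftOp L z (mulJet χ J))}
  zero_mem' := by
    refine ⟨0, Submodule.zero_mem _, ?_, ?_⟩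
    · have : hexagon.indicator ((0 : L2 hexagon) : Plane → ℂ) =ᵐ[volume] 0 := by
        have := indicator_coeFn_smul measurableSet_hexagon 0 (0 : L2 hexagon)
        rwa [zero_smul, zero_smul] at this
      rw [map_zero]
      exact ((foldSum_congr k _ this).trans (by rw [foldSum_zero])).symm
    · have e : mulJet χ 0 = 0 := by
        have := mulJet_smul χ 0 0
        rwa [zero_smul, zero_smul] at this
      rw [e, map_zero, foldSum_zero, smul_zero]
      exact Lp.coeFn_zero _ _ _
  add_mem' := fun {p q} ⟨J, hJ, h1, h2⟩ ⟨J', hJ', h1', h2'⟩ => by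
    refine ⟨J + J', Submodule.add_mem _ hJ hJ', ?_, ?_⟩
    · rw [map_add]
      refine (h1.add h1').trans ?_
      rw [← foldSum_add]
      exact (foldSum_congr k _ (indicator_coeFn_add measurableSet_hexagon p.1 q.1)).symm
    · rw [mulJet_add, map_add, foldSum_add, smul_add]
      exact (Lp.coeFn_add _ _).trans (h2.add h2')
  smul_mem' := fun c p ⟨J, hJ, h1, h2⟩ => by
    refine ⟨c • J, Submodule.smul_mem _ c hJ, ?_, ?_⟩
    · rw [map_smul]
      refine (h1.const_smul c).trans ?_
      rw [← foldSum_smul]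
      exact (foldSum_congr k _ (indicator_coeFn_smul measurableSet_hexagon c p.1)).symm
    · rw [mulJet_smul, map_smul, foldSum_smul, smul_comm]
      exact (Lp.coeFn_smul _ _).trans (h2.const_smul c)

theorem memLp_indicator_hexagon (f : L2 hexagon) : MemLp (hexagon.indicator f) 2 volume :=
  (memLp_indicator_iff_restrict measurableSet_hexagon).2 (Lp.memLp f)

theorem eLpNorm_indicator_hexagon (f : L2 hexagon) :
    eLpNorm (hexagon.indicator f) 2 volume = ‖f‖ₑ := by
  rw [eLpNorm_indicator_eq_eLpNorm_restrict measurableSet_hexagon, Lp.enorm_def]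

theorem memLp_foldSum (k : ℝ × ℝ) (S : Finset (ℤ × ℤ)) {F : Plane → ℂ} (hF : MemLp F 2 volume) :
    MemLp (foldSum k S F) 2 (volume : Measure Plane) :=
  memLp_finsetSum _ fun n _ => (memLp_comp_sub hF (lat n)).const_mul _

/-- The datum `f` is copied with Bloch phases to (2N + 1)² cells, the equation is solved in the
plane, and the solution is cut off, periodized and divided by the number of cells. This reproduces
`f` up to the folded commutator, which is small for large N; the resulting relation is close to the
identity and hence onto. -/
theorem bloch_surjective {L : RealDiffOp} (hsa : IsSelfAdjoint L.planeOp)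
    (ha₁ : L.InvariantUnder fun x => x + latticeA1)
    (ha₂ : L.InvariantUnder fun x => x + latticeA2) {z : ℂ} (hz : z.im ≠ 0) (k : ℝ × ℝ)
    (f : L2 hexagon) :
    ∃ J ∈ blochJets k, L.onJet J - z • J.1 =ᵐ[volume.restrict hexagon] f := by
  obtain ⟨C₀, hC₀, hsol⟩ := plane_resolvent hsa hz
  obtain ⟨K, hK0, hK⟩ := exists_commutator_le L
  obtain ⟨C₁, hC₁, hcut⟩ := exists_cutoff
  obtain ⟨N, hN⟩ := exists_nat_ge (max 1 (58 * C₀ * K * C₁))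
  have hN1' : (1 : ℝ) ≤ N := (le_max_left _ _).trans hN
  have hN1 : 1 ≤ N := by exact_mod_cast hN1'
  have hN2 : 58 * C₀ * K * C₁ ≤ N := (le_max_right _ _).trans hN
  obtain ⟨χ, hχ⟩ := hcut N hN1
  have hind : ∀ (f : L2 hexagon) x, x ∉ hexagon → hexagon.indicator f x = 0 := fun f x hx =>
    indicator_of_notMem hx _
  have hc0 : ((2 * N + 1 : ℂ) ^ 2) ≠ 0 := by
    have : (2 * N + 1 : ℂ) = ((2 * N + 1 : ℕ) : ℂ) := by push_cast; rfl
    rw [this]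
    exact pow_ne_zero _ (Nat.cast_ne_zero.2 (Nat.succ_ne_zero _))
  have hm : ∀ J ∈ sobolevJets univ, MemLp (shiftOp L z J) 2 volume := fun J hJ => by
    have := (memLp_onJet L hJ.1 hJ.2.1 hJ.2.2.1).sub (hJ.1.const_smul z)
    rwa [Measure.restrict_univ] at this
  have hmul : ∀ J ∈ sobolevJets univ, mulJet χ J ∈ sobolevJets univ := fun J hJ =>
    mulJet_mem hJ.2.2.2 (jetL2loc_of_mem_sobolevJets hJ) hχ.smooth hχ.compact
  obtain ⟨F, J, hJ, h1, h2⟩ := exists_mem_of_norm_sub_le (approxGraph L z k N χ) (fun f => by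
    have hw := memLp_foldSum k (square N) (memLp_indicator_hexagon f)
    have hw' : MemLp (foldSum k (square N) (hexagon.indicator f)) 2 (volume.restrict univ) := by
      rwa [Measure.restrict_univ]
    obtain ⟨J, hJ, e⟩ := hsol (hw'.toLp _)
    have hg := (memLp_foldSum k (square (14 * N)) (hm _ (hmul J hJ))).const_smul
      ((2 * N + 1 : ℂ) ^ 2)⁻¹
    have hg' := hg.restrict hexagon
    refine ⟨hg'.toLp _, J, hJ, ?_, hg'.coeFn_toLp⟩
    have := e.trans hw'.coeFn_toLp
    rwa [Measure.restrict_univ] at this) (by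
    rintro ⟨f, g⟩ ⟨J, hJ, h1, h2⟩
    simp only at h1 h2 ⊢
    set w := foldSum k (square N) (hexagon.indicator f) with hw
    set R : Plane → ℂ := fun x => L.onJet (mulJet χ J) x - (χ x : ℂ) * L.onJet J x with hR
    have hl := jetL2loc_of_mem_sobolevJets hJ
    have hRm : AEStronglyMeasurable R volume := by
      have a := (memLp_onJet L (hmul J hJ).1 (hmul J hJ).2.1 (hmul J hJ).2.2.1).1
      have b := (memLp_mul_compact (memL2loc_onJet L hl) hχ.smooth.continuous hχ.compact).1
      have := a.sub b
      rwa [Measure.restrict_univ] at this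
    -- The right hand side `w` lives where the cutoff is 1, so cutting off the solution leaves `w`
    -- and adds only the commutator.
    have e1 : shiftOp L z (mulJet χ J) =ᵐ[volume] w + R := by
      filter_upwards [h1] with x hx
      have hχw : (χ x : ℂ) * w x = w x := by
        by_cases hb : x ∈ Metric.ball (0 : Plane) (3 * N)
        · rw [hχ.eq_one x hb]
          simp
        · rw [hw, foldSum_eq_zero k hN1 (hind f) hb, mul_zero]
      rw [Pi.add_apply, ← hχw, ← hx]
      simp only [hR, shiftOp_apply, mulJet, Pi.sub_apply, Pi.smul_apply, smul_eq_mul]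
      ring
    have e2 : ((f - g : L2 hexagon) : Plane → ℂ) =ᵐ[volume.restrict hexagon]
        -((2 * N + 1 : ℂ) ^ 2)⁻¹ • foldSum k (square (14 * N)) R := by
      filter_upwards [Lp.coeFn_sub f g, h2, ae_restrict_of_ae (foldSum_congr k (square (14 * N)) e1),
        ae_restrict_mem measurableSet_hexagon] with x a b c d
      rw [a, Pi.sub_apply, b, Pi.smul_apply, c, foldSum_add, Pi.add_apply, hw,
        foldSum_foldSum k (by omega) (hind f) d, indicator_of_mem d, Pi.smul_apply]
      simp only [smul_eq_mul]
      rw [mul_add, inv_mul_cancel_left₀ hc0]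
      ring
    have n1 : eLpNorm R 2 volume ≤ ENNReal.ofReal (K * (C₁ / N)) *
        (C₀ * (ENNReal.ofReal (2 * N + 1) * ‖f‖ₑ)) := by
      have a := hK hχ J hl
      rw [Measure.restrict_univ] at a
      refine a.trans ?_
      gcongr
      refine (jetNorm_mono (subset_univ _) J).trans ((hC₀ J hJ).trans ?_)
      gcongr
      rw [Measure.restrict_univ, ← shiftOp_apply, eLpNorm_congr_ae h1, ← eLpNorm_indicator_hexagon]
      exact eLpNorm_translates_le k N (hind f) (memLp_indicator_hexagon f).1
    have n2 : ‖f - g‖ₑ ≤ ENNReal.ofReal (((2 * (N : ℝ) + 1) ^ 2)⁻¹ * ((2 * (14 * N : ℕ) + 1) *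
        (K * (C₁ / N) * (C₀ * ((2 * N + 1) * ‖f‖))))) := by
      rw [Lp.enorm_def, eLpNorm_congr_ae e2, eLpNorm_const_smul, enorm_neg]
      have e3 : ‖((2 * N + 1 : ℂ) ^ 2)⁻¹‖ₑ = ENNReal.ofReal ((2 * (N : ℝ) + 1) ^ 2)⁻¹ := by
        rw [← ofReal_norm, norm_inv, norm_pow]
        have : (2 * N + 1 : ℂ) = ((2 * N + 1 : ℝ) : ℂ) := by push_cast; rfl
        rw [this, Complex.norm_real, Real.norm_of_nonneg (by positivity)]
      rw [e3, ENNReal.ofReal_mul (by positivity)]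
      gcongr
      refine (eLpNorm_foldSum_le k (14 * N) hRm).trans ?_
      rw [ENNReal.ofReal_mul (by positivity)]
      gcongr
      refine n1.trans_eq ?_
      rw [ENNReal.ofReal_mul (p := K * (C₁ / N)) (by positivity),
        ENNReal.ofReal_mul (p := (C₀ : ℝ)) (by positivity),
        ENNReal.ofReal_mul (p := 2 * (N : ℝ) + 1) (by positivity), ENNReal.ofReal_coe_nnreal,
        ofReal_norm]
    rw [← ofReal_norm, ENNReal.ofReal_le_ofReal_iff (by positivity)] at n2
    refine n2.trans ?_
    have hN0 : (0 : ℝ) < N := by linarith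
    have e4 : ((2 * (N : ℝ) + 1) ^ 2)⁻¹ * ((2 * (14 * N : ℕ) + 1) *
        (K * (C₁ / N) * (C₀ * ((2 * N + 1) * ‖f‖)))) =
        (C₀ * K * C₁ / N) * ((28 * N + 1) / (2 * N + 1)) * ‖f‖ := by
      have hx : 2 * (N : ℝ) + 1 ≠ 0 := by positivity
      push_cast
      field_simp
      ring
    rw [e4]
    gcongr
    -- Copying costs 2N + 1, folding back costs 28N + 1, and the average divides by (2N + 1)². These
    -- balance up to a factor at most 29, and the 1/N from the commutator brings the total to 1/2.
    have q1 : C₀ * K * C₁ / N ≤ 1 / 58 := by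
      rw [div_le_div_iff₀ hN0 (by norm_num)]
      linarith
    have q2 : (28 * (N : ℝ) + 1) / (2 * N + 1) ≤ 29 := by
      rw [div_le_iff₀ (by positivity)]
      linarith
    calc _ ≤ (1 / 58 : ℝ) * 29 := mul_le_mul q1 q2 (by positivity) (by norm_num)
      _ = 1 / 2 := by norm_num) f
  simp only at h2
  have hψ := hmul J hJ
  have hψ0 := fun x hx => mulJet_of_notMem hχ J (x := x) hx
  set ψ := mulJet χ J
  have hb : perJet k ψ ∈ blochJets k := perJet_mem k hψ (C := 6 * N) fun x hx =>
    hψ0 x fun h => by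
      rw [Metric.mem_ball, dist_zero_right] at h
      exact absurd h (not_lt.2 hx.le)
  refine ⟨((2 * N + 1 : ℂ) ^ 2)⁻¹ • perJet k ψ, Submodule.smul_mem _ _ hb, ?_⟩
  filter_upwards [h2, onJet_perJet ha₁ ha₂ k hψ hN1 hψ0,
    ae_restrict_mem measurableSet_hexagon] with x a b c
  rw [a, map_smul]
  simp only [Pi.sub_apply, Pi.smul_apply, Prod.smul_fst, smul_eq_mul, b]
  have e : (perJet k ψ).1 x = foldSum k (square (14 * N)) ψ.1 x :=
    per_eq_foldSum k hN1 (fun y hy => (hψ0 y hy).1) c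
  have e' : shiftOp L z ψ = L.onJet ψ + (-z) • ψ.1 := by
    rw [shiftOp_apply, sub_eq_add_neg, neg_smul]
  rw [e, e', foldSum_add, foldSum_smul]
  simp only [Pi.add_apply, Pi.smul_apply, smul_eq_mul]
  ring

/-- The a priori estimate gives the lower bound and `bloch_surjective` the range. No
self-adjointness of the Bloch operator is established or needed. -/
theorem inResolventSet_blochOp {L : RealDiffOp} (hsa : IsSelfAdjoint L.planeOp)
    (ha₁ : L.InvariantUnder fun x => x + latticeA1)
    (ha₂ : L.InvariantUnder fun x => x + latticeA2) {z : ℂ} (hz : z.im ≠ 0) (k : ℝ × ℝ) :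
    InResolventSet (L.blochOp k) z := by
  obtain ⟨C, hC⟩ := bloch_estimate hsa ha₁ ha₂ hz k
  refine inResolventSet_of_surjective (c := C) (fun u => ?_) fun f => ?_
  · have hu : ((u : L2 hexagon), L.blochOp k u) ∈ (L.blochOp k).graph :=
      LinearPMap.mem_graph _ u
    rw [L.blochOp_graph] at hu
    obtain ⟨J, hJ, h1, h2⟩ := hu
    have h3 : ((L.blochOp k u - z • (u : L2 hexagon) : L2 hexagon) : Plane → ℂ)
        =ᵐ[volume.restrict hexagon] L.onJet J - z • J.1 := by
      filter_upwards [h1, h2, Lp.coeFn_sub (L.blochOp k u) (z • (u : L2 hexagon)),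
        Lp.coeFn_smul z (u : L2 hexagon)] with x a b c d
      rw [c, Pi.sub_apply, d, Pi.smul_apply, a, b, Pi.sub_apply, Pi.smul_apply]
    have h4 : ‖(u : L2 hexagon)‖ₑ ≤ C * ‖L.blochOp k u - z • (u : L2 hexagon)‖ₑ := by
      rw [Lp.enorm_def, Lp.enorm_def, eLpNorm_congr_ae h1, eLpNorm_congr_ae h3]
      refine le_trans ?_ (hC J hJ)
      rw [jetNorm, add_assoc]
      exact le_self_add
    rw [← ofReal_norm, ← ofReal_norm, ← ENNReal.ofReal_coe_nnreal,
      ← ENNReal.ofReal_mul (by positivity), ENNReal.ofReal_le_ofReal_iff (by positivity)] at h4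
    exact h4
  · obtain ⟨J, hJ, e⟩ := bloch_surjective hsa ha₁ ha₂ hz k f
    have hl := jetL2loc_of_mem_blochJets hJ
    have m0 := hl.1.memLp (subset_univ _) isBounded_hexagon
    have m1 := (memL2loc_onJet L hl).memLp (subset_univ _) isBounded_hexagon
    have hg : (m0.toLp _, m1.toLp _) ∈ (L.blochOp k).graph := by
      rw [L.blochOp_graph]
      exact ⟨J, hJ, m0.coeFn_toLp, m1.coeFn_toLp⟩
    obtain ⟨u, hu1, hu2⟩ := LinearPMap.mem_graph_iff _ |>.1 hg
    refine ⟨u, ?_⟩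
    simp only at hu1 hu2
    rw [hu1, hu2]
    refine Lp.ext ?_
    filter_upwards [e, Lp.coeFn_sub (m1.toLp _) (z • m0.toLp _), Lp.coeFn_smul z (m0.toLp _),
      m0.coeFn_toLp, m1.coeFn_toLp] with x a b c d e
    rw [b, Pi.sub_apply, c, Pi.smul_apply, d, e, ← a, Pi.sub_apply, Pi.smul_apply]

/-! ### Transfer of resolvent sets and eigenspaces -/

section Transfer

variable {E : Type*} [NormedAddCommGroup E] [NormedSpace ℂ E]

/-- In terms of graphs the condition can be transported by any map of graphs, without handling
membership in domains. -/
theorem inResolventSet_iff {A : E →ₗ.[ℂ] E} {z : ℂ} : InResolventSet A z ↔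
    ∃ B : E →L[ℂ] E, (∀ f, (B f, f + z • B f) ∈ A.graph) ∧
      ∀ p ∈ A.graph, B (p.2 - z • p.1) = p.1 := by
  refine exists_congr fun B => and_congr (forall_congr' fun f => ?_) ?_
  · rw [LinearPMap.mem_graph_iff]
    constructor
    · rintro ⟨h, e⟩
      exact ⟨⟨B f, h⟩, rfl, sub_eq_iff_eq_add.1 e⟩
    · rintro ⟨y, h1, h2⟩
      simp only at h1 h2
      have hm : B f ∈ A.domain := by
        rw [← h1]
        exact y.2
      have : (⟨B f, hm⟩ : A.domain) = y := Subtype.ext h1.symm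
      refine ⟨hm, ?_⟩
      rw [this, h2]
      exact add_sub_cancel_right _ _
  · constructor
    · intro h p hp
      obtain ⟨y, h1, h2⟩ := (LinearPMap.mem_graph_iff _).1 hp
      rw [← h1, ← h2, h]
    · exact fun h u => h _ (LinearPMap.mem_graph _ u)

theorem mem_opEigenspace {A : E →ₗ.[ℂ] E} {z : ℂ} {u : E} :
    u ∈ opEigenspace A z ↔ (u, z • u) ∈ A.graph := by
  rw [LinearPMap.mem_graph_iff, opEigenspace, Submodule.mem_map]
  refine exists_congr fun y => ?_
  rw [LinearMap.mem_ker, LinearMap.sub_apply, LinearMap.smul_apply, sub_eq_zero]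
  constructor
  · rintro ⟨h1, rfl⟩
    exact ⟨rfl, h1⟩
  · rintro ⟨h1, h2⟩
    refine ⟨?_, h1⟩
    change A y = z • (y : E)
    rw [h2, h1]

theorem opEigenspace_eq_bot {A : E →ₗ.[ℂ] E} {z : ℂ} (h : InResolventSet A z) :
    opEigenspace A z = ⊥ := by
  obtain ⟨B, -, hB⟩ := inResolventSet_iff.1 h
  refine (Submodule.eq_bot_iff _).2 fun u hu => ?_
  have := hB _ (mem_opEigenspace.1 hu)
  rwa [sub_self, map_zero, eq_comm] at this

variable {s : ℂ →+* ℂ} [RingHomInvPair s s]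

/-- The resolvent is conjugated by `W`. Semilinearity moves the spectral parameter to `s z`, which
covers the unitary and the antiunitary case together. -/
theorem InResolventSet.map {A B : E →ₗ.[ℂ] E} (W : E ≃ₛₗᵢ[s] E)
    (hW : ∀ φ f, (φ, f) ∈ A.graph ↔ (W φ, W f) ∈ B.graph) {z : ℂ} (h : InResolventSet A z) :
    InResolventSet B (s z) := by
  obtain ⟨R, h1, h2⟩ := inResolventSet_iff.1 h
  let W₁ : E →SL[s] E := W.toLinearIsometry.toContinuousLinearMap
  let W₂ : E →SL[s] E := W.symm.toLinearIsometry.toContinuousLinearMap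
  refine inResolventSet_iff.2 ⟨W₁.comp (R.comp W₂), fun f => ?_, fun p hp => ?_⟩
  · have := (hW _ _).1 (h1 (W.symm f))
    rw [map_add, W.apply_symm_apply, map_smulₛₗ] at this
    exact this
  · have e : (W (W.symm p.1), W (W.symm p.2)) = p := by
      rw [W.apply_symm_apply, W.apply_symm_apply]
    rw [← e] at hp
    have := h2 _ ((hW _ _).2 hp)
    change W (R (W.symm (p.2 - s z • p.1))) = p.1
    rw [map_sub, map_smulₛₗ, RingHomInvPair.comp_apply_eq, this, W.apply_symm_apply]

theorem inResolventSet_map_iff {A B : E →ₗ.[ℂ] E} (W : E ≃ₛₗᵢ[s] E)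
    (hW : ∀ φ f, (φ, f) ∈ A.graph ↔ (W φ, W f) ∈ B.graph) {z : ℂ} :
    InResolventSet A z ↔ InResolventSet B (s z) := by
  refine ⟨fun h => h.map W hW, fun h => ?_⟩
  have := h.map W.symm fun φ f => by
    rw [hW, W.apply_symm_apply, W.apply_symm_apply]
  rwa [RingHomInvPair.comp_apply_eq] at this

/-- The eigenspaces are semilinearly isomorphic, and the rank does not change when scalars are
twisted by an automorphism of ℂ. -/
theorem rank_opEigenspace_map {A B : E →ₗ.[ℂ] E} (W : E ≃ₛₗᵢ[s] E)
    (hW : ∀ φ f, (φ, f) ∈ A.graph ↔ (W φ, W f) ∈ B.graph) (z : ℂ) :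
    Module.rank ℂ (opEigenspace A z) = Module.rank ℂ (opEigenspace B (s z)) := by
  have key : ∀ u, u ∈ opEigenspace A z ↔ W u ∈ opEigenspace B (s z) := fun u => by
    rw [mem_opEigenspace, mem_opEigenspace, hW, map_smulₛₗ]
  let e : opEigenspace A z ≃+ opEigenspace B (s z) :=
    { toFun := fun u => ⟨W u, (key _).1 u.2⟩
      invFun := fun u => ⟨W.symm u, (key _).2 (by rw [W.apply_symm_apply]; exact u.2)⟩
      left_inv := fun u => Subtype.ext (W.symm_apply_apply _)
      right_inv := fun u => Subtype.ext (W.apply_symm_apply _)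
      map_add' := fun u v => Subtype.ext (map_add W _ _) }
  refine rank_eq_of_equiv_equiv s e ⟨s.injective, fun c => ⟨s c, RingHomInvPair.comp_apply_eq⟩⟩
    fun r u => Subtype.ext ?_
  exact map_smulₛₗ W r (u : E)

theorem isospectral_of_linear {A B : E →ₗ.[ℂ] E} (W : E ≃ₗᵢ[ℂ] E)
    (hW : ∀ φ f, (φ, f) ∈ A.graph ↔ (W φ, W f) ∈ B.graph) : Isospectral A B := by
  refine ⟨Set.ext fun z => not_congr ?_, fun z => ?_⟩
  · exact inResolventSet_map_iff (s := RingHom.id ℂ) W hW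
  · exact rank_opEigenspace_map (s := RingHom.id ℂ) W hW z

/-- An antilinear equivalence relates `z` to its conjugate, which says nothing new for real `z`. At
nonreal `z` both operators have a resolvent and trivial eigenspaces by hypothesis. -/
theorem isospectral_of_antilinear {A B : E →ₗ.[ℂ] E} (W : E ≃ₗᵢ⋆[ℂ] E)
    (hW : ∀ φ f, (φ, f) ∈ A.graph ↔ (W φ, W f) ∈ B.graph)
    (hA : ∀ z : ℂ, z.im ≠ 0 → InResolventSet A z) (hB : ∀ z : ℂ, z.im ≠ 0 → InResolventSet B z) :
    Isospectral A B := by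
  have real : ∀ z : ℂ, z.im = 0 → starRingEnd ℂ z = z := fun z hz => Complex.conj_eq_iff_im.2 hz
  refine ⟨Set.ext fun z => not_congr ?_, fun z => ?_⟩
  · rcases eq_or_ne z.im 0 with hz | hz
    · have := inResolventSet_map_iff W hW (z := z)
      rwa [real z hz] at this
    · exact iff_of_true (hA z hz) (hB z hz)
  · rcases eq_or_ne z.im 0 with hz | hz
    · have := rank_opEigenspace_map W hW z
      rwa [real z hz] at this
    · rw [opEigenspace_eq_bot (hA z hz), opEigenspace_eq_bot (hB z hz)]

end Transfer

/-! ### Orthogonal sums of operators -/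

section Reduction

variable {E G : Type*} [NormedAddCommGroup E] [InnerProductSpace ℂ E] [NormedAddCommGroup G]
  [InnerProductSpace ℂ G]

/-- The operator `H` is the orthogonal sum of the operators `A j`, by means of the isometries
`T j`. -/
structure IsOrthogonalSum {ι : Type*} (H : G →ₗ.[ℂ] G) (A : ι → E →ₗ.[ℂ] E)
    (T : ι → E →ₗᵢ[ℂ] G) : Prop where
  orthogonal : OrthogonalFamily ℂ (fun _ => E) T
  domain_le : H.domain ≤ ⨆ j, (A j).domain.map (T j).toLinearMap
  map_graph : ∀ {j φ f}, (φ, f) ∈ (A j).graph → (T j φ, T j f) ∈ H.graph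

variable {ι : Type*} [Fintype ι] {H : G →ₗ.[ℂ] G} {A : ι → E →ₗ.[ℂ] E} {T : ι → E →ₗᵢ[ℂ] G}

theorem OrthogonalFamily.eq_of_sum_eq (hT : OrthogonalFamily ℂ (fun _ : ι => E) T) {φ : ι → E}
    {j : ι} {ψ : E} (h : ∑ i, T i (φ i) = T j ψ) : φ j = ψ := by
  refine ext_inner_left ℂ fun v => ?_
  rw [← hT.inner_right_fintype φ j v, h, (T j).inner_map_map]

/-- The domain decomposes by assumption. The sum of the corresponding images is also an image of
`u`, and the graph is single valued. -/
theorem IsOrthogonalSum.exists_sum (h : IsOrthogonalSum H A T) {u g : G} (hu : (u, g) ∈ H.graph) :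
    ∃ φ f : ι → E, (∀ i, (φ i, f i) ∈ (A i).graph) ∧ u = ∑ i, T i (φ i) ∧ g = ∑ i, T i (f i) := by
  classical
  have main : ∃ φ f : ι → E, (∀ i, (φ i, f i) ∈ (A i).graph) ∧ u = ∑ i, T i (φ i) := by
    refine Submodule.iSup_induction _ (motive := fun u => ∃ φ f : ι → E,
      (∀ i, (φ i, f i) ∈ (A i).graph) ∧ u = ∑ i, T i (φ i))
      (h.domain_le (LinearPMap.mem_domain_of_mem_graph hu)) ?_ ?_ ?_
    · rintro i _ ⟨φ, hφ, rfl⟩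
      refine ⟨Pi.single i φ, Pi.single i (A i ⟨φ, hφ⟩), fun l => ?_, ?_⟩
      · rcases eq_or_ne l i with rfl | hl
        · rw [Pi.single_eq_same, Pi.single_eq_same]
          exact LinearPMap.mem_graph _ ⟨φ, hφ⟩
        · rw [Pi.single_eq_of_ne hl, Pi.single_eq_of_ne hl]
          exact Submodule.zero_mem _
      · rw [Finset.sum_eq_single_of_mem i (Finset.mem_univ i), Pi.single_eq_same]
        · rfl
        · intro l _ hl
          rw [Pi.single_eq_of_ne hl, map_zero]
    · exact ⟨0, 0, fun i => Submodule.zero_mem _, by simp⟩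
    · rintro _ _ ⟨φ, f, h1, rfl⟩ ⟨φ', f', h1', rfl⟩
      refine ⟨φ + φ', f + f', fun i => Submodule.add_mem _ (h1 i) (h1' i), ?_⟩
      simp only [Pi.add_apply, map_add, Finset.sum_add_distrib]
  obtain ⟨φ, f, h1, rfl⟩ := main
  refine ⟨φ, f, h1, rfl, ?_⟩
  have := Submodule.sum_mem H.graph fun i (_ : i ∈ Finset.univ) => h.map_graph (h1 i)
  refine LinearPMap.mem_graph_snd_inj' _ hu this (by simp [Prod.fst_sum]) |>.trans ?_
  simp [Prod.snd_sum]

theorem IsOrthogonalSum.mem_graph_iff (h : IsOrthogonalSum H A T) {j : ι} {φ f : E} :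
    (φ, f) ∈ (A j).graph ↔ (T j φ, T j f) ∈ H.graph := by
  refine ⟨h.map_graph, fun hg => ?_⟩
  obtain ⟨φ', f', h1, h2, h3⟩ := h.exists_sum hg
  rw [← OrthogonalFamily.eq_of_sum_eq h.orthogonal h2.symm,
    ← OrthogonalFamily.eq_of_sum_eq h.orthogonal h3.symm]
  exact h1 j

/-- The resolvent of `H` supplies the lower bound on each summand, and the j-th component of a
solution in the large space solves the equation in the summand. -/
theorem IsOrthogonalSum.inResolventSet (h : IsOrthogonalSum H A T) {z : ℂ}
    (hz : InResolventSet H z) (j : ι) : InResolventSet (A j) z := by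
  obtain ⟨B, h1, h2⟩ := inResolventSet_iff.1 hz
  refine inResolventSet_of_surjective (c := ‖B‖) (fun u => ?_) fun f => ?_
  · have := h2 _ (h.map_graph (LinearPMap.mem_graph _ u))
    simp only at this
    rw [← map_smul, ← map_sub] at this
    calc ‖(u : E)‖ = ‖T j u‖ := ((T j).norm_map _).symm
      _ = ‖B (T j (A j u - z • (u : E)))‖ := by rw [this]
      _ ≤ ‖B‖ * ‖T j (A j u - z • (u : E))‖ := B.le_opNorm _
      _ = _ := by rw [(T j).norm_map]
  · obtain ⟨φ', f', h3, h4, h5⟩ := h.exists_sum (h1 (T j f))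
    have e : ∑ i, T i (f' i - z • φ' i) = T j f := by
      simp only [map_sub, map_smul, Finset.sum_sub_distrib, ← Finset.smul_sum]
      rw [← h4, ← h5, add_sub_cancel_right]
    obtain ⟨u, hu1, hu2⟩ := (LinearPMap.mem_graph_iff _).1 (h3 j)
    refine ⟨u, ?_⟩
    simp only at hu1 hu2
    rw [hu1, hu2]
    exact OrthogonalFamily.eq_of_sum_eq (φ := fun i => f' i - z • φ' i) h.orthogonal e

variable {s : ℂ →+* ℂ} [RingHomInvPair s s]

/-- A symmetry of `H` which exchanges two summands gives an equivalence of the summands. -/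
theorem IsOrthogonalSum.exists_equiv (h : IsOrthogonalSum H A T) (U : G →ₛₗᵢ[s] G)
    (hU : ∀ u, U (U u) = u) (hgr : ∀ u g, (u, g) ∈ H.graph → (U u, U g) ∈ H.graph) {i j : ι}
    (hij : ∀ φ, ∃ ψ, T j ψ = U (T i φ)) (hji : ∀ φ, ∃ ψ, T i ψ = U (T j φ)) :
    ∃ W : E ≃ₛₗᵢ[s] E, ∀ φ f, (φ, f) ∈ (A i).graph ↔ (W φ, W f) ∈ (A j).graph := by
  choose w hw using hij
  let W₀ : E →ₛₗᵢ[s] E :=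
    { toFun := w
      map_add' := fun φ ψ => (T j).injective (by rw [hw, map_add, map_add, map_add, hw, hw])
      map_smul' := fun c φ => (T j).injective (by
        rw [hw, (T i).map_smul, (T j).map_smul, map_smulₛₗ, hw])
      norm_map' := fun φ => by
        change ‖w φ‖ = ‖φ‖
        rw [← (T j).norm_map, hw, U.norm_map, (T i).norm_map] }
  have hs : Function.Surjective W₀ := fun ψ => by
    obtain ⟨φ, hφ⟩ := hji ψ
    refine ⟨φ, (T j).injective ?_⟩
    rw [← hU (T j ψ), ← hφ]
    exact hw φ
  refine ⟨LinearIsometryEquiv.ofSurjective W₀ hs, fun φ f => ?_⟩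
  rw [LinearIsometryEquiv.coe_ofSurjective, h.mem_graph_iff, h.mem_graph_iff]
  change _ ↔ (T j (w φ), T j (w f)) ∈ _
  rw [hw, hw]
  refine ⟨hgr _ _, fun hh => ?_⟩
  have := hgr _ _ hh
  rwa [hU, hU] at this

end Reduction

/-! ### Reflection and inversion -/

def reflMatrix : Matrix (Fin 2) (Fin 2) ℝ := !![-1, 0; 0, 1]

theorem det_reflMatrix : reflMatrix.det = -1 := by simp [reflMatrix, Matrix.det_fin_two_of]

theorem reflMap_eq_aff : reflMap = aff reflMatrix 0 := by
  funext x
  simp [reflMap, aff, reflMatrix]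

theorem invMap_eq_aff : invMap = aff (-1) 0 := by
  funext x
  rw [aff_neg_one, zero_sub]
  rfl

theorem reflMap_reflMap (x : Plane) : reflMap (reflMap x) = x := by simp [reflMap]

theorem invMap_invMap (x : Plane) : invMap (invMap x) = x := by simp [invMap]

theorem reflMap_turn (x : Plane) : reflMap (turn x) = rotMap (reflMap x) := by
  ext <;> simp only [reflMap, turn, rotMap] <;> ring

theorem invMap_turn (x : Plane) : invMap (turn x) = turn (invMap x) := by
  ext <;> simp only [invMap, turn] <;> ring

theorem reflMap_add_lat (x : Plane) (n : ℤ × ℤ) :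
    reflMap (x + lat n) = reflMap x + lat (-n.2, -n.1) := by
  ext
  · simp only [reflMap, Prod.fst_add, lat_fst]
    push_cast
    ring
  · simp only [reflMap, Prod.snd_add, lat_snd]
    push_cast
    ring

theorem reflMap_mem_hexagon {x : Plane} : reflMap x ∈ hexagon ↔ x ∈ hexagon := by
  have e1 : √3 / 2 * -x.1 + 1 / 2 * x.2 = -(√3 / 2 * x.1 - 1 / 2 * x.2) := by ring
  have e2 : √3 / 2 * -x.1 - 1 / 2 * x.2 = -(√3 / 2 * x.1 + 1 / 2 * x.2) := by ring
  simp only [hexagon, reflMap, mem_ofPred_eq, e1, e2, abs_neg]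
  tauto

theorem invMap_mem_hexagon {x : Plane} : invMap x ∈ hexagon ↔ x ∈ hexagon := by
  have e1 : √3 / 2 * -x.1 + 1 / 2 * -x.2 = -(√3 / 2 * x.1 + 1 / 2 * x.2) := by ring
  have e2 : √3 / 2 * -x.1 - 1 / 2 * -x.2 = -(√3 / 2 * x.1 - 1 / 2 * x.2) := by ring
  simp only [hexagon, invMap, mem_ofPred_eq, e1, e2, abs_neg]

theorem measurePreserving_aff {M : Matrix (Fin 2) (Fin 2) ℝ} (hM : |M.det| = 1) {Ω : Set Plane}
    (hΩ : MeasurableSet Ω) (h : aff M 0 ⁻¹' Ω = Ω) :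
    MeasurePreserving (aff M 0) (volume.restrict Ω) (volume.restrict Ω) := by
  have hM0 : M.det ≠ 0 := fun h0 => by simp [h0] at hM
  have : MeasurePreserving (aff M 0) (volume : Measure Plane) volume :=
    ⟨(continuous_aff M 0).measurable, by
      rw [map_aff_volume hM0, abs_inv, hM, inv_one, ENNReal.ofReal_one, one_smul]⟩
  have := this.restrict_preimage hΩ
  rwa [h] at this

theorem measurePreserving_reflMap :
    MeasurePreserving reflMap (volume.restrict hexagon) (volume.restrict hexagon) := by
  rw [reflMap_eq_aff]
  refine measurePreserving_aff (by rw [det_reflMatrix]; norm_num) measurableSet_hexagon ?_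
  rw [← reflMap_eq_aff]
  exact Set.ext fun x => reflMap_mem_hexagon

theorem measurePreserving_invMap :
    MeasurePreserving invMap (volume.restrict hexagon) (volume.restrict hexagon) := by
  rw [invMap_eq_aff]
  refine measurePreserving_aff (by simp [Matrix.det_fin_two]) measurableSet_hexagon ?_
  rw [← invMap_eq_aff]
  exact Set.ext fun x => invMap_mem_hexagon

/-- The reflection on the hexagon. -/
def reflIsom : L2 hexagon →ₗᵢ[ℂ] L2 hexagon :=
  Lp.compMeasurePreservingₗᵢ ℂ reflMap measurePreserving_reflMap

theorem reflIsom_coe (u : L2 hexagon) :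
    reflIsom u =ᵐ[volume.restrict hexagon] fun x => u (reflMap x) :=
  Lp.coeFn_compMeasurePreserving u measurePreserving_reflMap

/-- The inversion on the hexagon, composed with complex conjugation. -/
def conjInvIsom : L2 hexagon →ₛₗᵢ[starRingEnd ℂ] L2 hexagon where
  toFun u := star (Lp.compMeasurePreservingₗᵢ ℂ invMap measurePreserving_invMap u)
  map_add' u v := by
    refine Lp.ext ?_
    rw [map_add]
    set u' := Lp.compMeasurePreservingₗᵢ ℂ invMap measurePreserving_invMap u
    set v' := Lp.compMeasurePreservingₗᵢ ℂ invMap measurePreserving_invMap v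
    filter_upwards [Lp.coeFn_star (u' + v'), Lp.coeFn_star u', Lp.coeFn_star v',
      Lp.coeFn_add u' v', Lp.coeFn_add (star u') (star v')] with x a b c d e
    rw [a, e, Pi.add_apply, b, c, Pi.star_apply, Pi.star_apply, Pi.star_apply, d, Pi.add_apply,
      star_add]
  map_smul' c u := by
    refine Lp.ext ?_
    rw [map_smul]
    set u' := Lp.compMeasurePreservingₗᵢ ℂ invMap measurePreserving_invMap u
    filter_upwards [Lp.coeFn_star (c • u'), Lp.coeFn_star u',
      Lp.coeFn_smul c u', Lp.coeFn_smul (starRingEnd ℂ c) (star u')] with x a b d e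
    rw [a, e, Pi.smul_apply, b, Pi.star_apply, Pi.star_apply, d, Pi.smul_apply, star_smul]
    rfl
  norm_map' u := by
    change ‖star (Lp.compMeasurePreservingₗᵢ ℂ invMap measurePreserving_invMap u)‖ = ‖u‖
    rw [← (Lp.compMeasurePreservingₗᵢ ℂ invMap measurePreserving_invMap).norm_map u, Lp.norm_def,
      Lp.norm_def, eLpNorm_congr_ae (Lp.coeFn_star _), eLpNorm_star]

theorem conjInvIsom_coe (u : L2 hexagon) :
    conjInvIsom u =ᵐ[volume.restrict hexagon] fun x => starRingEnd ℂ (u (invMap x)) := by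
  filter_upwards [Lp.coeFn_star (Lp.compMeasurePreservingₗᵢ ℂ invMap measurePreserving_invMap u),
    Lp.coeFn_compMeasurePreserving u measurePreserving_invMap] with x a b
  refine a.trans ?_
  rw [Pi.star_apply]
  exact congrArg star b

theorem reflIsom_reflIsom (u : L2 hexagon) : reflIsom (reflIsom u) = u := by
  refine Lp.ext ?_
  filter_upwards [reflIsom_coe (reflIsom u),
    measurePreserving_reflMap.quasiMeasurePreserving.ae (reflIsom_coe u)] with x a b
  rw [a, b, reflMap_reflMap]

theorem conjInvIsom_conjInvIsom (u : L2 hexagon) : conjInvIsom (conjInvIsom u) = u := by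
  refine Lp.ext ?_
  filter_upwards [conjInvIsom_coe (conjInvIsom u),
    measurePreserving_invMap.quasiMeasurePreserving.ae (conjInvIsom_coe u)] with x a b
  rw [a, b, invMap_invMap, Complex.conj_conj]

/-- The reflection acts on lattice indices by (n₁, n₂) ↦ (-n₂, -n₁). This preserves n₁-n₂, hence the
character of `σ k*`. -/
theorem pullJet_refl_mem {σ : ℤ} {J : Jet} (hJ : J ∈ blochJets ((σ : ℝ) • kStar)) :
    pullJet reflMatrix 0 J ∈ blochJets ((σ : ℝ) • kStar) := by
  have hd : reflMatrix.det ≠ 0 := by rw [det_reflMatrix]; norm_num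
  have hl := jetL2loc_of_mem_blochJets hJ
  have w := hJ.2.2.2.1.pull hd 0 hl
  have l := hl.pull hd 0
  rw [preimage_univ] at w l
  refine ⟨l.1, l.2.1, l.2.2, w, (isBloch_iff _ _).2 fun n => ?_⟩
  filter_upwards [ae_aff hd 0 ((isBloch_iff _ _).1 hJ.2.2.2.2 (-n.2, -n.1))] with x hx
  simp only [pullJet, Function.comp_apply]
  rw [← reflMap_eq_aff] at hx ⊢
  rw [reflMap_add_lat, hx, blochChar_kStar, blochChar_kStar]
  congr 3
  ring

/-- Inversion changes the quasimomentum to its negative, and complex conjugation changes it back;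
this holds for every `k`. -/
theorem conjJet_pull_inv_mem {k : ℝ × ℝ} {J : Jet} (hJ : J ∈ blochJets k) :
    conjJet (pullJet (-1) 0 J) ∈ blochJets k := by
  have hl := jetL2loc_of_mem_blochJets hJ
  have w := hJ.2.2.2.1.pull pointMatrix_det 0 hl
  have l := hl.pull pointMatrix_det 0
  rw [preimage_univ] at w l
  have l' := l.conj
  refine ⟨l'.1, l'.2.1, l'.2.2, w.conj, (isBloch_iff _ _).2 fun n => ?_⟩
  filter_upwards [ae_aff pointMatrix_det 0 ((isBloch_iff _ _).1 hJ.2.2.2.2 (-n))] with x hx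
  simp only [pullJet, conjJet, Function.comp_apply]
  rw [aff_neg_one, zero_sub] at hx ⊢
  rw [aff_neg_one, zero_sub, neg_add, ← lat_neg, hx, map_mul, conj_blochChar, neg_neg]

/-- Here it matters that the coefficients are real. -/
theorem onJet_conjJet (L : RealDiffOp) (J : Jet) (x : Plane) :
    L.onJet (conjJet J) x = starRingEnd ℂ (L.onJet J x) := by
  simp only [onJet, conjJet, LinearMap.coe_mk, AddHom.coe_mk, map_add, map_sum, map_mul,
    Complex.conj_ofReal]

theorem reflIsom_mem_graph {L : RealDiffOp} (hF : L.InvariantUnder reflMap) {σ : ℤ}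
    {u g : L2 hexagon} (h : (u, g) ∈ (L.blochOp ((σ : ℝ) • kStar)).graph) :
    (reflIsom u, reflIsom g) ∈ (L.blochOp ((σ : ℝ) • kStar)).graph := by
  rw [L.blochOp_graph] at h ⊢
  obtain ⟨J, hJ, h1, h2⟩ := h
  have hd : reflMatrix.det ≠ 0 := by rw [det_reflMatrix]; norm_num
  have q := measurePreserving_reflMap.quasiMeasurePreserving
  rw [reflMap_eq_aff] at hF
  refine ⟨pullJet reflMatrix 0 J, pullJet_refl_mem hJ, ?_, ?_⟩
  · filter_upwards [reflIsom_coe u, q.ae h1] with x a b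
    rw [a, b, reflMap_eq_aff]
    rfl
  · filter_upwards [reflIsom_coe g, q.ae h2, ae_restrict_of_ae
      (onJet_pullJet_ae hd hF hJ.2.2.2.1 (jetL2loc_of_mem_blochJets hJ))] with x a b c
    rw [a, b, c, reflMap_eq_aff]

theorem conjInvIsom_mem_graph {L : RealDiffOp} (hV : L.InvariantUnder invMap) {k : ℝ × ℝ}
    {u g : L2 hexagon} (h : (u, g) ∈ (L.blochOp k).graph) :
    (conjInvIsom u, conjInvIsom g) ∈ (L.blochOp k).graph := by
  rw [L.blochOp_graph] at h ⊢
  obtain ⟨J, hJ, h1, h2⟩ := h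
  have q := measurePreserving_invMap.quasiMeasurePreserving
  rw [invMap_eq_aff] at hV
  refine ⟨conjJet (pullJet (-1) 0 J), conjJet_pull_inv_mem hJ, ?_, ?_⟩
  · filter_upwards [conjInvIsom_coe u, q.ae h1] with x a b
    rw [a, b, invMap_eq_aff]
    rfl
  · filter_upwards [conjInvIsom_coe g, q.ae h2, ae_restrict_of_ae
      (onJet_pullJet_ae pointMatrix_det hV hJ.2.2.2.1 (jetL2loc_of_mem_blochJets hJ))] with x a b c
    rw [a, b, onJet_conjJet, c, invMap_eq_aff]

theorem exists_rotIsom_eq {m : ℤ} {j : Fin 3} {w : Plane → ℂ} {v : L2 hexagon}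
    (hv : v =ᵐ[volume.restrict hexagon] w) (hw : ∀ x, w (turn x) = innerPhase j * w x) :
    ∃ ψ, rotIsom m j ψ = v := by
  have h1 : MemLp w 2 (volume.restrict hexagon) := (memLp_congr_ae hv).1 (Lp.memLp v)
  have h2 : MemLp w 2 (volume.restrict (rhombus m)) :=
    h1.mono_measure (Measure.restrict_mono (rhombus_subset_hexagon m) le_rfl)
  exact ⟨_, Lp.ext ((rotIsom_toLp (ae_of_all _ hw) (h2.const_mul _)).trans hv.symm)⟩

/-- The reflection turns `turn` into its inverse, so a function of phase θ becomes one of phase θ⁻¹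
= θ². -/
theorem exists_rotIsom_eq_refl {m : ℤ} {i j : Fin 3} (hij : innerPhase i ^ 2 = innerPhase j)
    (φ : L2 (rhombus m)) : ∃ ψ, rotIsom m j ψ = reflIsom (rotIsom m i φ) := by
  refine exists_rotIsom_eq (w := fun x => rotSum m i φ (reflMap x)) ?_ fun x => ?_
  · filter_upwards [reflIsom_coe (rotIsom m i φ),
      measurePreserving_reflMap.quasiMeasurePreserving.ae (rotIsom_coe m i φ)] with x a b
    rw [a, b]
  · rw [reflMap_turn, ← turn_turn, rotSum_turn, rotSum_turn, ← hij]
    ring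

/-- Inversion commutes with `turn`, and conjugation replaces the phase θ by its conjugate θ². -/
theorem exists_rotIsom_eq_conjInv {m : ℤ} {i j : Fin 3} (hij : innerPhase i ^ 2 = innerPhase j)
    (φ : L2 (rhombus m)) : ∃ ψ, rotIsom m j ψ = conjInvIsom (rotIsom m i φ) := by
  refine exists_rotIsom_eq (w := fun x => starRingEnd ℂ (rotSum m i φ (invMap x))) ?_ fun x => ?_
  · filter_upwards [conjInvIsom_coe (rotIsom m i φ),
      measurePreserving_invMap.quasiMeasurePreserving.ae (rotIsom_coe m i φ)] with x a b
    rw [a, b]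
  · rw [invMap_turn, rotSum_turn, map_mul, conj_innerPhase, hij]

theorem isOrthogonalSum_blochOp {L : RealDiffOp} (hR : L.InvariantUnder rotMap) (m σ : ℤ) :
    IsOrthogonalSum (L.blochOp ((σ : ℝ) • kStar)) (L.twistedOp m σ) (rotIsom m) :=
  ⟨orthogonalFamily_rotIsom m, domain_le L m σ, rotIsom_mem_graph hR⟩

/-- Either symmetry exchanges the ranges of T₁ and T₂ and preserves the graph of the Bloch operator.
The reflection gives a unitary equivalence; with inversion and conjugation the equivalence is
antiunitary, and the resolvent at nonreal numbers completes the argument. -/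
theorem isospectral_twistedOp {L : RealDiffOp} (hsa : IsSelfAdjoint L.planeOp)
    (ha₁ : L.InvariantUnder fun x => x + latticeA1)
    (ha₂ : L.InvariantUnder fun x => x + latticeA2) (hR : L.InvariantUnder rotMap) (m σ : ℤ)
    (h : L.InvariantUnder reflMap ∨ L.InvariantUnder invMap) :
    Isospectral (L.twistedOp m σ 1) (L.twistedOp m σ 2) := by
  have hs := isOrthogonalSum_blochOp hR m σ
  have p12 : innerPhase 1 ^ 2 = innerPhase 2 := by
    rw [innerPhase_eq_pow, innerPhase_eq_pow]
    simp
  have p21 : innerPhase 2 ^ 2 = innerPhase 1 := by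
    rw [← p12, ← pow_mul, pow_succ, innerPhase_pow_three, one_mul]
  rcases h with hF | hV
  · obtain ⟨W, hW⟩ := hs.exists_equiv reflIsom reflIsom_reflIsom
      (fun _ _ => reflIsom_mem_graph hF) (exists_rotIsom_eq_refl p12) (exists_rotIsom_eq_refl p21)
    exact isospectral_of_linear W hW
  · obtain ⟨W, hW⟩ := hs.exists_equiv conjInvIsom conjInvIsom_conjInvIsom
      (fun _ _ => conjInvIsom_mem_graph hV) (exists_rotIsom_eq_conjInv p12)
      (exists_rotIsom_eq_conjInv p21)
    exact isospectral_of_antilinear W hW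
      (fun z hz => hs.inResolventSet (inResolventSet_blochOp hsa ha₁ ha₂ hz _) 1)
      fun z hz => hs.inResolventSet (inResolventSet_blochOp hsa ha₁ ha₂ hz _) 2

end

end Honeycomb

theorem theorem4 (L : Honeycomb.RealDiffOp)
    (hsa : IsSelfAdjoint L.planeOp)
    (ha₁ : L.InvariantUnder (fun x => x + Honeycomb.latticeA1))
    (ha₂ : L.InvariantUnder (fun x => x + Honeycomb.latticeA2))
    (hR : L.InvariantUnder Honeycomb.rotMap)
    (m : ℤ) (σ : ℤ) (hσ : σ = 1 ∨ σ = -1) :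
    (∃ T : Fin 3 → (Honeycomb.L2 (Honeycomb.rhombus m) →ₗᵢ[ℂ] Honeycomb.L2 Honeycomb.hexagon),
      (∀ j φ, T j φ =ᵐ[volume.restrict Honeycomb.hexagon] Honeycomb.rotSum m j φ) ∧
      OrthogonalFamily ℂ (fun _ : Fin 3 => Honeycomb.L2 (Honeycomb.rhombus m)) T ∧
      (⨆ j, LinearMap.range (T j).toLinearMap) = ⊤ ∧
      (L.blochOp ((σ : ℝ) • Honeycomb.kStar)).domain =
        (⨆ j, (L.twistedOp m σ j).domain.map (T j).toLinearMap) ∧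
      ∀ (j : Fin 3) (φ : (L.twistedOp m σ j).domain),
        ∃ h : T j φ ∈ (L.blochOp ((σ : ℝ) • Honeycomb.kStar)).domain,
          L.blochOp ((σ : ℝ) • Honeycomb.kStar) ⟨T j φ, h⟩ = T j (L.twistedOp m σ j φ)) ∧
    (L.InvariantUnder Honeycomb.reflMap ∨ L.InvariantUnder Honeycomb.invMap →
      Honeycomb.Isospectral (L.twistedOp m σ 1) (L.twistedOp m σ 2)) := by
  refine ⟨⟨Honeycomb.rotIsom m, Honeycomb.rotIsom_coe m, Honeycomb.orthogonalFamily_rotIsom m,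
    Honeycomb.iSup_range_rotIsom m, Honeycomb.domain_blochOp hR m σ,
    Honeycomb.rotIsom_intertwines hR⟩, ?_⟩
  exact Honeycomb.isospectral_twistedOp hsa ha₁ ha₂ hR m σ
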